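/- \textbf{Setting.} Let $V:\mathbb R\to\mathbb R$ be smooth and even with $V(0)=0$, $V''(0)>0$, let $f=V'$, and fix $d>0$, $T>0$, $M\ge 1$. Let $X_M$ be the span of the Fourier modes $e^{2\pi i k t/T}$, $|k|\le M$ (real-valued functions for the dynamics, complex-valued ones for the eigenvalue problem), $P_M$ the $L^2(0,T)$-orthogonal projection onto it, and $X_{M,e}\subset X_M$ the functions even in $t$. Consider the lattice system $$\ddot u_n=d(u_{n+1}-2u_n+u_{n-1})-P_Mf(u_n),\qquad u_n\in X_M,$$ written as $U(n+1)=F_M(U(n))$ with $U(n)=(u_n,u_{n-1})\in X_M^2$. Assume that $DF_M(0)$ has no spectrum on the unit circle, and let $r>1$ be the smallest modulus of an eigenvalue of $DF_M(0)$ outside the unit circle. Let the primary breather $Q(n)=(q_n,q_{n-1})$ be an orbit in $X_{M,e}^2$ homoclinic to $0$ along which the stable and unstable manifolds of $0$ intersect transversely in $X_{M,e}^2$, and whose tangent spaces in the full space $X_M^2$ intersect in exactly one dimension. Let $y=\omega\,\partial_\omega q\in\ell^2$ be the derivative along the family of breathers with frequency $\omega$ (at $\omega=2\pi/T$, at fixed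 rescaled time $\omega t$) and let $$K=\sum_{n\in\mathbb Z}\int_0^T(\dot q_n^2+2\dot y_n\dot q_n)\,dt .$$ Fix $m\ge2$. For orientations $\sigma_i\in\{\pm1\}$ ($1\le i\le m$) and distances $N_i\in\mathbb N$ ($1\le i\le m-1$) put $N_i^+=\lfloor N_i/2\rfloor$, $N_i^-=N_i-N_i^+$, $N=\tfrac12\min_iN_i$, $$a_i=\sigma_i\sigma_{i+1}\int_0^T\left(\dot q_{N_i^+}\dot q_{-N_i^--1}-\dot q_{N_i^+-1}\dot q_{-N_i^-}\right)dt,\qquad \tilde a_i=\sigma_i\sigma_{i+1}\int_0^T\left(\dot q_{-N_i^-}\dot q_{N_i^+-1}-\dot q_{-N_i^--1}\dot q_{N_i^+}\right)dt,$$ and let $A$ be the tridiagonal $m\times m$ matrix whose $i$-th row has the entries $-\tilde a_{i-1},\ \tilde a_{i-1}-a_i,\ a_i$ in columns $i-1,i,i+1$ (terms with indices $0$ or $m$ are omitted). A multi-breather with these data is a solution $u$ of the lattice system with $u_n\in X_{M,e}$ that is uniformly close to the concatenation of the $m$ copies $\sigma_i q$, with consecutive centers at distances $N_1,\dots,N_{m-1}$,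 the $i$-th copy being used on the sites from $N_{i-1}^-$ to the left to $N_i^+$ to the right of its center ($N_0^-=N_m^+=\infty$). Its eigenmodes are the $\lambda\in\mathbb C$ for which $$d(w_{n+1}-2w_n+w_{n-1})-P_M(f'(u_n)w_n)-\ddot w_n=2\lambda\dot w_n+\lambda^2w_n$$ has a bounded nonzero solution with $w_n$ in the complex space $X_M$. \textbf{Statement.} Suppose that the primary breather is spatially even, $q_{-n}=q_n$ for all $n$. (1) For all $\sigma_i$, $N_i$ the matrix $A$ is symmetric tridiagonal; its $i$-th row has the entries $a_{i-1},\ -a_{i-1}-a_i,\ a_i$ in columns $i-1,i,i+1$, and $a_i=\sigma_i\sigma_{i+1}b_i$, where $$b_i=\begin{cases}\int_0^T\dot q_{\frac{N_i}2}\left(\dot q_{\frac{N_i}2+1}-\dot q_{\frac{N_i}2-1}\right)dt,& N_i\text{ even},\\[2pt] \int_0^T\left(\dot q_{\frac{N_i-1}2}\dot q_{\frac{N_i+3}2}-\dot q_{\frac{N_i+1}2}\dot q_{\frac{N_i-3}2}\right)dt,& N_i\text{ odd}.\end{cases}$$ (2) If all $b_i\ne0$, then $A$ has the simple eigenvalue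 $0$ and $m-1$ further eigenvalues $\mu_1,\dots,\mu_{m-1}$, which are real, distinct and nonzero. (3) Suppose $K\neq0$. There are $\rho>0$, $\delta>0$ and $N^*$ such that for all $\sigma_i$ and all $N_i\ge N^*$ there is exactly one multi-breather within distance $\rho$ of the concatenated copies, and, if $0,\mu_1,\dots,\mu_{m-1}$ are the eigenvalues of $A$ (listed with multiplicity), there are $\lambda_1,\dots,\lambda_{m-1}$ in the disc $|\lambda|<\delta$, each real or purely imaginary, such that the eigenmodes of the multi-breather in this disc are exactly $0$ and the $m-1$ pairs $\pm\lambda_j$: for $|\lambda|<\delta$ the space of bounded solutions has dimension $\#\{j:\lambda=\pm\lambda_j\}$, plus $1$ if $\lambda=0$. Moreover, for every $\kappa>0$ there is $C$, independent of $\sigma_i$ and $N_i$, such that $$\left|\lambda_j-\sqrt{-\frac{d\mu_j}{K}}\right|\le C\,r^{-2N},\qquad j=1,\dots,m-1,$$ whenever the interactions are nondegenerate in the sense that $|b_i|\ge\kappa\,\|\dot Q(N_i^+)\|\,\|\dot Q(-N_i^-)\|$ for all $i$, where $\dot Q(n)=(\dot q_n,\dot q_{n-1})$ and $\|\cdot\|$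 is the norm of $L^2(0,T)^2$. Here $\sqrt{\cdot}$ is the principal square root, so the eigenmodes $\pm\lambda_j$ are $\pm\sqrt{-d\mu_j/K}+O(r^{-2N})$. -/

import Mathlib

open Filter Topology
open scoped ContDiff

noncomputable section

namespace DKG

/-! ### The Fourier spaces -/

/-- The `k`-th element of the standard orthonormal Fourier basis of the complex Hilbert space of
square integrable `T`-periodic functions. -/
def mode (T : ℝ) (k : ℤ) : ℝ → ℂ := fun t =>
  (((Real.sqrt T)⁻¹ : ℝ) : ℂ) * Complex.exp (Complex.I * ((2 * Real.pi * k * t / T : ℝ) : ℂ))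

/-- The complex space spanned by the Fourier modes with wave number `|k| ≤ M`. -/
def XC (T : ℝ) (M : ℕ) : Submodule ℂ (ℝ → ℂ) :=
  Submodule.span ℂ (mode T '' {k : ℤ | |k| ≤ (M : ℤ)})

/-- The space `X_M` of real-valued functions in the span of the modes with `|k| ≤ M`. -/
def XR (T : ℝ) (M : ℕ) : Submodule ℝ (ℝ → ℝ) where
  carrier := {u | (fun t => (u t : ℂ)) ∈ XC T M}
  add_mem' := by
    intro a b ha hb
    have h := (XC T M).add_mem ha hb
    have e : (fun t => ((a + b) t : ℂ)) = (fun t => (a t : ℂ)) + (fun t => (b t : ℂ)) := by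
      funext t; simp
    simpa only [Set.mem_ofPred_eq, e] using h
  zero_mem' := by
    have e : (fun t => ((0 : ℝ → ℝ) t : ℂ)) = 0 := by funext t; simp
    simp only [Set.mem_ofPred_eq, e]
    exact (XC T M).zero_mem
  smul_mem' := by
    intro c a ha
    have h := (XC T M).smul_mem (c : ℂ) ha
    have e : (fun t => ((c • a) t : ℂ)) = (c : ℂ) • (fun t => (a t : ℂ)) := by
      funext t; simp
    simpa only [Set.mem_ofPred_eq, e] using h

/-- The subspace `X_{M,e}` of the functions in `X_M` that are even in time. -/
def XRe (T : ℝ) (M : ℕ) : Submodule ℝ (ℝ → ℝ) where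
  carrier := {u | u ∈ XR T M ∧ ∀ t, u (-t) = u t}
  add_mem' := by
    rintro a b ⟨ha, ha'⟩ ⟨hb, hb'⟩
    exact ⟨(XR T M).add_mem ha hb, fun t => by simp [ha', hb']⟩
  zero_mem' := ⟨(XR T M).zero_mem, fun t => rfl⟩
  smul_mem' := by
    rintro c a ⟨ha, ha'⟩
    exact ⟨(XR T M).smul_mem c ha, fun t => by simp [ha']⟩

/-- The orthogonal projection `P_M` onto the span of the modes with `|k| ≤ M`. -/
def proj (T : ℝ) (M : ℕ) (h : ℝ → ℂ) : ℝ → ℂ := fun t =>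
  ∑ k ∈ Finset.Icc (-(M : ℤ)) (M : ℤ),
    (∫ s in (0 : ℝ)..T, h s * (starRingEnd ℂ) (mode T k s)) * mode T k t

/-- The `L²` norm over one period. -/
def l2 (T : ℝ) (u : ℝ → ℝ) : ℝ := Real.sqrt (∫ t in (0 : ℝ)..T, u t ^ 2)

/-- The `L²` norm over one period of a pair of functions. -/
def l2pair (T : ℝ) (p : (ℝ → ℝ) × (ℝ → ℝ)) : ℝ :=
  Real.sqrt (l2 T p.1 ^ 2 + l2 T p.2 ^ 2)

/-! ### The lattice dynamical system, `f = V'` -/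

/-- The projected nonlinearity `g(u) = P_M f(u)` (real, since the projection of a real function
is real). -/
def galerkin (V : ℝ → ℝ) (T : ℝ) (M : ℕ) (u : ℝ → ℝ) : ℝ → ℝ := fun t =>
  (proj T M (fun s => ((deriv V (u s) : ℝ) : ℂ)) t).re

/-- The map `F_M` of the spatial dynamics. -/
def stepMap (V : ℝ → ℝ) (d T : ℝ) (M : ℕ) (p : (ℝ → ℝ) × (ℝ → ℝ)) : (ℝ → ℝ) × (ℝ → ℝ) :=
  (fun t => 2 * p.1 t + (1 / d) * galerkin V T M p.1 t + (1 / d) * deriv (deriv p.1) t - p.2 t,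
    p.1)

/-- `U(n) = (u_n, u_{n-1})`. -/
def pairAt (u : ℤ → ℝ → ℝ) (n : ℤ) : (ℝ → ℝ) × (ℝ → ℝ) := (u n, u (n - 1))

/-- `U(n) = (u_n, u_{n-1})` solves `U(n+1) = F_M(U(n))`. -/
def IsSolution (V : ℝ → ℝ) (d T : ℝ) (M : ℕ) (u : ℤ → ℝ → ℝ) : Prop :=
  ∀ n, pairAt u (n + 1) = stepMap V d T M (pairAt u n)

/-- The eigenvalues of the linearization `DF_M(0)` on (the complexification of) `X_M²`. -/
def spectrumAtZero (V : ℝ → ℝ) (d T : ℝ) (M : ℕ) : Set ℂ :=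
  {ν | ∃ v w : ℝ → ℂ, v ∈ XC T M ∧ w ∈ XC T M ∧ (v, w) ≠ 0 ∧
    (∀ t, ((1 / d : ℝ) : ℂ) * deriv (deriv v) t
        + ((deriv (deriv V) 0 / d + 2 : ℝ) : ℂ) * v t - w t = ν * v t) ∧
    (∀ t, v t = ν * w t)}

/-- Hyperbolicity of the zero solution: `DF_M(0)` has no spectrum on the unit circle. -/
def IsHyperbolic (V : ℝ → ℝ) (d T : ℝ) (M : ℕ) : Prop :=
  ∀ ν ∈ spectrumAtZero V d T M, ‖ν‖ ≠ 1

/-- `r_M`, the smallest modulus of an unstable eigenvalue of `DF_M(0)`. -/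
def rM (V : ℝ → ℝ) (d T : ℝ) (M : ℕ) : ℝ :=
  sInf {x : ℝ | 1 < x ∧ ∃ ν ∈ spectrumAtZero V d T M, ‖ν‖ = x}

/-! ### Stable and unstable manifolds along a homoclinic orbit

`S` is the space in which the dynamics takes place (`X_M` or `X_{M,e}`). -/

/-- The part of the stable manifold `W^s(0)` in `S²` whose forward orbits stay `ε`-close to the
orbit `Q(n) = (q_n, q_{n-1})`. -/
def stableNear (V : ℝ → ℝ) (d T : ℝ) (M : ℕ) (S : Submodule ℝ (ℝ → ℝ)) (q : ℤ → ℝ → ℝ) (ε : ℝ) :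
    Set ((ℝ → ℝ) × (ℝ → ℝ)) :=
  {p | ∃ P : ℕ → (ℝ → ℝ) × (ℝ → ℝ), P 0 = p ∧ (∀ n, P n ∈ S.prod S) ∧
    (∀ n, P (n + 1) = stepMap V d T M (P n)) ∧
    (∀ n : ℕ, l2pair T (P n - pairAt q n) < ε) ∧
    Tendsto (fun n => l2pair T (P n)) atTop (𝓝 0)}

/-- The part of the unstable manifold `W^u(0)` in `S²` whose backward orbits stay `ε`-close to the
orbit `Q(n) = (q_n, q_{n-1})`. -/
def unstableNear (V : ℝ → ℝ) (d T : ℝ) (M : ℕ) (S : Submodule ℝ (ℝ → ℝ)) (q : ℤ → ℝ → ℝ)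
    (ε : ℝ) : Set ((ℝ → ℝ) × (ℝ → ℝ)) :=
  {p | ∃ P : ℕ → (ℝ → ℝ) × (ℝ → ℝ), P 0 = p ∧ (∀ n, P n ∈ S.prod S) ∧
    (∀ n, P n = stepMap V d T M (P (n + 1))) ∧
    (∀ n : ℕ, l2pair T (P n - pairAt q (-(n : ℤ))) < ε) ∧
    Tendsto (fun n => l2pair T (P n)) atTop (𝓝 0)}

/-- The tangent space of the stable manifold at `Q(0)`. The stable manifold may return to `Q(0)`
along other sheets; the localization along the orbit selects the sheet through `Q(0)`. -/
def tangentStable (V : ℝ → ℝ) (d T : ℝ) (M : ℕ) (S : Submodule ℝ (ℝ → ℝ)) (q : ℤ → ℝ → ℝ) :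
    Set ((ℝ → ℝ) × (ℝ → ℝ)) :=
  ⋂ ε : {ε : ℝ // 0 < ε}, tangentConeAt ℝ (stableNear V d T M S q ε) (pairAt q 0)

/-- The tangent space of the unstable manifold at `Q(0)`. -/
def tangentUnstable (V : ℝ → ℝ) (d T : ℝ) (M : ℕ) (S : Submodule ℝ (ℝ → ℝ)) (q : ℤ → ℝ → ℝ) :
    Set ((ℝ → ℝ) × (ℝ → ℝ)) :=
  ⋂ ε : {ε : ℝ // 0 < ε}, tangentConeAt ℝ (unstableNear V d T M S q ε) (pairAt q 0)

/-- `Q(n) = (q_n, q_{n-1})` is an orbit in `X_{M,e}²` that is homoclinic to zero. -/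
def IsHomoclinic (V : ℝ → ℝ) (d T : ℝ) (M : ℕ) (q : ℤ → ℝ → ℝ) : Prop :=
  (∀ n, q n ∈ XRe T M) ∧ IsSolution V d T M q ∧
    Tendsto (fun n => l2 T (q n)) atTop (𝓝 0) ∧ Tendsto (fun n => l2 T (q n)) atBot (𝓝 0)

/-- The primary breather: a homoclinic orbit along which the stable and unstable manifolds
intersect transversely in `X_{M,e}²`. -/
def IsPrimaryBreather (V : ℝ → ℝ) (d T : ℝ) (M : ℕ) (q : ℤ → ℝ → ℝ) : Prop :=
  IsHomoclinic V d T M q ∧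
    Submodule.span ℝ (tangentStable V d T M (XRe T M) q ∪ tangentUnstable V d T M (XRe T M) q)
      = (XRe T M).prod (XRe T M)

/-- In the full space `X_M²` the intersection of the (tangent spaces of the) stable and unstable
manifolds at the primary breather is exactly one-dimensional. -/
def IsNondegenerate (V : ℝ → ℝ) (d T : ℝ) (M : ℕ) (q : ℤ → ℝ → ℝ) : Prop :=
  ∃ v : (ℝ → ℝ) × (ℝ → ℝ), v ≠ 0 ∧
    tangentStable V d T M (XR T M) q ∩ tangentUnstable V d T M (XR T M) q
      = (Submodule.span ℝ {v} : Set ((ℝ → ℝ) × (ℝ → ℝ)))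

/-- `y = ω ∂_ω q` at `ω = 2π/T`: the breather `q` belongs to a family, indexed by the frequency
`ω`, of breathers `t ↦ p ω n (ω t)` of period `2π/ω`; the derivative with respect to `ω` is taken
at fixed rescaled time, and `y` is square summable. -/
def IsFrequencyDerivative (V : ℝ → ℝ) (d T : ℝ) (M : ℕ) (q y : ℤ → ℝ → ℝ) : Prop :=
  ∃ p : ℝ → ℤ → ℝ → ℝ,
    (∀ᶠ om in 𝓝 (2 * Real.pi / T),
      IsHomoclinic V d (2 * Real.pi / om) M (fun n t => p om n (om * t))) ∧
    (∀ n t, p (2 * Real.pi / T) n (2 * Real.pi / T * t) = q n t) ∧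
    (∀ n t, ∃ D : ℝ,
      HasDerivAt (fun om => p om n (2 * Real.pi / T * t)) D (2 * Real.pi / T) ∧
        y n t = 2 * Real.pi / T * D) ∧
    Summable (fun n => l2 T (y n) ^ 2)

/-- `K = ∑ₙ ∫₀ᵀ (q̇ₙ² + 2 ẏₙ q̇ₙ) dt`. -/
def kConst (T : ℝ) (q y : ℤ → ℝ → ℝ) : ℝ :=
  ∑' n : ℤ, ∫ t in (0 : ℝ)..T, (deriv (q n) t ^ 2 + 2 * deriv (y n) t * deriv (q n) t)

/-! ### Multi-breathers

A multi-breather has `m = l + 1` copies of the primary breather, indexed by `Fin (l + 1)`, and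
`l = m - 1` gaps, indexed by `Fin l`; gap `g` lies between copies `g.castSucc` and `g.succ`. -/

/-- `N_i^+ = ⌊N_i / 2⌋`. -/
def Nplus (N : ℕ) : ℤ := ((N / 2 : ℕ) : ℤ)

/-- `N_i^- = N_i - N_i^+`. -/
def Nminus (N : ℕ) : ℤ := (N : ℤ) - Nplus N

/-- The lattice site at which the `i`-th copy is centered: the sum of the preceding distances. -/
def position {l : ℕ} (N : Fin l → ℕ) (i : Fin (l + 1)) : ℤ :=
  ∑ g : Fin l, if g.castSucc < i then (N g : ℤ) else 0

/-- The sites belonging to the `i`-th copy: from `N_{i-1}^-` to the left of its center to `N_i^+`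
to the right of it, where `N_0^- = N_m^+ = ∞`. -/
def block {l : ℕ} (N : Fin l → ℕ) (i : Fin (l + 1)) : Set ℤ :=
  {n | (∀ g : Fin l, g.succ = i → position N i - Nminus (N g) ≤ n) ∧
    (∀ g : Fin l, g.castSucc = i → n ≤ position N i + Nplus (N g))}

/-- `u` is a solution in `X_{M,e}` that on each block is uniformly within `rad` of the copy
`σ_i q` of the primary breather. -/
def IsMultiBreather (V : ℝ → ℝ) (d T : ℝ) (M : ℕ) (q : ℤ → ℝ → ℝ) {l : ℕ}
    (σ : Fin (l + 1) → ℝ) (N : Fin l → ℕ) (rad : ℝ) (u : ℤ → ℝ → ℝ) : Prop :=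
  (∀ n, u n ∈ XRe T M) ∧ IsSolution V d T M u ∧
    ∀ i, ∀ n ∈ block N i, l2 T (u n - σ i • q (n - position N i)) ≤ rad

/-- `a_i`. -/
def aCoef (T : ℝ) (q : ℤ → ℝ → ℝ) {l : ℕ} (σ : Fin (l + 1) → ℝ) (N : Fin l → ℕ) (g : Fin l) : ℝ :=
  σ g.castSucc * σ g.succ * ∫ t in (0 : ℝ)..T,
    (deriv (q (Nplus (N g))) t * deriv (q (-Nminus (N g) - 1)) t
      - deriv (q (Nplus (N g) - 1)) t * deriv (q (-Nminus (N g))) t)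

/-- `ã_i`. -/
def aTilde (T : ℝ) (q : ℤ → ℝ → ℝ) {l : ℕ} (σ : Fin (l + 1) → ℝ) (N : Fin l → ℕ) (g : Fin l) :
    ℝ :=
  σ g.castSucc * σ g.succ * ∫ t in (0 : ℝ)..T,
    (deriv (q (-Nminus (N g))) t * deriv (q (Nplus (N g) - 1)) t
      - deriv (q (-Nminus (N g) - 1)) t * deriv (q (Nplus (N g))) t)

/-- The tridiagonal matrix with rows `(…, -ã_{i-1}, ã_{i-1} - a_i, a_i, …)`. -/
def tridiag {l : ℕ} (a a' : Fin l → ℝ) : Matrix (Fin (l + 1)) (Fin (l + 1)) ℝ :=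
  ∑ g : Fin l, (Matrix.single g.castSucc g.castSucc (-a g) + Matrix.single g.castSucc g.succ (a g)
    + Matrix.single g.succ g.castSucc (-a' g) + Matrix.single g.succ g.succ (a' g))

/-- The symmetric tridiagonal matrix with rows `(…, a_{i-1}, -a_{i-1} - a_i, a_i, …)`. -/
def symTridiag {l : ℕ} (a : Fin l → ℝ) : Matrix (Fin (l + 1)) (Fin (l + 1)) ℝ :=
  ∑ g : Fin l, (Matrix.single g.castSucc g.castSucc (-a g) + Matrix.single g.castSucc g.succ (a g)
    + Matrix.single g.succ g.castSucc (a g) + Matrix.single g.succ g.succ (-a g))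

/-- The interaction matrix `A`. -/
def matrixA (T : ℝ) (q : ℤ → ℝ → ℝ) {l : ℕ} (σ : Fin (l + 1) → ℝ) (N : Fin l → ℕ) :
    Matrix (Fin (l + 1)) (Fin (l + 1)) ℝ :=
  tridiag (aCoef T q σ N) (aTilde T q σ N)

/-- `b_i` as a function of the distance `N_i` (all divisions are exact). -/
def bCoef (T : ℝ) (q : ℤ → ℝ → ℝ) (N : ℕ) : ℝ :=
  if Even N then
    ∫ t in (0 : ℝ)..T, deriv (q ((N : ℤ) / 2)) t *
      (deriv (q ((N : ℤ) / 2 + 1)) t - deriv (q ((N : ℤ) / 2 - 1)) t)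
  else
    ∫ t in (0 : ℝ)..T,
      (deriv (q (((N : ℤ) - 1) / 2)) t * deriv (q (((N : ℤ) + 3) / 2)) t
        - deriv (q (((N : ℤ) + 1) / 2)) t * deriv (q (((N : ℤ) - 3) / 2)) t)

/-- The characteristic distance `N = (1/2) min N_i`. -/
def charDist {l : ℕ} (N : Fin l → ℕ) : ℝ := (1 / 2) * ⨅ g, (N g : ℝ)

/-- The bounded solutions of the Floquet eigenvalue problem
`d (Δ₂ w)ₙ - g'(uₙ) wₙ - ẅₙ = 2 lam ẇₙ + lam² wₙ` with `wₙ` in the complexification of `X_M`,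
where `g'(u) w = P_M (f'(u) w)`. -/
def eigenmodes (V : ℝ → ℝ) (d T : ℝ) (M : ℕ) (u : ℤ → ℝ → ℝ) (lam : ℂ) : Set (ℤ → ℝ → ℂ) :=
  {w | (∀ n, w n ∈ XC T M) ∧ (∃ B : ℝ, ∀ n t, ‖w n t‖ ≤ B) ∧
    ∀ n t, (d : ℂ) * (w (n + 1) t - 2 * w n t + w (n - 1) t)
        - proj T M (fun s => ((deriv (deriv V) (u n s) : ℝ) : ℂ) * w n s) t
        - deriv (deriv (w n)) t
      = 2 * lam * deriv (w n) t + lam ^ 2 * w n t}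

/-- The adjoint solution `Z_M(n) = (-q̇_{n-1}, q̇_n)` and `Q̇_M(n) = (q̇_n, q̇_{n-1})` have the same
norm; this is that norm. -/
def tailNorm (T : ℝ) (q : ℤ → ℝ → ℝ) (n : ℤ) : ℝ :=
  l2pair T (deriv (q n), deriv (q (n - 1)))

/-- The interaction across a gap of length `N` is nondegenerate with constant `κ`: with
`b = ⟨Z_M(N⁺), Q̇_M(-N⁻)⟩`, the cosine of the angle between these two tails is at least `κ` in
absolute value. -/
def GapNondegenerate (T : ℝ) (q : ℤ → ℝ → ℝ) (κ : ℝ) (N : ℕ) : Prop :=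
  κ * (tailNorm T q (Nplus N) * tailNorm T q (-Nminus N)) ≤ |bCoef T q N|

/-- The principal complex square root of a real number. -/
def csqrt (x : ℝ) : ℂ := (Real.sqrt x : ℂ) + Complex.I * (Real.sqrt (-x) : ℂ)

end DKG

end

open DKG

/-!
Part one is algebra: the spatial symmetry `q (-n) = q n` identifies the two interaction integrals at
each gap, and a symmetric tridiagonal matrix with nonzero off-diagonal entries has simple spectrum.

In a real Fourier basis the lattice system becomes an equation for sequences of vectors in `ι → ℝ`
(`Chain`). Hyperbolicity says that the linearization at zero is invertible on bounded sequences with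
exponentially decaying Green's function (`Chain.free_bound`); the weights have rates slightly below
`r`, namely powers of `φ = r ^ (-1/9)`. Hence solutions near zero decay (`Chain.far_bound`), and
solutions of the linearization along `q` that decay at `+∞` are tangent to the stable manifold
(`Chain.exists_hasCurve`, `Chain.HasCurve.pred`). So transversality and the one-dimensional
intersection of the tangent spaces say that the only bounded solutions of the linearization along
`q` are the multiples of `q̇`, which is odd in time. This is the structure `Primary`; on sequences
that are even in time the linearization is injective.

The linearization is bordered by sources in the direction `q̇ n₀` at a reference site of each copy and
by the amplitudes there. A cut-off to long windows around the copies gives an a priori estimate for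
the bordered operator that is uniform in the weights, the positions and the signs
(`Primary.multi_bound`), and solvability follows from the Fredholm alternative
(`Primary.fredholm`). On even sequences the border is invisible, so a contraction argument around
the sum of the copies gives existence and uniqueness of the multi-breather.

For the eigenvalue problem at `λ` the substitution of `λ` times the time derivative by a parity
splitting makes everything depend on `s = λ²`, whence the symmetry `λ ↦ -λ`. Solving the bordered
problem with prescribed amplitudes leaves a symmetric `m × m` matrix `F s`, real for real `s`, whose
kernel is isomorphic to the space of bounded solutions (`Primary.IsReduction.modes_equiv`). Testing
the equation for one parameter with a solution for another gives `F s - F s' ≈ -(s - s') K`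
(`Primary.IsReduction.cross`, `Primary.form_approx`). Testing at `s = 0` with the copies to the left
of a gap leaves the Wronskian across the gap, so the sums of `F 0` over the rows on one side of a
gap are given by the interaction of two neighboring copies, with an error that is small relative to
their tails (`Primary.gap_estimate`). As `u̇` is in the kernel at `s = 0`, the all-ones vector is in
the kernel of `F 0`.

The rest is finite-dimensional. The eigenvalues of `F s` move with speed about `-K`, so each of them
has exactly one zero in `s`, these zeros are real, and they account for all the singular parameters
with multiplicity (`IsSloped.exists_zeros`). By the nondegeneracy the error in `F 0 + d A` is small
relative to the quadratic form `∑ |bᵢ| |xᵢ - xᵢ₊₁|²`, so it moves each eigenvalue by a small multiple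
of its own size; this is why the square roots are still accurate to order `r ^ (-2N)`
(`interaction_eigenvalues`).
-/

noncomputable section

namespace Breather

open Finset hiding card
open Fintype (card)
open Matrix Complex Real Function intervalIntegral

/-! ### Weighted bounds for sequences on the lattice -/

lemma exists_mul_le {c ε : ℝ} (hc : 0 ≤ c) (hε : 0 < ε) : ∃ b, 0 < b ∧ b ≤ 1 ∧ c * b ≤ ε := by
  refine ⟨min 1 (ε / (c + 1)), by positivity, min_le_left _ _, ?_⟩
  calc _ ≤ (c + 1) * (ε / (c + 1)) := by gcongr <;> simp
    _ = ε := by field_simp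

/-- The values of `σ` are signs. -/
abbrev IsSign {κ : Type*} (σ : κ → ℝ) : Prop := ∀ i, σ i = 1 ∨ σ i = -1

lemma IsSign.norm_smul {κ E : Type*} [NormedAddCommGroup E] [NormedSpace ℝ E] {σ : κ → ℝ}
    (h : IsSign σ) (i : κ) (x : E) : ‖σ i • x‖ = ‖x‖ := by rcases h i with h | h <;> simp [h]

/-- The sequence `v` is bounded. -/
abbrev IsBdd {E : Type*} [Norm E] (v : ℤ → E) : Prop := ∃ K, ∀ n, ‖v n‖ ≤ K

lemma IsBdd.add {E : Type*} [SeminormedAddCommGroup E] {v w : ℤ → E} :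
    IsBdd v → IsBdd w → IsBdd (v + w) := fun ⟨_, h⟩ ⟨_, h'⟩ =>
  ⟨_, fun n => norm_add_le_of_le (h n) (h' n)⟩

lemma IsBdd.sub {E : Type*} [SeminormedAddCommGroup E] {v w : ℤ → E} :
    IsBdd v → IsBdd w → IsBdd (v - w) := fun ⟨_, h⟩ ⟨_, h'⟩ =>
  ⟨_, fun n => norm_sub_le_of_le (h n) (h' n)⟩

lemma IsBdd.smul {E : Type*} [SeminormedAddCommGroup E] [NormedSpace ℂ E] {v : ℤ → E} (c : ℂ) :
    IsBdd v → IsBdd (c • v) := fun ⟨_, h⟩ =>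
  ⟨_, fun n => (norm_smul_le _ _).trans (mul_le_mul_of_nonneg_left (h n) (norm_nonneg _))⟩

/-- A positive weight on the lattice that changes at most by the factor `θ⁻¹` from one site to the
next. -/
structure IsWeight (θ : ℝ) (ϱ : ℤ → ℝ) : Prop where
  pos : ∀ n, 0 < ϱ n
  up : ∀ n, θ * ϱ (n + 1) ≤ ϱ n
  down : ∀ n, θ * ϱ n ≤ ϱ (n + 1)

/-- The sequence `v` is bounded by `a` in the sup norm with weight `ϱ`. -/
def WBound {E : Type*} [Norm E] (ϱ : ℤ → ℝ) (a : ℝ) (v : ℤ → E) : Prop :=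
  ∀ n, ‖v n‖ ≤ a * ϱ n

lemma WBound.mono {E : Type*} [Norm E] {θ : ℝ} {ϱ : ℤ → ℝ} {a b : ℝ} {v : ℤ → E}
    (h : WBound ϱ a v) (hϱ : IsWeight θ ϱ) (hab : a ≤ b) : WBound ϱ b v := fun n =>
  (h n).trans (mul_le_mul_of_nonneg_right hab (hϱ.pos n).le)

lemma WBound.nonneg {E : Type*} [SeminormedAddCommGroup E] {θ : ℝ} {ϱ : ℤ → ℝ} {a : ℝ}
    {v : ℤ → E} (h : WBound ϱ a v) (hϱ : IsWeight θ ϱ) : 0 ≤ a := by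
  exact nonneg_of_mul_nonneg_left ((norm_nonneg _).trans (h 0)) (hϱ.pos 0)

/-- An a priori estimate `|v| ≤ a + k |v|` with `k < 1` bounds `v`, provided that the norm is
finite. -/
lemma WBound.absorb {E : Type*} [SeminormedAddCommGroup E] {θ : ℝ} {ϱ : ℤ → ℝ} {a k : ℝ}
    {v : ℤ → E} (hϱ : IsWeight θ ϱ) (hk : k < 1) (hfin : ∃ B, WBound ϱ B v)
    (h : ∀ B, 0 ≤ B → WBound ϱ B v → WBound ϱ (a + k * B) v) : WBound ϱ (a / (1 - k)) v := by
  obtain ⟨B₁, hB₁⟩ := hfin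
  have hbdd : BddAbove (Set.range fun n => ‖v n‖ / ϱ n) :=
    ⟨B₁, Set.forall_mem_range.2 fun n => (div_le_iff₀ (hϱ.pos n)).2 (hB₁ n)⟩
  set B := ⨆ n, ‖v n‖ / ϱ n
  have hBv : WBound ϱ B v := fun n => (div_le_iff₀ (hϱ.pos n)).1 (le_ciSup hbdd n)
  have h3 : B ≤ a + k * B :=
    ciSup_le fun n => (div_le_iff₀ (hϱ.pos n)).2 (h B (hBv.nonneg hϱ) hBv n)
  refine hBv.mono hϱ ?_
  rw [le_div_iff₀ (by linarith)]
  linarith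

lemma IsWeight.succ_le {θ : ℝ} {ϱ : ℤ → ℝ} (hϱ : IsWeight θ ϱ) (hθ : 0 < θ) (n : ℤ) :
    ϱ (n + 1) ≤ θ⁻¹ * ϱ n := by
  rw [inv_mul_eq_div, le_div_iff₀ hθ, mul_comm]; exact hϱ.up n

lemma IsWeight.pred_le {θ : ℝ} {ϱ : ℤ → ℝ} (hϱ : IsWeight θ ϱ) (hθ : 0 < θ) (n : ℤ) :
    ϱ (n - 1) ≤ θ⁻¹ * ϱ n := by
  rw [inv_mul_eq_div, le_div_iff₀ hθ, mul_comm]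
  simpa using hϱ.down (n - 1)

lemma IsWeight.max {θ : ℝ} {ϱ₁ ϱ₂ : ℤ → ℝ} (h₁ : IsWeight θ ϱ₁) (h₂ : IsWeight θ ϱ₂)
    (hθ : 0 < θ) : IsWeight θ (fun n => max (ϱ₁ n) (ϱ₂ n)) where
  pos n := lt_max_of_lt_left (h₁.pos n)
  up n := by
    rw [mul_max_of_nonneg _ _ hθ.le]; exact max_le_max (h₁.up n) (h₂.up n)
  down n := by
    rw [mul_max_of_nonneg _ _ hθ.le]; exact max_le_max (h₁.down n) (h₂.down n)

lemma IsWeight.const_mul {θ c : ℝ} {ϱ : ℤ → ℝ} (h : IsWeight θ ϱ) (hc : 0 < c) :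
    IsWeight θ (fun n => c * ϱ n) where
  pos n := mul_pos hc (h.pos n)
  up n := by have := mul_le_mul_of_nonneg_left (h.up n) hc.le; linarith
  down n := by have := mul_le_mul_of_nonneg_left (h.down n) hc.le; linarith

lemma IsWeight.one {θ : ℝ} (hθ : θ ≤ 1) : IsWeight θ (fun _ => 1) where
  pos _ := one_pos
  up _ := by linarith
  down _ := by linarith

lemma IsWeight.sum {θ : ℝ} {κ : Type*} [Fintype κ] [Nonempty κ] {ϱ : κ → ℤ → ℝ}
    (h : ∀ i, IsWeight θ (ϱ i)) : IsWeight θ (fun n => ∑ i, ϱ i n) where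
  pos n := sum_pos (fun i _ => (h i).pos n) univ_nonempty
  up n := by rw [mul_sum]; exact sum_le_sum fun i _ => (h i).up n
  down n := by rw [mul_sum]; exact sum_le_sum fun i _ => (h i).down n

/-- The weight `θ^|n - p|`, which decays away from the site `p`. -/
def bump (θ : ℝ) (p n : ℤ) : ℝ := θ ^ (n - p).natAbs

lemma bump_pos {θ : ℝ} (hθ : 0 < θ) (p n : ℤ) : 0 < bump θ p n := pow_pos hθ _

lemma bump_le_one {θ : ℝ} (hθ : 0 < θ) (hθ1 : θ < 1) (p n : ℤ) : bump θ p n ≤ 1 :=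
  pow_le_one₀ hθ.le hθ1.le

lemma bump_isWeight {θ : ℝ} (hθ : 0 < θ) (hθ1 : θ < 1) (p : ℤ) : IsWeight θ (bump θ p) where
  pos n := bump_pos hθ p n
  up n := by
    rw [bump, ← pow_succ']; exact pow_le_pow_of_le_one hθ.le hθ1.le (by omega)
  down n := by
    rw [bump, ← pow_succ']; exact pow_le_pow_of_le_one hθ.le hθ1.le (by omega)

lemma bump_inv_isWeight {θ : ℝ} (hθ : 0 < θ) (hθ1 : θ < 1) (p : ℤ) :
    IsWeight θ (fun n => (bump θ p n)⁻¹) where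
  pos n := inv_pos.2 (bump_pos hθ p n)
  up n := by
    rw [← div_eq_mul_inv, div_le_iff₀ (bump_pos hθ p _), inv_mul_eq_div,
      le_div_iff₀ (bump_pos hθ p n)]
    exact (bump_isWeight hθ hθ1 p).down n
  down n := by
    rw [← div_eq_mul_inv, div_le_iff₀ (bump_pos hθ p n), inv_mul_eq_div,
      le_div_iff₀ (bump_pos hθ p _)]
    exact (bump_isWeight hθ hθ1 p).up n

lemma IsWeight.le_bump_inv {θ : ℝ} {ϱ : ℤ → ℝ} (hϱ : IsWeight θ ϱ) (hθ : 0 < θ)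
    (p n : ℤ) : bump θ p n * ϱ n ≤ ϱ p := by
  unfold bump
  obtain ⟨k, hk⟩ : ∃ k : ℕ, (n - p).natAbs = k := ⟨_, rfl⟩
  induction k generalizing n with
  | zero => have : n = p := by omega
            subst this; simp
  | succ k ih =>
    have key : ∀ n', (n' - p).natAbs = k → θ * ϱ n ≤ ϱ n' → θ ^ (n - p).natAbs * ϱ n ≤ ϱ p :=
      fun n' h1 h2 => by
        have := ih n' h1
        rw [h1] at this
        rw [hk, pow_succ, mul_assoc]
        exact le_trans (by gcongr) this
    rcases le_or_gt p n with h | h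
    · exact key (n - 1) (by omega) (by simpa using hϱ.up (n - 1))
    · exact key (n + 1) (by omega) (hϱ.down n)

lemma IsWeight.bump_le {θ : ℝ} {ϱ : ℤ → ℝ} (hϱ : IsWeight θ ϱ) (hθ : 0 < θ)
    (p n : ℤ) : bump θ p n * ϱ p ≤ ϱ n := by
  have h := hϱ.le_bump_inv hθ n p
  have : bump θ n p = bump θ p n := by unfold bump; congr 1; omega
  rwa [this] at h

/-! ### The lattice system in Fourier coordinates -/

/-- The Galerkin lattice system `d Δu - g(u) + S u = 0` in the coordinates of a real orthonormal
basis of trigonometric functions: `J` is the time derivative, `-S = J²` is diagonal, `A` is the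
derivative of the nonlinearity `g`, and `par` records the parity in time of the basis functions.
The numbers `ν k` are the stable eigenvalues of the spatial dynamics linearized at zero. -/
structure Chain (ι : Type) [Fintype ι] [DecidableEq ι] where
  d : ℝ
  a₀ : ℝ
  S : ι → ℝ
  J : Matrix ι ι ℝ
  par : ι → ℝ
  g : (ι → ℝ) → ι → ℝ
  A : (ι → ℝ) → Matrix ι ι ℝ
  ν : ι → ℝ
  d_pos : 0 < d
  par_eq : IsSign par
  J_skew : J.transpose = -J
  J_sq : J * J = -diagonal S
  J_par : ∀ i j, par i * J i j = -(J i j * par j)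
  A_symm : ∀ x, (A x).transpose = A x
  A_par : ∀ x, (∀ i, par i * x i = x i) → ∀ i j, par i * A x i j = A x i j * par j
  g_par : ∀ x, (∀ i, par i * x i = x i) → ∀ i, par i * g x i = g x i
  A_zero : A 0 = a₀ • (1 : Matrix ι ι ℝ)
  A_neg : ∀ x, A (-x) = A x
  g_neg : ∀ x, g (-x) = -g x
  A_lip : ∀ R : ℝ, ∃ C, 0 ≤ C ∧ ∀ x y, ‖x‖ ≤ R → ‖y‖ ≤ R → ∀ i j,
    |A x i j - A y i j| ≤ C * (‖x‖ + ‖y‖) * ‖x - y‖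
  g_taylor : ∀ R : ℝ, ∃ C, 0 ≤ C ∧ ∀ x y, ‖x‖ ≤ R → ‖y‖ ≤ R →
    ‖g x - g y - (A y).mulVec (x - y)‖ ≤ C * (‖x‖ + ‖y‖) * ‖x - y‖ ^ 2
  A_J : ∀ x, (A x).mulVec (J.mulVec x) = J.mulVec (g x)
  ν_ne : ∀ i, ν i ≠ 0
  ν_eq : ∀ i, d * (ν i + (ν i)⁻¹) = 2 * d + a₀ - S i

variable {ι : Type} [Fintype ι] [DecidableEq ι] (Λ : Chain ι)

/-- The linear lattice operator `d Δv + S v - B v` with a matrix potential `B`. -/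
def Chain.op (B : ℤ → Matrix ι ι ℂ) : (ℤ → ι → ℂ) →ₗ[ℂ] ℤ → ι → ℂ where
  toFun v n i := (Λ.d : ℂ) * (v (n + 1) i + v (n - 1) i - 2 * v n i) + (Λ.S i : ℂ) * v n i
    - (B n).mulVec (v n) i
  map_add' v w := by funext n i; simp only [mulVec_add, Pi.add_apply]; ring
  map_smul' c v := by
    funext n i; simp only [mulVec_smul, Pi.smul_apply, smul_eq_mul, RingHom.id_apply]; ring

lemma Chain.op_apply (B : ℤ → Matrix ι ι ℂ) (v : ℤ → ι → ℂ) (n : ℤ) (i : ι) :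
    Λ.op B v n i = Λ.d * (v (n + 1) i + v (n - 1) i - 2 * v n i) + Λ.S i * v n i
      - (B n).mulVec (v n) i := rfl

/-- The potential of the linearization at zero. -/
def Chain.pot₀ : ℤ → Matrix ι ι ℂ := fun _ =>
  (Λ.a₀ : ℂ) • (1 : Matrix ι ι ℂ)

/-- The potential of the linearization along `u`. -/
def Chain.pot (u : ℤ → ι → ℝ) : ℤ → Matrix ι ι ℂ := fun n =>
  (Λ.A (u n)).map (fun x : ℝ => (x : ℂ))

lemma norm_dotProduct_le {E : Type*} [NormedField E] (x y : ι → E) :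
    ‖x ⬝ᵥ y‖ ≤ card ι * (‖x‖ * ‖y‖) :=
  (norm_sum_le_of_le _ fun i _ => (norm_mul_le _ _).trans (mul_le_mul (norm_le_pi_norm x i)
    (norm_le_pi_norm y i) (norm_nonneg _) (norm_nonneg _))).trans_eq (by simp)

lemma norm_mulVec_le {E : Type*} [NormedField E] {b : ℝ} (M : Matrix ι ι E) (hb : 0 ≤ b)
    (hM : ∀ i j, ‖M i j‖ ≤ b) (v : ι → E) : ‖M.mulVec v‖ ≤ card ι * b * ‖v‖ := by
  rw [pi_norm_le_iff_of_nonneg (by positivity)]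
  intro i
  rw [mul_assoc]
  refine (norm_dotProduct_le _ v).trans ?_
  gcongr
  exact (pi_norm_le_iff_of_nonneg hb).2 (hM i)

lemma Chain.op_sub_pot (B B' : ℤ → Matrix ι ι ℂ)
    (v : ℤ → ι → ℂ) (n : ℤ) : Λ.op B' v n = Λ.op B v n + (B n - B' n).mulVec (v n) := by
  funext i
  simp only [op_apply, sub_mulVec, Pi.add_apply, Pi.sub_apply]
  ring

/-! ### The linearization at zero -/

lemma shift_bound {θ κ ν a : ℝ} {ϱ : ℤ → ℝ} (hϱ : IsWeight θ ϱ) (hθ : 0 < θ)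
    (hν : |ν| ≤ κ * θ) (hκ : κ < 1) {s : ℤ} (hs : s = 1 ∨ s = -1) {y f : ℤ → ℂ}
    (hy : ∃ B, WBound ϱ B y) (hf : WBound ϱ a f)
    (h : ∀ n, y n - ν * y (n + s) = f n) : WBound ϱ (a / (1 - κ)) y := by
  refine WBound.absorb hϱ hκ hy fun B hB hyB n => ?_
  have hsϱ : ϱ (n + s) ≤ θ⁻¹ * ϱ n := by
    rcases hs with rfl | rfl
    · exact hϱ.succ_le hθ n
    · exact hϱ.pred_le hθ n
  rw [show y n = f n + ν * y (n + s) by rw [← h n]; ring, add_mul]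
  refine norm_add_le_of_le (hf n) ?_
  have hκ0 : 0 ≤ κ * θ := (abs_nonneg _).trans hν
  calc _ = |ν| * ‖y (n + s)‖ := by rw [norm_mul, norm_real, norm_eq_abs]
    _ ≤ (κ * θ) * (B * (θ⁻¹ * ϱ n)) := by gcongr; exact (hyB _).trans (by gcongr)
    _ = κ * B * ϱ n := by field_simp

/-- The linearization at zero factors into two first order operators. -/
lemma Chain.op_pot₀_apply (v : ℤ → ι → ℂ) (n : ℤ) (i : ι) :
    Λ.op Λ.pot₀ v n i = -(Λ.d / Λ.ν i : ℂ) * ((v n i - Λ.ν i * v (n - 1) i)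
      - Λ.ν i * (v (n + 1) i - Λ.ν i * v n i)) := by
  have hνi : (Λ.ν i : ℂ) ≠ 0 := by exact_mod_cast Λ.ν_ne i
  have e : ((2 * Λ.d + Λ.a₀ - Λ.S i : ℝ) : ℂ) = Λ.d * (Λ.ν i + (Λ.ν i : ℂ)⁻¹) := by
    rw [← Λ.ν_eq i]; push_cast; ring
  rw [show Λ.op Λ.pot₀ v n i = Λ.d * (v (n + 1) i + v (n - 1) i)
      - ((2 * Λ.d + Λ.a₀ - Λ.S i : ℝ) : ℂ) * v n i by
    simp only [op_apply, pot₀, smul_mulVec, one_mulVec, Pi.smul_apply, smul_eq_mul]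
    push_cast; ring, e]
  field_simp
  ring

/-- The a priori estimate with constant `C` for the linearization at zero, in all weights. -/
def Chain.Free (θ C : ℝ) : Prop :=
  ∀ ϱ, IsWeight θ ϱ → ∀ (v : ℤ → ι → ℂ) (a : ℝ), (∃ B, WBound ϱ B v) →
    WBound ϱ a (Λ.op Λ.pot₀ v) → WBound ϱ (C * a) v

lemma Chain.Free.bdd {Λ : Chain ι} {θ C a : ℝ} (h : Λ.Free θ C) (hθ : θ ≤ 1) {v : ℤ → ι → ℂ}
    (hv : IsBdd v) (hL : ∀ n, ‖Λ.op Λ.pot₀ v n‖ ≤ a) (n : ℤ) : ‖v n‖ ≤ C * a := by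
  simpa using h _ (.one hθ) v a (by simpa [WBound] using hv) (by simpa [WBound] using hL) n

/-- The linearization at zero is boundedly invertible in every weighted sup norm whose weight
varies more slowly than the eigenvalues `ν`: it factors into two first order operators. -/
lemma Chain.free_bound {θ : ℝ} (hθ : 0 < θ)
    (hν : ∀ i, |Λ.ν i| < θ) : ∃ C, 0 < C ∧ Λ.Free θ C := by
  obtain ⟨κ, hκ0, hκ1, hκ⟩ : ∃ κ, 0 < κ ∧ κ < 1 ∧ ∀ i, |Λ.ν i| ≤ κ * θ := by
    rcases isEmpty_or_nonempty ι with hι | hι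
    · exact ⟨1/2, by norm_num, by norm_num, fun i => (hι.false i).elim⟩
    · obtain ⟨i₀, hi₀⟩ := Finite.exists_max fun i => |Λ.ν i|
      refine ⟨|Λ.ν i₀| / θ, div_pos (abs_pos.2 (Λ.ν_ne i₀)) hθ, (div_lt_one hθ).2 (hν i₀),
        fun i => ?_⟩
      rw [div_mul_cancel₀ _ hθ.ne']; exact hi₀ i
  have hκ' : 0 < 1 - κ := by linarith
  have hd := Λ.d_pos
  refine ⟨θ / Λ.d / (1 - κ) / (1 - κ), by positivity, fun ϱ hϱ v a hv hLv n => ?_⟩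
  have ha : 0 ≤ a := hLv.nonneg hϱ
  rw [pi_norm_le_iff_of_nonneg (mul_nonneg (by positivity) (hϱ.pos n).le)]
  intro i
  have hd' : (Λ.d : ℂ) ≠ 0 := by exact_mod_cast hd.ne'
  have hνi : (Λ.ν i : ℂ) ≠ 0 := by exact_mod_cast Λ.ν_ne i
  obtain ⟨B, hB⟩ := hv
  have hBi : WBound ϱ B fun n => v n i := fun n => (norm_le_pi_norm _ i).trans (hB n)
  have hB0 : 0 ≤ B := hBi.nonneg hϱ
  set y : ℤ → ℂ := fun n => v n i - Λ.ν i * v (n - 1) i with hy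
  have hyb : ∃ B, WBound ϱ B y := by
    refine ⟨B + |Λ.ν i| * (B * θ⁻¹), fun n => ?_⟩
    rw [add_mul, mul_assoc, mul_assoc]
    refine norm_sub_le_of_le (hBi n) ?_
    rw [norm_mul, norm_real, norm_eq_abs]
    gcongr
    exact (hBi _).trans (by gcongr; exact hϱ.pred_le hθ n)
  have hyw : WBound ϱ (θ / Λ.d * a / (1 - κ)) y := by
    refine shift_bound (s := 1) hϱ hθ (hκ i) hκ1 (Or.inl rfl) hyb
      (f := fun n => -(Λ.ν i / Λ.d : ℂ) * Λ.op Λ.pot₀ v n i) (fun n => ?_) (fun n => ?_)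
    · rw [norm_mul, norm_neg, norm_div, norm_real, norm_real, norm_eq_abs,
        norm_eq_abs, abs_of_pos hd, mul_assoc]
      gcongr
      exacts [(hν i).le, (norm_le_pi_norm _ i).trans (hLv n)]
    · rw [Λ.op_pot₀_apply]
      simp only [hy, add_sub_cancel_right]
      field_simp
  have hvw := shift_bound (s := -1) hϱ hθ (hκ i) hκ1 (Or.inr rfl) (y := fun n => v n i) ⟨B, hBi⟩ hyw
    (fun n => by simp only [hy, sub_eq_add_neg])
  refine (hvw n).trans (le_of_eq ?_)
  field_simp

open Chain

/-! ### Real operators and the primary breather -/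

/-- The linearization `d Δv + S v - A(u) v` along `u`, on real sequences. -/
def Chain.opR (u : ℤ → ι → ℝ) : (ℤ → ι → ℝ) →ₗ[ℝ] ℤ → ι → ℝ where
  toFun v n i :=
    Λ.d * (v (n + 1) i + v (n - 1) i - 2 * v n i) + Λ.S i * v n i - (Λ.A (u n)).mulVec (v n) i
  map_add' v w := by funext n i; simp only [mulVec_add, Pi.add_apply]; ring
  map_smul' c v := by
    funext n i; simp only [mulVec_smul, Pi.smul_apply, smul_eq_mul, RingHom.id_apply]; ring

lemma Chain.opR_apply (u v : ℤ → ι → ℝ) (n : ℤ) (i : ι) :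
    Λ.opR u v n i = Λ.d * (v (n + 1) i + v (n - 1) i - 2 * v n i) + Λ.S i * v n i
      - (Λ.A (u n)).mulVec (v n) i := rfl

/-- The complexification of a real sequence. -/
def toC (v : ℤ → ι → ℝ) : ℤ → ι → ℂ := fun n i => (v n i : ℂ)

lemma norm_toC (v : ℤ → ι → ℝ) (n : ℤ) : ‖toC v n‖ = ‖v n‖ := by
  simp [toC, Pi.norm_def]

lemma map_mulVec (M : Matrix ι ι ℝ) (v : ι → ℝ) (i : ι) :
    (M.map (fun x : ℝ => (x : ℂ))).mulVec (fun j => (v j : ℂ)) i = ((M.mulVec v i : ℝ) : ℂ) := by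
  simp [mulVec, dotProduct]

lemma Chain.op_toC (u v : ℤ → ι → ℝ) :
    Λ.op (Λ.pot u) (toC v) = toC (Λ.opR u v) := by
  funext n i
  have : (Λ.pot u n).mulVec (toC v n) i = (((Λ.A (u n)).mulVec (v n) i : ℝ) : ℂ) :=
    map_mulVec _ _ _
  simp only [op_apply, this]
  simp [toC, opR_apply]

/-- A nonlinear solution of the lattice system. -/
def Chain.IsSol (u : ℤ → ι → ℝ) : Prop :=
  ∀ n i, Λ.d * (u (n + 1) i + u (n - 1) i - 2 * u n i) + Λ.S i * u n i - Λ.g (u n) i = 0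

/-- A sequence of functions that are even in time. -/
def Chain.IsEven (u : ℤ → ι → ℝ) : Prop :=
  ∀ n i, Λ.par i * u n i = u n i

/-- The time derivative of a sequence. -/
def Chain.dot (u : ℤ → ι → ℝ) : ℤ → ι → ℝ := fun n =>
  Λ.J.mulVec (u n)

lemma Chain.opR_dot (u v : ℤ → ι → ℝ) (n : ℤ) :
    Λ.J.mulVec (fun i => Λ.d * (v (n + 1) i + v (n - 1) i - 2 * v n i) + Λ.S i * v n i - u n i)
      = fun i => Λ.d * (Λ.dot v (n + 1) i + Λ.dot v (n - 1) i - 2 * Λ.dot v n i)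
        + Λ.S i * Λ.dot v n i - Λ.dot u n i := by
  have hJS : Λ.J * diagonal Λ.S = diagonal Λ.S * Λ.J := by
    have h : diagonal Λ.S = -(Λ.J * Λ.J) := by rw [Λ.J_sq]; simp
    rw [h]; simp [mul_assoc]
  have e : (fun i => Λ.d * (v (n + 1) i + v (n - 1) i - 2 * v n i) + Λ.S i * v n i - u n i)
      = Λ.d • (v (n + 1) + v (n - 1) - (2 : ℝ) • v n) + (diagonal Λ.S).mulVec (v n)
        - u n := by
    funext i; simp [mulVec_diagonal]
  rw [e, mulVec_sub, mulVec_add, mulVec_smul, mulVec_sub,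
    mulVec_add, mulVec_smul, mulVec_mulVec, hJS]
  funext i
  simp only [dot, Pi.sub_apply, Pi.add_apply, Pi.smul_apply, smul_eq_mul,
    ← mulVec_mulVec, mulVec_diagonal]

/-- Time translation: the time derivative of a solution solves the linearized equation. -/
lemma Chain.IsSol.opR_dot_eq_zero {Λ : Chain ι} {u : ℤ → ι → ℝ}
    (hu : Λ.IsSol u) : Λ.opR u (Λ.dot u) = 0 := by
  funext n
  have h := Λ.opR_dot (fun n => Λ.g (u n)) u n
  have h0 : (fun i => Λ.d * (u (n + 1) i + u (n - 1) i - 2 * u n i) + Λ.S i * u n i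
      - Λ.g (u n) i) = 0 := funext fun i => hu n i
  rw [h0, mulVec_zero] at h
  have h1 : Λ.dot (fun n => Λ.g (u n)) n = (Λ.A (u n)).mulVec (Λ.dot u n) := (Λ.A_J _).symm
  rw [h1] at h
  exact h.symm

/-- The primary breather `q` in Fourier coordinates, with its frequency derivative `y`: both decay
exponentially, and the bounded solutions of the linearization along `q` are the multiples of the
time derivative of `q`, which does not vanish at the site `n₀`. -/
structure Primary (θ : ℝ) where
  q : ℤ → ι → ℝ
  y : ℤ → ι → ℝ
  n₀ : ℤ
  D : ℝ
  θ_pos : 0 < θ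
  θ_lt : θ < 1
  ν_lt : ∀ i, |Λ.ν i| < θ
  q_even : Λ.IsEven q
  y_even : Λ.IsEven y
  q_sol : Λ.IsSol q
  y_eq : ∀ n, Λ.opR q y n = (2 : ℝ) • Λ.J.mulVec (Λ.dot q n)
  q_dec : WBound (bump θ 0) D q
  y_dec : WBound (bump θ 0) D y
  ne : Λ.dot q n₀ ≠ 0
  ker : ∀ v : ℤ → ι → ℝ, IsBdd v → Λ.opR q v = 0 → ∃ c : ℝ, v = c • Λ.dot q

/-! ### Bounds from the smallness of the potential away from the centers -/

lemma Chain.A_sub_zero_le (R : ℝ) :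
    ∃ C, 0 < C ∧ ∀ x, ‖x‖ ≤ R → ∀ i j, |Λ.A x i j - Λ.A 0 i j| ≤ C * ‖x‖ ^ 2 := by
  obtain ⟨C, hC, h⟩ := Λ.A_lip R
  refine ⟨C + 1, by positivity, fun x hx i j => ?_⟩
  have := h x 0 hx (by simpa using (norm_nonneg x).trans hx) i j
  simp only [norm_zero, add_zero, sub_zero] at this
  nlinarith [sq_nonneg ‖x‖]

lemma Chain.pot_sub_pot₀ (u : ℤ → ι → ℝ) (n : ℤ) (i j : ι) :
    ‖(Λ.pot u n - Λ.pot₀ n) i j‖ = |Λ.A (u n) i j - Λ.A 0 i j| := by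
  have : (Λ.pot u n - Λ.pot₀ n) i j = ((Λ.A (u n) i j - Λ.A 0 i j : ℝ) : ℂ) := by
    rw [Λ.A_zero]
    by_cases h : i = j <;> simp [pot, pot₀, h]
  rw [this, norm_real, norm_eq_abs]

lemma Chain.A_bound (R : ℝ) :
    ∃ C, 0 < C ∧ ∀ u : ℤ → ι → ℝ, ∀ n, ‖u n‖ ≤ R → ∀ i j,
      ‖(Λ.pot u n - Λ.pot₀ n) i j‖ ≤ C := by
  obtain ⟨C, hC, h⟩ := Λ.A_sub_zero_le R
  refine ⟨C * R ^ 2 + 1, by positivity, fun u n hu i j => ?_⟩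
  rw [Λ.pot_sub_pot₀]
  refine (h _ hu i j).trans ?_
  have : ‖u n‖ ^ 2 ≤ R ^ 2 := pow_le_pow_left₀ (norm_nonneg _) hu 2
  nlinarith

lemma Chain.A_small {b : ℝ} (hb : 0 < b) :
    ∃ ρ, 0 < ρ ∧ ∀ u : ℤ → ι → ℝ, ∀ n, ‖u n‖ ≤ ρ → ∀ i j,
      ‖(Λ.pot u n - Λ.pot₀ n) i j‖ ≤ b := by
  obtain ⟨C, hC, h⟩ := Λ.A_sub_zero_le 1
  obtain ⟨ρ, hρ, h1, h2⟩ := exists_mul_le hC.le hb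
  refine ⟨ρ, hρ, fun u n hu i j => ?_⟩
  rw [Λ.pot_sub_pot₀]
  refine (h _ (hu.trans h1) i j).trans (le_trans ?_ h2)
  gcongr
  nlinarith [norm_nonneg (u n)]

lemma exists_bump_le {θ : ℝ} (hθ : 0 < θ) (hθ1 : θ < 1) (D : ℝ) {ε : ℝ} (hε : 0 < ε) :
    ∃ R : ℕ, ∀ p n : ℤ, R ≤ (n - p).natAbs → D * bump θ p n ≤ ε := by
  have h := (tendsto_pow_atTop_nhds_zero_of_lt_one hθ.le hθ1).const_mul (|D|)
  rw [mul_zero] at h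
  obtain ⟨R, hR⟩ := eventually_atTop.1 (h.eventually (ge_mem_nhds hε))
  refine ⟨R, fun p n hn => ?_⟩
  exact (mul_le_mul_of_nonneg_right (le_abs_self D) (bump_pos hθ _ _).le).trans (hR _ hn)

/-- If the linearization at zero is small compared with `v`, up to a term that is bounded in the
weight `ϱ`, then `v` is bounded in this weight. It need only be bounded in another weight before. -/
lemma Chain.weighted_bound {θ C₀ : ℝ} (hθ : 0 < θ)
    (hfree : Λ.Free θ C₀)
    {ϱ ϱ' : ℤ → ℝ} (hϱ : IsWeight θ ϱ) (hϱ' : IsWeight θ ϱ') {b : ℝ} (hb : 0 ≤ b)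
    (hsmall : C₀ * b ≤ 1 / 2) {v : ℤ → ι → ℂ} {a : ℝ} (hv : ∃ K, WBound ϱ' K v) (ha : 0 ≤ a)
    (hL : ∀ n, ‖Λ.op Λ.pot₀ v n‖ ≤ b * ‖v n‖ + a * ϱ n) : WBound ϱ (2 * C₀ * a) v := by
  obtain ⟨K, hK⟩ := hv
  have hK0 : 0 ≤ K := hK.nonneg hϱ'
  -- the weight `max ϱ (ϱ' / k)` makes the norm finite
  have key : ∀ k : ℕ, WBound (fun n => max (ϱ n) ((k + 1 : ℝ)⁻¹ * ϱ' n)) (2 * C₀ * a) v := by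
    intro k
    have hw := hϱ.max (hϱ'.const_mul (c := (k + 1 : ℝ)⁻¹) (by positivity)) hθ
    set w : ℤ → ℝ := fun n => max (ϱ n) ((k + 1 : ℝ)⁻¹ * ϱ' n)
    have hfin : WBound w (K * (k + 1)) v := fun n => by
      refine (hK n).trans ?_
      have : (k + 1 : ℝ)⁻¹ * ϱ' n ≤ w n := le_max_right _ _
      calc K * ϱ' n = K * (k + 1) * ((k + 1 : ℝ)⁻¹ * ϱ' n) := by field_simp
        _ ≤ _ := by gcongr
    refine (WBound.absorb (a := C₀ * a) (k := 1 / 2) hw (by norm_num) ⟨_, hfin⟩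
      fun M hM hMv => (hfree w hw v (b * M + a) ⟨_, hMv⟩ fun n => (hL n).trans ?_).mono hw
        (by nlinarith)).mono hw (le_of_eq (by ring))
    have h1 : ϱ n ≤ w n := le_max_left _ _
    have h2 := hMv n
    calc _ ≤ b * (M * w n) + a * w n := by gcongr
      _ = _ := by ring
  intro n
  have hlim : Tendsto (fun k : ℕ => 2 * C₀ * a * max (ϱ n) ((k + 1 : ℝ)⁻¹ * ϱ' n)) atTop
      (𝓝 (2 * C₀ * a * max (ϱ n) (0 * ϱ' n))) := by
    refine Tendsto.const_mul _ (Tendsto.max tendsto_const_nhds (Tendsto.mul_const _ ?_))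
    simpa [one_div] using tendsto_one_div_add_atTop_nhds_zero_nat (𝕜 := ℝ)
  rw [zero_mul, max_eq_left (hϱ.pos n).le] at hlim
  exact ge_of_tendsto' hlim fun k => key k n

/-- If the potential is close to its value at zero off the set `s`, then weighted bounds of a
solution follow from bounds on `s`. -/
lemma Chain.far_bound {θ C₀ : ℝ} (hθ : 0 < θ)
    (hfree : Λ.Free θ C₀)
    {ϱ ϱ' : ℤ → ℝ} (hϱ : IsWeight θ ϱ) (hϱ' : IsWeight θ ϱ') {B : ℤ → Matrix ι ι ℂ} (s : Set ℤ)
    {b b' : ℝ} (hb : 0 ≤ b) (hb' : 0 ≤ b') (hsmall : C₀ * (card ι * b) ≤ 1 / 2)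
    (hBs : ∀ n ∉ s, ∀ i j, ‖(B n - Λ.pot₀ n) i j‖ ≤ b)
    (hB : ∀ n, ∀ i j, ‖(B n - Λ.pot₀ n) i j‖ ≤ b')
    {v : ℤ → ι → ℂ} {a m : ℝ} (hv : ∃ K, WBound ϱ' K v) (hm : 0 ≤ m)
    (hvs : ∀ n ∈ s, ‖v n‖ ≤ m * ϱ n) (hL : WBound ϱ a (Λ.op B v)) :
    WBound ϱ (2 * C₀ * (a + card ι * b' * m)) v := by
  have ha : 0 ≤ a := hL.nonneg hϱ
  refine Λ.weighted_bound hθ hfree hϱ hϱ' (by positivity) hsmall hv (by positivity) fun n => ?_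
  rw [Λ.op_sub_pot B Λ.pot₀ v n]
  have hn0 := (hϱ.pos n).le
  have h1 := norm_add_le (Λ.op B v n) ((B n - Λ.pot₀ n).mulVec (v n))
  have h2 := hL n
  have h3 : 0 ≤ card ι * b' * m * ϱ n := by positivity
  have h4 : 0 ≤ card ι * b * ‖v n‖ := by positivity
  by_cases hn : n ∈ s
  · have h5 := norm_mulVec_le (B n - Λ.pot₀ n) hb' (hB n) (v n)
    have h6 := mul_le_mul_of_nonneg_left (hvs n hn) (show 0 ≤ card ι * b' by positivity)
    linarith
  · linarith [norm_mulVec_le (B n - Λ.pot₀ n) hb (hBs n hn) (v n)]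

/-! ### Pairings and Green's identity -/

lemma summable_dotProduct {v w : ℤ → ι → ℂ} (hv : Summable fun n => ‖v n‖ ^ 2)
    (hw : Summable fun n => ‖w n‖ ^ 2) : Summable fun n => v n ⬝ᵥ w n := by
  refine Summable.of_norm_bounded (g := fun n => card ι * (‖v n‖ ^ 2 + ‖w n‖ ^ 2))
    ((hv.add hw).mul_left _) fun n => (norm_dotProduct_le _ _).trans ?_
  gcongr
  nlinarith [sq_nonneg (‖v n‖ - ‖w n‖), sq_nonneg ‖v n‖, sq_nonneg ‖w n‖]

lemma summable_shift {v : ℤ → ι → ℂ} (hv : Summable fun n => ‖v n‖ ^ 2) (k : ℤ) :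
    Summable fun n => ‖v (n + k)‖ ^ 2 :=
  (Equiv.addRight k).summable_iff (f := fun n => ‖v n‖ ^ 2) |>.2 hv

/-- The lattice Wronskian of two sequences between the sites `n - 1` and `n`. -/
def Chain.wronskian (v w : ℤ → ι → ℂ) (n : ℤ) : ℂ :=
  Λ.d * (v n ⬝ᵥ w (n - 1) - v (n - 1) ⬝ᵥ w n)

lemma Chain.summable_wronskian {v w : ℤ → ι → ℂ}
    (hv : Summable fun n => ‖v n‖ ^ 2) (hw : Summable fun n => ‖w n‖ ^ 2) :
    Summable (Λ.wronskian v w) := by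
  have h1 := summable_dotProduct hv (summable_shift hw (-1))
  have h2 := summable_dotProduct (summable_shift hv (-1)) hw
  exact ((h1.sub h2).mul_left (Λ.d : ℂ)).congr fun n => rfl

lemma Chain.wronskian_sub {B : ℤ → Matrix ι ι ℂ}
    (hB : ∀ n, (B n).transpose = B n) (v w : ℤ → ι → ℂ) (n : ℤ) :
    Λ.op B v n ⬝ᵥ w n - v n ⬝ᵥ Λ.op B w n = Λ.wronskian v w (n + 1) - Λ.wronskian v w n := by
  have h1 : (B n).mulVec (v n) ⬝ᵥ w n = v n ⬝ᵥ (B n).mulVec (w n) := by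
    rw [dotProduct_mulVec, ← mulVec_transpose, hB]
  have h2 : ∀ v : ℤ → ι → ℂ, Λ.op B v n = (Λ.d : ℂ) • (v (n + 1) + v (n - 1) - (2 : ℂ) • v n)
      + (fun i => (Λ.S i : ℂ) * v n i) - (B n).mulVec (v n) := fun v => by
    funext i; simp [op_apply]
  have h3 : (fun i => (Λ.S i : ℂ) * v n i) ⬝ᵥ w n = v n ⬝ᵥ fun i => (Λ.S i : ℂ) * w n i := by
    unfold dotProduct; exact sum_congr rfl fun i _ => by ring
  rw [h2, h2]
  simp only [sub_dotProduct, dotProduct_sub, add_dotProduct, dotProduct_add, smul_dotProduct,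
    dotProduct_smul, h1, h3, wronskian, add_sub_cancel_right, smul_eq_mul]
  ring

lemma Chain.norm_op_le (b : ℝ) (hb : 0 ≤ b) :
    ∃ C, 0 < C ∧ ∀ (B : ℤ → Matrix ι ι ℂ) (v : ℤ → ι → ℂ) (n : ℤ), (∀ i j, ‖B n i j‖ ≤ b) →
      ‖Λ.op B v n‖ ≤ C * (‖v (n + 1)‖ + ‖v (n - 1)‖ + ‖v n‖) := by
  set S := ∑ i, |Λ.S i|
  have hS : ∀ i, |Λ.S i| ≤ S := fun i =>
    single_le_sum (f := fun i => |Λ.S i|) (fun i _ => abs_nonneg _) (mem_univ i)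
  have hS0 : 0 ≤ S := by positivity
  have hd := Λ.d_pos
  refine ⟨2 * Λ.d + S + card ι * b, by positivity, fun B v n hB => ?_⟩
  rw [pi_norm_le_iff_of_nonneg (by positivity)]
  intro i
  have h : ∀ n, ‖v n i‖ ≤ ‖v n‖ := fun n => norm_le_pi_norm (v n) i
  simp only [op_apply]
  calc
    _ ≤ Λ.d * (‖v (n + 1)‖ + ‖v (n - 1)‖ + 2 * ‖v n‖) + S * ‖v n‖
        + card ι * b * ‖v n‖ := by
      refine norm_sub_le_of_le (norm_add_le_of_le ?_ ?_)
        ((norm_le_pi_norm ((B n).mulVec (v n)) i).trans (norm_mulVec_le _ hb hB _))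
      · rw [norm_mul, norm_real, norm_eq_abs, abs_of_pos hd]
        gcongr
        refine norm_sub_le_of_le (norm_add_le_of_le (h _) (h _)) ?_
        rw [norm_mul, Complex.norm_ofNat]
        gcongr
        exact h n
      · rw [norm_mul, norm_real, norm_eq_abs]
        gcongr
        exacts [hS i, h n]
    _ ≤ Λ.d * (2 * (‖v (n + 1)‖ + ‖v (n - 1)‖ + ‖v n‖))
        + S * (‖v (n + 1)‖ + ‖v (n - 1)‖ + ‖v n‖)
        + card ι * b * (‖v (n + 1)‖ + ‖v (n - 1)‖ + ‖v n‖) := by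
      have p1 := norm_nonneg (v (n + 1))
      have p2 := norm_nonneg (v (n - 1))
      gcongr <;> linarith
    _ = _ := by ring

lemma Chain.summable_op {B : ℤ → Matrix ι ι ℂ} {b : ℝ}
    (hB : ∀ n i j, ‖B n i j‖ ≤ b) {v : ℤ → ι → ℂ} (hv : Summable fun n => ‖v n‖ ^ 2) :
    Summable fun n => ‖Λ.op B v n‖ ^ 2 := by
  obtain ⟨X, hX, hle⟩ := Λ.norm_op_le |b| (abs_nonneg b)
  have hsum := (((summable_shift hv 1).add (summable_shift hv (-1))).add hv).mul_left (3 * X ^ 2)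
  refine Summable.of_nonneg_of_le (fun n => sq_nonneg _) (fun n => ?_) hsum
  calc ‖Λ.op B v n‖ ^ 2 ≤ (X * (‖v (n + 1)‖ + ‖v (n - 1)‖ + ‖v n‖)) ^ 2 :=
        by gcongr; exact hle B v n fun i j => (hB n i j).trans (le_abs_self b)
    _ ≤ 3 * X ^ 2 * (‖v (n + 1)‖ ^ 2 + ‖v (n + -1)‖ ^ 2 + ‖v n‖ ^ 2) := by
        rw [← sub_eq_add_neg, mul_pow]
        have := sq_nonneg X
        nlinarith [mul_nonneg this (sq_nonneg (‖v (n + 1)‖ - ‖v (n - 1)‖)),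
          mul_nonneg this (sq_nonneg (‖v (n + 1)‖ - ‖v n‖)),
          mul_nonneg this (sq_nonneg (‖v (n - 1)‖ - ‖v n‖))]

/-- Green's identity on the whole lattice. -/
lemma Chain.green {B : ℤ → Matrix ι ι ℂ} {b : ℝ}
    (hBs : ∀ n, (B n).transpose = B n) (hB : ∀ n i j, ‖B n i j‖ ≤ b) {v w : ℤ → ι → ℂ}
    (hv : Summable fun n => ‖v n‖ ^ 2) (hw : Summable fun n => ‖w n‖ ^ 2) :
    ∑' n, Λ.op B v n ⬝ᵥ w n = ∑' n, v n ⬝ᵥ Λ.op B w n := by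
  have h1 := summable_dotProduct (Λ.summable_op hB hv) hw
  have h2 := summable_dotProduct hv (Λ.summable_op hB hw)
  rw [← sub_eq_zero, ← h1.tsum_sub h2]
  simp only [Λ.wronskian_sub hBs]
  have hW := Λ.summable_wronskian hv hw
  have hW' : Summable fun n => Λ.wronskian v w (n + 1) :=
    (Equiv.addRight (1 : ℤ)).summable_iff (f := fun n => Λ.wronskian v w n) |>.2 hW
  rw [hW'.tsum_sub hW, sub_eq_zero]
  exact (Equiv.addRight (1 : ℤ)).tsum_eq fun n => Λ.wronskian v w n

lemma summable_bump_sq {θ : ℝ} (hθ : 0 < θ) (hθ1 : θ < 1) (p : ℤ) :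
    Summable fun n => bump θ p n ^ 2 := by
  have h0 : Summable fun n : ℤ => (θ ^ 2) ^ n.natAbs := by
    have h := summable_geometric_of_lt_one (r := θ ^ 2) (by positivity)
      (pow_lt_one₀ hθ.le hθ1 (by norm_num))
    refine Summable.of_nat_of_neg ?_ ?_ <;> simpa using h
  have := (Equiv.subRight p).summable_iff (f := fun n : ℤ => (θ ^ 2) ^ n.natAbs) |>.2 h0
  refine this.congr fun n => ?_
  simp [bump, ← pow_mul, mul_comm]

lemma WBound.summable_sq {θ : ℝ} (hθ : 0 < θ) (hθ1 : θ < 1) {p : ℤ} {a : ℝ} {v : ℤ → ι → ℂ}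
    (h : WBound (bump θ p) a v) : Summable fun n => ‖v n‖ ^ 2 := by
  refine Summable.of_nonneg_of_le (fun n => sq_nonneg _) (fun n => ?_)
    ((summable_bump_sq hθ hθ1 p).mul_left (a ^ 2))
  rw [← mul_pow]
  gcongr
  exact h n

open Primary

variable {Λ : Chain ι} {θ : ℝ}

variable (P : Primary Λ θ)

/-! ### A priori estimate along one copy of the primary breather -/

lemma Primary.D_nonneg : 0 ≤ P.D :=
  P.q_dec.nonneg (bump_isWeight P.θ_pos P.θ_lt 0)

lemma Primary.norm_q_le (n : ℤ) : ‖P.q n‖ ≤ P.D :=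
  (P.q_dec n).trans (mul_le_of_le_one_right P.D_nonneg (bump_le_one P.θ_pos P.θ_lt 0 n))

lemma pot_transpose (Λ : Chain ι) (u : ℤ → ι → ℝ) (n : ℤ) :
    (Λ.pot u n).transpose = Λ.pot u n := by
  unfold pot
  rw [← transpose_map, Λ.A_symm]

lemma pot_bound (Λ : Chain ι) (R : ℝ) :
    ∃ C, 0 < C ∧ ∀ u : ℤ → ι → ℝ, (∀ n, ‖u n‖ ≤ R) → ∀ n i j, ‖Λ.pot u n i j‖ ≤ C := by
  obtain ⟨C, hC, h⟩ := Λ.A_bound R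
  refine ⟨C + |Λ.a₀|, by positivity, fun u hu n i j => ?_⟩
  have h1 : Λ.pot u n i j = (Λ.pot u n - Λ.pot₀ n) i j + Λ.pot₀ n i j := by simp
  rw [h1]
  refine (norm_add_le _ _).trans (add_le_add (h u n (hu n) i j) ?_)
  by_cases h : i = j <;> simp [pot₀, h]

lemma toC_dotProduct_self_ne {b : ι → ℝ} (hb : b ≠ 0) :
    (fun i => (b i : ℂ)) ⬝ᵥ (fun i => (b i : ℂ)) ≠ 0 := by
  have : (fun i => (b i : ℂ)) ⬝ᵥ (fun i => (b i : ℂ)) = ((b ⬝ᵥ b : ℝ) : ℂ) := by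
    simp [dotProduct]
  rw [this]
  exact_mod_cast fun h => hb (dotProduct_self_eq_zero.1 h)

lemma norm_mulVec_matrix_le (M : Matrix ι ι ℝ) :
    ∃ C, 0 < C ∧ ∀ v : ι → ℝ, ‖M.mulVec v‖ ≤ C * ‖v‖ := by
  refine ⟨card ι * (∑ i, ∑ j, |M i j|) + 1, by positivity, fun v => ?_⟩
  refine (norm_mulVec_le M (b := ∑ i, ∑ j, |M i j|) (by positivity) (fun i j => ?_) v).trans ?_
  · exact (single_le_sum (f := fun j => |M i j|) (fun _ _ => abs_nonneg _)
      (mem_univ j)).trans (single_le_sum (f := fun i => ∑ j, |M i j|)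
      (fun _ _ => by positivity) (mem_univ i))
  · nlinarith [norm_nonneg v]

lemma Primary.dot_q_dec : ∃ D', WBound (bump θ 0) D' (Λ.dot P.q) := by
  obtain ⟨C, hC, h⟩ := norm_mulVec_matrix_le Λ.J
  refine ⟨C * P.D, fun n => (h _).trans ?_⟩
  rw [mul_assoc]
  exact mul_le_mul_of_nonneg_left (P.q_dec n) hC.le

/-- The vector `q̇` at the reference site, with complex entries. -/
def Primary.b : ι → ℂ := toC (Λ.dot P.q) P.n₀

lemma Primary.b_ne : P.b ⬝ᵥ P.b ≠ 0 := toC_dotProduct_self_ne P.ne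

lemma Primary.b_norm_pos : 0 < ‖P.b‖ := by
  rw [norm_pos_iff]
  intro h
  apply P.b_ne
  rw [h, zero_dotProduct]

/-- The sequence with the single value `ξ q̇` at the reference site. -/
def Primary.pulse (ξ : ℂ) : ℤ → ι → ℂ := Pi.single P.n₀ (ξ • P.b)

/-- Away from the center the potential is close to its value at zero, so that a solution is
controlled by its values near the center. -/
lemma Primary.far_bound :
    ∃ C, 0 < C ∧ ∃ R : ℕ, ∀ ϱ ϱ', IsWeight θ ϱ → IsWeight θ ϱ' →
      ∀ (v : ℤ → ι → ℂ) (ξ : ℂ) (a m : ℝ), (∃ K, WBound ϱ' K v) → 0 ≤ m →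
        (∀ n : ℤ, n.natAbs ≤ R → ‖v n‖ ≤ m * ϱ n) →
        WBound ϱ a (Λ.op (Λ.pot P.q) v - P.pulse ξ) →
        WBound ϱ (C * (a + m)) v ∧ ‖ξ • P.b‖ ≤ C * (a + m) * ϱ P.n₀ := by
  have hθ := P.θ_pos
  obtain ⟨C₀, hC₀, hfree⟩ := Λ.free_bound hθ P.ν_lt
  obtain ⟨b', hb', hB⟩ := Λ.A_bound P.D
  obtain ⟨b, hb, -, hsmall⟩ := exists_mul_le (c := C₀ * card ι) (by positivity) one_half_pos
  obtain ⟨ρ, hρ, hsm⟩ := Λ.A_small hb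
  obtain ⟨R, hR⟩ := exists_bump_le hθ P.θ_lt P.D hρ
  obtain ⟨Cb, hCb0, hCb⟩ := pot_bound Λ P.D
  obtain ⟨C₁, hC₁, hop⟩ := Λ.norm_op_le Cb hCb0.le
  obtain ⟨k, hk⟩ : ∃ k, k = 1 + C₁ * (2 * θ⁻¹ + 1) := ⟨_, rfl⟩
  have hk0 : 0 < k := by rw [hk]; positivity
  refine ⟨2 * C₀ * (1 + k + card ι * b') + k, by positivity, max R (P.n₀.natAbs + 1),
    fun ϱ ϱ' hϱ hϱ' v ξ a m hv hm hvs hL => ?_⟩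
  have ha : 0 ≤ a := hL.nonneg hϱ
  have h0 := fun n => (hϱ.pos n).le
  have hξ : ‖ξ • P.b‖ ≤ k * (a + m) * ϱ P.n₀ := by
    rw [show ξ • P.b = Λ.op (Λ.pot P.q) v P.n₀ - (Λ.op (Λ.pot P.q) v - P.pulse ξ) P.n₀ by
      simp [pulse]]
    refine (norm_sub_le_of_le (hop _ v _ (hCb _ P.norm_q_le _)) (hL _)).trans ?_
    have h1 := hvs (P.n₀ + 1) (by omega)
    have h2 := hvs (P.n₀ - 1) (by omega)
    have h3 := hvs P.n₀ (by omega)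
    have h4 := h0 P.n₀
    calc _ ≤ C₁ * (m * (θ⁻¹ * ϱ P.n₀) + m * (θ⁻¹ * ϱ P.n₀) + m * ϱ P.n₀) + a * ϱ P.n₀ := by
          gcongr
          · exact h1.trans (by gcongr; exact hϱ.succ_le hθ _)
          · exact h2.trans (by gcongr; exact hϱ.pred_le hθ _)
      _ ≤ _ := by
          have : 0 ≤ (m + C₁ * (2 * θ⁻¹ + 1) * a) * ϱ P.n₀ := by positivity
          rw [hk]; linarith
  refine ⟨(Λ.far_bound hθ hfree hϱ hϱ' {n : ℤ | n.natAbs ≤ max R (P.n₀.natAbs + 1)} hb.le hb'.le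
    (by rwa [← mul_assoc]) (B := Λ.pot P.q) (a := a + k * (a + m)) (fun n hn => hsm _ n
      ((P.q_dec n).trans (hR 0 n (by
        have h1 : ¬ n.natAbs ≤ max R (P.n₀.natAbs + 1) := hn
        simp only [sub_zero]; omega)))) (fun n => hB _ n (P.norm_q_le n)) hv hm hvs
    fun n => ?_).mono hϱ ?_, hξ.trans ?_⟩
  · rw [← sub_add_cancel (Λ.op (Λ.pot P.q) v) (P.pulse ξ), add_mul]
    refine norm_add_le_of_le (hL n) ?_
    obtain rfl | hn := eq_or_ne n P.n₀
    · simpa [pulse] using hξ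
    · have := h0 n
      simpa [pulse, hn] using by positivity
  · have : 0 ≤ 2 * C₀ * (m + card ι * b' * a) + k * (a + m) := by positivity
    linarith
  · have := h0 P.n₀
    gcongr
    exact le_add_of_nonneg_left (by positivity)

/-- Bounded complex solutions of the linearization along `q` are multiples of `q̇`. -/
lemma Primary.kerC (v : ℤ → ι → ℂ) (hb : IsBdd v)
    (hv : Λ.op (Λ.pot P.q) v = 0) : ∃ c : ℂ, v = c • toC (Λ.dot P.q) := by
  obtain ⟨B, hB⟩ := hb
  have key : ∀ f : ℂ →L[ℝ] ℝ, (∀ z, |f z| ≤ ‖z‖) →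
      ∃ c : ℝ, (fun n i => f (v n i)) = c • Λ.dot P.q := fun f hf => by
    have hs : ∀ (r : ℝ) z, f (r * z) = r * f z := fun r z => by
      rw [← real_smul, map_smul, smul_eq_mul]
    have h2 := hs 2
    push_cast at h2
    refine P.ker _ ⟨B, fun n => (pi_norm_le_iff_of_nonneg ((norm_nonneg _).trans (hB 0))).2 fun i =>
      (hf _).trans ((norm_le_pi_norm _ i).trans (hB n))⟩ (funext fun n => funext fun i => ?_)
    simpa [op_apply, opR_apply, pot, mulVec, dotProduct, hs, h2] using congrArg f (congrFun (congrFun hv n) i)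
  obtain ⟨c₁, h₁⟩ := key reCLM abs_re_le_norm
  obtain ⟨c₂, h₂⟩ := key imCLM abs_im_le_norm
  refine ⟨c₁ + c₂ * Complex.I, funext fun n => funext fun i => ?_⟩
  have e₁ : (v n i).re = c₁ * Λ.dot P.q n i := congrFun (congrFun h₁ n) i
  have e₂ : (v n i).im = c₂ * Λ.dot P.q n i := congrFun (congrFun h₂ n) i
  rw [← re_add_im (v n i), e₁, e₂]
  simp [toC]; ring

/-- The bordered linearization along `q` is injective, even on growing sequences. -/
lemma Primary.bordered_injective (v : ℤ → ι → ℂ) (ξ : ℂ) (K : ℝ)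
    (hK : WBound (fun n => (bump θ 0 n)⁻¹) K v) (hv : Λ.op (Λ.pot P.q) v = P.pulse ξ)
    (hb : P.b ⬝ᵥ v P.n₀ = 0) : v = 0 := by
  have hθ := P.θ_pos
  have hθ1 := P.θ_lt
  obtain ⟨C, hC, R, hfar⟩ := P.far_bound
  have hw := bump_isWeight hθ hθ1 0
  have hw' := bump_inv_isWeight hθ hθ1 0
  have hK0 := hK.nonneg hw'
  have hdec := (hfar _ _ hw hw' v ξ 0 (K / (θ ^ R * θ ^ R)) ⟨K, hK⟩ (by positivity)
    (fun n hn => (hK n).trans ?_) fun n => by simp [hv]).1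
  swap
  · have h1 : θ ^ R ≤ bump θ 0 n := pow_le_pow_of_le_one hθ.le hθ1.le (by simpa using hn)
    rw [← div_eq_mul_inv, div_mul_eq_mul_div, div_le_div_iff₀ (bump_pos hθ _ _) (by positivity),
      mul_assoc]
    have := (bump_pos hθ 0 n).le
    gcongr
  obtain ⟨D', hD'⟩ := P.dot_q_dec
  have hs2 : Summable fun n => ‖toC (Λ.dot P.q) n‖ ^ 2 :=
    WBound.summable_sq (a := D') hθ hθ1 (p := 0) fun n => by rw [norm_toC]; exact hD' n
  obtain ⟨Cb, -, hCb⟩ := pot_bound Λ P.D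
  have hg := Λ.green (pot_transpose Λ P.q) (hCb P.q P.norm_q_le) (hdec.summable_sq hθ hθ1) hs2
  rw [Λ.op_toC, P.q_sol.opR_dot_eq_zero, hv, show toC (0 : ℤ → ι → ℝ) = 0 by funext n i; simp [toC],
    tsum_eq_single P.n₀ (fun n hn => by simp [pulse, hn])] at hg
  have hξ : ξ = 0 := by
    simp only [pulse, Pi.single_eq_same, smul_dotProduct, smul_eq_mul, Pi.zero_apply,
      dotProduct_zero, tsum_zero] at hg
    exact (mul_eq_zero.1 hg).resolve_right P.b_ne
  obtain ⟨c, rfl⟩ := P.kerC v ⟨_, fun n => (hdec n).trans (mul_le_of_le_one_right (hdec.nonneg hw)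
    (bump_le_one hθ hθ1 0 n))⟩ (by rw [hv, hξ]; simp [pulse])
  rw [Pi.smul_apply, dotProduct_smul, smul_eq_mul] at hb
  rw [(mul_eq_zero.1 hb).resolve_right P.b_ne, zero_smul]

lemma Chain.continuous_op (Λ : Chain ι) (B : ℤ → Matrix ι ι ℂ) (n : ℤ) :
    Continuous fun v : ℤ → ι → ℂ => Λ.op B v n := by
  refine continuous_pi fun i => ?_
  simp only [op_apply, mulVec, dotProduct]
  fun_prop

/-- The a priori estimate in normalized form: a small residual improves the bound of a sequence by
a factor. It follows by compactness from the injectivity of the bordered operator. -/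
lemma Primary.halve_bound :
    ∃ c, 0 < c ∧ ∀ ϱ, IsWeight θ ϱ → ϱ 0 = 1 → ∀ (v : ℤ → ι → ℂ) (ξ : ℂ), WBound ϱ 1 v →
      WBound ϱ c (Λ.op (Λ.pot P.q) v - P.pulse ξ) → ‖P.b ⬝ᵥ v P.n₀‖ ≤ c * ϱ P.n₀ →
      WBound ϱ (1 / 2) v := by
  have hθ := P.θ_pos
  obtain ⟨C, hC, R, hfar⟩ := P.far_bound
  by_contra! hcon
  obtain ⟨m, hm⟩ : ∃ m, m = 1 / (4 * C) := ⟨_, rfl⟩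
  have hm0 : 0 < m := by rw [hm]; positivity
  set a : ℕ → ℝ := fun k => min m (k + 1 : ℝ)⁻¹
  have ha : ∀ k, 0 < a k := fun k => by positivity
  choose ϱ hϱ hϱ0 v ξ hv hres hbv hbad using fun k => hcon (a k) (ha k)
  have halim : Tendsto a atTop (𝓝 0) :=
    squeeze_zero (fun k => (ha k).le) (fun k => min_le_right _ _) (by
      simpa [one_div] using tendsto_one_div_add_atTop_nhds_zero_nat (𝕜 := ℝ))
  have hres' := fun k => (hres k).mono (hϱ k) (min_le_left m _)
  -- the sequences are not small near the center
  have hlow : ∀ k, ∃ n : ℤ, n.natAbs ≤ R ∧ m * ϱ k n < ‖v k n‖ := fun k => by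
    by_contra! h
    refine hbad k ((hfar _ _ (hϱ k) (hϱ k) _ (ξ k) m m ⟨1, hv k⟩ hm0.le h (hres' k)).1.mono (hϱ k) ?_)
    rw [hm]
    exact le_of_eq (by field_simp; norm_num)
  have hϱle : ∀ k n, ϱ k n ≤ (bump θ 0 n)⁻¹ := fun k n => by
    have := (hϱ k).le_bump_inv hθ 0 n
    rw [hϱ0, mul_comm] at this
    rwa [← one_div, le_div_iff₀ (bump_pos hθ _ _)]
  have hX : ∀ k, ‖ξ k‖ ≤ C * (m + 1) * (bump θ 0 P.n₀)⁻¹ / ‖P.b‖ := fun k => by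
    rw [le_div_iff₀ P.b_norm_pos, ← norm_smul]
    refine (hfar _ _ (hϱ k) (hϱ k) _ (ξ k) m 1 ⟨1, hv k⟩ one_pos.le (fun n _ => hv k n)
      (hres' k)).2.trans ?_
    gcongr
    exact hϱle k _
  obtain ⟨⟨w, η⟩, hw, φ, hφ, hlim⟩ := ((isCompact_univ_pi fun n : ℤ =>
    isCompact_closedBall (0 : ι → ℂ) (bump θ 0 n)⁻¹).prod (isCompact_closedBall (0 : ℂ)
    (C * (m + 1) * (bump θ 0 P.n₀)⁻¹ / ‖P.b‖))).tendsto_subseq (x := fun k => (v k, ξ k))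
    fun k => ⟨fun n _ => by
      rw [mem_closedBall_zero_iff]
      exact (hv k n).trans (by simpa using hϱle k n), by simpa using hX k⟩
  have hle : ∀ n, Tendsto (fun k => a (φ k) * (bump θ 0 n)⁻¹) atTop (𝓝 0) := fun n => by
    simpa using (halim.comp hφ.tendsto_atTop).mul_const (bump θ 0 n)⁻¹
  have hle' := fun k n => mul_le_mul_of_nonneg_left (hϱle (φ k) n) (ha (φ k)).le
  have hzero : ∀ {E : Type} [NormedAddCommGroup E] (f : (ℤ → ι → ℂ) × ℂ → E) (n : ℤ), Continuous f →
      (∀ k, ‖f (v (φ k), ξ (φ k))‖ ≤ a (φ k) * ϱ (φ k) n) → f (w, η) = 0 := fun f n hf h =>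
    tendsto_nhds_unique ((hf.tendsto _).comp hlim)
      (squeeze_zero_norm (fun k => (h k).trans (hle' k n)) (hle n))
  have hw0 : w = 0 := by
    refine P.bordered_injective w η 1 (fun n => ?_) (funext fun n => ?_) ?_
    · simpa using hw.1 n (Set.mem_univ n)
    · refine sub_eq_zero.1 (hzero (fun x => (Λ.op (Λ.pot P.q) x.1 - P.pulse x.2) n) n
        (((Λ.continuous_op _ n).comp continuous_fst).sub ?_) fun k => hres (φ k) n)
      simp only [pulse, Pi.single_apply]
      split_ifs <;> fun_prop
    · exact hzero (fun x => P.b ⬝ᵥ x.1 P.n₀) _ (by unfold dotProduct; fun_prop) fun k => hbv (φ k)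
  have hev : ∀ᶠ k in atTop, ∀ n ∈ Finset.Icc (-(R : ℤ)) R, ‖v (φ k) n‖ < m * θ ^ R :=
    (eventually_all_finset _).2 fun n _ =>
      (tendsto_pi_nhds.1 ((continuous_fst.tendsto _).comp hlim) n).norm.eventually_lt_const (by
        simp only [hw0, Pi.zero_apply, norm_zero]; positivity)
  obtain ⟨k, hk⟩ := hev.exists
  obtain ⟨n, hn, hmn⟩ := hlow (φ k)
  have h1 : θ ^ R ≤ ϱ (φ k) n := by
    have h2 := (hϱ (φ k)).bump_le hθ 0 n
    rw [hϱ0, mul_one] at h2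
    exact (pow_le_pow_of_le_one hθ.le P.θ_lt.le (by simpa using hn)).trans h2
  exact absurd (hk n (mem_Icc.2 (by omega))) (not_lt.2
    ((mul_le_mul_of_nonneg_left h1 hm0.le).trans hmn.le))

/-- The bordered linearization along the primary breather satisfies an a priori estimate that is
uniform in the weight. -/
lemma Primary.bordered_bound :
    ∃ C, 0 < C ∧ ∀ ϱ, IsWeight θ ϱ → ∀ (v : ℤ → ι → ℂ) (ξ : ℂ) (a : ℝ), (∃ K, WBound ϱ K v) →
      WBound ϱ a (Λ.op (Λ.pot P.q) v - P.pulse ξ) →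
      ‖P.b ⬝ᵥ v P.n₀‖ ≤ a * ϱ P.n₀ → WBound ϱ (C * a) v := by
  obtain ⟨c, hc, h⟩ := P.halve_bound
  refine ⟨c⁻¹, inv_pos.2 hc, fun ϱ hϱ v ξ a hK hres hb => ?_⟩
  have ha : 0 ≤ a := hres.nonneg hϱ
  refine (WBound.absorb (a := a / c / 2) (k := 1 / 2) hϱ (by norm_num) hK
    fun M hM hMv n => ?_).mono hϱ (le_of_eq (by ring))
  have h0 := hϱ.pos
  have hac : 0 ≤ a / c := by positivity
  rcases (add_nonneg hM hac).eq_or_lt with hB | hB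
  · exact (hMv n).trans (mul_le_mul_of_nonneg_right (by linarith) (h0 n).le)
  -- normalize by the bound `B` and by the value of the weight at `0`
  set B := M + a / c with hBdef
  have haB : a ≤ c * B := by rw [hBdef, mul_add, mul_div_cancel₀ _ hc.ne']; nlinarith
  have h00 := h0 0
  obtain ⟨t, ht⟩ : ∃ t, t = (B * ϱ 0)⁻¹ := ⟨_, rfl⟩
  have ht0 : 0 < t := by rw [ht]; positivity
  have htn : ‖(t : ℂ)‖ = t := by rw [norm_real, norm_eq_abs, abs_of_pos ht0]
  have hcB : ∀ n x, x ≤ a * ϱ n → t * x ≤ c * (t * (B * ϱ n)) := fun n x hx => by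
    have := h0 n
    calc _ ≤ t * (c * B * ϱ n) := by gcongr; exact hx.trans (by gcongr)
      _ = _ := by ring
  have key := h _ ((hϱ.const_mul hB).const_mul ht0) (by rw [ht]; field_simp) ((t : ℂ) • v) (t * ξ)
    (fun n => ?_) (fun n => ?_) ?_ n
  · rw [Pi.smul_apply, norm_smul, htn] at key
    refine le_of_mul_le_mul_left (key.trans (le_of_eq ?_)) ht0
    rw [hBdef]; ring
  · have := h0 n
    rw [Pi.smul_apply, norm_smul, htn, one_mul]
    exact mul_le_mul_of_nonneg_left ((hMv n).trans (by gcongr; linarith)) ht0.le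
  · rw [show P.pulse (t * ξ) = (t : ℂ) • P.pulse ξ by rw [pulse, mul_smul, Pi.single_smul]; rfl,
      map_smul, ← smul_sub, Pi.smul_apply, norm_smul, htn]
    exact hcB n _ (hres n)
  · rw [Pi.smul_apply, dotProduct_smul, norm_smul, htn]
    exact hcB _ _ hb

/-! ### A priori estimate along several copies of the primary breather -/

/-- Near every site `n`, within distance `L`, the sequence `u` is `ρ`-close to one of the copies
`σ i • q (· - p i)`, and only that copy may have its reference site there. -/
def Primary.IsNear {κ : Type*} (σ : κ → ℝ) (p : κ → ℤ) (u : ℤ → ι → ℝ)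
    (L : ℕ) (ρ : ℝ) : Prop :=
  ∀ n : ℤ, ∃ i, (∀ k : ℤ, (k - n).natAbs < L → ‖u k - σ i • P.q (k - p i)‖ ≤ ρ) ∧
    ∀ j, j ≠ i → L ≤ (p j + P.n₀ - n).natAbs

/-- Sources in the direction `q̇ n₀` at the reference sites of the copies. -/
def Primary.src {κ : Type*} [Fintype κ] (p : κ → ℤ) :
    (κ → ℂ) →ₗ[ℂ] ℤ → ι → ℂ where
  toFun ξ n := ∑ j, if n = p j + P.n₀ then ξ j • P.b else 0
  map_add' ξ η := funext fun n => (sum_congr rfl fun j _ => by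
    split_ifs <;> simp [add_smul]).trans sum_add_distrib
  map_smul' c ξ := by
    funext n
    simp [mul_smul, smul_sum]

lemma Primary.src_def {κ : Type*} [Fintype κ] (p : κ → ℤ) (ξ : κ → ℂ) (n : ℤ) :
    P.src p ξ n = ∑ j, if n = p j + P.n₀ then ξ j • P.b else 0 := rfl

/-- The tent function of width `L` centered at `n`. -/
def tent (L : ℕ) (n k : ℤ) : ℝ := max 0 (1 - |((k - n : ℤ) : ℝ)| / L)

lemma tent_nonneg (L : ℕ) (n k : ℤ) : 0 ≤ tent L n k := le_max_left _ _

lemma tent_le_one (L : ℕ) (n k : ℤ) : tent L n k ≤ 1 :=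
  max_le zero_le_one (sub_le_self _ (by positivity))

lemma norm_tent_smul_le (L : ℕ) (n k : ℤ) {E : Type*} [SeminormedAddCommGroup E]
    [NormedSpace ℂ E] (x : E) : ‖(tent L n k : ℂ) • x‖ ≤ ‖x‖ := by
  rw [norm_smul, norm_real, norm_eq_abs, abs_of_nonneg (tent_nonneg L n k)]
  exact mul_le_of_le_one_left (norm_nonneg _) (tent_le_one L n k)

lemma tent_self (L : ℕ) (n : ℤ) : tent L n n = 1 := by simp [tent]

lemma tent_eq_zero {L : ℕ} (hL : 0 < L) {n k : ℤ} (h : L ≤ (k - n).natAbs) : tent L n k = 0 := by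
  have hL' : (0 : ℝ) < L := by exact_mod_cast hL
  refine max_eq_left ?_
  rw [sub_nonpos, le_div_iff₀ hL', one_mul, ← Int.cast_abs, Int.abs_eq_natAbs]
  exact_mod_cast h

lemma abs_tent_sub_le {L : ℕ} (hL : 0 < L) (n k k' : ℤ) (h : |k - k'| ≤ 1) :
    |tent L n k - tent L n k'| ≤ 1 / L := by
  have hL' : (0 : ℝ) < L := by exact_mod_cast hL
  unfold tent
  have h1 := abs_max_sub_max_le_abs (1 - |((k - n : ℤ) : ℝ)| / L) (1 - |((k' - n : ℤ) : ℝ)| / L) 0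
  rw [max_comm, max_comm (1 - |((k' - n : ℤ) : ℝ)| / L) 0] at h1
  refine h1.trans ?_
  rw [sub_sub_sub_cancel_left, ← sub_div, abs_div, abs_of_pos hL']
  gcongr
  have h2 := abs_abs_sub_abs_le (((k' - n : ℤ) : ℝ)) ((k - n : ℤ) : ℝ)
  refine h2.trans ?_
  rw [← Int.cast_sub, ← Int.cast_abs]
  have : |k' - n - (k - n)| ≤ 1 := by rw [abs_sub_comm] at h; simpa using h
  exact_mod_cast this

/-- The a priori estimate for the bordered operator along several copies of the primary breather,
uniformly in the weight and in the positions and signs of the copies: a cut-off to a long window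
reduces it to a single copy. -/
lemma Primary.multi_bound :
    ∃ C, 0 < C ∧ ∃ L : ℕ, 0 < L ∧ ∃ ρ, 0 < ρ ∧ ∃ β, 0 < β ∧
      ∀ (κ : Type) [Fintype κ] (σ : κ → ℝ) (p : κ → ℤ) (u : ℤ → ι → ℝ)
        (B : ℤ → Matrix ι ι ℂ), IsSign σ → P.IsNear σ p u L ρ →
        (∀ n i j, ‖(B n - Λ.pot u n) i j‖ ≤ β) →
        ∀ ϱ, IsWeight θ ϱ → ∀ (v : ℤ → ι → ℂ) (ξ : κ → ℂ) (a : ℝ), (∃ K, WBound ϱ K v) →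
          WBound ϱ a (Λ.op B v - P.src p ξ) →
          (∀ j, ‖P.b ⬝ᵥ v (p j + P.n₀)‖ ≤ a * ϱ (p j + P.n₀)) → WBound ϱ (C * a) v := by
  obtain ⟨C₁, hC₁, hone⟩ := P.bordered_bound
  have hθ := P.θ_pos
  have hd := Λ.d_pos
  obtain ⟨Cl, hCl, hlip⟩ := Λ.A_lip (P.D + 1)
  obtain ⟨ε, hε⟩ : ∃ ε, ε = 1 / (2 * C₁) := ⟨_, rfl⟩
  have hε0 : 0 < ε := by rw [hε]; positivity
  obtain ⟨L, hL⟩ := exists_nat_gt (2 * (2 * Λ.d * θ⁻¹) / ε)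
  have hLpos : (0 : ℝ) < L := lt_of_le_of_lt (by positivity) hL
  have hL0 : 0 < L := by exact_mod_cast hLpos
  have hLε : 2 * Λ.d * θ⁻¹ / L ≤ ε / 2 := by
    rw [div_lt_iff₀ hε0] at hL
    rw [div_le_iff₀ hLpos]; linarith
  obtain ⟨β, hβ, -, hβε⟩ := exists_mul_le (c := card ι * 2) (by positivity) (half_pos hε0)
  have hD := P.D_nonneg
  obtain ⟨ρ, hρ, hρ1, hρβ⟩ := exists_mul_le (c := Cl * (2 * P.D + 1)) (by positivity) hβ
  refine ⟨2 * C₁, by positivity, L, hL0, ρ, hρ, β, hβ, ?_⟩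
  intro κ _ σ p u B hσ hnear hB ϱ hϱ v ξ a hv hres hb
  have ha : 0 ≤ a := hres.nonneg hϱ
  have hhalf : C₁ * ε = 1 / 2 := by rw [hε]; field_simp
  suffices h : WBound ϱ (C₁ * a / (1 - 1 / 2)) v from h.mono hϱ (le_of_eq (by ring))
  refine WBound.absorb hϱ (by norm_num) hv fun M hM hMv n => ?_
  obtain ⟨i, hi, hij⟩ := hnear n
  have hϱ' : IsWeight θ (fun k => ϱ (k + p i)) :=
    ⟨fun k => hϱ.pos _, fun k => by have := hϱ.up (k + p i); rwa [add_right_comm] at this,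
      fun k => by have := hϱ.down (k + p i); rwa [add_right_comm] at this⟩
  -- the cut-off sequence, recentered at the copy `i`
  let t : ℤ → ℝ := fun k => tent L n (k + p i)
  let w : ℤ → ι → ℂ := fun k => v (k + p i)
  have hpot : ∀ k, t k ≠ 0 → ∀ i₁ j₁, ‖(B (k + p i) - Λ.pot P.q k) i₁ j₁‖ ≤ 2 * β := by
    intro k hk i₁ j₁
    have h1 := hi (k + p i) (not_le.1 fun h => hk (tent_eq_zero hL0 h))
    rw [add_sub_cancel_right] at h1
    have hσn : ‖σ i • P.q k‖ ≤ P.D := by rw [hσ.norm_smul]; exact P.norm_q_le k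
    have hu := (norm_le_norm_add_norm_sub' (u (k + p i)) (σ i • P.q k)).trans
      (add_le_add hσn (h1.trans hρ1))
    have hA := hlip _ _ hu (by linarith : ‖σ i • P.q k‖ ≤ P.D + 1) i₁ j₁
    rw [show Λ.A (σ i • P.q k) = Λ.A (P.q k) by
      rcases hσ i with h | h <;> simp [h, Λ.A_neg]] at hA
    rw [show (B (k + p i) - Λ.pot P.q k) i₁ j₁ = (B (k + p i) - Λ.pot u (k + p i)) i₁ j₁
      + ((Λ.A (u (k + p i)) i₁ j₁ - Λ.A (P.q k) i₁ j₁ : ℝ) : ℂ) by simp [pot], two_mul]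
    refine norm_add_le_of_le (hB _ i₁ j₁) ?_
    rw [norm_real, norm_eq_abs]
    refine (hA.trans ?_).trans hρβ
    gcongr Cl * ?_ * ?_
    linarith
  have hop : ∀ k, (Λ.op (Λ.pot P.q) (fun k => (t k : ℂ) • w k) - P.pulse (t P.n₀ * ξ i)) k
      = (t k : ℂ) • (Λ.op B v - P.src p ξ) (k + p i)
        + (Λ.d : ℂ) • (((t (k + 1) - t k : ℝ) : ℂ) • w (k + 1)
          + ((t (k - 1) - t k : ℝ) : ℂ) • w (k - 1))
        + (t k : ℂ) • (B (k + p i) - Λ.pot P.q k).mulVec (w k) := by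
    intro k
    have hsrc : (t k : ℂ) • P.src p ξ (k + p i) = P.pulse (t P.n₀ * ξ i) k := by
      rw [src_def, pulse, smul_sum, sum_eq_single i (fun j _ hj => ?_) (by simp), Pi.single_apply]
      · obtain rfl | hk := eq_or_ne k P.n₀
        · simp [add_comm, smul_smul]
        · rw [if_neg hk, if_neg (by omega), smul_zero]
      · split_ifs with hk
        · simp only [t, hk, tent_eq_zero hL0 (hij j hj)]; simp
        · simp
    rw [Pi.sub_apply, Pi.sub_apply, smul_sub, hsrc]
    funext i₁
    simp only [op_apply, w, Pi.sub_apply, Pi.add_apply, Pi.smul_apply, smul_eq_mul, mulVec_smul,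
      sub_mulVec, show k + 1 + p i = k + p i + 1 by ring, show k - 1 + p i = k + p i - 1 by ring]
    push_cast
    ring
  have hw : ∀ k, ‖w k‖ ≤ M * ϱ (k + p i) := fun k => hMv _
  have hres' : WBound (fun k => ϱ (k + p i)) (a + ε * M)
      (Λ.op (Λ.pot P.q) (fun k => (t k : ℂ) • w k) - P.pulse (t P.n₀ * ξ i)) := by
    intro k
    have hwn := (hϱ.pos (k + p i)).le
    have hdiff : ∀ k', |k' - k| ≤ 1 → ‖w k'‖ ≤ M * (θ⁻¹ * ϱ (k + p i)) →
        ‖((t k' - t k : ℝ) : ℂ) • w k'‖ ≤ 1 / L * (M * (θ⁻¹ * ϱ (k + p i))) := fun k' h h' => by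
      rw [norm_smul, norm_real, norm_eq_abs]
      exact mul_le_mul (abs_tent_sub_le hL0 n _ _ (by simpa using h)) h' (norm_nonneg _)
        (by positivity)
    rw [hop]
    refine (norm_add₃_le.trans (add_le_add (add_le_add ((norm_tent_smul_le _ _ _ _).trans (hres _))
      (d := ε / 2 * (M * ϱ (k + p i))) ?_) (d := ε / 2 * (M * ϱ (k + p i))) ?_)).trans_eq (by ring)
    · rw [norm_smul, norm_real, norm_eq_abs, abs_of_pos hd]
      calc _ ≤ Λ.d * (1 / L * (M * (θ⁻¹ * ϱ (k + p i))) + 1 / L * (M * (θ⁻¹ * ϱ (k + p i)))) := by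
            gcongr
            refine norm_add_le_of_le (hdiff _ (by simp) ((hw _).trans ?_))
              (hdiff _ (by simp) ((hw _).trans ?_))
            · rw [add_right_comm]; gcongr; exact hϱ.succ_le hθ _
            · rw [sub_add_eq_add_sub]; gcongr; exact hϱ.pred_le hθ _
        _ = 2 * Λ.d * θ⁻¹ / L * (M * ϱ (k + p i)) := by ring
        _ ≤ _ := by gcongr
    · by_cases ht : t k = 0
      · rw [ht, ofReal_zero, zero_smul, norm_zero]; positivity
      · refine (norm_tent_smul_le _ _ _ _).trans
          ((norm_mulVec_le _ (by positivity) (hpot k ht) _).trans ?_)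
        rw [← mul_assoc]
        gcongr
        exact hw k
  have key := hone _ hϱ' _ _ _ ⟨M, fun k => (norm_tent_smul_le _ _ _ _).trans (hw k)⟩ hres' (by
    rw [dotProduct_smul]
    refine (norm_tent_smul_le _ _ _ _).trans ?_
    have h1 := hb i
    have := (hϱ.pos (P.n₀ + p i)).le
    rw [add_comm] at h1
    refine h1.trans ?_
    gcongr
    nlinarith) (n - p i)
  simp only [w, sub_add_cancel, tent_self, ofReal_one, one_smul] at key
  refine key.trans (le_of_eq ?_)
  linear_combination ϱ n * M * hhalf

/-! ### Solvability on bounded sequences -/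

/-- The contraction principle for bounded sequences, with contraction factor `1 / 2`. -/
lemma exists_fixed_seq {E : Type*} [NormedAddCommGroup E] [CompleteSpace E]
    (Φ : (ℤ → E) → ℤ → E) {r : ℝ} (hr : 0 ≤ r)
    (hmaps : ∀ v, (∀ n, ‖v n‖ ≤ r) → ∀ n, ‖Φ v n‖ ≤ r)
    (hcontr : ∀ v w, (∀ n, ‖v n‖ ≤ r) → (∀ n, ‖w n‖ ≤ r) → ∀ M, (∀ n, ‖v n - w n‖ ≤ M) →
      ∀ n, ‖Φ v n - Φ w n‖ ≤ M / 2) : ∃ v, (∀ n, ‖v n‖ ≤ r) ∧ Φ v = v := by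
  classical
  have hmem : ∀ f : BoundedContinuousFunction ℤ E, f ∈ Metric.closedBall 0 r ↔ ∀ n, ‖f n‖ ≤ r :=
    fun f => by rw [mem_closedBall_zero_iff, BoundedContinuousFunction.norm_le hr]
  let F : BoundedContinuousFunction ℤ E → BoundedContinuousFunction ℤ E := fun f =>
    if h : ∀ n, ‖Φ f n‖ ≤ r then .ofNormedAddCommGroupDiscrete (Φ f) r h else 0
  have hF : ∀ f ∈ Metric.closedBall 0 r, ⇑(F f) = Φ f := fun f hf => by
    simp [F, dif_pos (hmaps f ((hmem f).1 hf))]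
  have hs : Set.MapsTo F (Metric.closedBall 0 r) (Metric.closedBall 0 r) := fun f hf => by
    rw [hmem, hF f hf]; exact hmaps f ((hmem f).1 hf)
  have hc : ContractingWith (1 / 2) (hs.restrict F _ _) :=
    ⟨NNReal.half_lt_self one_ne_zero, LipschitzWith.of_dist_le_mul fun x y => by
      refine (BoundedContinuousFunction.dist_le (by positivity)).2 fun n => ?_
      rw [Set.MapsTo.val_restrict_apply, Set.MapsTo.val_restrict_apply, hF _ x.2, hF _ y.2,
        dist_eq_norm]
      refine (hcontr _ _ ((hmem _).1 x.2) ((hmem _).1 y.2) (dist x y) (fun n => ?_) n).trans_eq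
        (by simp [div_eq_inv_mul])
      rw [← dist_eq_norm]
      exact BoundedContinuousFunction.dist_coe_le_dist n⟩
  obtain ⟨f, hf, hfix, -⟩ := hc.exists_fixedPoint' Metric.isClosed_closedBall.isComplete hs
    (Metric.mem_closedBall_self hr) (edist_ne_top _ _)
  exact ⟨f, (hmem f).1 hf, by rw [← hF f hf, hfix]⟩

lemma shift_solve {ν F : ℝ} (hν : |ν| < 1) (s : ℤ) (f : ℤ → ℂ)
    (hf : ∀ n, ‖f n‖ ≤ F) : ∃ y : ℤ → ℂ, IsBdd y ∧
      ∀ n, y n - ν * y (n + s) = f n := by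
  have hb : ∀ n (k : ℕ), ‖(ν : ℂ) ^ k * f (n + k * s)‖ ≤ |ν| ^ k * F := fun n k => by
    rw [norm_mul, norm_pow, norm_real, norm_eq_abs]
    exact mul_le_mul_of_nonneg_left (hf _) (by positivity)
  have hg :=
    (hasSum_geometric_of_lt_one (abs_nonneg ν) hν).mul_right F
  refine ⟨fun n => ∑' k : ℕ, (ν : ℂ) ^ k * f (n + k * s), ⟨(1 - |ν|)⁻¹ * F, fun n =>
    tsum_of_norm_bounded hg (hb n)⟩, fun n => ?_⟩
  dsimp only
  rw [((fun n => Summable.of_norm_bounded hg.summable (hb n)) n).tsum_eq_zero_add, ← tsum_mul_left]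
  have : ∀ k : ℕ, (ν : ℂ) ^ (k + 1) * f (n + ((k + 1 : ℕ) : ℤ) * s)
      = ν * ((ν : ℂ) ^ k * f (n + s + k * s)) := fun k => by
    rw [pow_succ]
    rw [(show n + ((k + 1 : ℕ) : ℤ) * s = n + s + k * s by push_cast; ring)]; ring
  simp only [this]
  simp

variable (Λ)

lemma Chain.free_solve (hν : ∀ i, |Λ.ν i| < 1) (h : ℤ → ι → ℂ)
    (hh : IsBdd h) : ∃ v : ℤ → ι → ℂ, IsBdd v ∧ Λ.op Λ.pot₀ v = h := by
  obtain ⟨F, hF⟩ := hh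
  have hi : ∀ i, ∃ w : ℤ → ℂ, IsBdd w ∧ ∀ n,
      -(Λ.d / Λ.ν i : ℂ) * ((w n - Λ.ν i * w (n - 1)) - Λ.ν i * (w (n + 1) - Λ.ν i * w n))
        = h n i := by
    intro i
    have hνi : (Λ.ν i : ℂ) ≠ 0 := by exact_mod_cast Λ.ν_ne i
    have hd' : (Λ.d : ℂ) ≠ 0 := by exact_mod_cast Λ.d_pos.ne'
    obtain ⟨y, ⟨Y, hY⟩, hy⟩ := shift_solve (hν i) 1 (fun n => -(Λ.ν i / Λ.d : ℂ) * h n i)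
      (F := ‖-(Λ.ν i / Λ.d : ℂ)‖ * F) (fun n => by
        rw [norm_mul]
        exact mul_le_mul_of_nonneg_left ((norm_le_pi_norm _ i).trans (hF n)) (norm_nonneg _))
    obtain ⟨w, hw, hwy⟩ := shift_solve (hν i) (-1) y hY
    refine ⟨w, hw, fun n => ?_⟩
    have e := hwy (n + 1)
    rw [add_neg_cancel_right] at e
    rw [e, sub_eq_add_neg n, hwy n, hy n]
    field_simp
  choose w hw hwe using hi
  choose K hK using hw
  refine ⟨fun n i => w i n, ⟨∑ i, |K i|, fun n => ?_⟩, ?_⟩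
  · rw [pi_norm_le_iff_of_nonneg (by positivity)]
    intro i
    exact ((hK i n).trans (le_abs_self _)).trans
      (single_le_sum (f := fun i => |K i|) (fun _ _ => abs_nonneg _) (mem_univ i))
  · funext n i
    rw [Λ.op_pot₀_apply]
    exact hwe i n

/-- Bounded solvability of a semilinear equation whose right-hand side has a small Lipschitz
constant. -/
lemma Chain.semilinear_solve (hθ : θ ≤ 1) (hν : ∀ i, |Λ.ν i| < θ) {C₀ b F : ℝ}
    (hC₀ : 0 < C₀) (hfree : Λ.Free θ C₀)
    (hsmall : C₀ * b ≤ 1 / 2) (N : ℤ → (ι → ℂ) → ι → ℂ) (hF : ∀ n, ‖N n 0‖ ≤ F)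
    (hN : ∀ n x y, ‖x‖ ≤ 2 * C₀ * F → ‖y‖ ≤ 2 * C₀ * F → ‖N n x - N n y‖ ≤ b * ‖x - y‖)
    (hb : 0 ≤ b) :
    ∃ v : ℤ → ι → ℂ, (∀ n, ‖v n‖ ≤ 2 * C₀ * F) ∧ Λ.op Λ.pot₀ v = fun n => N n (v n) := by
  have hF0 := (norm_nonneg _).trans (hF 0)
  have hr : 0 ≤ 2 * C₀ * F := by positivity
  have hNb : ∀ v : ℤ → ι → ℂ, (∀ n, ‖v n‖ ≤ 2 * C₀ * F) → ∀ n,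
      ‖N n (v n)‖ ≤ F + b * (2 * C₀ * F) := fun v hv n => by
    have h1 := hN n (v n) 0 (hv n) (by simpa)
    rw [sub_zero] at h1
    rw [← add_sub_cancel (N n 0) (N n (v n))]
    exact norm_add_le_of_le (hF n) (h1.trans (by gcongr; exact hv n))
  choose! Φ h1 h2 using fun v hv =>
    Λ.free_solve (fun i => (hν i).trans_le hθ) (fun n => N n (v n)) ⟨_, hNb v hv⟩
  obtain ⟨v, hv, hfix⟩ := exists_fixed_seq Φ hr
    (fun v hv n => by
      refine (hfree.bdd hθ (h1 v hv) (fun n => by rw [h2 v hv]; exact hNb v hv n) n).trans ?_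
      nlinarith)
    (fun v w hv hw M hM n => by
      have hM0 := (norm_nonneg _).trans (hM 0)
      refine (hfree.bdd hθ (a := b * M) ((h1 v hv).sub (h1 w hw)) (fun n => ?_) n).trans
        (by nlinarith)
      rw [map_sub, h2 v hv, h2 w hw]
      exact (hN n _ _ (hv n) (hw n)).trans (mul_le_mul_of_nonneg_left (hM n) hb))
  exact ⟨v, hv, by rw [← h2 v hv, hfix]⟩

/-- Bounded solvability for a potential that is close to its value at zero everywhere. -/
lemma Chain.near_free_solve (hθ : θ ≤ 1) (hν : ∀ i, |Λ.ν i| < θ) {C₀ b : ℝ}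
    (hC₀ : 0 < C₀) (hb : 0 ≤ b) (hfree : Λ.Free θ C₀)
    (hsmall : C₀ * (card ι * b) ≤ 1 / 2) {B : ℤ → Matrix ι ι ℂ}
    (hB : ∀ n, ∀ i j, ‖(B n - Λ.pot₀ n) i j‖ ≤ b) (h : ℤ → ι → ℂ) (hh : IsBdd h) :
    ∃ v : ℤ → ι → ℂ, IsBdd v ∧ Λ.op B v = h := by
  obtain ⟨F, hF⟩ := hh
  obtain ⟨v, hv, h2⟩ := Λ.semilinear_solve hθ hν hC₀ hfree hsmall
    (fun n x => h n + (B n - Λ.pot₀ n).mulVec x) (F := F) (by simpa using hF) (fun n x y _ _ => by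
      rw [add_sub_add_left_eq_sub, ← mulVec_sub]
      exact norm_mulVec_le _ hb (hB n) _) (by positivity)
  refine ⟨v, ⟨_, hv⟩, funext fun n => ?_⟩
  rw [Λ.op_sub_pot Λ.pot₀ B v n, h2, add_assoc, ← add_mulVec]
  simp

variable {Λ}

lemma Primary.src_bdd {κ : Type*} [Fintype κ] (p : κ → ℤ) (ξ : κ → ℂ) :
    IsBdd (P.src p ξ) :=
  ⟨∑ j, ‖ξ j • P.b‖, fun n => norm_sum_le_of_le _ fun j _ => by split_ifs <;> simp⟩

/-- Fredholm alternative for the bordered operator: if the potential is close to its value at zero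
off a finite set, then injectivity on bounded sequences gives solvability. -/
lemma Primary.fredholm {κ : Type} [Fintype κ] (p : κ → ℤ) {C₀ b : ℝ}
    (hC₀ : 0 < C₀) (hb : 0 ≤ b) (hfree : Λ.Free θ C₀)
    (hsmall : C₀ * (card ι * b) ≤ 1 / 2) {B : ℤ → Matrix ι ι ℂ} (s : Finset ℤ)
    (hB : ∀ n ∉ s, ∀ i j, ‖(B n - Λ.pot₀ n) i j‖ ≤ b)
    (hinj : ∀ (v : ℤ → ι → ℂ) (ξ : κ → ℂ), IsBdd v → Λ.op B v = P.src p ξ →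
      (∀ j, P.b ⬝ᵥ v (p j + P.n₀) = 0) → v = 0 ∧ ξ = 0)
    (h : ℤ → ι → ℂ) (hh : IsBdd h) (c : κ → ℂ) :
    ∃ (v : ℤ → ι → ℂ) (ξ : κ → ℂ), IsBdd v ∧ Λ.op B v = h + P.src p ξ ∧
      ∀ j, P.b ⬝ᵥ v (p j + P.n₀) = c j := by
  classical
  set B' : ℤ → Matrix ι ι ℂ := fun n => if n ∈ s then Λ.pot₀ n else B n with hB'
  have hB'b : ∀ n, ∀ i j, ‖(B' n - Λ.pot₀ n) i j‖ ≤ b := fun n i j => by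
    by_cases hn : n ∈ s
    · simpa [hB', hn] using hb
    · simpa [hB', hn] using hB n hn i j
  have hw : IsWeight θ (fun _ : ℤ => (1 : ℝ)) := .one P.θ_lt.le
  have huniq : ∀ v : ℤ → ι → ℂ, IsBdd v → Λ.op B' v = 0 → v = 0 := fun v hv h0 => by
    have := Λ.far_bound P.θ_pos hfree hw hw ∅ hb hb hsmall (fun n _ => hB'b n) hB'b (a := 0)
      (m := 0) (by simpa [WBound] using hv) le_rfl (by simp) (by simp [WBound, h0])
    funext n
    simpa using this n
  choose! G hGb hG using
    Λ.near_free_solve P.θ_lt.le P.ν_lt hC₀ hb hfree hsmall hB'b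
  -- the finite-dimensional unknowns: the sources on `s` and the multipliers `ξ`
  let f : (s → ι → ℂ) × (κ → ℂ) → ℤ → ι → ℂ := fun z n =>
    (if hn : n ∈ s then z.1 ⟨n, hn⟩ else 0) + P.src p z.2 n
  have hfs : ∀ z {n} (hn : n ∈ s), f z n = z.1 ⟨n, hn⟩ + P.src p z.2 n := fun z n hn => by
    simp [f, hn]
  have hfb : ∀ z, IsBdd (f z) := fun z => by
    have h : IsBdd fun n : ℤ => (if hn : n ∈ s then z.1 ⟨n, hn⟩ else 0 : ι → ℂ) := by
      refine ⟨∑ n, ‖z.1 n‖, fun n => ?_⟩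
      dsimp only
      split_ifs with hn
      · exact single_le_sum (f := fun n : s => ‖z.1 n‖) (fun _ _ => norm_nonneg _)
          (mem_univ (⟨n, hn⟩ : s))
      · rw [norm_zero]; positivity
    exact h.add (P.src_bdd p z.2)
  have hG_eq : ∀ z w, IsBdd w → Λ.op B' w = f z → G (f z) = w := fun z w hw hfw => by
    rw [← sub_eq_zero]
    exact huniq _ ((hGb _ (hfb z)).sub hw) (by rw [map_sub, hG _ (hfb z), hfw, sub_self])
  have hGadd : ∀ z z', G (f (z + z')) = G (f z) + G (f z') := fun z z' => by
    refine hG_eq _ _ ((hGb _ (hfb z)).add (hGb _ (hfb z'))) ?_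
    rw [map_add, hG _ (hfb z), hG _ (hfb z')]
    funext n
    simp only [f, Pi.add_apply, Prod.fst_add, Prod.snd_add, map_add]
    split_ifs <;> abel
  have hGsmul : ∀ (x : ℂ) z, G (f (x • z)) = x • G (f z) := fun x z => by
    refine hG_eq _ _ ((hGb _ (hfb z)).smul x) ?_
    rw [map_smul, hG _ (hfb z)]
    funext n
    simp only [f, Pi.smul_apply, Prod.smul_fst, Prod.smul_snd, map_smul, smul_add]
    split_ifs <;> simp
  let T : ((s → ι → ℂ) × (κ → ℂ)) →ₗ[ℂ] (s → ι → ℂ) × (κ → ℂ) :=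
    { toFun := fun z => (fun n => z.1 n - (B n - Λ.pot₀ n).mulVec (G (f z) n),
        fun j => P.b ⬝ᵥ G (f z) (p j + P.n₀))
      map_add' := fun z z' => by
        rw [hGadd]
        refine Prod.ext (funext fun n => ?_) (funext fun j => ?_)
        · simp only [Pi.add_apply, Prod.fst_add, mulVec_add]; abel
        · simp only [Pi.add_apply, Prod.snd_add, dotProduct_add]
      map_smul' := fun x z => by
        rw [hGsmul]
        refine Prod.ext (funext fun n => ?_) (funext fun j => ?_)
        · simp only [Pi.smul_apply, Prod.smul_fst, RingHom.id_apply, smul_sub, mulVec_smul]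
        · simp only [Pi.smul_apply, Prod.smul_snd, RingHom.id_apply, dotProduct_smul] }
  have hopB : ∀ v : ℤ → ι → ℂ, ∀ n, Λ.op B v n = Λ.op B' v n
      - if n ∈ s then (B n - Λ.pot₀ n).mulVec (v n) else 0 := fun v n => by
    rw [Λ.op_sub_pot B' B v n, sub_eq_add_neg (Λ.op B' v n)]
    congr 1
    by_cases hn : n ∈ s
    · simp only [hB', hn, if_true, ← neg_mulVec, neg_sub]
    · simp [hB', hn]
  have hT : Function.Injective T := by
    rw [← LinearMap.ker_eq_bot, LinearMap.ker_eq_bot']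
    intro z hz
    have h1 := fun n =>
      sub_eq_zero.1 (congrFun (congrArg Prod.fst hz) n)
    obtain ⟨h4, h5⟩ := hinj (G (f z)) z.2 (hGb _ (hfb z)) (funext fun n => by
      rw [hopB, hG _ (hfb z)]
      by_cases hn : n ∈ s
      · rw [hfs z hn, h1 ⟨n, hn⟩, if_pos hn, add_sub_cancel_left]
      · simp [f, hn]) (congrFun (congrArg Prod.snd hz))
    refine Prod.ext (funext fun n => ?_) h5
    rw [h1, h4]; simp
  obtain ⟨z, hz⟩ := LinearMap.injective_iff_surjective.1 hT
    (fun n => (B n - Λ.pot₀ n).mulVec (G h n), fun j => c j - P.b ⬝ᵥ G h (p j + P.n₀))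
  have h2 : ∀ j, P.b ⬝ᵥ G (f z) (p j + P.n₀) = c j - P.b ⬝ᵥ G h (p j + P.n₀) :=
    congrFun (congrArg Prod.snd hz)
  refine ⟨G h + G (f z), z.2, (hGb h hh).add (hGb _ (hfb z)), funext fun n => ?_, fun j => ?_⟩
  · rw [hopB, map_add, hG h hh, hG _ (hfb z)]
    by_cases hn : n ∈ s
    · rw [if_pos hn, Pi.add_apply, Pi.add_apply, Pi.add_apply, mulVec_add, hfs z hn, (fun n => sub_eq_iff_eq_add.1 (congrFun (congrArg Prod.fst hz) n)) ⟨n, hn⟩]; abel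
    · simp [f, hn]
  · rw [Pi.add_apply, dotProduct_add, h2]; ring

/-- The solution theory of the bordered operator along configurations of copies of the primary
breather: the constants `L, ρ, β` say how close the sequence and the potential have to be to a
configuration, `C` is the constant of the a priori estimate. -/
def Primary.Solvable (C : ℝ) (L : ℕ) (ρ β : ℝ) : Prop :=
  ∀ (κ : Type) [Fintype κ] (σ : κ → ℝ) (p : κ → ℤ) (u : ℤ → ι → ℝ)
    (B : ℤ → Matrix ι ι ℂ), IsSign σ → P.IsNear σ p u L ρ →
    (∀ n i j, ‖(B n - Λ.pot u n) i j‖ ≤ β) →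
    (∀ ϱ, IsWeight θ ϱ → ∀ (v : ℤ → ι → ℂ) (ξ : κ → ℂ) (a : ℝ), (∃ K, WBound ϱ K v) →
      WBound ϱ a (Λ.op B v - P.src p ξ) →
      (∀ j, ‖P.b ⬝ᵥ v (p j + P.n₀)‖ ≤ a * ϱ (p j + P.n₀)) → WBound ϱ (C * a) v) ∧
    (Function.Injective p → (∃ s : Finset ℤ, ∀ n ∉ s, ‖u n‖ ≤ ρ) →
      ∀ (h : ℤ → ι → ℂ), IsBdd h → ∀ c : κ → ℂ,
      ∃ (v : ℤ → ι → ℂ) (ξ : κ → ℂ), IsBdd v ∧ Λ.op B v = h + P.src p ξ ∧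
        ∀ j, P.b ⬝ᵥ v (p j + P.n₀) = c j)

lemma Primary.src_apply {κ : Type*} [Fintype κ] {p : κ → ℤ}
    (hp : Function.Injective p) (ξ : κ → ℂ) (j : κ) : P.src p ξ (p j + P.n₀) = ξ j • P.b := by
  rw [src_def, sum_eq_single j (fun i _ hi => if_neg fun h => hi (hp (by omega))) (by simp), if_pos rfl]

lemma Primary.exists_solvable :
    ∃ C, 0 < C ∧ ∃ L : ℕ, 0 < L ∧ ∃ ρ, 0 < ρ ∧ ∃ β, 0 < β ∧ P.Solvable C L ρ β := by
  obtain ⟨C, hC, L, hL, ρ, hρ, β, hβ, hmain⟩ := P.multi_bound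
  obtain ⟨C₀, hC₀, hfree⟩ := Λ.free_bound P.θ_pos P.ν_lt
  obtain ⟨b, hb, -, hsmall⟩ := exists_mul_le (c := C₀ * card ι) (by positivity) one_half_pos
  obtain ⟨ρ', hρ', hsm⟩ := Λ.A_small (half_pos hb)
  refine ⟨C, hC, L, hL, min ρ ρ', by positivity, min β (b / 2), by positivity, ?_⟩
  intro κ _ σ p u B hσ hnear hB
  have hap := hmain κ σ p u B hσ (fun n => by
    obtain ⟨i, h1, h2⟩ := hnear n
    exact ⟨i, fun k hk => (h1 k hk).trans (min_le_left _ _), h2⟩) fun n i j =>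
      (hB n i j).trans (min_le_left _ _)
  refine ⟨hap, fun hp ⟨s, hs⟩ h hh c => P.fredholm p hC₀ hb.le hfree (by rwa [← mul_assoc]) s
    (fun n hn i j => ?_) (fun v ξ hv hv' hb => ?_) h hh c⟩
  · rw [show (B n - Λ.pot₀ n) i j = (B n - Λ.pot u n) i j + (Λ.pot u n - Λ.pot₀ n) i j by simp]
    exact (norm_add_le_of_le ((hB n i j).trans (min_le_right _ _))
      (hsm u n ((hs n hn).trans (min_le_right _ _)) i j)).trans (by linarith)
  · have h1 := hap _ (.one P.θ_lt.le) v ξ 0 (by simpa [WBound] using hv)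
      (fun n => by rw [hv', sub_self]; simp) (fun j => by rw [hb]; simp)
    have hv0 : v = 0 := funext fun n => by simpa using h1 n
    refine ⟨hv0, funext fun j => ?_⟩
    have h2 := congrFun hv' (p j + P.n₀)
    rw [P.src_apply hp, hv0, show Λ.op B 0 = 0 by simp, Pi.zero_apply] at h2
    exact (smul_eq_zero.1 h2.symm).resolve_right (norm_pos_iff.1 P.b_norm_pos)

/-- At every site, `u` is `ρ`-close to one of the copies, and the other copies are centered at
distance about `D / 2` at least. -/
def Primary.IsClose {κ : Type*} (σ : κ → ℝ) (p : κ → ℤ) (u : ℤ → ι → ℝ)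
    (D : ℕ) (ρ : ℝ) : Prop :=
  ∀ n : ℤ, ∃ i, ‖u n - σ i • P.q (n - p i)‖ ≤ ρ ∧ ∀ j, j ≠ i → D ≤ 2 * (n - p j).natAbs + 1

lemma Primary.isNear_of_isClose (L : ℕ) {ρ : ℝ} (hρ : 0 < ρ) :
    ∃ D₀ : ℕ, ∀ (κ : Type) (σ : κ → ℝ) (p : κ → ℤ) (u : ℤ → ι → ℝ) (D : ℕ),
      IsSign σ → D₀ ≤ D → P.IsClose σ p u D (ρ / 2) →
      P.IsNear σ p u L ρ := by
  obtain ⟨R, hR⟩ := exists_bump_le P.θ_pos P.θ_lt P.D (ε := ρ / 4) (by positivity)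
  have hq := fun p n h =>
    (P.q_dec (n - p)).trans (hR 0 (n - p) (by simpa using h))
  refine ⟨2 * (R + L + P.n₀.natAbs) + 1, fun κ σ p u D hσ hD hu n => ?_⟩
  obtain ⟨i, hi, hij⟩ := hu n
  refine ⟨i, fun k hk => ?_, fun j hj => ?_⟩
  · obtain ⟨j, hj, hji⟩ := hu k
    by_cases h : j = i
    · rw [h] at hj; linarith
    · have h1 := hij j h
      have h2 := hji i (Ne.symm h)
      rw [show u k - σ i • P.q (k - p i) = (u k - σ j • P.q (k - p j)) + σ j • P.q (k - p j)
        - σ i • P.q (k - p i) by abel]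
      refine (norm_sub_le_of_le (norm_add_le_of_le hj ((hσ.norm_smul j _).trans_le (hq (p j) k (by omega))))
        ((hσ.norm_smul i _).trans_le (hq (p i) k (by omega)))).trans ?_
      linarith
  · have := hij j hj
    omega

/-! ### Parity in time -/

variable (Λ)

/-- The part of a vector that is even in time. -/
def Chain.ev {𝕜 : Type*} [RCLike 𝕜] : (ι → 𝕜) →ₗ[𝕜] ι → 𝕜 :=
  LinearMap.pi fun i => ((1 + Λ.par i) / 2) • LinearMap.proj i

/-- The part of a vector that is odd in time. -/
def Chain.od : (ι → ℂ) →ₗ[ℂ] ι → ℂ := LinearMap.id - Λ.ev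

/-- The time derivative on complex vectors. -/
def Chain.Jc : Matrix ι ι ℂ := Λ.J.map (fun x : ℝ => (x : ℂ))

variable {Λ}

section RCLike
variable {𝕜 : Type*} [RCLike 𝕜]

lemma Chain.ev_apply (Λ : Chain ι) (x : ι → 𝕜) (i : ι) :
    Λ.ev x i = ((1 + Λ.par i) / 2) • x i := rfl

@[simp] theorem Chain.ev_ev (Λ : Chain ι) (x : ι → 𝕜) : Λ.ev (Λ.ev x) = Λ.ev x := by
  funext i; rcases Λ.par_eq i with h | h <;> simp [ev_apply, h]

lemma Chain.norm_ev_le (Λ : Chain ι) (x : ι → 𝕜) : ‖Λ.ev x‖ ≤ ‖x‖ :=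
  (pi_norm_le_iff_of_nonneg (norm_nonneg _)).2 fun i => by
    rcases Λ.par_eq i with h | h <;> simp [ev_apply, h, norm_le_pi_norm]

end RCLike

variable (Λ)

lemma Chain.ev_add_od (x : ι → ℂ) : Λ.ev x + Λ.od x = x := by simp [od]

@[simp] theorem Chain.od_od (Λ : Chain ι) (x : ι → ℂ) : Λ.od (Λ.od x) = Λ.od x := by simp [od]

@[simp] theorem Chain.ev_od (Λ : Chain ι) (x : ι → ℂ) : Λ.ev (Λ.od x) = 0 := by simp [od]

@[simp] theorem Chain.od_ev (Λ : Chain ι) (x : ι → ℂ) : Λ.od (Λ.ev x) = 0 := by simp [od]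

lemma Chain.norm_od_le (x : ι → ℂ) : ‖Λ.od x‖ ≤ ‖x‖ :=
  (pi_norm_le_iff_of_nonneg (norm_nonneg _)).2 fun i => by
    rcases Λ.par_eq i with h | h <;> simp [od, ev_apply, h, norm_le_pi_norm]

lemma Chain.ev_Jc (x : ι → ℂ) :
    Λ.ev (Λ.Jc.mulVec x) = Λ.Jc.mulVec (Λ.od x) := by
  funext i
  simp only [od, LinearMap.sub_apply, LinearMap.id_apply, ev_apply, mulVec, dotProduct, smul_sum,
    Pi.sub_apply, Jc, Matrix.map_apply]
  refine sum_congr rfl fun j _ => ?_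
  have h : (Λ.par i * Λ.J i j : ℂ) = -(Λ.J i j * Λ.par j) := by exact_mod_cast Λ.J_par i j
  simp only [real_smul]
  push_cast
  linear_combination x j / 2 * h

lemma Chain.od_Jc (x : ι → ℂ) :
    Λ.od (Λ.Jc.mulVec x) = Λ.Jc.mulVec (Λ.ev x) := by
  change _ - Λ.ev (Λ.Jc.mulVec x) = _
  rw [ev_Jc, LinearMap.id_apply, ← mulVec_sub]
  simp [od]

lemma Chain.dotProduct_ev (x y : ι → ℂ) : x ⬝ᵥ Λ.ev y = Λ.ev x ⬝ᵥ y :=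
  sum_congr rfl fun i _ => by simp only [ev_apply, real_smul]; ring

lemma toC_dot (u : ℤ → ι → ℝ) (n : ℤ) :
    toC (Λ.dot u) n = Λ.Jc.mulVec (toC u n) := funext fun i => (map_mulVec Λ.J (u n) i).symm

variable {Λ}

lemma Chain.isEven_iff {u : ℤ → ι → ℝ} : Λ.IsEven u ↔ ∀ n, Λ.ev (u n) = u n := by
  simp only [IsEven, funext_iff, ev_apply, smul_eq_mul]
  exact forall₂_congr fun n i =>
    ⟨fun h => by linear_combination h / 2, fun h => by linear_combination 2 * h⟩

lemma Chain.IsEven.ev_toC {u : ℤ → ι → ℝ} (hu : Λ.IsEven u) (n : ℤ) :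
    Λ.ev (toC u n) = toC u n := by
  funext i
  have h := congrFun (isEven_iff.1 hu n) i
  rw [ev_apply, smul_eq_mul] at h
  rw [ev_apply, real_smul, toC]
  exact_mod_cast h

lemma Chain.IsEven.od_toC {u : ℤ → ι → ℝ} (hu : Λ.IsEven u) (n : ℤ) :
    Λ.od (toC u n) = 0 := by simp [od, hu.ev_toC]

lemma Chain.IsEven.ev_dot {u : ℤ → ι → ℝ} (hu : Λ.IsEven u) (n : ℤ) :
    Λ.ev (toC (Λ.dot u) n) = 0 := by
  rw [toC_dot, Λ.ev_Jc, hu.od_toC, mulVec_zero]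

lemma Chain.IsEven.od_dot {u : ℤ → ι → ℝ} (hu : Λ.IsEven u) (n : ℤ) :
    Λ.od (toC (Λ.dot u) n) = toC (Λ.dot u) n := by simp [od, hu.ev_dot]

lemma Chain.ev_op {u : ℤ → ι → ℝ} (hu : Λ.IsEven u) (v : ℤ → ι → ℂ) (n : ℤ) :
    Λ.ev (Λ.op (Λ.pot u) v n) = Λ.op (Λ.pot u) (fun n => Λ.ev (v n)) n := by
  have h : (Λ.pot u n).mulVec (Λ.ev (v n)) = Λ.ev ((Λ.pot u n).mulVec (v n)) := by
    funext i
    simp only [ev_apply, mulVec, dotProduct, smul_sum, pot, Matrix.map_apply]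
    refine sum_congr rfl fun j _ => ?_
    have h : (Λ.par i * Λ.A (u n) i j : ℂ) = Λ.A (u n) i j * Λ.par j := by
      exact_mod_cast Λ.A_par _ (hu n) i j
    simp only [real_smul]
    push_cast
    linear_combination -v n j / 2 * h
  funext i
  rw [op_apply, h]
  simp only [op_apply, ev_apply, real_smul]
  ring

lemma Chain.od_op {u : ℤ → ι → ℝ} (hu : Λ.IsEven u) (v : ℤ → ι → ℂ) (n : ℤ) :
    Λ.od (Λ.op (Λ.pot u) v n) = Λ.op (Λ.pot u) (fun n => Λ.od (v n)) n := by
  change _ - Λ.ev (Λ.op (Λ.pot u) v n) = _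
  rw [ev_op hu]
  exact (congrFun (map_sub (Λ.op (Λ.pot u)) v fun n => Λ.ev (v n)) n).symm

lemma Primary.ev_b : Λ.ev P.b = 0 := P.q_even.ev_dot P.n₀

lemma Primary.b_dotProduct_ev (x : ι → ℂ) : P.b ⬝ᵥ Λ.ev x = 0 := by
  rw [Λ.dotProduct_ev, P.ev_b, zero_dotProduct]

lemma Primary.b_dotProduct_od (x : ι → ℂ) : P.b ⬝ᵥ Λ.od x = P.b ⬝ᵥ x := by
  simp [od, dotProduct_sub, P.b_dotProduct_ev]

lemma Primary.ev_src {κ : Type*} [Fintype κ] (p : κ → ℤ) (ξ : κ → ℂ) (n : ℤ) :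
    Λ.ev (P.src p ξ n) = 0 := by
  simp [src_def, apply_ite Λ.ev, P.ev_b]

/-- Real parts of solutions with real right-hand side. -/
lemma Chain.opR_re {u : ℤ → ι → ℝ} {v : ℤ → ι → ℂ} {h : ℤ → ι → ℝ}
    (hv : Λ.op (Λ.pot u) v = toC h) : Λ.opR u (fun n i => (v n i).re) = h := by
  funext n i
  simpa [op_apply, opR_apply, pot, toC, mulVec, dotProduct] using
    congrArg re (congrFun (congrFun hv n) i)

/-- The linearization on even sequences along a configuration is boundedly invertible. -/
lemma Primary.Solvable.even_bound {P : Primary Λ θ} {C ρ β : ℝ} {L : ℕ}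
    (hS : P.Solvable C L ρ β) (hβ : 0 ≤ β) {κ : Type} [Fintype κ] {σ : κ → ℝ} {p : κ → ℤ}
    {u : ℤ → ι → ℝ} (hσ : IsSign σ) (hu : P.IsNear σ p u L ρ)
    {ϱ : ℤ → ℝ} (hϱ : IsWeight θ ϱ) {v : ℤ → ι → ℝ} (hve : Λ.IsEven v)
    {a : ℝ} (hv : ∃ K, WBound ϱ K v) (hL : WBound ϱ a (Λ.opR u v)) : WBound ϱ (C * a) v := by
  have h := (hS κ σ p u (Λ.pot u) hσ hu (fun n i j => by simpa using hβ)).1 ϱ hϱ (toC v) 0 a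
  rw [Λ.op_toC, map_zero, sub_zero] at h
  simp only [WBound, norm_toC] at h
  refine h hv hL fun j => ?_
  rw [← hve.ev_toC, P.b_dotProduct_ev, norm_zero]
  exact mul_nonneg (hL.nonneg hϱ) (hϱ.pos _).le

/-- The linearization is bijective on even bounded sequences. -/
def Chain.EvenBij (Λ : Chain ι) (u : ℤ → ι → ℝ) : Prop :=
  (∀ f : ℤ → ι → ℂ, IsBdd f → (∀ n, Λ.ev (f n) = f n) →
    ∃ z : ℤ → ι → ℂ, IsBdd z ∧ (∀ n, Λ.ev (z n) = z n) ∧ Λ.op (Λ.pot u) z = f) ∧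
  ∀ z : ℤ → ι → ℂ, IsBdd z → (∀ n, Λ.ev (z n) = z n) → Λ.op (Λ.pot u) z = 0 → z = 0

lemma Primary.Solvable.evenBij {P : Primary Λ θ} {C ρ β : ℝ} {L : ℕ}
    (hS : P.Solvable C L ρ β) (hβ : 0 ≤ β) {κ : Type} [Fintype κ] {σ : κ → ℝ} {p : κ → ℤ}
    {u : ℤ → ι → ℝ} (hσ : IsSign σ) (hu : P.IsNear σ p u L ρ)
    (hp : Function.Injective p) (hs : ∃ s : Finset ℤ, ∀ n ∉ s, ‖u n‖ ≤ ρ) (hue : Λ.IsEven u) :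
    Λ.EvenBij u := by
  obtain ⟨hap, hsol⟩ := hS κ σ p u (Λ.pot u) hσ hu (fun n i j => by simpa using hβ)
  refine ⟨fun h hh hhe => ?_, fun v hv hve h0 => funext fun n => ?_⟩
  · obtain ⟨v, ξ, ⟨K, hK⟩, hv, -⟩ := hsol hp hs h hh 0
    refine ⟨fun n => Λ.ev (v n), ⟨K, fun n => (Λ.norm_ev_le _).trans (hK n)⟩,
      fun n => Λ.ev_ev _, funext fun n => ?_⟩
    rw [← ev_op hue, hv, Pi.add_apply, map_add, P.ev_src, hhe, add_zero]
  · simpa using hap _ (.one P.θ_lt.le) v 0 0 (by simpa [WBound] using hv)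
      (fun n => by rw [h0]; simp) (fun j => by rw [← hve, P.b_dotProduct_ev]; simp) n

lemma Chain.EvenBij.solve {u : ℤ → ι → ℝ} (hu : Λ.EvenBij u) {h : ℤ → ι → ℝ}
    (hhe : Λ.IsEven h) (hh : IsBdd h) : ∃ v : ℤ → ι → ℝ, Λ.IsEven v ∧ IsBdd v ∧ Λ.opR u v = h := by
  obtain ⟨v, ⟨K, hK⟩, hve, hv⟩ := hu.1 (toC h) (by simpa only [IsBdd, norm_toC] using hh) hhe.ev_toC
  refine ⟨fun n i => (v n i).re, fun n i => ?_, ⟨K, fun n => (pi_norm_le_iff_of_nonneg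
    ((norm_nonneg _).trans (hK n))).2 fun i => (abs_re_le_norm _).trans
      ((norm_le_pi_norm _ i).trans (hK n))⟩, Λ.opR_re hv⟩
  dsimp only
  rw [← hve n]
  rcases Λ.par_eq i with h | h <;> simp [ev_apply, h]

/-! ### Multi-breathers -/

/-- The concatenation of the copies as a sum. -/
def Primary.ansatz {κ : Type*} [Fintype κ] (σ : κ → ℝ) (p : κ → ℤ) :
    ℤ → ι → ℝ := fun n => ∑ i, σ i • P.q (n - p i)

/-- The weight that decays away from the centers of the copies. -/
def multiBump (θ : ℝ) {κ : Type*} [Fintype κ] (p : κ → ℤ) (n : ℤ) : ℝ := ∑ i, bump θ (p i) n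

/-- The copies are separated by distances at least `D`. -/
def Separated {κ : Type*} (p : κ → ℤ) (D : ℕ) : Prop := ∀ i j, i ≠ j → D ≤ (p i - p j).natAbs

lemma Separated.injective {κ : Type*} {p : κ → ℤ} {D : ℕ} (h : Separated p D) (hD : 0 < D) :
    Function.Injective p := by
  intro i j hij
  by_contra hne
  have := h i j hne
  rw [hij, sub_self, Int.natAbs_zero] at this
  omega

lemma multiBump_isWeight {κ : Type*} [Fintype κ] [Nonempty κ] (hθ : 0 < θ) (hθ1 : θ < 1)
    (p : κ → ℤ) : IsWeight θ (multiBump θ p) :=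
  IsWeight.sum fun i => bump_isWeight hθ hθ1 (p i)

lemma bump_le_multiBump {κ : Type*} [Fintype κ] (hθ : 0 < θ) (p : κ → ℤ) (i : κ) (n : ℤ) :
    bump θ (p i) n ≤ multiBump θ p n :=
  single_le_sum (f := fun i => bump θ (p i) n) (fun _ _ => (bump_pos hθ _ _).le)
    (mem_univ i)

lemma multiBump_le {κ : Type*} [Fintype κ] (hθ : 0 < θ) (hθ1 : θ < 1) (p : κ → ℤ) (n : ℤ) :
    multiBump θ p n ≤ card κ := by
  unfold multiBump
  calc ∑ i, bump θ (p i) n ≤ ∑ _i : κ, (1 : ℝ) :=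
        sum_le_sum fun i _ => bump_le_one hθ hθ1 _ _
    _ = card κ := by simp

lemma Separated.bump_mul_le {κ : Type*} {p : κ → ℤ} {D : ℕ} (h : Separated p D) (hθ : 0 < θ)
    (hθ1 : θ < 1) {i j : κ} (hij : i ≠ j) (n : ℤ) : bump θ (p i) n * bump θ (p j) n ≤ θ ^ D := by
  unfold bump
  rw [← pow_add]
  refine pow_le_pow_of_le_one hθ.le hθ1.le ?_
  have := h i j hij
  omega

lemma exists_nearest {κ : Type*} [Finite κ] [Nonempty κ] (p : κ → ℤ) (n : ℤ) :
    ∃ i, ∀ j, (n - p i).natAbs ≤ (n - p j).natAbs := Finite.exists_min _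

lemma Primary.norm_shift_le (p n : ℤ) :
    ‖P.q (n - p)‖ ≤ P.D * bump θ p n := by
  have := P.q_dec (n - p)
  simpa [bump] using this

lemma Primary.norm_ansatz_le {κ : Type*} [Fintype κ] {σ : κ → ℝ}
    (hσ : IsSign σ) (p : κ → ℤ) (n : ℤ) :
    ‖P.ansatz σ p n‖ ≤ P.D * multiBump θ p n := by
  unfold ansatz multiBump
  rw [mul_sum]
  refine norm_sum_le_of_le _ fun i _ => ?_
  rw [hσ.norm_smul i]
  exact P.norm_shift_le _ _

lemma Primary.norm_ansatz_sub_le {κ : Type*} [Fintype κ] [DecidableEq κ]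
    {σ : κ → ℝ} (hσ : IsSign σ) (p : κ → ℤ) (n : ℤ) (i : κ) :
    ‖P.ansatz σ p n - σ i • P.q (n - p i)‖ ≤ P.D * ∑ j ∈ univ.erase i, bump θ (p j) n := by
  unfold ansatz
  rw [← add_sum_erase _ _ (mem_univ i), add_sub_cancel_left, mul_sum]
  refine norm_sum_le_of_le _ fun j _ => ?_
  rw [hσ.norm_smul j]
  exact P.norm_shift_le _ _

lemma Primary.ansatz_isEven {κ : Type*} [Fintype κ] (σ : κ → ℝ) (p : κ → ℤ) :
    Λ.IsEven (P.ansatz σ p) := by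
  intro n i
  simp only [ansatz, Finset.sum_apply, Pi.smul_apply, smul_eq_mul, mul_sum]
  refine sum_congr rfl fun j _ => ?_
  rw [mul_left_comm, P.q_even]

lemma sum_le_of_card {κ : Type*} [Fintype κ] (s : Finset κ) {f : κ → ℝ} {ρ : ℝ} (hρ : 0 < ρ)
    (h : ∀ i ∈ s, f i ≤ ρ / (card κ + 1)) : ∑ i ∈ s, f i ≤ ρ := by
  refine (sum_le_card_nsmul s f _ h).trans ?_
  have : (s.card : ℝ) ≤ card κ := by exact_mod_cast card_le_univ s
  rw [nsmul_eq_mul, mul_div_assoc', div_le_iff₀ (by positivity)]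
  nlinarith

/-- Sites far from the centers of the other copies see a single copy in the ansatz. -/
lemma Primary.ansatz_close (κ : Type) [Fintype κ] {ρ : ℝ} (hρ : 0 < ρ) :
    ∃ D₀ : ℕ, ∀ (σ : κ → ℝ) (p : κ → ℤ) (D : ℕ), IsSign σ → D₀ ≤ D →
      ∀ n i, (∀ j, j ≠ i → D ≤ 2 * (n - p j).natAbs + 1) →
        ‖P.ansatz σ p n - σ i • P.q (n - p i)‖ ≤ ρ := by
  classical
  obtain ⟨R, hR⟩ := exists_bump_le P.θ_pos P.θ_lt P.D (ε := ρ / (card κ + 1)) (by positivity)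
  refine ⟨2 * R + 1, fun σ p D hσ hD n i hij => (P.norm_ansatz_sub_le hσ p n i).trans ?_⟩
  rw [mul_sum]
  refine sum_le_of_card _ hρ fun j hj => hR _ _ ?_
  have := hij j (ne_of_mem_erase hj)
  omega

lemma Primary.ansatz_small {κ : Type*} [Fintype κ] {σ : κ → ℝ}
    (hσ : IsSign σ) (p : κ → ℤ) {ρ : ℝ} (hρ : 0 < ρ) :
    ∃ s : Finset ℤ, ∀ n ∉ s, ‖P.ansatz σ p n‖ ≤ ρ := by
  classical
  obtain ⟨R, hR⟩ := exists_bump_le P.θ_pos P.θ_lt P.D (ε := ρ / (card κ + 1)) (by positivity)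
  refine ⟨univ.biUnion fun i => Finset.Icc (p i - R) (p i + R), fun n hn =>
    (P.norm_ansatz_le hσ p n).trans ?_⟩
  rw [multiBump, mul_sum]
  refine sum_le_of_card _ hρ fun i _ => hR _ _ ?_
  by_contra h
  exact hn (mem_biUnion.2 ⟨i, mem_univ i, mem_Icc.2 (by omega)⟩)

variable (Λ)

/-- The nonlinearity without its linear part. -/
def Chain.cubic (x : ι → ℝ) : ι → ℝ := Λ.g x - Λ.a₀ • x

lemma Chain.cubic_sign {κ : Type*} {σ : κ → ℝ} (hσ : IsSign σ) (j : κ)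
    (x : ι → ℝ) : Λ.cubic (σ j • x) = σ j • Λ.cubic x := by
  rcases hσ j with h | h
  · simp [h]
  · simp only [h, cubic, neg_smul, one_smul, Λ.g_neg, smul_neg]; abel

lemma Chain.cubic_lip (R : ℝ) :
    ∃ C, 0 ≤ C ∧ ∀ x y, ‖x‖ ≤ R → ‖y‖ ≤ R →
      ‖Λ.cubic x - Λ.cubic y‖ ≤ C * (‖x‖ + ‖y‖) ^ 2 * ‖x - y‖ := by
  obtain ⟨C₁, hC₁, h1⟩ := Λ.g_taylor R
  obtain ⟨C₂, hC₂, h2⟩ := Λ.A_sub_zero_le R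
  refine ⟨C₁ + card ι * C₂, by positivity, fun x y hx hy => ?_⟩
  rw [show Λ.cubic x - Λ.cubic y = (Λ.g x - Λ.g y - (Λ.A y).mulVec (x - y))
      + (Λ.A y - Λ.A 0).mulVec (x - y) by
    rw [sub_mulVec, Λ.A_zero, smul_mulVec, one_mulVec, smul_sub, cubic, cubic]; abel]
  refine (norm_add_le_of_le (h1 x y hx hy) (norm_mulVec_le (Λ.A y - Λ.A 0) (b := C₂ * ‖y‖ ^ 2)
    (by positivity) (fun i j => h2 y hy i j) (x - y))).trans ?_
  calc _ = C₁ * (‖x‖ + ‖y‖) * ‖x - y‖ * ‖x - y‖ + card ι * (C₂ * ‖y‖ ^ 2) * ‖x - y‖ := by ring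
    _ ≤ C₁ * (‖x‖ + ‖y‖) * (‖x‖ + ‖y‖) * ‖x - y‖
        + card ι * (C₂ * (‖x‖ + ‖y‖) ^ 2) * ‖x - y‖ := by
      gcongr
      exacts [norm_sub_le _ _, le_add_of_nonneg_left (norm_nonneg _)]
    _ = _ := by ring

/-- The left-hand side of the nonlinear lattice equation. -/
def Chain.defect (u : ℤ → ι → ℝ) : ℤ → ι → ℝ := fun n i =>
  Λ.d * (u (n + 1) i + u (n - 1) i - 2 * u n i) + Λ.S i * u n i - Λ.g (u n) i

lemma Chain.defect_eq (u : ℤ → ι → ℝ) (n : ℤ) :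
    Λ.defect u n = Λ.opR 0 u n - Λ.cubic (u n) := by
  funext i
  simp [defect, opR_apply, cubic, Λ.A_zero, smul_mulVec]

variable {Λ}

/-- The residual of the ansatz, which is cubic and so of the order of the separation of the
copies. -/
lemma Primary.ansatz_residual (κ : Type) [Fintype κ] [Nonempty κ] :
    ∃ C, 0 < C ∧ ∀ (σ : κ → ℝ) (p : κ → ℤ) (D : ℕ), IsSign σ → Separated p D →
      WBound (multiBump θ p) (C * θ ^ D) (Λ.defect (P.ansatz σ p)) := by
  classical
  have hD := P.D_nonneg
  have hθ := P.θ_pos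
  obtain ⟨m, hm⟩ : ∃ m, m = (card κ : ℝ) := ⟨_, rfl⟩
  have hm0 : 0 ≤ m := by rw [hm]; positivity
  obtain ⟨C, hC, hlip⟩ := Λ.cubic_lip ((m + 1) * P.D)
  obtain ⟨X, hX⟩ : ∃ X, X = C * ((m + 1) * P.D) ^ 2 * P.D := ⟨_, rfl⟩
  have hX0 : 0 ≤ X := by rw [hX]; positivity
  refine ⟨2 * X * m + 1, by positivity, fun σ p D hσ hsep n => ?_⟩
  obtain ⟨i, hi⟩ := exists_nearest p n
  have hap := bump_pos hθ (p i) n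
  have ha1 := bump_le_one hθ P.θ_lt (p i) n
  -- the nearest copy dominates
  obtain ⟨B, hB⟩ : ∃ B, B = (m + 1) * P.D * bump θ (p i) n := ⟨_, rfl⟩
  have hBle : B ≤ (m + 1) * P.D := hB ▸ mul_le_of_le_one_right (by positivity) ha1
  have hone : ∀ j, ‖σ j • P.q (n - p j)‖ ≤ P.D * bump θ (p j) n := fun j => by
    rw [hσ.norm_smul]; exact P.norm_shift_le _ _
  have hone' : ∀ j, ‖σ j • P.q (n - p j)‖ ≤ P.D * bump θ (p i) n := fun j => (hone j).trans
    (mul_le_mul_of_nonneg_left (pow_le_pow_of_le_one hθ.le P.θ_lt.le (hi j)) hD)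
  have hu : ‖P.ansatz σ p n‖ ≤ m * (P.D * bump θ (p i) n) :=
    (norm_sum_le_of_le _ fun j _ => hone' j).trans_eq (by simp [hm])
  have hsum : ∑ j ∈ univ.erase i, X * (bump θ (p i) n ^ 2 * bump θ (p j) n)
      ≤ m * (X * (θ ^ D * bump θ (p i) n)) := by
    refine (sum_le_card_nsmul _ _ (X * (θ ^ D * bump θ (p i) n)) fun j hj => ?_).trans ?_
    · have := hsep.bump_mul_le hθ P.θ_lt (ne_of_mem_erase hj).symm n
      rw [sq, mul_assoc, mul_comm (bump θ (p i) n)]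
      gcongr
    · rw [nsmul_eq_mul, hm]
      gcongr
      exact card_le_univ _
  have key : Λ.defect (P.ansatz σ p) n = (Λ.cubic (σ i • P.q (n - p i)) - Λ.cubic (P.ansatz σ p n))
      + ∑ j ∈ univ.erase i, Λ.cubic (σ j • P.q (n - p j)) := by
    have e : P.ansatz σ p = ∑ j, σ j • fun n => P.q (n - p j) := by
      funext n; simp [ansatz]
    have e' : ∀ j, Λ.opR 0 (fun n => P.q (n - p j)) n = Λ.cubic (P.q (n - p j)) := fun j => by
      have h : Λ.defect P.q (n - p j) = 0 := funext (P.q_sol (n - p j))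
      rw [Λ.defect_eq, sub_eq_zero] at h
      rw [← h]
      funext k
      simp only [opR_apply, Pi.zero_apply, sub_add_eq_add_sub, sub_right_comm]
    rw [Λ.defect_eq, sub_add_eq_add_sub, add_sum_erase _ (fun j => Λ.cubic (σ j • P.q (n - p j)))
      (mem_univ i)]
    nth_rw 1 [e]
    simp only [map_sum, map_smul, Finset.sum_apply, Pi.smul_apply, e', Λ.cubic_sign hσ]
  have t1 := hlip _ _ ((hone' i).trans ((by rw [hB]; nlinarith [mul_nonneg hD hap.le] :
    _ ≤ B).trans hBle)) (hu.trans ((by rw [hB]; nlinarith [mul_nonneg hD hap.le] : _ ≤ B).trans hBle))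
  have t2 : ‖∑ j ∈ univ.erase i, Λ.cubic (σ j • P.q (n - p j))‖
      ≤ ∑ j ∈ univ.erase i, X * (bump θ (p i) n ^ 2 * bump θ (p j) n) := by
    refine norm_sum_le_of_le _ fun j _ => ?_
    have hjB : ‖σ j • P.q (n - p j)‖ ≤ B := (hone' j).trans (by
      rw [hB]; nlinarith [mul_nonneg hD hap.le])
    have h1 := hlip _ 0 (hjB.trans hBle) (by simp; positivity)
    rw [show Λ.cubic 0 = 0 by simp [cubic, self_eq_neg.1 (by simpa using Λ.g_neg 0)], sub_zero,
      sub_zero, norm_zero, add_zero] at h1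
    refine h1.trans ?_
    calc _ ≤ C * B ^ 2 * (P.D * bump θ (p j) n) := by gcongr; exact hone j
      _ = _ := by rw [hB, hX]; ring
  have t3 : ‖Λ.cubic (σ i • P.q (n - p i)) - Λ.cubic (P.ansatz σ p n)‖
      ≤ ∑ j ∈ univ.erase i, X * (bump θ (p i) n ^ 2 * bump θ (p j) n) := by
    refine t1.trans ?_
    rw [norm_sub_rev, ← mul_sum, ← mul_sum]
    calc _ ≤ C * B ^ 2 * (P.D * ∑ j ∈ univ.erase i, bump θ (p j) n) := by
          gcongr
          exacts [by rw [hB]; linarith [hone' i], P.norm_ansatz_sub_le hσ p n i]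
      _ = _ := by rw [hB, hX]; ring
  rw [key]
  refine (norm_add_le_of_le (t3.trans hsum) (t2.trans hsum)).trans ?_
  have h3 := bump_le_multiBump hθ p i n
  calc _ = (2 * X * m) * θ ^ D * bump θ (p i) n := by ring
    _ ≤ _ := by gcongr; linarith

lemma WBound.of_max {E : Type*} [Norm E] {ϱ : ℤ → ℝ} (hϱ : ∀ n, 0 < ϱ n) {a : ℝ} {v : ℤ → E}
    (h : ∀ k : ℕ, WBound (fun n => max (ϱ n) (1 / ((k : ℝ) + 1) * 1)) a v) : WBound ϱ a v := by
  intro n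
  obtain ⟨k, hk⟩ := exists_nat_one_div_lt (hϱ n)
  have := h k n
  simp only [mul_one] at this
  rwa [max_eq_left hk.le] at this

/-- Bounded sequences are finite in the norms of `WBound.of_max`. -/
lemma IsBdd.wbound_max {E : Type*} [SeminormedAddCommGroup E] {v : ℤ → E} (h : IsBdd v)
    (ϱ : ℤ → ℝ) (k : ℕ) : ∃ K, WBound (fun n => max (ϱ n) (1 / ((k : ℝ) + 1) * 1)) K v := by
  obtain ⟨K, hK⟩ := h
  have hK0 := (norm_nonneg _).trans (hK 0)
  refine ⟨K * (k + 1), fun n => (hK n).trans ?_⟩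
  calc K = K * (k + 1) * (1 / (k + 1) * 1) := by field_simp
    _ ≤ _ := by gcongr; exact le_max_right _ _

lemma Chain.IsEven.defect {u : ℤ → ι → ℝ} (hu : Λ.IsEven u) : Λ.IsEven (Λ.defect u) := by
  intro n i
  have h1 := hu (n + 1) i
  have h2 := hu (n - 1) i
  have h3 := hu n i
  have h4 := Λ.g_par (u n) (hu n) i
  simp only [Chain.defect]
  linear_combination Λ.d * (h1 + h2 - 2 * h3) + Λ.S i * h3 - h4

/-- The part of the nonlinearity that is of higher order in the correction `δ`. -/
def Chain.remainder (Λ : Chain ι) (u δ : ℤ → ι → ℝ) : ℤ → ι → ℝ := fun n =>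
  Λ.g (u n + δ n) - Λ.g (u n) - (Λ.A (u n)).mulVec (δ n)

lemma Chain.defect_add (Λ : Chain ι) (u δ : ℤ → ι → ℝ) :
    Λ.defect (u + δ) = Λ.defect u + Λ.opR u δ - Λ.remainder u δ := by
  funext n i
  simp only [defect, opR_apply, remainder, Pi.add_apply,
    Pi.sub_apply]
  ring

lemma Chain.isEven_add {u v : ℤ → ι → ℝ} (hu : Λ.IsEven u) (hv : Λ.IsEven v) :
    Λ.IsEven (u + v) := fun n i => by
  simp only [Pi.add_apply]
  rw [mul_add, hu, hv]

lemma Chain.isEven_sub {u v : ℤ → ι → ℝ} (hu : Λ.IsEven u) (hv : Λ.IsEven v) :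
    Λ.IsEven (u - v) := fun n i => by
  simp only [Pi.sub_apply]
  rw [mul_sub, hu, hv]

lemma Chain.isEven_mulVec {u v : ℤ → ι → ℝ} (hu : Λ.IsEven u) (hv : Λ.IsEven v) :
    Λ.IsEven (fun n => (Λ.A (u n)).mulVec (v n)) := fun n i => by
  simp only [mulVec, dotProduct, mul_sum]
  refine sum_congr rfl fun j _ => ?_
  rw [← mul_assoc, Λ.A_par (u n) (hu n), mul_assoc, hv]

lemma Chain.isEven_remainder {u δ : ℤ → ι → ℝ} (hu : Λ.IsEven u) (hδ : Λ.IsEven δ) :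
    Λ.IsEven (Λ.remainder u δ) := fun n i => by
  have h1 := Λ.g_par _ (isEven_add hu hδ n) i
  have h2 := Λ.g_par _ (hu n) i
  have h3 := isEven_mulVec hu hδ n i
  simp only [Pi.add_apply] at h1
  simp only [remainder, Pi.sub_apply]
  linear_combination h1 - h2 - h3

variable (Λ)

lemma Chain.remainder_lip (R : ℝ) :
    ∃ C, 0 < C ∧ ∀ u δ δ' : ℤ → ι → ℝ, ∀ n, ‖u n‖ ≤ R → ‖δ n‖ ≤ 1 → ‖δ' n‖ ≤ 1 →
      ‖Λ.remainder u δ n - Λ.remainder u δ' n‖ ≤ C * (‖δ n‖ + ‖δ' n‖) * ‖δ n - δ' n‖ := by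
  obtain ⟨C₁, hC₁, h1⟩ := Λ.g_taylor (|R| + 1)
  obtain ⟨C₂, hC₂, h2⟩ := Λ.A_lip (|R| + 1)
  refine ⟨2 * (|R| + 1) * (C₁ + card ι * C₂) + 1, by positivity, fun u δ δ' n hu hδ hδ' => ?_⟩
  have hu' : ‖u n‖ ≤ |R| + 1 := by linarith [le_abs_self R]
  have hx : ‖u n + δ n‖ ≤ |R| + 1 := norm_add_le_of_le (hu.trans (le_abs_self R)) hδ
  have hy : ‖u n + δ' n‖ ≤ |R| + 1 := norm_add_le_of_le (hu.trans (le_abs_self R)) hδ'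
  have a1 := h1 _ _ hx hy
  have a2 := norm_mulVec_le (Λ.A (u n + δ' n) - Λ.A (u n)) (by positivity)
    (fun i j => h2 _ _ hy hu' i j) (δ n - δ' n)
  rw [add_sub_add_left_eq_sub] at a1
  rw [add_sub_cancel_left] at a2
  rw [show Λ.remainder u δ n - Λ.remainder u δ' n
      = (Λ.g (u n + δ n) - Λ.g (u n + δ' n) - (Λ.A (u n + δ' n)).mulVec (δ n - δ' n))
        + (Λ.A (u n + δ' n) - Λ.A (u n)).mulVec (δ n - δ' n) by
    rw [sub_mulVec, mulVec_sub (Λ.A (u n))]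
    simp only [remainder]
    abel]
  have hx2 : ‖u n + δ n‖ + ‖u n + δ' n‖ ≤ 2 * (|R| + 1) := by linarith
  have hy2 : ‖u n + δ' n‖ + ‖u n‖ ≤ 2 * (|R| + 1) := by linarith
  refine (norm_add_le_of_le a1 a2).trans ?_
  calc _ ≤ C₁ * (2 * (|R| + 1)) * ((‖δ n‖ + ‖δ' n‖) * ‖δ n - δ' n‖)
        + card ι * (C₂ * (2 * (|R| + 1)) * (‖δ n‖ + ‖δ' n‖)) * ‖δ n - δ' n‖ := by
        rw [sq]
        gcongr
        exacts [norm_sub_le _ _, le_add_of_nonneg_left (norm_nonneg _)]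
    _ = (2 * (|R| + 1) * (C₁ + card ι * C₂)) * (‖δ n‖ + ‖δ' n‖) * ‖δ n - δ' n‖ := by ring
    _ ≤ _ := by gcongr; linarith

lemma Chain.remainder_zero (u : ℤ → ι → ℝ) : Λ.remainder u 0 = 0 := by
  funext n; simp [remainder]

/-- The remainder is small relative to small corrections. -/
lemma Chain.exists_remainder_le (R : ℝ) {ε : ℝ} (hε : 0 < ε) :
    ∃ r, 0 < r ∧ ∀ (u δ δ' : ℤ → ι → ℝ) n, ‖u n‖ ≤ R → ‖δ n‖ ≤ r → ‖δ' n‖ ≤ r →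
      ‖Λ.remainder u δ n - Λ.remainder u δ' n‖ ≤ ε * ‖δ n - δ' n‖ := by
  obtain ⟨C, hC, h⟩ := Λ.remainder_lip R
  obtain ⟨r, hr, hr1, hCr⟩ := exists_mul_le (c := C * 2) (by positivity) hε
  refine ⟨r, hr, fun u δ δ' n hu hδ hδ' => (h u δ δ' n hu (hδ.trans hr1) (hδ'.trans hr1)).trans ?_⟩
  gcongr
  exact le_trans (by gcongr; linarith) (hCr.trans' (by linarith : C * (2 * r) ≤ _))

variable {Λ}

/-- The concatenation of well separated copies is an admissible configuration. -/
lemma Primary.ansatz_isNear (P : Primary Λ θ) (κ : Type) [Fintype κ] [Nonempty κ] (L : ℕ) {ρ : ℝ}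
    (hρ : 0 < ρ) : ∃ D₀ : ℕ, ∀ (σ : κ → ℝ) (p : κ → ℤ) (D : ℕ), IsSign σ →
      D₀ ≤ D → Separated p D → P.IsNear σ p (P.ansatz σ p) L ρ := by
  obtain ⟨D₁, h1⟩ := P.isNear_of_isClose L hρ
  obtain ⟨D₂, h2⟩ := P.ansatz_close κ (half_pos hρ)
  refine ⟨max D₁ D₂, fun σ p D hσ hD hsep => h1 κ σ p _ D hσ ((le_max_left _ _).trans hD)
    fun n => ?_⟩
  obtain ⟨i, hi⟩ := exists_nearest p n
  have hij : ∀ j, j ≠ i → D ≤ 2 * (n - p j).natAbs + 1 := fun j hj => by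
    have := hsep j i hj
    have := hi j
    omega
  exact ⟨i, h2 σ p D hσ ((le_max_right _ _).trans hD) n i hij, hij⟩

/-- Existence of a multi-breather near every concatenation of well separated copies, with the
distance from the concatenation measured in the decaying weight. -/
lemma Primary.exists_multi {P : Primary Λ θ} {C ρ β : ℝ} {L : ℕ}
    (hS : P.Solvable C L ρ β) (hC : 0 < C) (hρ : 0 < ρ) (hβ : 0 ≤ β) (κ : Type) [Fintype κ]
    [Nonempty κ] :
    ∃ C', 0 < C' ∧ ∃ D₀ : ℕ, ∀ (σ : κ → ℝ) (p : κ → ℤ) (D : ℕ), IsSign σ →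
      D₀ ≤ D → Separated p D → ∃ u, Λ.IsEven u ∧ Λ.IsSol u ∧
        WBound (multiBump θ p) (C' * θ ^ D) (u - P.ansatz σ p) := by
  have hθ := P.θ_pos
  have hθ1 := P.θ_lt
  have hPD := P.D_nonneg
  obtain ⟨D₁, hnear⟩ := P.ansatz_isNear κ L hρ
  obtain ⟨Cr, hCr, hres⟩ := P.ansatz_residual κ
  obtain ⟨ε, hε, -, hCε⟩ := exists_mul_le hC.le (ε := 1 / 2) (by norm_num)
  obtain ⟨r, hr0, hlip⟩ := Λ.exists_remainder_le (P.D * card κ) hε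
  obtain ⟨D₂, hD₂⟩ := exists_bump_le hθ hθ1 (C * (Cr * card κ)) (half_pos hr0)
  refine ⟨2 * C * Cr, by positivity, max (max D₁ D₂) 1, fun σ p D hσ hD hsep => ?_⟩
  simp only [max_le_iff] at hD
  have hDθ : C * (Cr * θ ^ D * card κ) ≤ r / 2 := by
    have := hD₂ 0 D (by simpa using hD.1.2)
    rw [show bump θ 0 D = θ ^ D by simp [bump]] at this
    linarith
  have hp := hsep.injective hD.2
  set u₀ := P.ansatz σ p
  have hu₀n := hnear σ p D hσ hD.1.1 hsep
  have hu₀e : Λ.IsEven u₀ := P.ansatz_isEven σ p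
  have hϱ := multiBump_isWeight hθ hθ1 p
  have h1w : IsWeight θ (fun _ : ℤ => (1 : ℝ)) := IsWeight.one hθ1.le
  have hu₀b : ∀ n, ‖u₀ n‖ ≤ P.D * card κ := fun n => (P.norm_ansatz_le hσ p n).trans
    (by gcongr; exact multiBump_le hθ hθ1 p n)
  have hresw := hres σ p D hσ hsep
  have hresb : ∀ n, ‖Λ.defect u₀ n‖ ≤ Cr * θ ^ D * card κ := fun n => (hresw n).trans
    (by gcongr; exact multiBump_le hθ hθ1 p n)
  have hrem : ∀ δ : ℤ → ι → ℝ, (∀ n, ‖δ n‖ ≤ r) → ∀ n, ‖Λ.remainder u₀ δ n‖ ≤ ε * ‖δ n‖ :=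
    fun δ hδ n => by
      simpa [Λ.remainder_zero] using hlip u₀ δ 0 n (hu₀b n) (hδ n) (by simpa using hr0.le)
  have hev : ∀ (v : ℤ → ι → ℝ) {a}, (∀ n, ‖v n‖ ≤ a) → ∀ n, ‖Λ.ev (v n)‖ ≤ a := fun v a hv n =>
    (Λ.norm_ev_le _).trans (hv n)
  have hrhs : ∀ v : ℤ → ι → ℝ, (∀ n, ‖v n‖ ≤ r) → ∀ n,
      ‖(Λ.remainder u₀ (fun n => Λ.ev (v n)) - Λ.defect u₀) n‖ ≤ ε * r + Cr * θ ^ D * card κ :=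
    fun v hv n => norm_sub_le_of_le ((hrem _ (hev v hv) n).trans (by gcongr; exact hev v hv n))
      (hresb n)
  have hex : ∀ δ : ℤ → ι → ℝ, (∀ n, ‖δ n‖ ≤ r) → ∃ v : ℤ → ι → ℝ, Λ.IsEven v ∧ IsBdd v ∧
      Λ.opR u₀ v = Λ.remainder u₀ (fun n => Λ.ev (δ n)) - Λ.defect u₀ := fun δ hδ =>
    (hS.evenBij hβ hσ hu₀n hp (P.ansatz_small hσ p hρ) hu₀e).solve (isEven_sub
      (isEven_remainder hu₀e (isEven_iff.2 fun n => Λ.ev_ev _)) hu₀e.defect) ⟨_, hrhs δ hδ⟩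
  choose! Φ hΦe hΦb hΦ using hex
  have hsup : ∀ {v : ℤ → ι → ℝ} {a : ℝ}, Λ.IsEven v → IsBdd v → (∀ n, ‖Λ.opR u₀ v n‖ ≤ a) →
      ∀ n, ‖v n‖ ≤ C * a := fun {v a} hve hvb hv => by
    simpa [WBound] using hS.even_bound hβ hσ hu₀n h1w hve (by simpa [WBound] using hvb)
      (a := a) (by simpa [WBound] using hv)
  obtain ⟨δ, hδr, hfix⟩ := exists_fixed_seq Φ hr0.le (fun v hv n => by
    refine (hsup (hΦe v hv) (hΦb v hv) (by rw [hΦ v hv]; exact hrhs v hv) n).trans ?_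
    nlinarith) fun v w hv hw M hM n => by
    refine (hsup (isEven_sub (hΦe v hv) (hΦe w hw)) ((hΦb v hv).sub (hΦb w hw)) (a := ε * M)
      (fun n => ?_) n).trans ?_
    · rw [map_sub, hΦ v hv, hΦ w hw, sub_sub_sub_cancel_right]
      refine (hlip u₀ _ _ n (hu₀b n) (hev v hv n) (hev w hw n)).trans ?_
      rw [← map_sub]
      gcongr
      exact hev (v - w) hM n
    · have := (norm_nonneg _).trans (hM 0)
      nlinarith
  have a1 := hΦe δ hδr
  have a3 := hΦ δ hδr
  rw [hfix] at a1 a3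
  simp only [isEven_iff.1 a1] at a3
  refine ⟨u₀ + δ, isEven_add hu₀e a1, fun n i => ?_, ?_⟩
  · refine (congrFun (congrFun (Λ.defect_add u₀ δ) n) i).trans ?_
    rw [a3]
    simp
  · rw [add_sub_cancel_left]
    refine WBound.of_max hϱ.pos fun k => ?_
    have hwk : IsWeight θ (fun n => max (multiBump θ p n) (1 / ((k : ℝ) + 1) * 1)) :=
      hϱ.max (h1w.const_mul (by positivity)) hθ
    refine (WBound.absorb (a := C * (Cr * θ ^ D)) (k := 1 / 2) hwk (by norm_num)
      (IsBdd.wbound_max ⟨r, hδr⟩ _ k) fun B hB hBδ => ?_).mono hwk (le_of_eq (by ring))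
    refine (hS.even_bound hβ hσ hu₀n hwk a1 (a := Cr * θ ^ D + ε * B) ⟨B, hBδ⟩
      fun n => ?_).mono hwk (by nlinarith)
    rw [a3, add_comm, add_mul, mul_assoc ε]
    refine norm_sub_le_of_le ((hrem δ hδr n).trans ?_) ((hresw n).trans ?_)
    · gcongr
      exact hBδ n
    · gcongr
      exact le_max_left _ _

/-- Multi-breathers are locally unique in the sup norm. -/
lemma Primary.unique_multi {P : Primary Λ θ} {C ρ β : ℝ} {L : ℕ}
    (hS : P.Solvable C L ρ β) (hC : 0 < C) (hβ : 0 ≤ β) (R : ℝ) :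
    ∃ ρ₁, 0 < ρ₁ ∧ ∀ (κ : Type) [Fintype κ] (σ : κ → ℝ) (p : κ → ℤ) (u u' : ℤ → ι → ℝ),
      IsSign σ → P.IsNear σ p u L ρ → (∀ n, ‖u n‖ ≤ R) → Λ.IsEven u →
      Λ.IsEven u' → Λ.IsSol u → Λ.IsSol u' → (∀ n, ‖u' n - u n‖ ≤ ρ₁) → u' = u := by
  obtain ⟨ε, hε, -, hCε⟩ := exists_mul_le hC.le (ε := 1 / 2) (by norm_num)
  obtain ⟨r, hr0, hlip⟩ := Λ.exists_remainder_le R hε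
  refine ⟨r, hr0, fun κ _ σ p u u' hσ hnear hu hue hue' hs hs' hd => ?_⟩
  have h1w : IsWeight θ (fun _ : ℤ => (1 : ℝ)) := IsWeight.one P.θ_lt.le
  have e : Λ.opR u (u' - u) = Λ.remainder u (u' - u) := by
    have h1 := Λ.defect_add u (u' - u)
    rwa [add_sub_cancel, show Λ.defect u' = 0 from funext₂ hs', show Λ.defect u = 0 from funext₂ hs,
      zero_add, eq_comm, sub_eq_zero] at h1
  have h0 : WBound (fun _ : ℤ => (1 : ℝ)) (0 / (1 - 1 / 2)) (u' - u) := by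
    refine WBound.absorb h1w (by norm_num) ⟨r, fun n => by rw [mul_one]; exact hd n⟩
      fun B hB hBδ => ?_
    refine (hS.even_bound hβ hσ hnear h1w (isEven_sub hue' hue) (a := ε * B)
      ⟨B, hBδ⟩ fun n => ?_).mono h1w (by nlinarith)
    rw [e, mul_assoc]
    have := hlip u (u' - u) 0 n (hu n) (hd n) (by simpa using hr0.le)
    simp only [Λ.remainder_zero, Pi.zero_apply, sub_zero] at this
    exact this.trans (by gcongr; exact hBδ n)
  exact sub_eq_zero.1 (funext fun n => by simpa using h0 n)

/-! ### The spectral parameter as a perturbation -/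

variable (Λ)

lemma Chain.dotProduct_Jc (x y : ι → ℂ) :
    x ⬝ᵥ Λ.Jc.mulVec y = -(Λ.Jc.mulVec x ⬝ᵥ y) := by
  have h : Λ.Jc.transpose = -Λ.Jc := by
    unfold Chain.Jc
    rw [← transpose_map, Λ.J_skew]
    ext i j; simp
  rw [dotProduct_mulVec, ← mulVec_transpose, h, neg_mulVec, neg_dotProduct]

lemma Chain.norm_Jc_le :
    ∃ C, 0 < C ∧ (∀ i j, ‖Λ.Jc i j‖ ≤ C) ∧ ∀ v : ι → ℂ, ‖Λ.Jc.mulVec v‖ ≤ C * ‖v‖ := by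
  obtain ⟨b, hb⟩ := Finite.exists_le fun x : ι × ι => ‖Λ.Jc x.1 x.2‖
  refine ⟨(card ι + 1) * (|b| + 1), by positivity, fun i j => (hb (i, j)).trans ?_, fun v =>
    (norm_mulVec_le _ (abs_nonneg b) (fun i j => (hb (i, j)).trans (le_abs_self b)) v).trans ?_⟩
  · nlinarith [le_abs_self b, mul_nonneg (Nat.cast_nonneg (α := ℝ) (card ι)) (abs_nonneg b)]
  · gcongr <;> simp

/-- The matrix `s + 2 J (t⁻¹ P_o + s t P_e)`. Splitting `w = w_o + λ z` into its odd and even parts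
and writing `v = w_o + t⁻¹ z`, it turns the quadratic eigenvalue problem with parameter `s = λ²` into
a small perturbation of the linearization, if `t` is large and `s t` is small. -/
def Chain.pert (t : ℝ) (s : ℂ) : Matrix ι ι ℂ :=
  fun i j => s * (1 : Matrix ι ι ℂ) i j
    + 2 * Λ.Jc i j * (if Λ.par j = 1 then s * t else (t : ℂ)⁻¹)

lemma Chain.pert_mulVec (t : ℝ) (s : ℂ) (x : ι → ℂ) :
    (Λ.pert t s).mulVec x = s • x
      + (2 : ℂ) • Λ.Jc.mulVec ((s * t) • Λ.ev x + (t : ℂ)⁻¹ • Λ.od x) := by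
  funext i
  have : ∀ j, Λ.pert t s i j * x j = s * ((1 : Matrix ι ι ℂ) i j * x j)
      + 2 * (Λ.Jc i j * ((s * t) • Λ.ev x + (t : ℂ)⁻¹ • Λ.od x) j) := fun j => by
    rcases Λ.par_eq j with hj | hj <;> norm_num [pert, ev_apply, od, hj] <;> ring
  simp only [mulVec, dotProduct, this, sum_add_distrib, ← mul_sum,
    Pi.add_apply (s • x), Pi.smul_apply, smul_eq_mul]
  congr 2
  simp [one_apply]

lemma Chain.exists_pert_small {β : ℝ} (hβ : 0 < β) :
    ∃ t : ℝ, 0 < t ∧ ∃ δ, 0 < δ ∧ ∀ s : ℂ, ‖s‖ ≤ δ → ∀ i j, ‖Λ.pert t s i j‖ ≤ β := by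
  obtain ⟨C, hC, hCJ, -⟩ := Λ.norm_Jc_le
  obtain ⟨r, hr, -, hCr⟩ := exists_mul_le (c := 2 * C) (by positivity) (half_pos hβ)
  obtain ⟨δ, hδ, -, hCδ⟩ := exists_mul_le (c := 1 + 2 * C * r⁻¹) (by positivity) (half_pos hβ)
  refine ⟨r⁻¹, by positivity, δ, hδ, fun s hs i j => ?_⟩
  have h1 : ‖(1 : Matrix ι ι ℂ) i j‖ ≤ 1 := by
    rw [one_apply]; split_ifs <;> simp
  have h2 : ‖if Λ.par j = 1 then s * (r⁻¹ : ℝ) else ((r⁻¹ : ℝ) : ℂ)⁻¹‖ ≤ ‖s‖ * r⁻¹ + r := by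
    split_ifs <;> simp [abs_of_pos hr, hr.le]; positivity
  refine (norm_add_le _ _).trans ?_
  rw [norm_mul, norm_mul, norm_mul, Complex.norm_ofNat]
  calc _ ≤ δ * 1 + 2 * C * (δ * r⁻¹ + r) := by
        gcongr
        exacts [hCJ i j, h2.trans (by gcongr)]
    _ = (1 + 2 * C * r⁻¹) * δ + 2 * C * r := by ring
    _ ≤ β := by linarith

lemma Chain.pert_sub_bound (t : ℝ) :
    ∃ C, 0 < C ∧ ∀ (s : ℂ) (x : ι → ℂ), ‖(Λ.pert t 0 - Λ.pert t s).mulVec x‖ ≤ C * ‖s‖ * ‖x‖ := by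
  obtain ⟨C, hC, -, hCJ⟩ := Λ.norm_Jc_le
  refine ⟨1 + 2 * C * |t|, by positivity, fun s x => ?_⟩
  have e : (Λ.pert t 0 - Λ.pert t s).mulVec x
      = -(s • (x + (2 * t : ℂ) • Λ.Jc.mulVec (Λ.ev x))) := by
    rw [sub_mulVec, Λ.pert_mulVec, Λ.pert_mulVec, mulVec_add, mulVec_add]
    simp only [mulVec_smul]
    module
  rw [e, norm_neg, norm_smul]
  have h1 : ‖x + (2 * t : ℂ) • Λ.Jc.mulVec (Λ.ev x)‖ ≤ ‖x‖ + 2 * |t| * (C * ‖x‖) := by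
    refine (norm_add_le _ _).trans (add_le_add le_rfl ?_)
    rw [norm_smul, norm_mul, Complex.norm_ofNat, norm_real, norm_eq_abs]
    gcongr
    refine (hCJ _).trans ?_
    gcongr
    exact Λ.norm_ev_le x
  calc ‖s‖ * _ ≤ ‖s‖ * (‖x‖ + 2 * |t| * (C * ‖x‖)) := by gcongr
    _ = _ := by ring

/-- The operator `L_u - s - 2 J (t⁻¹ P_o + s t P_e)`. -/
def Chain.opS (u : ℤ → ι → ℝ) (t : ℝ) (s : ℂ) :=
  Λ.op fun n => Λ.pot u n + Λ.pert t s

lemma Chain.opS_apply (u : ℤ → ι → ℝ) (t : ℝ) (s : ℂ)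
    (v : ℤ → ι → ℂ) (n : ℤ) :
    Λ.opS u t s v n = Λ.op (Λ.pot u) v n - (Λ.pert t s).mulVec (v n) := by
  unfold opS
  rw [Λ.op_sub_pot (Λ.pot u) _ v n, sub_add_cancel_left, neg_mulVec, sub_eq_add_neg]

variable {Λ}

lemma Chain.od_opS {u : ℤ → ι → ℝ} (hu : Λ.IsEven u) (t : ℝ) (s : ℂ)
    (v : ℤ → ι → ℂ) (n : ℤ) :
    Λ.od (Λ.opS u t s v n) = Λ.op (Λ.pot u) (fun n => Λ.od (v n)) n - s • Λ.od (v n)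
      - (2 * s) • Λ.Jc.mulVec ((t : ℂ) • Λ.ev (v n)) := by
  rw [Λ.opS_apply, map_sub, od_op hu, Λ.pert_mulVec, map_add, map_smul, map_smul,
    Λ.od_Jc, map_add, map_smul, map_smul]
  simp only [ev_ev, ev_od, smul_zero, add_zero, mulVec_smul]
  module

lemma Chain.ev_opS {u : ℤ → ι → ℝ} (hu : Λ.IsEven u) {t : ℝ} (ht : t ≠ 0) (s : ℂ)
    (v : ℤ → ι → ℂ) (n : ℤ) :
    (t : ℂ) • Λ.ev (Λ.opS u t s v n) = Λ.op (Λ.pot u) (fun n => (t : ℂ) • Λ.ev (v n)) n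
      - s • ((t : ℂ) • Λ.ev (v n)) - (2 : ℂ) • Λ.Jc.mulVec (Λ.od (v n)) := by
  have h' : (fun n => (t : ℂ) • Λ.ev (v n)) = (t : ℂ) • fun n => Λ.ev (v n) := rfl
  rw [h', congrFun (map_smul (Λ.op (Λ.pot u)) (t : ℂ) fun n => Λ.ev (v n)) n, Pi.smul_apply, Λ.opS_apply, map_sub, ev_op hu, Λ.pert_mulVec, map_add,
    map_smul, map_smul, Λ.ev_Jc, map_add, map_smul, map_smul]
  simp only [od_od, od_ev, smul_zero, zero_add, mulVec_smul,
    smul_sub, smul_add]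
  rw [smul_comm (t : ℂ) (2 : ℂ), smul_smul (t : ℂ) (t : ℂ)⁻¹, mul_inv_cancel₀ (by exact_mod_cast ht), one_smul,
    smul_comm (t : ℂ) s]
  abel

/-! ### Approximate kernel vectors -/

/-- The function `q̇ + t⁻¹ y`, which is annihilated by the operator at `s = 0` along `q`. -/
def Primary.prof (t : ℝ) : ℤ → ι → ℂ := fun n =>
  toC (Λ.dot P.q) n + (t : ℂ)⁻¹ • toC P.y n

lemma Primary.od_prof (t : ℝ) (n : ℤ) :
    Λ.od (P.prof t n) = toC (Λ.dot P.q) n := by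
  rw [prof, map_add, map_smul, P.q_even.od_dot, P.y_even.od_toC, smul_zero, add_zero]

lemma Primary.ev_prof (t : ℝ) (n : ℤ) :
    Λ.ev (P.prof t n) = (t : ℂ)⁻¹ • toC P.y n := by
  rw [prof, map_add, map_smul, P.q_even.ev_dot, P.y_even.ev_toC, zero_add]

lemma Primary.opS_prof (t : ℝ) : Λ.opS P.q t 0 (P.prof t) = 0 := by
  funext n
  have h1 : P.prof t = toC (Λ.dot P.q) + (t : ℂ)⁻¹ • toC P.y := rfl
  rw [Λ.opS_apply, Λ.pert_mulVec, P.od_prof, h1, map_add, map_smul, Λ.op_toC, Λ.op_toC,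
    P.q_sol.opR_dot_eq_zero]
  have h2 : toC (Λ.opR P.q P.y) n = (2 : ℂ) • Λ.Jc.mulVec (toC (Λ.dot P.q) n) := by
    funext i
    have h4 : Λ.Jc.mulVec (toC (Λ.dot P.q) n) i = ((Λ.J.mulVec (Λ.dot P.q n) i : ℝ) : ℂ) :=
      map_mulVec _ _ _
    rw [Pi.smul_apply, h4]
    simp only [toC, congrFun (P.y_eq n) i, Pi.smul_apply, smul_eq_mul]
    push_cast; ring
  rw [Pi.add_apply, Pi.smul_apply, (show toC (0 : ℤ → ι → ℝ) n = 0 by funext i; simp [toC]), h2]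
  simp only [zero_mul, zero_smul, zero_add, mulVec_smul, Pi.zero_apply]
  module

lemma Primary.prof_dec (t : ℝ) :
    ∃ C, 0 < C ∧ ∀ p n : ℤ, ‖P.prof t (n - p)‖ ≤ C * bump θ p n := by
  obtain ⟨D', hD'⟩ := P.dot_q_dec
  have h0 := hD'.nonneg (bump_isWeight P.θ_pos P.θ_lt 0)
  refine ⟨D' + |t|⁻¹ * P.D + 1, by have := P.D_nonneg; positivity, fun p n => ?_⟩
  rw [show bump θ p n = bump θ 0 (n - p) by simp [bump], add_mul, add_mul, mul_assoc]
  refine (norm_add_le_of_le (r₂ := |t|⁻¹ * (P.D * bump θ 0 (n - p))) ((norm_toC _ _).trans_le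
    (hD' _)) ?_).trans (le_add_of_nonneg_right (by have := bump_pos P.θ_pos 0 (n - p); positivity))
  rw [norm_smul, norm_toC, norm_inv, norm_real, norm_eq_abs]
  gcongr
  exact P.y_dec _

/-- A multi-breather: a solution close to the concatenation of copies of the primary breather. -/
structure Primary.IsMulti {κ : Type} [Fintype κ] (C' : ℝ) (L : ℕ) (ρ : ℝ)
    (σ : κ → ℝ) (p : κ → ℤ) (D : ℕ) (u : ℤ → ι → ℝ) : Prop where
  sign : IsSign σ
  inj : Function.Injective p
  sep : Separated p D
  even : Λ.IsEven u
  sol : Λ.IsSol u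
  near : P.IsNear σ p u L ρ
  small : ∃ s : Finset ℤ, ∀ n ∉ s, ‖u n‖ ≤ ρ
  close : WBound (multiBump θ p) (C' * θ ^ D) (u - P.ansatz σ p)

/-- The superposition of the approximate kernel vectors of the copies. -/
def Primary.superpos {κ : Type} [Fintype κ] (t : ℝ) (σ : κ → ℝ)
    (p : κ → ℤ) : (κ → ℂ) →ₗ[ℂ] ℤ → ι → ℂ where
  toFun x n := ∑ i, (x i * σ i) • P.prof t (n - p i)
  map_add' x y := by
    funext n
    simp [add_mul, add_smul, sum_add_distrib]
  map_smul' c x := by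
    funext n
    simp [mul_smul, mul_assoc, smul_sum]

lemma Primary.superpos_apply {κ : Type} [Fintype κ] (t : ℝ) (σ : κ → ℝ)
    (p : κ → ℤ) (x : κ → ℂ) (n : ℤ) :
    P.superpos t σ p x n = ∑ i, (x i * σ i) • P.prof t (n - p i) := rfl

lemma multiBump_pos {κ : Type*} [Fintype κ] [Nonempty κ] (hθ : 0 < θ) (p : κ → ℤ) (n : ℤ) :
    0 < multiBump θ p n := sum_pos (fun i _ => bump_pos hθ (p i) n) univ_nonempty

variable {κ : Type} [Fintype κ] [Nonempty κ]

lemma Primary.IsMulti.norm_le {P : Primary Λ θ} {C' : ℝ} (hC' : 0 ≤ C') {L : ℕ} {ρ : ℝ}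
    {σ : κ → ℝ} {p : κ → ℤ} {D : ℕ} {u : ℤ → ι → ℝ} (h : P.IsMulti C' L ρ σ p D u) (n : ℤ) :
    ‖u n‖ ≤ (C' + P.D) * multiBump θ p n := by
  have h4 := multiBump_pos P.θ_pos p n
  rw [← sub_add_cancel (u n) (P.ansatz σ p n), add_mul]
  exact norm_add_le_of_le ((h.close n).trans (by gcongr; exact mul_le_of_le_one_right hC' (pow_le_one₀ P.θ_pos.le P.θ_lt.le)))
    (P.norm_ansatz_le h.sign p n)

/-- Where one copy is large, the multi-breather is close to this copy. -/
lemma Primary.IsMulti.sub_mul_bump_le {P : Primary Λ θ} {C' : ℝ} (hC' : 0 ≤ C') {L : ℕ} {ρ : ℝ}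
    {σ : κ → ℝ} {p : κ → ℤ} {D : ℕ} {u : ℤ → ι → ℝ} (h : P.IsMulti C' L ρ σ p D u) (n : ℤ) (i : κ) :
    ‖u n - σ i • P.q (n - p i)‖ * bump θ (p i) n ≤ (C' + P.D) * card κ * θ ^ D := by
  classical
  have hθ := P.θ_pos
  have hD := P.D_nonneg
  have hb := bump_pos hθ (p i) n
  have h2 : (∑ j ∈ univ.erase i, bump θ (p j) n) * bump θ (p i) n ≤ card κ * θ ^ D := by
    rw [sum_mul]
    refine (sum_le_card_nsmul _ _ (θ ^ D) fun j hj =>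
      h.sep.bump_mul_le hθ P.θ_lt (ne_of_mem_erase hj) n).trans ?_
    rw [nsmul_eq_mul]
    gcongr
    exact card_le_univ _
  have h3 :=
    mul_le_mul (multiBump_le hθ P.θ_lt p n) (bump_le_one hθ P.θ_lt (p i) n) hb.le (by positivity)
  rw [← sub_add_sub_cancel (u n) (P.ansatz σ p n)]
  calc _ ≤ (C' * θ ^ D * multiBump θ p n
      + P.D * ∑ j ∈ univ.erase i, bump θ (p j) n) * bump θ (p i) n := by
        gcongr
        exact norm_add_le_of_le (h.close n) (P.norm_ansatz_sub_le h.sign p n i)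
    _ = C' * θ ^ D * (multiBump θ p n * bump θ (p i) n)
      + P.D * ((∑ j ∈ univ.erase i, bump θ (p j) n) * bump θ (p i) n) := by ring
    _ ≤ C' * θ ^ D * (card κ * 1) + P.D * (card κ * θ ^ D) := by gcongr
    _ = _ := by ring

lemma op_shift (Λ : Chain ι) (B : ℤ → Matrix ι ι ℂ) (v : ℤ → ι → ℂ) (p n : ℤ) :
    Λ.op (fun n => B (n - p)) (fun n => v (n - p)) n = Λ.op B v (n - p) := by
  funext i
  simp only [op_apply]
  rw [show n + 1 - p = n - p + 1 by ring, show n - 1 - p = n - p - 1 by ring]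

lemma Primary.superpos_eq {κ : Type} [Fintype κ] (t : ℝ) (σ : κ → ℝ)
    (p : κ → ℤ) (x : κ → ℂ) :
    P.superpos t σ p x = ∑ i, (x i * σ i) • fun n => P.prof t (n - p i) := by
  funext n; simp [superpos_apply]

lemma IsSign.norm_coeff_le {κ : Type} [Fintype κ] {σ : κ → ℝ} (hσ : IsSign σ) (x : κ → ℂ) (i : κ) :
    ‖x i * σ i‖ ≤ ‖x‖ := by
  rcases hσ i with h | h <;> simp [h, norm_le_pi_norm]

/-- The superposition almost solves the equation, with an error in the decaying weight. -/
lemma Primary.superpos_residual (κ : Type) [Fintype κ] [Nonempty κ] (t : ℝ)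
    {C' : ℝ} (hC' : 0 ≤ C') :
    ∃ C, 0 < C ∧ ∀ (L : ℕ) (ρ : ℝ) (σ : κ → ℝ) (p : κ → ℤ) (D : ℕ) (u : ℤ → ι → ℝ),
      P.IsMulti C' L ρ σ p D u → ∀ (s : ℂ) (x : κ → ℂ),
      WBound (multiBump θ p) (C * (θ ^ D + ‖s‖) * ‖x‖) (Λ.opS u t s (P.superpos t σ p x)) := by
  have hθ := P.θ_pos
  have hD := P.D_nonneg
  obtain ⟨C₁, hC₁, hprof⟩ := P.prof_dec t
  obtain ⟨C₂, hC₂, hlip⟩ := Λ.A_lip ((C' + P.D) * card κ + P.D)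
  obtain ⟨C₃, hC₃, hpert⟩ := Λ.pert_sub_bound t
  obtain ⟨K₁, hK₁⟩ : ∃ K₁, K₁ = C₂ * (C' + P.D + P.D) * ((C' + P.D) * card κ) := ⟨_, rfl⟩
  have hK₁0 : 0 ≤ K₁ := by rw [hK₁]; positivity
  obtain ⟨K, hK⟩ : ∃ K, K = card ι * K₁ * C₁ + C₃ * C₁ := ⟨_, rfl⟩
  refine ⟨card κ * (K + 1), mul_pos (by exact_mod_cast Fintype.card_pos) (by rw [hK]; positivity),
    fun L ρ σ p D u hu s x n => ?_⟩
  have hmb := multiBump_pos hθ p n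
  have hub : ‖u n‖ ≤ (C' + P.D) * card κ + P.D := (hu.norm_le hC' n).trans
    (le_add_of_le_of_nonneg (by gcongr; exact multiBump_le hθ P.θ_lt p n) hD)
  -- one copy
  have hone : ∀ i, ‖Λ.opS u t s (fun n => P.prof t (n - p i)) n‖
      ≤ (K + 1) * (θ ^ D + ‖s‖) * multiBump θ p n := by
    intro i
    have hb := bump_pos hθ (p i) n
    have hbm := bump_le_multiBump hθ p i n
    have h0 : Λ.op (fun n => Λ.pot P.q (n - p i) + Λ.pert t 0) (fun n => P.prof t (n - p i)) n
        = 0 := by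
      rw [op_shift Λ fun n => Λ.pot P.q n + Λ.pert t 0]
      exact congrFun (P.opS_prof t) (n - p i)
    have hent : ∀ a b, ‖(Λ.pot P.q (n - p i) - Λ.pot u n) a b‖ * bump θ (p i) n
        ≤ K₁ * θ ^ D * multiBump θ p n := by
      intro a b
      have hq : ‖σ i • P.q (n - p i)‖ ≤ P.D * bump θ (p i) n := by
        rw [hu.sign.norm_smul]; exact P.norm_shift_le _ _
      have hq2 : ‖σ i • P.q (n - p i)‖ ≤ (C' + P.D) * card κ + P.D := by
        rw [hu.sign.norm_smul]
        exact (P.norm_q_le _).trans (le_add_of_nonneg_left (by positivity))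
      have hA : Λ.A (σ i • P.q (n - p i)) = Λ.A (P.q (n - p i)) := by
        rcases hu.sign i with h | h <;> simp [h, Λ.A_neg]
      have h2 := hlip _ _ hub hq2 a b
      have h3 := hu.sub_mul_bump_le hC' n i
      have h4 : ‖u n‖ + ‖σ i • P.q (n - p i)‖ ≤ (C' + P.D + P.D) * multiBump θ p n := by
        rw [add_mul _ P.D]
        exact add_le_add (hu.norm_le hC' n) (hq.trans (by gcongr))
      have e : ‖(Λ.pot P.q (n - p i) - Λ.pot u n) a b‖
          = |Λ.A (u n) a b - Λ.A (P.q (n - p i)) a b| := by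
        rw [abs_sub_comm, ← norm_eq_abs, ← norm_real]; simp [pot]
      rw [hA] at h2
      rw [e]
      calc _ ≤ C₂ * (‖u n‖ + ‖σ i • P.q (n - p i)‖) * ‖u n - σ i • P.q (n - p i)‖
            * bump θ (p i) n := by gcongr
        _ = C₂ * (‖u n‖ + ‖σ i • P.q (n - p i)‖) * (‖u n - σ i • P.q (n - p i)‖
            * bump θ (p i) n) := by ring
        _ ≤ C₂ * ((C' + P.D + P.D) * multiBump θ p n) * ((C' + P.D) * card κ * θ ^ D) := by gcongr
        _ = _ := by rw [hK₁]; ring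
    rw [opS, Λ.op_sub_pot _ _ _ n, h0, zero_add, add_sub_add_comm, add_mulVec]
    refine (norm_add_le_of_le ((norm_mulVec_le _ (b := K₁ * θ ^ D * multiBump θ p n
      / bump θ (p i) n) (by positivity) (fun a b => (le_div_iff₀ hb).2 (hent a b)) _).trans
      (mul_le_mul_of_nonneg_left (hprof (p i) n) (by positivity))) ((hpert s _).trans
      (mul_le_mul_of_nonneg_left ((hprof (p i) n).trans (mul_le_mul_of_nonneg_left hbm hC₁.le))
        (by positivity)))).trans ?_
    have a1 : 0 ≤ card ι * K₁ * C₁ * ‖s‖ * multiBump θ p n := by positivity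
    have a2 : 0 ≤ C₃ * C₁ * θ ^ D * multiBump θ p n := by positivity
    calc _ = (card ι * K₁ * C₁ * θ ^ D + C₃ * C₁ * ‖s‖) * multiBump θ p n := by field_simp
      _ ≤ (K * (θ ^ D + ‖s‖)) * multiBump θ p n := by rw [hK]; linarith
      _ ≤ _ := by gcongr; linarith
  rw [P.superpos_eq, map_sum, Finset.sum_apply]
  refine (norm_sum_le_of_le univ fun i _ => ?_ : _ ≤
    ∑ _i : κ, ‖x‖ * ((K + 1) * (θ ^ D + ‖s‖) * multiBump θ p n)).trans_eq ?_
  · rw [map_smul, Pi.smul_apply, norm_smul]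
    exact mul_le_mul (hu.sign.norm_coeff_le x i) (hone i) (norm_nonneg _) (norm_nonneg _)
  · rw [sum_const, nsmul_eq_mul, card_univ]; ring

lemma Primary.superpos_le (κ : Type) [Fintype κ] (t : ℝ) :
    ∃ C, 0 < C ∧ ∀ (σ : κ → ℝ) (p : κ → ℤ), IsSign σ → ∀ x : κ → ℂ,
      WBound (multiBump θ p) (C * ‖x‖) (P.superpos t σ p x) := by
  obtain ⟨C₁, hC₁, hprof⟩ := P.prof_dec t
  refine ⟨C₁, hC₁, fun σ p hσ x n => ?_⟩
  rw [superpos_apply, multiBump, mul_sum]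
  refine norm_sum_le_of_le _ fun i _ => ?_
  rw [norm_smul, mul_comm C₁, mul_assoc]
  exact mul_le_mul (hσ.norm_coeff_le x i) (hprof _ _) (norm_nonneg _) (norm_nonneg _)

lemma Chain.dot_sub (Λ : Chain ι) (u v : ℤ → ι → ℝ) :
    Λ.dot (u - v) = Λ.dot u - Λ.dot v := by
  funext n
  simp [dot, mulVec_sub]

lemma Primary.toC_dot_ansatz (σ : κ → ℝ) (p : κ → ℤ) (n : ℤ) :
    toC (Λ.dot (P.ansatz σ p)) n = ∑ i, (σ i : ℂ) • toC (Λ.dot P.q) (n - p i) := by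
  funext a
  simp only [toC, dot, ansatz, Finset.sum_apply, Pi.smul_apply, smul_eq_mul,
    mulVec_sum, mulVec_smul]
  push_cast
  rfl

lemma Primary.od_superpos (t : ℝ) (σ : κ → ℝ) (p : κ → ℤ) (x : κ → ℂ) (n : ℤ) :
    Λ.od (P.superpos t σ p x n) = ∑ i, (x i * σ i) • toC (Λ.dot P.q) (n - p i) := by
  simp only [superpos_apply, map_sum, map_smul, P.od_prof]

/-! ### The reduction to finitely many amplitudes -/

/-- The component of `u̇` in the direction of the source at the `j`-th reference site. It is the
scale for the `j`-th amplitude, chosen so that `u̇` itself has all amplitudes equal to one. -/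
def Primary.coef {κ : Type} (u : ℤ → ι → ℝ) (p : κ → ℤ) (j : κ) :
    ℂ := P.b ⬝ᵥ toC (Λ.dot u) (p j + P.n₀)

lemma Primary.src_injective {κ : Type*} [Fintype κ] {p : κ → ℤ}
    (hp : Function.Injective p) {ξ η : κ → ℂ} (h : P.src p ξ = P.src p η) : ξ = η := by
  funext j
  have h1 := congrFun h (p j + P.n₀)
  rw [P.src_apply hp, P.src_apply hp] at h1
  exact smul_left_injective ℂ (norm_pos_iff.1 P.b_norm_pos) h1

variable {κ : Type} [Fintype κ] [Nonempty κ]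

lemma norm_dot_le (Λ : Chain ι) :
    ∃ C, 0 < C ∧ ∀ (u : ℤ → ι → ℝ) n, ‖Λ.dot u n‖ ≤ C * ‖u n‖ := by
  obtain ⟨C, hC, h⟩ := norm_mulVec_matrix_le Λ.J
  exact ⟨C, hC, fun u n => h _⟩

lemma Separated.bump_le {κ : Type*} {p : κ → ℤ} {D : ℕ} (h : Separated p D) (hθ : 0 < θ)
    (hθ1 : θ < 1) {i j : κ} (hij : i ≠ j) (k : ℤ) :
    bump θ (p i) (p j + k) ≤ (θ ^ k.natAbs)⁻¹ * θ ^ D := by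
  rw [inv_mul_eq_div, le_div_iff₀ (by positivity)]
  simpa [bump] using h.bump_mul_le hθ hθ1 hij (p j + k)

lemma WBound.isBdd {E : Type*} [SeminormedAddCommGroup E] (hθ : 0 < θ) (hθ1 : θ < 1) {p : κ → ℤ}
    {a : ℝ} {v : ℤ → E} (h : WBound (multiBump θ p) a v) : IsBdd v :=
  ⟨a * card κ, fun n => (h n).trans (mul_le_mul_of_nonneg_left (multiBump_le hθ hθ1 p n)
    (h.nonneg (multiBump_isWeight hθ hθ1 p)))⟩

/-- At the reference sites, the amplitudes of the superposition are almost the prescribed ones. -/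
lemma Primary.superpos_data (κ : Type) [Fintype κ] [Nonempty κ] (t : ℝ)
    {C' : ℝ} (hC' : 0 ≤ C') :
    ∃ C, 0 < C ∧ ∀ (L : ℕ) (ρ : ℝ) (σ : κ → ℝ) (p : κ → ℤ) (D : ℕ) (u : ℤ → ι → ℝ),
      P.IsMulti C' L ρ σ p D u → ∀ (x : κ → ℂ) (j : κ),
      ‖x j * P.coef u p j - P.b ⬝ᵥ P.superpos t σ p x (p j + P.n₀)‖ ≤ C * θ ^ D * ‖x‖ ∧
      ‖P.coef u p j - σ j * (P.b ⬝ᵥ P.b)‖ ≤ C * θ ^ D := by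
  classical
  have hθ := P.θ_pos
  obtain ⟨C₁, hC₁, hprof⟩ := P.prof_dec t
  obtain ⟨C₂, hC₂, hdot⟩ := norm_dot_le Λ
  obtain ⟨w, hw⟩ : ∃ w, w = (θ ^ P.n₀.natAbs)⁻¹ := ⟨_, rfl⟩
  obtain ⟨K₁, hK₁⟩ : ∃ K, K = card ι * (‖P.b‖ * (C₂ * (C' * card κ))) := ⟨_, rfl⟩
  obtain ⟨K₂, hK₂⟩ : ∃ K, K = card ι * (‖P.b‖ * (card κ * (C₁ * w))) := ⟨_, rfl⟩
  have hw0 : 0 < w := by rw [hw]; positivity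
  have hK₁0 : 0 ≤ K₁ := by rw [hK₁]; positivity
  have hK₂0 : 0 ≤ K₂ := by rw [hK₂]; positivity
  refine ⟨K₁ + 2 * K₂ + 1, by positivity, fun L ρ σ p D u hu x j => ?_⟩
  -- `u̇` against the superposition with equal amplitudes
  have e1 : ‖P.coef u p j - P.b ⬝ᵥ P.superpos t σ p 1 (p j + P.n₀)‖ ≤ K₁ * θ ^ D := by
    have e : toC (Λ.dot u) (p j + P.n₀) - toC (Λ.dot (P.ansatz σ p)) (p j + P.n₀)
        = toC (Λ.dot (u - P.ansatz σ p)) (p j + P.n₀) := by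
      rw [Λ.dot_sub]; funext i; simp [toC]
    rw [← P.b_dotProduct_od (P.superpos t σ p 1 _), P.od_superpos, coef,
      ← dotProduct_sub]
    simp only [Pi.one_apply, one_mul, ← P.toC_dot_ansatz, e]
    refine (norm_dotProduct_le _ _).trans ?_
    rw [norm_toC]
    calc _ ≤ card ι * (‖P.b‖ * (C₂ * (C' * θ ^ D * card κ))) := by
          gcongr
          refine (hdot _ _).trans ?_
          gcongr
          exact (hu.close _).trans (by gcongr; exact multiBump_le hθ P.θ_lt p _)
      _ = _ := by rw [hK₁]; ring
  -- the contribution of the other copies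
  have e2 : ∀ y : κ → ℂ, y j = 0 →
      ‖P.b ⬝ᵥ P.superpos t σ p y (p j + P.n₀)‖ ≤ K₂ * θ ^ D * ‖y‖ := by
    intro y hy
    have h1 : ‖P.superpos t σ p y (p j + P.n₀)‖ ≤ ∑ _i : κ, ‖y‖ * (C₁ * (w * θ ^ D)) := by
      refine norm_sum_le_of_le _ fun i _ => ?_
      by_cases hij : i = j
      · rw [hij, hy]; simp; positivity
      · rw [norm_smul, hw]
        exact mul_le_mul (hu.sign.norm_coeff_le y i) ((hprof _ _).trans
          (by gcongr; exact hu.sep.bump_le hθ P.θ_lt hij _)) (norm_nonneg _) (norm_nonneg _)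
    rw [sum_const, nsmul_eq_mul, card_univ] at h1
    refine (norm_dotProduct_le _ _).trans ?_
    calc _ ≤ card ι * (‖P.b‖ * (card κ * (‖y‖ * (C₁ * (w * θ ^ D))))) := by gcongr
      _ = _ := by rw [hK₂]; ring
  constructor
  · rw [show x j * P.coef u p j - P.b ⬝ᵥ P.superpos t σ p x (p j + P.n₀)
        = x j * (P.coef u p j - P.b ⬝ᵥ P.superpos t σ p 1 (p j + P.n₀))
          - P.b ⬝ᵥ P.superpos t σ p (x - x j • 1) (p j + P.n₀) by
      rw [map_sub, map_smul, Pi.sub_apply, Pi.smul_apply, dotProduct_sub, dotProduct_smul,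
        smul_eq_mul]
      ring]
    have h3 : ‖x - x j • (1 : κ → ℂ)‖ ≤ 2 * ‖x‖ :=
      (pi_norm_le_iff_of_nonneg (by positivity)).2 fun i => by
        simpa [two_mul] using norm_sub_le_of_le (norm_le_pi_norm x i) (norm_le_pi_norm x j)
    calc _ ≤ ‖x‖ * (K₁ * θ ^ D) + K₂ * θ ^ D * (2 * ‖x‖) :=
          norm_sub_le_of_le ((norm_mul _ _).trans_le (mul_le_mul (norm_le_pi_norm x j) e1
            (norm_nonneg _) (norm_nonneg _))) ((e2 _ (by simp)).trans (by gcongr))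
      _ = (K₁ + 2 * K₂) * θ ^ D * ‖x‖ := by ring
      _ ≤ _ := by gcongr ?_ * _ * _; linarith
  · have h2 : P.b ⬝ᵥ P.superpos t σ p (Pi.single j 1) (p j + P.n₀) = σ j * (P.b ⬝ᵥ P.b) := by
      rw [P.superpos_apply, sum_eq_single j (fun i _ hi => by simp [hi]) (by simp), Pi.single_eq_same,
        one_mul, add_sub_cancel_left, dotProduct_smul, smul_eq_mul, ← P.b_dotProduct_od, P.od_prof]
      rfl
    rw [show P.coef u p j - σ j * (P.b ⬝ᵥ P.b)
        = (P.coef u p j - P.b ⬝ᵥ P.superpos t σ p 1 (p j + P.n₀))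
          + P.b ⬝ᵥ P.superpos t σ p (1 - Pi.single j 1) (p j + P.n₀) by
      rw [map_sub, Pi.sub_apply, dotProduct_sub, h2]
      ring]
    have h5 : ‖(1 - Pi.single j 1 : κ → ℂ)‖ ≤ 1 := by
      rw [pi_norm_le_iff_of_nonneg zero_le_one]
      intro i
      by_cases hij : i = j
      · subst hij; simp
      · simp [hij]
    calc _ ≤ K₁ * θ ^ D + K₂ * θ ^ D * 1 :=
          norm_add_le_of_le e1 ((e2 _ (by simp)).trans (by gcongr))
      _ = (K₁ + K₂) * θ ^ D := by ring
      _ ≤ _ := by gcongr ?_ * _; linarith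

/-- The solution operator of the bordered problem with prescribed amplitudes: `V x` is the solution
with amplitudes `x`, and `Ξ x` is the vector of multipliers. -/
structure Primary.IsReduction (C t : ℝ) (s : ℂ) (σ : κ → ℝ) (p : κ → ℤ) (D : ℕ)
    (u : ℤ → ι → ℝ) (V : (κ → ℂ) →ₗ[ℂ] ℤ → ι → ℂ) (Ξ : (κ → ℂ) →ₗ[ℂ] κ → ℂ) : Prop where
  eq : ∀ x, Λ.opS u t s (V x) = P.src p (Ξ x)
  data : ∀ x j, P.b ⬝ᵥ V x (p j + P.n₀) = x j * P.coef u p j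
  bound : ∀ x, WBound (multiBump θ p) (C * ‖x‖) (V x)
  approx : ∀ x, WBound (multiBump θ p) (C * (θ ^ D + ‖s‖) * ‖x‖) (V x - P.superpos t σ p x)
  unique : ∀ x v ξ, IsBdd v → Λ.opS u t s v = P.src p ξ →
    (∀ j, P.b ⬝ᵥ v (p j + P.n₀) = x j * P.coef u p j) → v = V x ∧ ξ = Ξ x

lemma Primary.Solvable.exists_reduction {P : Primary Λ θ} {C₀ ρ β : ℝ} {L : ℕ}
    (hS : P.Solvable C₀ L ρ β) (hC₀ : 0 < C₀) (κ : Type) [Fintype κ] [Nonempty κ] {t δ : ℝ}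
    (hδ : 0 < δ) (ht : ∀ s : ℂ, ‖s‖ ≤ δ → ∀ i j, ‖Λ.pert t s i j‖ ≤ β) {C' : ℝ} (hC' : 0 ≤ C') :
    ∃ C, 0 < C ∧ ∀ (σ : κ → ℝ) (p : κ → ℤ) (D : ℕ) (u : ℤ → ι → ℝ), P.IsMulti C' L ρ σ p D u →
      ∀ s : ℂ, ‖s‖ ≤ δ → ∃ V Ξ, P.IsReduction C t s σ p D u V Ξ := by
  have hθ := P.θ_pos
  have hθ1 := P.θ_lt
  obtain ⟨C₁, hC₁, hres⟩ := P.superpos_residual κ t hC'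
  obtain ⟨C₂, hC₂, hdata⟩ := P.superpos_data κ t hC'
  obtain ⟨C₃, hC₃, hsup⟩ := P.superpos_le κ t
  obtain ⟨w, hw⟩ : ∃ w, w = (θ ^ P.n₀.natAbs)⁻¹ := ⟨_, rfl⟩
  have hw0 : 0 < w := by rw [hw]; positivity
  obtain ⟨K, hK⟩ : ∃ K, K = C₀ * (C₁ + C₂ * w) := ⟨_, rfl⟩
  have hK0 : 0 < K := by rw [hK]; positivity
  refine ⟨K * (2 + δ) + C₃, by positivity, fun σ p D u hu s hs => ?_⟩
  obtain ⟨hap, hsolv⟩ := hS κ σ p u (fun n => Λ.pot u n + Λ.pert t s) hu.sign hu.near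
    fun n i j => by rw [add_sub_cancel_left]; exact ht s hs i j
  have hop : ∀ v, Λ.op (fun n => Λ.pot u n + Λ.pert t s) v = Λ.opS u t s v := fun _ => rfl
  simp only [hop] at hap hsolv
  have h1w := IsWeight.one hθ1.le
  have hϱ := multiBump_isWeight hθ hθ1 p
  choose V Ξ hVb hV hVd using fun x : κ → ℂ => hsolv hu.inj hu.small 0 ⟨0, fun n => by simp⟩
    (fun j => x j * P.coef u p j)
  simp only [zero_add] at hV
  have hsub : ∀ (v v' : ℤ → ι → ℂ) (ξ ξ' : κ → ℂ), IsBdd v →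
      IsBdd v' → Λ.opS u t s v = P.src p ξ → Λ.opS u t s v' = P.src p ξ' →
      (∀ j, P.b ⬝ᵥ v (p j + P.n₀) = P.b ⬝ᵥ v' (p j + P.n₀)) → v = v' ∧ ξ = ξ' := by
    intro v v' ξ ξ' hv hv' h1 h2 h3
    have h4 := hap _ h1w (v - v') (ξ - ξ') 0 (by simpa [WBound, IsBdd] using hv.sub hv')
      (fun n => by rw [map_sub, map_sub, h1, h2]; simp)
      (fun j => by rw [Pi.sub_apply, dotProduct_sub, h3]; simp)
    have h5 : v = v' := sub_eq_zero.1 (funext fun n => by simpa using h4 n)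
    exact ⟨h5, P.src_injective hu.inj (by rw [← h1, ← h2, h5])⟩
  have hadd := fun x y => hsub _ (V x + V y) _ (Ξ x + Ξ y) (hVb (x + y)) ((hVb x).add (hVb y)) (hV _)
    (by rw [map_add, hV, hV, map_add]) fun j => by simp [hVd, dotProduct_add, add_mul]
  have hsmul := fun (c : ℂ) x => hsub _ (c • V x) _ (c • Ξ x) (hVb (c • x)) ((hVb x).smul c) (hV _)
    (by rw [map_smul, hV, map_smul]) fun j => by simp [hVd, dotProduct_smul, mul_assoc]
  have happ : ∀ x, WBound (multiBump θ p) (K * (θ ^ D + ‖s‖) * ‖x‖)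
      (V x - P.superpos t σ p x) := by
    intro x
    refine WBound.of_max hϱ.pos fun k => ?_
    have hwk : IsWeight θ (fun n => max (multiBump θ p n) (1 / ((k : ℝ) + 1) * 1)) :=
      hϱ.max (h1w.const_mul (by positivity)) hθ
    refine (hap _ hwk (V x - P.superpos t σ p x) (Ξ x) ((C₁ + C₂ * w) * (θ ^ D + ‖s‖) * ‖x‖)
      (((hVb x).sub ((hsup σ p hu.sign x).isBdd hθ hθ1)).wbound_max _ k) (fun n => ?_)
      fun j => ?_).mono hwk (le_of_eq (by rw [hK]; ring))
    · rw [map_sub, hV, sub_sub_cancel_left, Pi.neg_apply, norm_neg]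
      refine (hres L ρ σ p D u hu s x n).trans ?_
      have := (hϱ.pos n).le
      gcongr
      exacts [le_add_of_nonneg_right (by positivity), le_max_left _ _]
    · rw [Pi.sub_apply, dotProduct_sub, hVd]
      refine (hdata L ρ σ p D u hu x j).1.trans ?_
      have h4 : 1 ≤ w * max (multiBump θ p (p j + P.n₀)) (1 / ((k : ℝ) + 1) * 1) := by
        rw [hw, inv_mul_eq_div, one_le_div (by positivity)]
        exact le_max_of_le_left (by simpa [bump] using bump_le_multiBump hθ p j (p j + P.n₀))
      calc _ = C₂ * (θ ^ D + 0) * ‖x‖ * 1 := by ring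
        _ ≤ C₂ * (θ ^ D + ‖s‖) * ‖x‖
            * (w * max (multiBump θ p (p j + P.n₀)) (1 / ((k : ℝ) + 1) * 1)) := by
          gcongr
          exact norm_nonneg s
        _ = C₂ * w * (θ ^ D + ‖s‖) * ‖x‖
            * max (multiBump θ p (p j + P.n₀)) (1 / ((k : ℝ) + 1) * 1) := by ring
        _ ≤ _ := by gcongr; exact le_add_of_nonneg_left hC₁.le
  refine ⟨⟨⟨V, fun x y => (hadd x y).1⟩, fun c x => (hsmul c x).1⟩,
    ⟨⟨Ξ, fun x y => (hadd x y).2⟩, fun c x => (hsmul c x).2⟩, hV, hVd, fun x n => ?_,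
    fun x => (happ x).mono hϱ ?_, fun x v ξ hv h1 h2 =>
    hsub v (V x) ξ (Ξ x) hv (hVb x) h1 (hV x) fun j => by rw [h2, hVd]⟩
  · have h3 := (hϱ.pos n).le
    have h4 : θ ^ D ≤ 1 := pow_le_one₀ hθ.le hθ1.le
    have h5 := norm_add_le_of_le (happ x n) (hsup σ p hu.sign x n)
    rw [Pi.sub_apply, sub_add_cancel] at h5
    refine h5.trans ?_
    rw [← add_mul, ← add_mul]
    gcongr
    linarith
  · gcongr
    nlinarith

section Reduction

variable {P : Primary Λ θ} {C t : ℝ} {s : ℂ} {σ : κ → ℝ} {p : κ → ℤ} {D : ℕ} {u : ℤ → ι → ℝ}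
  {V : (κ → ℂ) →ₗ[ℂ] ℤ → ι → ℂ} {Ξ : (κ → ℂ) →ₗ[ℂ] κ → ℂ}

lemma Primary.IsReduction.bounded (h : P.IsReduction C t s σ p D u V Ξ) (x : κ → ℂ) :
    IsBdd (V x) := (h.bound x).isBdd P.θ_pos P.θ_lt

/-- The reduced matrix: its kernel describes the bounded solutions of the eigenvalue problem. -/
def Primary.reduced (u : ℤ → ι → ℝ) (p : κ → ℤ)
    (Ξ : (κ → ℂ) →ₗ[ℂ] κ → ℂ) [DecidableEq κ] : Matrix κ κ ℂ :=
  diagonal (P.coef u p) * LinearMap.toMatrix' Ξ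

lemma Primary.mulVec_reduced [DecidableEq κ] (x : κ → ℂ) :
    (P.reduced u p Ξ).mulVec x = fun i => P.coef u p i * Ξ x i := by
  funext i
  rw [reduced, ← mulVec_mulVec, LinearMap.toMatrix'_mulVec, mulVec_diagonal]

/-- The bounded solutions of the quadratic eigenvalue problem. -/
def Chain.modes (Λ : Chain ι) (u : ℤ → ι → ℝ) (lam : ℂ) :
    Submodule ℂ (ℤ → ι → ℂ) where
  carrier := {w | IsBdd w ∧
    ∀ n, Λ.op (Λ.pot u) w n = (2 * lam) • Λ.Jc.mulVec (w n) + lam ^ 2 • w n}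
  add_mem' := fun ⟨h1, h2⟩ ⟨h3, h4⟩ => ⟨h1.add h3, fun n => by
    rw [map_add, Pi.add_apply, h2, h4, Pi.add_apply, mulVec_add]
    module⟩
  zero_mem' := ⟨⟨0, fun n => by simp⟩, fun n => by simp⟩
  smul_mem' c w := fun ⟨h1, h2⟩ => ⟨h1.smul c, fun n => by
    rw [map_smul, Pi.smul_apply, h2, Pi.smul_apply, mulVec_smul]
    module⟩

lemma IsBdd.ev {v : ℤ → ι → ℂ} : IsBdd v → IsBdd fun n => Λ.ev (v n) := fun ⟨K, h⟩ =>
  ⟨K, fun n => (Λ.norm_ev_le _).trans (h n)⟩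

lemma IsBdd.od {v : ℤ → ι → ℂ} : IsBdd v → IsBdd fun n => Λ.od (v n) := fun ⟨K, h⟩ =>
  ⟨K, fun n => (Λ.norm_od_le _).trans (h n)⟩

/-- A bounded solution of the eigenvalue problem is recovered from its amplitudes. -/
lemma Primary.IsReduction.of_mode {lam : ℂ} (hs : s = lam ^ 2)
    (h : P.IsReduction C t s σ p D u V Ξ) (ht : t ≠ 0) (hu : Λ.IsEven u) (heven : Λ.EvenBij u)
    (w : ℤ → ι → ℂ) (hw : w ∈ Λ.modes u lam) (x : κ → ℂ)
    (hx : ∀ j, P.b ⬝ᵥ w (p j + P.n₀) = x j * P.coef u p j) :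
    Ξ x = 0 ∧ ∀ n, w n = Λ.od (V x n) + (lam * t) • Λ.ev (V x n) := by
  have ht' : (t : ℂ) ≠ 0 := by exact_mod_cast ht
  obtain ⟨hwb, hweq⟩ := hw
  have hwe : Λ.op (Λ.pot u) (fun n => Λ.ev (w n))
      = fun n => (2 * lam) • Λ.Jc.mulVec (Λ.od (w n)) + lam ^ 2 • Λ.ev (w n) := funext fun n => by
    rw [← ev_op hu, hweq, map_add, map_smul, map_smul, Λ.ev_Jc]
  -- a solution `w` gives a solution `v` of the bordered problem with the same odd part
  obtain ⟨z, hzb, hze, hwz, hzeq⟩ : ∃ z : ℤ → ι → ℂ, IsBdd z ∧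
      (∀ n, Λ.ev (z n) = z n) ∧ (∀ n, Λ.ev (w n) = lam • z n) ∧
      (∀ n, Λ.op (Λ.pot u) z n = s • z n + (2 : ℂ) • Λ.Jc.mulVec (Λ.od (w n))) := by
    by_cases hl : lam = 0
    · obtain ⟨CJ, hCJ, -, hJ⟩ := Λ.norm_Jc_le
      obtain ⟨K, hK⟩ := hwb.od (Λ := Λ)
      obtain ⟨z, h1, h2, h3⟩ := heven.1 ((2 : ℂ) • fun n => Λ.Jc.mulVec (Λ.od (w n)))
        (IsBdd.smul _ ⟨CJ * K, fun n => (hJ _).trans (by gcongr; exact hK n)⟩)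
        (fun n => by rw [Pi.smul_apply, map_smul, Λ.ev_Jc, Λ.od_od])
      refine ⟨z, h1, h2, fun n => ?_, fun n => ?_⟩
      · rw [hl, zero_smul]
        exact congrFun (heven.2 _ hwb.ev (fun n => Λ.ev_ev _) (by rw [hwe, hl]; funext n; simp)) n
      · rw [h3, hs, hl]; simp
    · refine ⟨lam⁻¹ • fun n => Λ.ev (w n), hwb.ev.smul _, fun n => by simp, fun n => ?_, fun n => ?_⟩
      · rw [Pi.smul_apply, smul_smul, mul_inv_cancel₀ hl, one_smul]
      · rw [map_smul, hwe, hs]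
        simp only [Pi.smul_apply, smul_add, smul_smul]
        rw [show lam⁻¹ * (2 * lam) = 2 by field_simp, mul_comm (lam ^ 2), add_comm]
  set v : ℤ → ι → ℂ := (fun n => Λ.od (w n)) + (t : ℂ)⁻¹ • z with hv
  have hvo : ∀ n, Λ.od (v n) = Λ.od (w n) := fun n => by
    rw [hv, Pi.add_apply, Pi.smul_apply, ← hze n]; simp
  have hve : ∀ n, (t : ℂ) • Λ.ev (v n) = z n := fun n => by
    simp [hv, hze, smul_smul, ht']
  have hopv : Λ.opS u t s v = P.src p 0 := by
    rw [map_zero]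
    funext n
    have h1 : Λ.od (Λ.opS u t s v n) = 0 := by
      rw [od_opS hu]
      simp only [hvo, hve]
      rw [← od_op hu, hweq, map_add, map_smul, map_smul, Λ.od_Jc, hwz, mulVec_smul, hs]
      module
    have h3 := ev_opS hu ht s v n
    simp only [hvo, hve] at h3
    rw [hzeq, add_sub_cancel_left, sub_self, smul_eq_zero_iff_right ht'] at h3
    rw [← Λ.ev_add_od (Λ.opS u t s v n), h1, h3, add_zero, Pi.zero_apply]
  obtain ⟨h1, h2⟩ := h.unique x v 0 (hwb.od.add (hzb.smul _)) hopv
    (fun j => by rw [← P.b_dotProduct_od, hvo, P.b_dotProduct_od, hx])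
  refine ⟨h2.symm, fun n => ?_⟩
  rw [← h1, hvo, mul_smul, hve, ← hwz]
  exact (Λ.ev_add_od (w n)).symm.trans (add_comm _ _)

/-- The bounded solutions of the eigenvalue problem at `lam` correspond to the kernel of the reduced
matrix at `s = lam²`. -/
lemma Primary.IsReduction.modes_equiv [DecidableEq κ] {lam : ℂ} (hs : s = lam ^ 2)
    (h : P.IsReduction C t s σ p D u V Ξ) (ht : t ≠ 0) (hu : Λ.IsEven u)
    (hc : ∀ j, P.coef u p j ≠ 0) (heven : Λ.EvenBij u) :
    Nonempty (Λ.modes u lam ≃ₗ[ℂ] LinearMap.ker (P.reduced u p Ξ).mulVecLin) := by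
  have hwV := h.of_mode hs ht hu heven
  let E : Λ.modes u lam →ₗ[ℂ] κ → ℂ :=
    { toFun := fun w j => (P.coef u p j)⁻¹ * (P.b ⬝ᵥ w.1 (p j + P.n₀))
      map_add' := fun v w => funext fun j => by simp [dotProduct_add, mul_add]
      map_smul' := fun c w => funext fun j => by simp [dotProduct_smul, mul_left_comm] }
  have hE : ∀ (w : Λ.modes u lam) j, P.b ⬝ᵥ w.1 (p j + P.n₀) = E w j * P.coef u p j := fun w j => by
    change _ = (P.coef u p j)⁻¹ * _ * _
    field_simp [hc j]
  have hinj : Function.Injective E := by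
    rw [← LinearMap.ker_eq_bot, LinearMap.ker_eq_bot']
    intro w hw
    refine Subtype.ext (funext fun n => ?_)
    rw [(hwV w.1 w.2 (E w) (hE w)).2, hw]
    simp
  have hrange : LinearMap.range E = LinearMap.ker (P.reduced u p Ξ).mulVecLin := by
    ext x
    rw [LinearMap.mem_range, LinearMap.mem_ker, mulVecLin_apply, mulVec_reduced]
    constructor
    · rintro ⟨w, rfl⟩
      rw [(hwV w.1 w.2 (E w) (hE w)).1]; funext j; simp
    · intro hx
      have hop : Λ.opS u t s (V x) = 0 := by rw [h.eq, (funext fun j => (mul_eq_zero.1 (congrFun hx j)).resolve_left (hc j) : Ξ x = 0), map_zero]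
      have hwm : (fun n => Λ.od (V x n)) + lam • (fun n => (t : ℂ) • Λ.ev (V x n))
          ∈ Λ.modes u lam := by
        refine ⟨(h.bounded x).od.add (((h.bounded x).ev.smul _).smul _), fun n => ?_⟩
        have h1 := od_opS hu t s (V x) n
        have h2 := ev_opS hu ht s (V x) n
        rw [hop, Pi.zero_apply, map_zero] at h1 h2
        rw [smul_zero] at h2
        rw [map_add, map_smul, Pi.add_apply, Pi.smul_apply, sub_eq_iff_eq_add.1 (sub_eq_iff_eq_add.1 h1.symm), sub_eq_iff_eq_add.1 (sub_eq_iff_eq_add.1 h2.symm)]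
        simp only [Pi.add_apply, Pi.smul_apply, mulVec_add, mulVec_smul, hs]
        module
      refine ⟨⟨_, hwm⟩, funext fun j => ?_⟩
      change (P.coef u p j)⁻¹ * (P.b ⬝ᵥ (Λ.od (V x _) + lam • (t : ℂ) • Λ.ev (V x _))) = x j
      rw [dotProduct_add, dotProduct_smul, dotProduct_smul, P.b_dotProduct_ev, P.b_dotProduct_od,
        h.data]
      field_simp [hc j]
      simp
  exact ⟨(LinearEquiv.ofInjective E hinj).trans (LinearEquiv.ofEq _ _ hrange)⟩

end Reduction

variable (P : Primary Λ θ)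

/-! ### Symmetry of the reduced matrix and its dependence on the spectral parameter -/

variable (Λ)

/-- The bilinear form that gives the derivative of the reduced matrix in the spectral parameter. -/
def Chain.form (t : ℝ) (s : ℂ) : (ι → ℂ) →ₗ[ℂ] (ι → ℂ) →ₗ[ℂ] ℂ :=
  LinearMap.mk₂ ℂ (fun a b => Λ.od a ⬝ᵥ Λ.od b + 2 * t * (Λ.od b ⬝ᵥ Λ.Jc.mulVec (Λ.ev a))
      - s * t ^ 2 * (Λ.ev a ⬝ᵥ Λ.ev b))
    (fun a a' b => by simp only [map_add, mulVec_add, add_dotProduct, dotProduct_add]; ring)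
    (fun c a b => by
      simp only [map_smul, mulVec_smul, smul_dotProduct, dotProduct_smul, smul_eq_mul]; ring)
    (fun a b b' => by simp only [map_add, add_dotProduct, dotProduct_add]; ring)
    (fun c a b => by simp only [map_smul, smul_dotProduct, dotProduct_smul, smul_eq_mul]; ring)

lemma Chain.form_apply (t : ℝ) (s : ℂ) (a b : ι → ℂ) :
    Λ.form t s a b = Λ.od a ⬝ᵥ Λ.od b + 2 * t * (Λ.od b ⬝ᵥ Λ.Jc.mulVec (Λ.ev a))
      - s * t ^ 2 * (Λ.ev a ⬝ᵥ Λ.ev b) := rfl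

lemma Chain.form_bound (t : ℝ) :
    ∃ C, 0 < C ∧ ∀ a b : ι → ℂ, ‖Λ.form t 0 a b‖ ≤ C * ‖a‖ * ‖b‖ ∧
      ∀ s, ‖Λ.form t s a b - Λ.form t 0 a b‖ ≤ C * ‖s‖ * ‖a‖ * ‖b‖ := by
  obtain ⟨CJ, hCJ, -, hJ⟩ := Λ.norm_Jc_le
  have hk : (0 : ℝ) ≤ card ι := Nat.cast_nonneg _
  have ho : ∀ x : ι → ℂ, ‖Λ.od x‖ ≤ ‖x‖ := Λ.norm_od_le
  have he : ∀ x : ι → ℂ, ‖Λ.ev x‖ ≤ ‖x‖ := Λ.norm_ev_le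
  refine ⟨card ι * (1 + 2 * |t| * CJ + t ^ 2) + 1, by positivity, fun a b => ⟨?_, fun s => ?_⟩⟩
  · calc _ ≤ card ι * (‖a‖ * ‖b‖) + 2 * |t| * (card ι * (‖b‖ * (CJ * ‖a‖))) := by
          rw [form_apply, zero_mul, zero_mul, sub_zero]
          refine norm_add_le_of_le ((norm_dotProduct_le _ _).trans (by gcongr <;> apply ho)) ?_
          rw [norm_mul, norm_mul, Complex.norm_ofNat, norm_real, norm_eq_abs]
          gcongr
          exact (norm_dotProduct_le _ _).trans
            (by gcongr; exacts [ho _, (hJ _).trans (by gcongr; apply he)])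
      _ = card ι * (1 + 2 * |t| * CJ) * ‖a‖ * ‖b‖ := by ring
      _ ≤ _ := by gcongr ?_ * _ * _; nlinarith [mul_nonneg hk (sq_nonneg t)]
  · rw [form_apply, form_apply, zero_mul, zero_mul, sub_zero, sub_sub_cancel_left, norm_neg,
      norm_mul, norm_mul, norm_pow, norm_real, norm_eq_abs, sq_abs]
    calc _ ≤ ‖s‖ * t ^ 2 * (card ι * (‖a‖ * ‖b‖)) := by
          gcongr
          exact (norm_dotProduct_le _ _).trans (by gcongr <;> apply he)
      _ = card ι * t ^ 2 * ‖s‖ * ‖a‖ * ‖b‖ := by ring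
      _ ≤ _ := by
          gcongr ?_ * _ * _ * _
          nlinarith [mul_nonneg hk (mul_nonneg (abs_nonneg t) hCJ.le)]

variable {Λ}

lemma summable_sq_of_le {E F : Type*} [SeminormedAddCommGroup E] [SeminormedAddCommGroup F]
    {f : ℤ → E} {g : ℤ → F} {c : ℝ} (hg : Summable fun n => ‖g n‖ ^ 2)
    (h : ∀ n, ‖f n‖ ≤ c * ‖g n‖) : Summable fun n => ‖f n‖ ^ 2 :=
  (hg.mul_left (c ^ 2)).of_nonneg_of_le (fun _ => sq_nonneg _) fun n =>
    (pow_le_pow_left₀ (norm_nonneg _) (h n) 2).trans_eq (mul_pow _ _ 2)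

lemma WBound.summable_multi (hθ : 0 < θ) (hθ1 : θ < 1) {κ : Type} [Fintype κ] {p : κ → ℤ} {a : ℝ}
    {v : ℤ → ι → ℂ} (h : WBound (multiBump θ p) a v) : Summable fun n => ‖v n‖ ^ 2 := by
  refine ((summable_sum fun i (_ : i ∈ univ) => summable_bump_sq hθ hθ1 (p i)).mul_left
    (a ^ 2 * card κ)).of_nonneg_of_le (fun _ => sq_nonneg _) fun n => ?_
  calc ‖v n‖ ^ 2 ≤ (a * multiBump θ p n) ^ 2 := pow_le_pow_left₀ (norm_nonneg _) (h n) 2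
    _ = a ^ 2 * multiBump θ p n ^ 2 := mul_pow _ _ _
    _ ≤ a ^ 2 * (card κ * ∑ i, bump θ (p i) n ^ 2) := by gcongr; exact sq_sum_le_card_mul_sum_sq
    _ = _ := by ring

lemma Primary.hasSum_src {κ : Type*} [Fintype κ] (p : κ → ℤ) (ξ : κ → ℂ)
    (v : ℤ → ι → ℂ) :
    HasSum (fun n => v n ⬝ᵥ P.src p ξ n) (∑ j, ξ j * (P.b ⬝ᵥ v (p j + P.n₀))) := by
  have h : (fun n => v n ⬝ᵥ P.src p ξ n)
      = fun n => ∑ j, if n = p j + P.n₀ then ξ j * (P.b ⬝ᵥ v (p j + P.n₀)) else 0 := by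
    funext n
    rw [src_def, dotProduct_sum]
    refine sum_congr rfl fun j _ => ?_
    split_ifs with hn
    · rw [dotProduct_smul, smul_eq_mul, hn, dotProduct_comm]
    · simp
  rw [h]
  exact hasSum_sum fun j _ => hasSum_ite_eq _ _

lemma Primary.od_src {κ : Type*} [Fintype κ] (p : κ → ℤ) (ξ : κ → ℂ) (n : ℤ) :
    Λ.od (P.src p ξ n) = P.src p ξ n := by
  simp [od, P.ev_src]

variable {κ : Type} [Fintype κ] [Nonempty κ]

/-- The reduced matrices at two values of the spectral parameter are compared by testing the
equation for one solution with the other. -/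
lemma Primary.IsReduction.cross {P : Primary Λ θ} {C t R : ℝ} {s s' : ℂ} {σ : κ → ℝ} {p : κ → ℤ}
    {D : ℕ} {u : ℤ → ι → ℝ} {V V' : (κ → ℂ) →ₗ[ℂ] ℤ → ι → ℂ} {Ξ Ξ' : (κ → ℂ) →ₗ[ℂ] κ → ℂ}
    (h : P.IsReduction C t s σ p D u V Ξ) (h' : P.IsReduction C t s' σ p D u V' Ξ') (ht : t ≠ 0)
    (hu : Λ.IsEven u) (huR : ∀ n, ‖u n‖ ≤ R) (x x' : κ → ℂ) :
    Summable (fun n => Λ.form t s' (V x n) (V' x' n)) ∧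
    ∑ j, P.coef u p j * Ξ x j * x' j - ∑ j, P.coef u p j * Ξ' x' j * x j
      = -(s - s') * ∑' n, Λ.form t s' (V x n) (V' x' n) := by
  obtain ⟨Cb, hCb, hpot⟩ := pot_bound Λ R
  have hpb := hpot u huR
  have hps := pot_transpose Λ u
  set Lu := Λ.op (Λ.pot u) with hLu
  -- the odd and the even part of one solution
  have hpart : ∀ {s : ℂ} {V : (κ → ℂ) →ₗ[ℂ] ℤ → ι → ℂ} {Ξ : (κ → ℂ) →ₗ[ℂ] κ → ℂ},
      P.IsReduction C t s σ p D u V Ξ → ∀ x, ∃ w z : ℤ → ι → ℂ,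
      (w = fun n => Λ.od (V x n)) ∧ (z = fun n => (t : ℂ) • Λ.ev (V x n)) ∧
      (Summable fun n => ‖w n‖ ^ 2) ∧ (Summable fun n => ‖z n‖ ^ 2) ∧
      (∀ n, P.src p (Ξ x) n = Lu w n - s • w n - (2 * s) • Λ.Jc.mulVec (z n)) ∧
      (∀ n y, (Lu z n - s • z n) ⬝ᵥ y = -(2 * (w n ⬝ᵥ Λ.Jc.mulVec y))) ∧
      ∀ j, P.b ⬝ᵥ w (p j + P.n₀) = x j * P.coef u p j := fun {s V Ξ} h x => by
    have h1 := (h.bound x).summable_multi P.θ_pos P.θ_lt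
    refine ⟨_, _, rfl, rfl, summable_sq_of_le (c := 1) h1 fun n => by
      rw [one_mul]; exact Λ.norm_od_le _, summable_sq_of_le (c := ‖(t : ℂ)‖) h1 fun n => by
      rw [norm_smul]; gcongr; exact Λ.norm_ev_le _, fun n => by
      rw [← P.od_src, ← h.eq x, od_opS hu], fun n y => ?_, fun j => by
      rw [P.b_dotProduct_od, h.data]⟩
    have h2 := ev_opS hu ht s (V x) n
    rw [h.eq x, P.ev_src, smul_zero] at h2
    rw [sub_eq_zero.1 h2.symm, smul_dotProduct, Λ.dotProduct_Jc, smul_eq_mul]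
    ring
  obtain ⟨wo, z, hwo, hz, ho, he, e1, a1, b1⟩ := hpart h x
  obtain ⟨wo', z', hwo', hz', ho', he', e1', a2, b2⟩ := hpart h' x'
  have hform : ∀ n, Λ.form t s' (V x n) (V' x' n)
      = wo n ⬝ᵥ wo' n + 2 * (wo' n ⬝ᵥ Λ.Jc.mulVec (z n)) - s' * (z n ⬝ᵥ z' n) := fun n => by
    simp only [form_apply, hwo, hwo', hz, hz', mulVec_smul, dotProduct_smul,
      smul_dotProduct, smul_eq_mul]
    ring
  obtain ⟨CJ, hCJ, -, hJ⟩ := Λ.norm_Jc_le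
  have s1 := summable_dotProduct (Λ.summable_op hpb ho) ho'
  have s2 := summable_dotProduct ho (Λ.summable_op hpb ho')
  have s3 := summable_dotProduct (Λ.summable_op hpb he') he
  have s4 := summable_dotProduct he' (Λ.summable_op hpb he)
  have sF : Summable fun n => Λ.form t s' (V x n) (V' x' n) := by
    simp only [hform]
    exact ((summable_dotProduct ho ho').add ((summable_dotProduct ho' (summable_sq_of_le he
      fun n => hJ (z n))).mul_left 2)).sub ((summable_dotProduct he he').mul_left s')
  refine ⟨sF, ?_⟩
  have key : ∀ n, wo' n ⬝ᵥ P.src p (Ξ x) n - wo n ⬝ᵥ P.src p (Ξ' x') n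
      = (Lu wo n ⬝ᵥ wo' n - wo n ⬝ᵥ Lu wo' n) + s' * (Lu z' n ⬝ᵥ z n - z' n ⬝ᵥ Lu z n)
        - (s - s') * Λ.form t s' (V x n) (V' x' n) := by
    intro n
    rw [hform, e1, e1']
    have a1 := a1 n (z' n)
    have a2 := a2 n (z n)
    simp only [sub_dotProduct, smul_dotProduct, smul_eq_mul] at a1 a2
    simp only [dotProduct_sub, dotProduct_smul, smul_eq_mul]
    rw [dotProduct_comm (wo' n) (Lu wo n), dotProduct_comm (wo' n) (wo n),
      dotProduct_comm (z' n) (Lu z n)]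
    rw [dotProduct_comm (z' n) (z n)] at a2
    linear_combination s' * a1 - s' * a2
  have t3 := ((P.hasSum_src p (Ξ x) wo').sub (P.hasSum_src p (Ξ' x') wo)).tsum_eq
  simp only [key] at t3
  rw [((s1.sub s2).add ((s3.sub s4).mul_left s')).tsum_sub (sF.mul_left (s - s')),
    (s1.sub s2).tsum_add ((s3.sub s4).mul_left s'), s1.tsum_sub s2, tsum_mul_left,
    s3.tsum_sub s4, tsum_mul_left, Λ.green hps hpb ho ho', Λ.green hps hpb he' he, sub_self,
    sub_self, mul_zero, add_zero, zero_sub] at t3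
  simp only [b1, b2] at t3
  rw [neg_mul, t3]
  congr 1 <;> exact sum_congr rfl fun j _ => by ring

/-- The constant `Σ ⟨q̇, q̇⟩ + 2 ⟨q̇, ẏ⟩`. -/
def Primary.mass : ℝ :=
  ∑' n, (Λ.dot P.q n ⬝ᵥ Λ.dot P.q n + 2 * (Λ.dot P.q n ⬝ᵥ Λ.dot P.y n))

lemma Primary.form_prof {t : ℝ} (ht : t ≠ 0) (n : ℤ) :
    Λ.form t 0 (P.prof t n) (P.prof t n)
      = ((Λ.dot P.q n ⬝ᵥ Λ.dot P.q n + 2 * (Λ.dot P.q n ⬝ᵥ Λ.dot P.y n) : ℝ) : ℂ) := by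
  have ht' : (t : ℂ) ≠ 0 := by exact_mod_cast ht
  have hd : ∀ a b : ℤ → ι → ℝ, toC a n ⬝ᵥ toC b n = ((a n ⬝ᵥ b n : ℝ) : ℂ) := fun a b => by
    simp [toC, dotProduct]
  simp only [form_apply, P.od_prof, P.ev_prof, mulVec_smul, ← toC_dot,
    dotProduct_smul, hd, smul_eq_mul, zero_mul, sub_zero]
  push_cast
  field_simp

lemma bump_pow_eight (φ : ℝ) (p n : ℤ) : bump (φ ^ 8) p n = bump φ p n ^ 8 := by
  unfold bump; rw [← pow_mul, ← pow_mul, mul_comm]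

/-- The approximate value of the bilinear form on the solutions of the bordered problem. -/
lemma Primary.form_approx {φ : ℝ} (hφ : 0 < φ) (hφ1 : φ < 1) (P : Primary Λ (φ ^ 8)) (κ : Type)
    [Fintype κ] [Nonempty κ] {t : ℝ} (ht : t ≠ 0) {C : ℝ} (hC : 0 < C) :
    ∃ C₁, 0 < C₁ ∧ ∀ (s s' : ℂ) (σ : κ → ℝ) (p : κ → ℤ) (D : ℕ) (u : ℤ → ι → ℝ)
      (V V' : (κ → ℂ) →ₗ[ℂ] ℤ → ι → ℂ) (Ξ Ξ' : (κ → ℂ) →ₗ[ℂ] κ → ℂ), IsSign σ →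
      Separated p D → P.IsReduction C t s σ p D u V Ξ →
      P.IsReduction C t s' σ p D u V' Ξ' → ∀ x x' : κ → ℂ,
      Summable (fun n => Λ.form t s' (V x n) (V' x' n)) →
      ‖∑' n, Λ.form t s' (V x n) (V' x' n) - P.mass * (x ⬝ᵥ x')‖
        ≤ C₁ * (φ ^ (6 * D) + ‖s‖ + ‖s'‖) * ‖x‖ * ‖x'‖ := by
  classical
  obtain ⟨Cf, hCf, hform⟩ := Λ.form_bound t
  obtain ⟨Cp, hCp, hprof⟩ := P.prof_dec t
  obtain ⟨Cs, hCs, hsup⟩ := P.superpos_le κ t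
  simp only [bump_pow_eight] at hprof
  have hb0 := bump_pos hφ
  have hb1 := bump_le_one hφ hφ1
  obtain ⟨S, hS⟩ := summable_bump_sq hφ hφ1 0
  have hS0 : 0 ≤ S := hS.nonneg fun n => sq_nonneg _
  set K₁ := (Cf * C * C + Cf * C * C + Cf * Cs * C + Cf * Cp * Cp) * card κ with hK₁
  have hK₁0 : 0 ≤ K₁ := by positivity
  refine ⟨K₁ * (card κ * S) + 1, by positivity,
    fun s s' σ p D u V V' Ξ Ξ' hσ hsep h h' x x' hsum => ?_⟩
  set f : ℤ → ℂ := fun n => Λ.form t 0 (P.prof t n) (P.prof t n) with hf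
  have hfsum : HasSum f (P.mass : ℂ) := by
    have h1 : Summable f := by
      refine Summable.of_norm_bounded (g := fun n => Cf * Cp * Cp * bump φ 0 n ^ 2)
        (hS.summable.mul_left _) fun n => ((hform _ _).1).trans ?_
      have h7 : ‖P.prof t n‖ ≤ Cp * bump φ 0 n := by
        simpa using (hprof 0 n).trans (mul_le_mul_of_nonneg_left
          (pow_le_of_le_one (hb0 0 n).le (hb1 0 n) (by norm_num)) hCp.le)
      calc _ ≤ Cf * (Cp * bump φ 0 n) * (Cp * bump φ 0 n) := by have := hb0 0 n; gcongr
        _ = _ := by ring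
    have h3 : ∑' n, f n = (P.mass : ℂ) := by
      simp only [hf, P.form_prof ht, mass, ofReal_tsum]
    exact h3 ▸ h1.hasSum
  have hfp : HasSum (fun n => ∑ i, x i * x' i * f (n - p i)) (P.mass * (x ⬝ᵥ x')) := by
    rw [dotProduct, mul_comm, sum_mul]
    exact hasSum_sum fun i _ => ((Equiv.subRight (p i)).hasSum_iff.2 hfsum).mul_left _
  set E : ℝ := φ ^ (6 * D) + ‖s‖ + ‖s'‖ with hE
  have hE1 : φ ^ (6 * D) ≤ E := by rw [hE]; linarith [norm_nonneg s, norm_nonneg s']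
  have hE0 : 0 ≤ E := (by positivity : 0 ≤ φ ^ (6 * D)).trans hE1
  have hE2 : ‖s'‖ ≤ E := le_add_of_nonneg_left (by positivity)
  have hθE : (φ ^ 8) ^ D ≤ φ ^ (6 * D) := by
    rw [← pow_mul]
    exact pow_le_pow_of_le_one hφ.le hφ1.le (by omega)
  set W : ℤ → ℝ := fun n => ∑ i, bump φ (p i) n ^ 2 with hW
  have hWsum : HasSum W (card κ * S) := by
    have h1 : HasSum W (∑ _i : κ, S) := hasSum_sum fun i _ => by
      have h2 := (Equiv.subRight (p i)).hasSum_iff.2 hS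
      have e : (fun n => bump φ (p i) n ^ 2) = (fun n => bump φ 0 n ^ 2) ∘ Equiv.subRight (p i) := by
        funext n; simp [bump]
      rwa [e]
    simpa using h1
  have hmB : ∀ n, multiBump (φ ^ 8) p n ^ 2 ≤ card κ * W n := fun n => by
    refine sq_sum_le_card_mul_sum_sq.trans (mul_le_mul_of_nonneg_left (sum_le_sum fun i _ => ?_)
      (Nat.cast_nonneg _))
    rw [bump_pow_eight, ← pow_mul]
    exact pow_le_pow_of_le_one (hb0 _ _).le (hb1 _ _) (by norm_num)
  have hpt : ∀ n, ‖Λ.form t s' (V x n) (V' x' n) - ∑ i, x i * x' i * f (n - p i)‖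
      ≤ K₁ * E * ‖x‖ * ‖x'‖ * W n := by
    intro n
    set A := P.superpos t σ p x n with hA
    set A' := P.superpos t σ p x' n with hA'
    set B := multiBump (φ ^ 8) p n with hB
    have hB0 : 0 < B := multiBump_pos (pow_pos hφ 8) p n
    have v1 : ‖V x n‖ ≤ C * ‖x‖ * B := h.bound x n
    have v1' : ‖V' x' n‖ ≤ C * ‖x'‖ * B := h'.bound x' n
    have v2 : ‖V x n - A‖ ≤ C * E * ‖x‖ * B := (h.approx x n).trans (by
      gcongr; rw [hE]; linarith [norm_nonneg s'])
    have v2' : ‖V' x' n - A'‖ ≤ C * E * ‖x'‖ * B := (h'.approx x' n).trans (by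
      gcongr; rw [hE]; linarith [norm_nonneg s])
    have v3 : ‖A‖ ≤ Cs * ‖x‖ * B := hsup σ p hσ x n
    -- different copies hardly interact
    have f4 : ‖Λ.form t 0 A A' - ∑ i, x i * x' i * f (n - p i)‖
        ≤ Cf * Cp * Cp * card κ * E * ‖x‖ * ‖x'‖ * W n := by
      have g2 : ∀ i, x i * x' i * f (n - p i) = Λ.form t 0 ((x i * σ i) • P.prof t (n - p i))
          ((x' i * σ i) • P.prof t (n - p i)) := fun i => by
        rcases hσ i with h | h <;> simp [h, hf, mul_assoc, mul_left_comm]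
      have g3 : ∀ y : κ → ℂ, ∀ i,
          ‖(y i * σ i) • P.prof t (n - p i)‖ ≤ ‖y‖ * (Cp * bump φ (p i) n ^ 8) := fun y i => by
        rw [norm_smul]
        exact mul_le_mul (hσ.norm_coeff_le y i) (hprof _ n) (norm_nonneg _) (norm_nonneg _)
      rw [hA, hA', superpos_apply, superpos_apply, map_sum, ← sum_sub_distrib]
      calc _ ≤ ∑ i : κ, ∑ _j : κ, Cf * Cp * Cp * E * ‖x‖ * ‖x'‖ * bump φ (p i) n ^ 2 := by
            refine norm_sum_le_of_le _ fun i _ => ?_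
            rw [map_sum, LinearMap.sum_apply, g2, ← sum_erase_eq_sub (mem_univ i)]
            refine (norm_sum_le_of_le _ fun j hj => ?_).trans (sum_le_univ_sum_of_nonneg fun _ =>
              by positivity)
            have k4 := hb0 (p i) n
            have k5 := hb0 (p j) n
            calc _ ≤ Cf * (‖x‖ * (Cp * bump φ (p j) n ^ 8)) * (‖x'‖ * (Cp * bump φ (p i) n ^ 8)) :=
                  (hform _ _).1.trans (by gcongr; exacts [g3 x j, g3 x' i])
              _ = Cf * Cp * Cp * ((bump φ (p i) n * bump φ (p j) n) ^ 6 * bump φ (p j) n ^ 2)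
                    * ‖x‖ * ‖x'‖ * bump φ (p i) n ^ 2 := by ring
              _ ≤ Cf * Cp * Cp * ((φ ^ D) ^ 6 * 1) * ‖x‖ * ‖x'‖ * bump φ (p i) n ^ 2 := by
                  gcongr
                  exacts [hsep.bump_mul_le hφ hφ1 (ne_of_mem_erase hj).symm n,
                    pow_le_one₀ k5.le (hb1 _ _)]
              _ ≤ _ := by
                  rw [mul_one, ← pow_mul, mul_comm D 6]
                  gcongr
        _ = _ := by
            simp only [sum_const, nsmul_eq_mul, card_univ, hW, mul_sum]
            exact sum_congr rfl fun i _ => by ring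
    rw [show Λ.form t s' (V x n) (V' x' n) - ∑ i, x i * x' i * f (n - p i)
        = (Λ.form t s' (V x n) (V' x' n) - Λ.form t 0 (V x n) (V' x' n))
          + Λ.form t 0 (V x n - A) (V' x' n) + Λ.form t 0 A (V' x' n - A')
          + (Λ.form t 0 A A' - ∑ i, x i * x' i * f (n - p i)) by
      rw [map_sub, map_sub, LinearMap.sub_apply]; ring]
    calc _ ≤ Cf * E * (C * ‖x‖ * B) * (C * ‖x'‖ * B) + Cf * (C * E * ‖x‖ * B) * (C * ‖x'‖ * B)
          + Cf * (Cs * ‖x‖ * B) * (C * E * ‖x'‖ * B)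
          + Cf * Cp * Cp * card κ * E * ‖x‖ * ‖x'‖ * W n :=
        norm_add_le_of_le (norm_add_le_of_le (norm_add_le_of_le
          (((hform _ _).2 s').trans (by gcongr)) ((hform _ _).1.trans (by gcongr)))
          ((hform _ _).1.trans (by gcongr))) f4
      _ = (Cf * C * C + Cf * C * C + Cf * Cs * C) * E * ‖x‖ * ‖x'‖ * B ^ 2
          + Cf * Cp * Cp * card κ * E * ‖x‖ * ‖x'‖ * W n := by ring
      _ ≤ (Cf * C * C + Cf * C * C + Cf * Cs * C) * E * ‖x‖ * ‖x'‖ * (card κ * W n)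
          + Cf * Cp * Cp * card κ * E * ‖x‖ * ‖x'‖ * W n := by gcongr; exact hmB n
      _ = _ := by rw [hK₁]; ring
  refine ((hsum.hasSum.sub hfp).norm_le_of_bounded
    (hWsum.mul_left (K₁ * E * ‖x‖ * ‖x'‖)) hpt).trans ?_
  have : 0 ≤ E * ‖x‖ * ‖x'‖ := by positivity
  nlinarith

/-- The family of reduced matrices of a multi-breather, parametrized by `s = λ²`. -/
structure Primary.IsFamily (P : Primary Λ θ) {κ : Type} [Fintype κ] [DecidableEq κ] (C δ ε : ℝ)
    (σ : κ → ℝ) (p : κ → ℤ) (D : ℕ) (u : ℤ → ι → ℝ) (F : ℂ → Matrix κ κ ℂ) : Prop where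
  symm : ∀ s, ‖s‖ ≤ δ → (F s).transpose = F s
  conj : ∀ s, ‖s‖ ≤ δ → F (starRingEnd ℂ s) = (F s).map (starRingEnd ℂ)
  slope : ∀ s s', ‖s‖ ≤ δ → ‖s'‖ ≤ δ → ∀ x x' : κ → ℂ,
    ‖x' ⬝ᵥ (F s).mulVec x - x' ⬝ᵥ (F s').mulVec x + (s - s') * (P.mass * (x ⬝ᵥ x'))‖
      ≤ C * ‖s - s'‖ * (ε + ‖s‖ + ‖s'‖) * ‖x‖ * ‖x'‖
  modes : ∀ lam : ℂ, ‖lam ^ 2‖ ≤ δ →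
    Nonempty (Λ.modes u lam ≃ₗ[ℂ] LinearMap.ker (F (lam ^ 2)).mulVecLin)
  one : (F 0).mulVec 1 = 0
  wave : ∀ x : κ → ℂ, ∃ (w : ℤ → ι → ℂ) (ξ : κ → ℂ), Λ.op (Λ.pot u) w = P.src p ξ ∧
    (F 0).mulVec x = (fun i => P.coef u p i * ξ i) ∧ WBound (multiBump θ p) (C * ‖x‖) w ∧
    WBound (multiBump θ p) (C * θ ^ D * ‖x‖)
      (fun n => w n - ∑ i, (x i * σ i) • toC (Λ.dot P.q) (n - p i))

lemma opS_conj (Λ : Chain ι) (u : ℤ → ι → ℝ) (t : ℝ) (s : ℂ) (v : ℤ → ι → ℂ) (n : ℤ)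
    (i : ι) : Λ.opS u t (starRingEnd ℂ s) (fun n i => starRingEnd ℂ (v n i)) n i
      = starRingEnd ℂ (Λ.opS u t s v n i) := by
  have h : ∀ j, starRingEnd ℂ (Λ.pert t s i j) = Λ.pert t (starRingEnd ℂ s) i j := fun j => by
    simp [pert, Jc, one_apply, conj_ofNat, apply_ite (starRingEnd ℂ)]
  simp only [opS, op_apply, mulVec, dotProduct, Matrix.add_apply,
    map_sub, map_add, map_mul, map_sum, conj_ofReal, conj_ofNat, h]
  simp only [pot, Matrix.map_apply, conj_ofReal]

lemma Primary.Solvable.exists_family {φ : ℝ} (hφ : 0 < φ) (hφ1 : φ < 1) {P : Primary Λ (φ ^ 8)}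
    {C₀ ρ β : ℝ} {L : ℕ} (hS : P.Solvable C₀ L ρ β) (hC₀ : 0 < C₀) (hβ : 0 < β) (κ : Type)
    [Fintype κ] [Nonempty κ] [DecidableEq κ] {C' : ℝ} (hC' : 0 ≤ C') :
    ∃ C, 0 < C ∧ ∃ δ, 0 < δ ∧ ∃ D₀ : ℕ, ∀ (σ : κ → ℝ) (p : κ → ℤ) (D : ℕ) (u : ℤ → ι → ℝ),
      D₀ ≤ D → P.IsMulti C' L ρ σ p D u → ∃ F, P.IsFamily C δ (φ ^ (6 * D)) σ p D u F := by
  obtain ⟨t, ht, δ, hδ, hpert⟩ := Λ.exists_pert_small hβ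
  obtain ⟨C, hC, hred⟩ := hS.exists_reduction hC₀ κ hδ hpert hC'
  obtain ⟨C₁, hC₁, hform⟩ := P.form_approx hφ hφ1 κ ht.ne' hC
  obtain ⟨C₂, hC₂, hdata⟩ := P.superpos_data κ t hC'
  have hbb : 0 < ‖P.b ⬝ᵥ P.b‖ := norm_pos_iff.2 P.b_ne
  obtain ⟨D₀, hD₀⟩ := exists_bump_le P.θ_pos P.θ_lt C₂ (half_pos hbb)
  refine ⟨C + C₁, by positivity, δ, hδ, D₀, fun σ p D u hD hu => ?_⟩
  have hcoef : ∀ j, P.coef u p j ≠ 0 := fun j hj => by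
    have h1 := (hdata L ρ σ p D u hu 0 j).2
    rw [hj, zero_sub, norm_neg, norm_mul, show ‖(σ j : ℂ)‖ = 1 by
      rcases hu.sign j with h | h <;> simp [h], one_mul] at h1
    have h3 := hD₀ 0 D (by simpa using hD)
    rw [show bump (φ ^ 8) 0 D = (φ ^ 8) ^ D by simp [bump]] at h3
    linarith
  have huR : ∀ n, ‖u n‖ ≤ (C' + P.D) * card κ := fun n => (hu.norm_le hC' n).trans
    (mul_le_mul_of_nonneg_left (multiBump_le P.θ_pos P.θ_lt p n)
      (add_nonneg hC' P.D_nonneg))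
  choose! V Ξ hVΞ using hred σ p D u hu
  have heven := hS.evenBij hβ.le hu.sign hu.near hu.inj hu.small hu.even
  have hent : ∀ s i j, P.reduced u p (Ξ s) i j = P.coef u p i * Ξ s (Pi.single j 1) i :=
    fun s i j => by simpa using congrFun (P.mulVec_reduced (Pi.single j 1)) i
  have hdot : ∀ (s : ℂ) (x x' : κ → ℂ),
      x' ⬝ᵥ (P.reduced u p (Ξ s)).mulVec x = ∑ j, P.coef u p j * Ξ s x j * x' j := fun s x x' => by
    rw [P.mulVec_reduced, dotProduct_comm, dotProduct]
  have hsymm : ∀ s, ‖s‖ ≤ δ → ∀ x x' : κ → ℂ, x' ⬝ᵥ (P.reduced u p (Ξ s)).mulVec x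
      = x ⬝ᵥ (P.reduced u p (Ξ s)).mulVec x' := fun s hs x x' => by
    have h1 := ((hVΞ s hs).cross (hVΞ s hs) ht.ne' hu.even huR x x').2
    rw [sub_self, neg_zero, zero_mul, sub_eq_zero] at h1
    rw [hdot, hdot, h1]
  have hr := hVΞ 0 (by simpa using hδ.le)
  refine ⟨fun s => P.reduced u p (Ξ s), ⟨fun s hs => ?_, fun s hs => ?_, fun s s' hs hs' x x' => ?_,
    fun lam hlam => (hVΞ _ hlam).modes_equiv rfl ht.ne' hu.even hcoef heven, ?_,
    fun x => ⟨fun n => Λ.od (V 0 x n), Ξ 0 x, funext fun n => ?_, P.mulVec_reduced x,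
      fun n => ?_, fun n => ?_⟩⟩⟩
  · ext i j
    simpa using hsymm s hs (Pi.single i 1) (Pi.single j 1)
  · ext i j
    have hr := hVΞ s hs
    obtain ⟨K, hK⟩ := hr.bounded (Pi.single j 1)
    have hcc : ∀ k, starRingEnd ℂ (P.coef u p k) = P.coef u p k := fun k => by
      simp [coef, b, dotProduct, toC]
    have hbc : ∀ v : ι → ℂ, P.b ⬝ᵥ (fun i => starRingEnd ℂ (v i)) = starRingEnd ℂ (P.b ⬝ᵥ v) :=
      fun v => by simp [b, dotProduct, toC]
    rw [hent, Matrix.map_apply, hent, map_mul, hcc, ← ((hVΞ _ (by rwa [RCLike.norm_conj])).unique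
      (Pi.single j 1) (fun n i => starRingEnd ℂ (V s (Pi.single j 1) n i))
      (fun k => starRingEnd ℂ (Ξ s (Pi.single j 1) k)) ⟨K, fun n => (pi_norm_le_iff_of_nonneg
        ((norm_nonneg _).trans (hK n))).2 fun i => by
        rw [RCLike.norm_conj]
        exact (norm_le_pi_norm _ i).trans (hK n)⟩ ?_ ?_).2]
    · funext n i
      rw [opS_conj, hr.eq]
      simp only [src_def, Finset.sum_apply, map_sum]
      refine sum_congr rfl fun k _ => ?_
      split_ifs <;> simp [b, toC]
    · intro k
      rw [hbc, hr.data, map_mul, hcc, Pi.single_apply]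
      split_ifs <;> simp
  · have h1 := (hVΞ s hs).cross (hVΞ s' hs') ht.ne' hu.even huR x x'
    have h2 := hform s s' σ p D u _ _ _ _ hu.sign hu.sep (hVΞ s hs) (hVΞ s' hs') x x' h1.1
    rw [hsymm s' hs' x x', hdot, hdot, h1.2, neg_mul, neg_add_eq_sub, ← mul_sub, norm_mul,
      norm_sub_rev ((P.mass : ℂ) * _)]
    calc _ ≤ ‖s - s'‖ * (C₁ * (φ ^ (6 * D) + ‖s‖ + ‖s'‖) * ‖x‖ * ‖x'‖) := by gcongr
      _ = C₁ * ‖s - s'‖ * (φ ^ (6 * D) + ‖s‖ + ‖s'‖) * ‖x‖ * ‖x'‖ := by ring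
      _ ≤ _ := by gcongr; linarith
  · obtain ⟨CJ, hCJ, hJ⟩ := norm_dot_le Λ
    rw [P.mulVec_reduced, (hr.of_mode (lam := 0) (by simp) ht.ne' hu.even heven (toC (Λ.dot u))
      ⟨⟨CJ * ((C' + P.D) * card κ), fun n => ?_⟩, fun n => ?_⟩ 1
      (fun j => by rw [Pi.one_apply, one_mul]; rfl)).1]
    · funext j; simp
    · rw [norm_toC]
      exact (hJ u n).trans (by gcongr; exact huR n)
    · rw [Λ.op_toC, hu.sol.opR_dot_eq_zero]
      funext i; simp [toC]
  · have h1 := od_opS hu.even t 0 (V 0 x) n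
    rw [hr.eq, P.od_src] at h1
    rw [h1]; simp
  · refine (Λ.norm_od_le _).trans ((hr.bound x n).trans ?_)
    have := multiBump_pos P.θ_pos p n
    gcongr
    linarith
  · have h1 := hr.approx x n
    rw [norm_zero, add_zero] at h1
    dsimp only
    rw [← P.od_superpos t, ← map_sub]
    refine (Λ.norm_od_le _).trans (h1.trans ?_)
    have := multiBump_pos P.θ_pos p n
    have := P.θ_pos
    gcongr
    linarith

/-! ### Interaction across a gap -/

/-- The sources to the left of a site, tested with a solution, are given by the Wronskian at this
site. -/
lemma Primary.sum_src_left {κ : Type*} [Fintype κ] {p : κ → ℤ} {u : ℤ → ι → ℝ}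
    {v w : ℤ → ι → ℂ} {ξ : κ → ℂ} (hv : Summable fun n => ‖v n‖ ^ 2)
    (hw : Summable fun n => ‖w n‖ ^ 2) (hv0 : Λ.op (Λ.pot u) v = 0)
    (hw0 : Λ.op (Λ.pot u) w = P.src p ξ) (k : ℤ) :
    ∑ j, (if p j + P.n₀ < k then ξ j * (P.b ⬝ᵥ v (p j + P.n₀)) else 0) = -Λ.wronskian v w k := by
  have h1 := P.hasSum_src p ξ (fun n => if n < k then v n else 0)
  have h2 : ∀ n, (if n < k then v n else 0) ⬝ᵥ P.src p ξ n
      = -(if n < k then Λ.wronskian v w (n + 1) - Λ.wronskian v w n else 0) := fun n => by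
    split_ifs with hn
    · have := Λ.wronskian_sub (pot_transpose Λ u) v w n
      rw [hv0, hw0, Pi.zero_apply, zero_dotProduct, zero_sub] at this
      rw [← this, neg_neg]
    · simp
  set G : ℤ → ℂ := fun n => if n ≤ k then Λ.wronskian v w n else 0 with hG
  have hGs : Summable G := by
    refine Summable.of_norm_bounded (Λ.summable_wronskian hv hw).norm fun n => ?_
    simp only [hG]
    split_ifs
    · exact le_rfl
    · simp
  have h3 : ∀ n, (if n < k then Λ.wronskian v w (n + 1) - Λ.wronskian v w n else 0)
      = (G (n + 1) - G n) + (if n = k then Λ.wronskian v w k else 0) := fun n => by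
    simp only [hG]
    rcases lt_trichotomy n k with h | h | h
    · rw [if_pos h, if_pos (by omega), if_pos h.le, if_neg h.ne, add_zero]
    · subst h; simp
    · rw [if_neg (by omega), if_neg (by omega), if_neg (by omega), if_neg h.ne']; simp
  have h4 : HasSum (fun n => G (n + 1) - G n) 0 := by
    have a := hGs.hasSum
    have b : HasSum (fun n => G (n + 1)) (∑' n, G n) :=
      ((Equiv.addRight (1 : ℤ)).hasSum_iff (f := G)).2 a
    have c := b.sub a
    rwa [sub_self] at c
  have h5 := (h4.add (hasSum_ite_eq k (Λ.wronskian v w k))).neg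
  simp only [← h3, ← h2] at h5
  have h6 := h1.unique h5
  rw [zero_add] at h6
  rw [← h6]
  refine sum_congr rfl fun j _ => ?_
  split_ifs <;> simp

/-- The size of `q̇` at the sites `n` and `n - 1`. -/
noncomputable def Primary.tail (n : ℤ) : ℝ :=
  max ‖Λ.dot P.q n‖ ‖Λ.dot P.q (n - 1)‖

/-- The interaction of two neighboring copies, with the left and the right center at distances `a`
and `c` from the gap site. -/
def Primary.inter (a c : ℤ) : ℝ :=
  Λ.dot P.q a ⬝ᵥ Λ.dot P.q (-c - 1) - Λ.dot P.q (a - 1) ⬝ᵥ Λ.dot P.q (-c)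

/-- Positions with prescribed distances. -/
def IsChain {l : ℕ} (N : Fin l → ℕ) (p : Fin (l + 1) → ℤ) : Prop :=
  ∀ g : Fin l, p g.succ = p g.castSucc + N g

lemma IsChain.mono {l : ℕ} {N : Fin l → ℕ} {p : Fin (l + 1) → ℤ} (h : IsChain N p) :
    Monotone p := Fin.monotone_iff_le_succ.2 fun g => by rw [h]; omega

lemma IsChain.le {l : ℕ} {N : Fin l → ℕ} {p : Fin (l + 1) → ℤ} (h : IsChain N p) {D : ℕ}
    (hD : ∀ g, D ≤ N g) {i j : Fin (l + 1)} (hij : i < j) : p i + D ≤ p j := by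
  obtain ⟨g, rfl⟩ := Fin.exists_succ_eq.2 (Fin.ne_zero_of_lt hij)
  have h2 := h.mono (Fin.le_castSucc_iff.2 hij)
  have h3 := hD g
  rw [h]
  omega

lemma IsChain.separated {l : ℕ} {N : Fin l → ℕ} {p : Fin (l + 1) → ℤ} (h : IsChain N p) {D : ℕ}
    (hD : ∀ g, D ≤ N g) : Separated p D := fun i j hij => by
  rcases lt_or_gt_of_ne hij with h1 | h1 <;> · have := h.le hD h1; omega

lemma bump_le_pow {φ : ℝ} (hφ : 0 < φ) (hφ1 : φ < 1) {p n : ℤ} {k c : ℕ}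
    (h : k ≤ 8 * (n - p).natAbs + c) : bump (φ ^ 8) p n ≤ (φ ^ c)⁻¹ * φ ^ k := by
  rw [inv_mul_eq_div, le_div_iff₀ (by positivity), bump, ← pow_mul, ← pow_add]
  exact pow_le_pow_of_le_one hφ.le hφ1.le h

/-- The Wronskian is stable under small perturbations. -/
lemma Chain.wronskian_sub_le (Λ : Chain ι) {v w a b : ℤ → ι → ℂ} {S : ℤ} {T e : ℝ}
    (h : ∀ n, n = S ∨ n = S - 1 → ‖a n‖ ≤ T ∧ ‖b n‖ ≤ T ∧ ‖v n - a n‖ ≤ e ∧ ‖w n - b n‖ ≤ e) :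
    ‖Λ.wronskian v w S - Λ.wronskian a b S‖ ≤ 2 * Λ.d * card ι * (e * (2 * T + e)) := by
  have he : ∀ n m, n = S ∨ n = S - 1 → m = S ∨ m = S - 1 →
      ‖v n ⬝ᵥ w m - a n ⬝ᵥ b m‖ ≤ card ι * (e * (2 * T + e)) := fun n m hn hm => by
    obtain ⟨h1, -, h3, -⟩ := h n hn
    obtain ⟨-, h2, -, h4⟩ := h m hm
    have e1 : v n ⬝ᵥ w m - a n ⬝ᵥ b m = (v n - a n) ⬝ᵥ w m + a n ⬝ᵥ (w m - b m) := by
      simp only [sub_dotProduct, dotProduct_sub]; ring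
    have h5 := norm_le_norm_add_norm_sub' (w m) (b m)
    have he0 := (norm_nonneg _).trans h3
    have hT0 := (norm_nonneg _).trans h1
    rw [e1]
    calc _ ≤ card ι * (‖v n - a n‖ * ‖w m‖) + card ι * (‖a n‖ * ‖w m - b m‖) :=
          norm_add_le_of_le (norm_dotProduct_le _ _) (norm_dotProduct_le _ _)
      _ ≤ card ι * (e * (T + e)) + card ι * (T * e) := by gcongr; linarith
      _ = _ := by ring
  have e2 : Λ.wronskian v w S - Λ.wronskian a b S
      = Λ.d * ((v S ⬝ᵥ w (S - 1) - a S ⬝ᵥ b (S - 1))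
        - (v (S - 1) ⬝ᵥ w S - a (S - 1) ⬝ᵥ b S)) := by simp only [wronskian]; ring
  rw [e2, norm_mul, norm_real, norm_of_nonneg Λ.d_pos.le]
  calc _ ≤ Λ.d * (card ι * (e * (2 * T + e)) + card ι * (e * (2 * T + e))) := by
        have := Λ.d_pos
        gcongr
        exact norm_sub_le_of_le (he _ _ (.inl rfl) (.inr rfl)) (he _ _ (.inr rfl) (.inl rfl))
    _ = _ := by ring

/-- The interaction form of the reduced matrix at `s = 0`: testing with the copies to the left of a
gap gives the Wronskian across the gap, to which only the two neighboring copies contribute up to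
small errors. -/
lemma Primary.gap_estimate {φ : ℝ} (hφ : 0 < φ) (hφ1 : φ < 1) (P : Primary Λ (φ ^ 8)) (l : ℕ)
    {C' C δ : ℝ} (hC' : 0 ≤ C') (hC : 0 < C) (L : ℕ) (ρ : ℝ) :
    ∃ C₁, 0 < C₁ ∧ ∃ D₀ : ℕ, ∀ (σ : Fin (l + 1) → ℝ) (N : Fin l → ℕ) (p : Fin (l + 1) → ℤ) (D : ℕ)
      (u : ℤ → ι → ℝ) (ε : ℝ) (F : ℂ → Matrix (Fin (l + 1)) (Fin (l + 1)) ℂ), D₀ ≤ D →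
      (∀ g, D ≤ N g) → IsChain N p →
      P.IsMulti C' L ρ σ p D u → P.IsFamily C δ ε σ p D u F →
      ∀ (g : Fin l) (a c : ℤ), a + c = N g → (D : ℤ) ≤ 2 * a + 1 → (D : ℤ) ≤ 2 * c + 1 →
      ∀ y : Fin (l + 1) → ℂ, ‖y‖ ≤ 1 →
      ‖(fun i => if i ≤ g.castSucc then 1 else 0) ⬝ᵥ (F 0).mulVec y
          - (y g.castSucc - y g.succ) * (Λ.d * (σ g.castSucc * σ g.succ * P.inter a c))‖
        ≤ C₁ * φ ^ (12 * D) * (P.tail a + P.tail (-c) + φ ^ (12 * D)) := by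
  classical
  obtain ⟨D', hD'⟩ := P.dot_q_dec
  have hD'0 := hD'.nonneg (bump_isWeight P.θ_pos P.θ_lt 0)
  obtain ⟨CJ, hCJ, hJ⟩ := norm_dot_le Λ
  set m : ℝ := (l + 1 : ℝ) with hm
  set K : ℝ := (φ ^ 12)⁻¹
  set E : ℝ := m * K * (CJ * C' + C + D') with hE
  have hE0 : 0 ≤ E := by positivity
  have hd := Λ.d_pos
  refine ⟨2 * Λ.d * card ι * (E * (2 + E)) + 1, by positivity, 2 * (P.n₀.natAbs + 2),
    fun σ N p D u ε F hD hN hp hu hF g a c hac ha hc y hy => ?_⟩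
  obtain ⟨w, ξ, hw, hFy, hwb, hwa⟩ := hF.wave y
  set η : ℝ := φ ^ (12 * D) with hη
  have hη0 : 0 < η := by positivity
  have hstep := hp g
  set i₁ := g.castSucc
  set i₂ := g.succ
  set S : ℤ := p i₁ + a with hS
  have hS' : S = p i₂ - c := by omega
  have hsgn : ∀ i, ‖(σ i : ℂ)‖ = 1 := fun i => by rcases hu.sign i with h | h <;> simp [h]
  have hle : ∀ i j, i < j → p i + D ≤ p j := fun i j hij => hp.le hN hij
  have hposge : ∀ i, ¬ i ≤ i₁ → p i₂ ≤ p i := fun i hi =>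
    hp.mono (Fin.castSucc_lt_iff_succ_le.1 (not_le.1 hi))
  -- the two sites next to the gap
  have hbump4 : ∀ n, n = S ∨ n = S - 1 → ∀ i, bump (φ ^ 8) (p i) n ≤ K * φ ^ (4 * D) := by
    intro n hn i
    refine bump_le_pow hφ hφ1 ?_
    by_cases hi : i ≤ i₁
    · have := hp.mono hi; omega
    · have := hposge i hi; omega
  have hbump12 : ∀ n, n = S ∨ n = S - 1 → ∀ i, i ≠ i₁ → i ≠ i₂ →
      bump (φ ^ 8) (p i) n ≤ K * η := by
    intro n hn i hi1 hi2
    refine bump_le_pow hφ hφ1 ?_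
    rcases lt_or_gt_of_ne hi1 with h | h
    · have := hle i _ h; omega
    · have := hle i₂ i (lt_of_le_of_ne (Fin.castSucc_lt_iff_succ_le.1 h) hi2.symm); omega
  set A : ℤ → ι → ℂ := fun n => (σ i₁ : ℂ) • toC (Λ.dot P.q) (n - p i₁) with hA
  set B : ℤ → ι → ℂ := fun n => (σ i₂ : ℂ) • toC (Λ.dot P.q) (n - p i₂) with hB
  have herr : ∀ (z : Fin (l + 1) → ℂ) (X : ℤ → ι → ℂ), ‖z‖ ≤ 1 →
      (∀ n, ‖X n - ∑ i, (z i * σ i) • toC (Λ.dot P.q) (n - p i)‖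
        ≤ (CJ * C' + C) * ((φ ^ 8) ^ D * multiBump (φ ^ 8) p n)) →
      ∀ n, n = S ∨ n = S - 1 → ‖X n - (z i₁ • A n + z i₂ • B n)‖ ≤ E * η := by
    intro z X hz hX n hn
    have hne : i₁ ≠ i₂ := (Fin.castSucc_lt_succ).ne
    have h1 : ‖∑ i, (z i * σ i) • toC (Λ.dot P.q) (n - p i) - (z i₁ • A n + z i₂ • B n)‖
        ≤ m * (D' * (K * η)) := by
      simp only [hA, hB, smul_smul]
      rw [← add_sum_erase _ _ (mem_univ i₁), ← add_sum_erase _ _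
        (mem_erase.2 ⟨hne.symm, mem_univ i₂⟩), ← add_assoc, add_sub_cancel_left]
      calc _ ≤ ∑ _i ∈ (univ.erase i₁).erase i₂, D' * (K * η) := by
            refine norm_sum_le_of_le _ fun i hi => ?_
            rw [norm_smul, norm_mul, hsgn, mul_one, norm_toC]
            have h1 : ‖z i‖ ≤ 1 := (norm_le_pi_norm z i).trans hz
            have h2 := hD' (n - p i)
            have h3 := hbump12 n hn i (ne_of_mem_erase (mem_of_mem_erase hi)) (ne_of_mem_erase hi)
            have h4 : bump (φ ^ 8) 0 (n - p i) = bump (φ ^ 8) (p i) n := by simp [bump]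
            calc _ ≤ 1 * (D' * (K * η)) := by
                  gcongr; rw [h4] at h2; exact h2.trans (by gcongr)
              _ = _ := one_mul _
        _ ≤ ∑ _i : Fin (l + 1), D' * (K * η) :=
            sum_le_sum_of_subset_of_nonneg (subset_univ _) fun _ _ _ => by positivity
        _ = _ := by simp [hm]
    have h2 : multiBump (φ ^ 8) p n ≤ m * (K * φ ^ (4 * D)) :=
      (sum_le_sum fun i _ => hbump4 n hn i).trans_eq (by simp [hm])
    calc _ ≤ (CJ * C' + C) * ((φ ^ 8) ^ D * (m * (K * φ ^ (4 * D)))) + m * (D' * (K * η)) :=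
          (norm_sub_le_norm_sub_add_norm_sub _ _ _).trans
            (add_le_add ((hX n).trans (by gcongr)) h1)
      _ = _ := by rw [hE, hη, show 12 * D = 8 * D + 4 * D by ring, pow_add, ← pow_mul]; ring
  set v : ℤ → ι → ℂ := toC (Λ.dot u) with hv
  have hverr := herr 1 v (by simp) fun n => by
    have e : v n - ∑ i, ((1 : Fin (l + 1) → ℂ) i * σ i) • toC (Λ.dot P.q) (n - p i)
        = toC (Λ.dot (u - P.ansatz σ p)) n := by
      have e1 : toC (Λ.dot u - Λ.dot (P.ansatz σ p)) n
          = toC (Λ.dot u) n - toC (Λ.dot (P.ansatz σ p)) n := by funext i; simp [toC]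
      rw [Λ.dot_sub, e1, P.toC_dot_ansatz]
      simp only [Pi.one_apply, one_mul, hv]
    have h0 := multiBump_pos P.θ_pos p n
    rw [e, norm_toC]
    calc _ ≤ CJ * (C' * (φ ^ 8) ^ D * multiBump (φ ^ 8) p n) := (hJ _ _).trans (by
          gcongr; exact hu.close n)
      _ = CJ * C' * ((φ ^ 8) ^ D * multiBump (φ ^ 8) p n) := by ring
      _ ≤ _ := by gcongr; linarith
  have hwerr := herr y w hy fun n => by
    have h0 := multiBump_pos P.θ_pos p n
    calc _ ≤ C * (φ ^ 8) ^ D * ‖y‖ * multiBump (φ ^ 8) p n := hwa n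
      _ = C * ‖y‖ * ((φ ^ 8) ^ D * multiBump (φ ^ 8) p n) := by ring
      _ ≤ _ := by gcongr; nlinarith [mul_nonneg hCJ.le hC']
  have hT : ∀ n, n = S ∨ n = S - 1 → ‖A n‖ ≤ P.tail a ∧ ‖B n‖ ≤ P.tail (-c) := by
    intro n hn
    simp only [hA, hB, norm_smul, hsgn, one_mul, norm_toC]
    rcases hn with rfl | rfl
    · rw [show S - p i₁ = a by omega, show S - p i₂ = -c by omega]
      exact ⟨le_max_left _ _, le_max_left _ _⟩
    · rw [show S - 1 - p i₁ = a - 1 by omega, show S - 1 - p i₂ = -c - 1 by omega]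
      exact ⟨le_max_right _ _, le_max_right _ _⟩
  -- reduction to the Wronskian
  have hsumv : Summable fun n => ‖v n‖ ^ 2 := by
    have : WBound (multiBump (φ ^ 8) p) (CJ * (C' + P.D)) v := fun n => by
      rw [hv, norm_toC, mul_assoc]
      exact (hJ _ _).trans (by gcongr; exact hu.norm_le hC' n)
    exact this.summable_multi P.θ_pos P.θ_lt
  have hv0 : Λ.op (Λ.pot u) v = 0 := by
    rw [hv, Λ.op_toC, hu.sol.opR_dot_eq_zero]
    funext n i; simp [toC]
  have hW : (fun i => if i ≤ i₁ then (1 : ℂ) else 0) ⬝ᵥ (F 0).mulVec y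
      = -Λ.wronskian v w S := by
    rw [← P.sum_src_left hsumv (hwb.summable_multi P.θ_pos P.θ_lt) hv0 hw S, hFy, dotProduct]
    refine sum_congr rfl fun i _ => ?_
    by_cases hi : i ≤ i₁
    · have := hp.mono hi
      rw [if_pos hi, if_pos (by omega), one_mul, mul_comm]; rfl
    · have h1 := hposge i hi
      rw [if_neg hi, if_neg (by omega), zero_mul]
  have hinter : Λ.wronskian (fun n => A n + B n) (fun n => y i₁ • A n + y i₂ • B n) S
      = -((y i₁ - y i₂) * (Λ.d * (σ i₁ * σ i₂ * P.inter a c))) := by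
    have hdd : ∀ i j, toC (Λ.dot P.q) i ⬝ᵥ toC (Λ.dot P.q) j
        = ((Λ.dot P.q i ⬝ᵥ Λ.dot P.q j : ℝ) : ℂ) := fun i j => by simp [toC, dotProduct]
    have h : A S ⬝ᵥ B (S - 1) - A (S - 1) ⬝ᵥ B S = σ i₁ * σ i₂ * P.inter a c := by
      simp only [hA, hB, show S - p i₁ = a by omega, show S - 1 - p i₁ = a - 1 by omega,
        show S - p i₂ = -c by omega, show S - 1 - p i₂ = -c - 1 by omega, smul_dotProduct,
        dotProduct_smul, hdd, smul_eq_mul, inter]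
      push_cast; ring
    rw [wronskian, ← h]
    simp only [add_dotProduct, dotProduct_add, dotProduct_smul, smul_eq_mul]
    rw [dotProduct_comm (A (S - 1)) (A S), dotProduct_comm (B (S - 1)) (B S),
      dotProduct_comm (B S) (A (S - 1)), dotProduct_comm (B (S - 1)) (A S)]
    ring
  have hyi : ∀ i, ‖y i‖ ≤ 1 := fun i => (norm_le_pi_norm y i).trans hy
  have key := Λ.wronskian_sub_le (T := P.tail a + P.tail (-c)) (e := E * η)
    (a := fun n => A n + B n) (b := fun n => y i₁ • A n + y i₂ • B n) fun n hn => ⟨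
    norm_add_le_of_le (hT n hn).1 (hT n hn).2, norm_add_le_of_le
      (by rw [norm_smul]; exact (mul_le_of_le_one_left (norm_nonneg _) (hyi _)).trans (hT n hn).1)
      (by rw [norm_smul]; exact (mul_le_of_le_one_left (norm_nonneg _) (hyi _)).trans (hT n hn).2),
    by simpa using hverr n hn, hwerr n hn⟩
  have hT0 : 0 ≤ P.tail a + P.tail (-c) :=
    add_nonneg (le_max_of_le_left (norm_nonneg _)) (le_max_of_le_left (norm_nonneg _))
  rw [hW, ← norm_neg, neg_sub', neg_neg, ← hinter]
  calc _ ≤ 2 * Λ.d * card ι * (E * η * (2 * (P.tail a + P.tail (-c)) + E * η)) := key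
    _ ≤ 2 * Λ.d * card ι * (E * η * ((2 + E) * (P.tail a + P.tail (-c) + η))) := by
        gcongr
        nlinarith [mul_nonneg hE0 hT0]
    _ = 2 * Λ.d * card ι * (E * (2 + E)) * η * (P.tail a + P.tail (-c) + η) := by ring
    _ ≤ _ := by gcongr; linarith

/-! ### Sorted eigenvalues of Hermitian matrices -/

/-- A diagonalization of a Hermitian matrix, the eigenvalues being listed in increasing order. -/
structure IsDiag {n : ℕ} (A : Matrix (Fin n) (Fin n) ℂ) (f : Fin n → ℝ)
    (U : Matrix (Fin n) (Fin n) ℂ) : Prop where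
  mono : Monotone f
  left : U.conjTranspose * U = 1
  right : U * U.conjTranspose = 1
  eq : A = U.conjTranspose * diagonal (fun i => (f i : ℂ)) * U

lemma exists_isDiag {n : ℕ} {A : Matrix (Fin n) (Fin n) ℂ} (hA : A.IsHermitian) :
    ∃ f U, IsDiag A f U := by
  set V : Matrix (Fin n) (Fin n) ℂ := hA.eigenvectorUnitary.1 with hV
  have h1 : V.conjTranspose * V = 1 := Unitary.coe_star_mul_self hA.eigenvectorUnitary
  have h2 : V * V.conjTranspose = 1 := Unitary.coe_mul_star_self hA.eigenvectorUnitary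
  have h3 : A = V * diagonal (fun i => (hA.eigenvalues i : ℂ)) * V.conjTranspose := by
    have := hA.spectral_theorem
    rw [Unitary.conjStarAlgAut_apply] at this
    exact this
  set e := Tuple.sort hA.eigenvalues with he
  refine ⟨hA.eigenvalues ∘ e, V.conjTranspose.submatrix e id, Tuple.monotone_sort _, ?_, ?_, ?_⟩
  · rw [conjTranspose_submatrix, conjTranspose_conjTranspose,
      submatrix_mul_equiv, h2]
    simp
  · rw [conjTranspose_submatrix, conjTranspose_conjTranspose,
      ← submatrix_mul _ _ _ _ _ bijective_id, h1]
    simp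
  · have h4 : diagonal (fun i => (((hA.eigenvalues ∘ e) i : ℝ) : ℂ))
        = (diagonal (fun i => (hA.eigenvalues i : ℂ))).submatrix e e := by
      rw [submatrix_diagonal_equiv]; rfl
    rw [h4, conjTranspose_submatrix, conjTranspose_conjTranspose,
      submatrix_mul_equiv, submatrix_mul_equiv, ← h3]
    simp

namespace IsDiag

variable {n : ℕ} {A B : Matrix (Fin n) (Fin n) ℂ} {f g : Fin n → ℝ}
  {U W : Matrix (Fin n) (Fin n) ℂ}

lemma form_gen (U : Matrix (Fin n) (Fin n) ℂ) (h : Fin n → ℝ) (x : Fin n → ℂ) :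
    star x ⬝ᵥ (U.conjTranspose * diagonal (fun i => (h i : ℂ)) * U).mulVec x
      = ((∑ i, h i * ‖U.mulVec x i‖ ^ 2 : ℝ) : ℂ) := by
  rw [← mulVec_mulVec, ← mulVec_mulVec, dotProduct_mulVec,
    ← star_mulVec, dotProduct]
  push_cast
  refine sum_congr rfl fun i _ => ?_
  rw [mulVec_diagonal, Pi.star_apply, ← mul_conj']
  simp only [RCLike.star_def]
  ring

lemma form (hd : IsDiag A f U) (x : Fin n → ℂ) :
    star x ⬝ᵥ A.mulVec x = ((∑ i, f i * ‖U.mulVec x i‖ ^ 2 : ℝ) : ℂ) := by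
  conv_lhs => rw [hd.eq]
  exact form_gen U f x

lemma star_dotProduct_self (x : Fin n → ℂ) : star x ⬝ᵥ x = ((∑ i, ‖x i‖ ^ 2 : ℝ) : ℂ) := by
  rw [dotProduct]
  push_cast
  refine sum_congr rfl fun i _ => ?_
  rw [Pi.star_apply, ← mul_conj', mul_comm]
  rfl

lemma norm_sq (hd : IsDiag A f U) (x : Fin n → ℂ) :
    ∑ i, ‖U.mulVec x i‖ ^ 2 = ∑ i, ‖x i‖ ^ 2 := by
  have h := form_gen U (fun _ => 1) x
  simp only [ofReal_one, diagonal_one, mul_one, hd.left, one_mulVec,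
    one_mul, star_dotProduct_self] at h
  exact_mod_cast h.symm

lemma mulVec_eq_zero (hd : IsDiag A f U) {x : Fin n → ℂ} (h : U.mulVec x = 0) : x = 0 := by
  have := congrArg U.conjTranspose.mulVec h
  rwa [mulVec_mulVec, hd.left, one_mulVec, mulVec_zero] at this

lemma norm_sq_pos {x : Fin n → ℂ} (hx : x ≠ 0) : 0 < ∑ i, ‖x i‖ ^ 2 := by
  obtain ⟨i, hi⟩ := ne_iff.1 hx
  exact sum_pos' (fun _ _ => by positivity) ⟨i, mem_univ _, by
    have := norm_pos_iff.2 hi; positivity⟩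

/-- The monotonicity principle for eigenvalues: if one quadratic form is dominated by another one,
then so are its increasingly ordered eigenvalues. -/
lemma le_of_form_le {f' g' : Fin n → ℝ} (hd : IsDiag A f U) (hg : IsDiag B g W)
    (hf' : Monotone f') (hg' : Monotone g')
    (h : ∀ x, ∑ i, f' i * ‖U.mulVec x i‖ ^ 2 ≤ ∑ i, g' i * ‖W.mulVec x i‖ ^ 2) (k : Fin n) :
    f' k ≤ g' k := by
  by_contra! hlt
  -- a nonzero vector in the intersection of two spectral subspaces of complementary index
  let Z : (Fin n → ℂ) →ₗ[ℂ] (Fin n → ℂ) :=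
    { toFun := fun x i => if i < k then U.mulVec x i else if k < i then W.mulVec x i else 0
      map_add' := fun x y => by
        funext i
        simp only [mulVec_add, Pi.add_apply]
        split_ifs <;> simp
      map_smul' := fun c x => by
        funext i
        simp only [mulVec_smul, Pi.smul_apply, RingHom.id_apply]
        split_ifs <;> simp }
  have hns : ¬Function.Surjective Z := fun hs => by
    obtain ⟨x, hx⟩ := hs 1
    have := congrFun hx k
    simp [Z] at this
  have hni : ¬Function.Injective Z := fun hi => hns (LinearMap.injective_iff_surjective.1 hi)
  rw [injective_iff_map_eq_zero] at hni
  push Not at hni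
  obtain ⟨x, hx, hx0⟩ := hni
  have h1 : f' k * ∑ i, ‖U.mulVec x i‖ ^ 2 ≤ ∑ i, f' i * ‖U.mulVec x i‖ ^ 2 := by
    rw [mul_sum]
    refine sum_le_sum fun i _ => ?_
    by_cases hik : i < k
    · have := congrFun hx i
      simp only [Z, LinearMap.coe_mk, AddHom.coe_mk, if_pos hik, Pi.zero_apply] at this
      simp [this]
    · exact mul_le_mul_of_nonneg_right (hf' (not_lt.1 hik)) (by positivity)
  have h2 : ∑ i, g' i * ‖W.mulVec x i‖ ^ 2 ≤ g' k * ∑ i, ‖W.mulVec x i‖ ^ 2 := by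
    rw [mul_sum]
    refine sum_le_sum fun i _ => ?_
    by_cases hik : k < i
    · have := congrFun hx i
      simp only [Z, LinearMap.coe_mk, AddHom.coe_mk, if_neg hik.le.not_gt, if_pos hik,
        Pi.zero_apply] at this
      simp [this]
    · exact mul_le_mul_of_nonneg_right (hg' (not_lt.1 hik)) (by positivity)
  have h3 := norm_sq_pos hx0
  have h4 := h x
  rw [hd.norm_sq] at h1
  rw [hg.norm_sq] at h2
  nlinarith

lemma finrank_ker (hd : IsDiag A f U) :
    Module.finrank ℂ (LinearMap.ker A.mulVecLin) = Nat.card {k // f k = 0} := by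
  have hU : IsUnit U.det := by
    have := congrArg det hd.right
    rw [det_mul, det_one] at this
    exact IsUnit.of_mul_eq_one _ this
  have hU' : IsUnit U.conjTranspose.det := by
    have := congrArg det hd.left
    rw [det_mul, det_one] at this
    exact IsUnit.of_mul_eq_one _ this
  have h1 : A.rank = card {k // (f k : ℂ) ≠ 0} := by
    rw [hd.eq, rank_mul_eq_left_of_isUnit_det _ _ hU,
      rank_mul_eq_right_of_isUnit_det _ _ hU', rank_diagonal]
  have h2 := LinearMap.finrank_range_add_finrank_ker A.mulVecLin
  rw [Module.finrank_fin_fun] at h2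
  have h3 : Module.finrank ℂ (LinearMap.range A.mulVecLin) = A.rank := rfl
  rw [h3, h1] at h2
  have h4 := Fintype.card_subtype_compl (fun k => f k = 0)
  rw [Fintype.card_fin] at h4
  have h5 : card {k // (f k : ℂ) ≠ 0} = card {k // ¬f k = 0} :=
    Fintype.card_congr (Equiv.subtypeEquivRight fun k => by simp)
  have h6 : card {k // f k = 0} ≤ n := by
    simpa using Fintype.card_subtype_le (fun k => f k = 0)
  rw [Nat.card_eq_fintype_card]
  omega

lemma charpoly (hd : IsDiag A f U) :
    A.charpoly = ∏ i, (Polynomial.X - Polynomial.C (f i : ℂ)) := by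
  rw [hd.eq, Matrix.mul_assoc, charpoly_mul_comm, Matrix.mul_assoc, hd.right, mul_one,
    charpoly_diagonal]

end IsDiag

lemma exists_perm_of_prod_eq {α : Type*} [Fintype α] [DecidableEq α] {f g : α → ℂ}
    (h : ∏ i, (Polynomial.X - Polynomial.C (f i)) = ∏ i, (Polynomial.X - Polynomial.C (g i))) :
    ∃ e : Equiv.Perm α, ∀ i, g (e i) = f i := by
  have h1 : ∀ f : α → ℂ, (∏ i, (Polynomial.X - Polynomial.C (f i))).roots
      = Multiset.map f univ.val := fun f => by
    rw [Polynomial.roots_prod _ _ (prod_ne_zero_iff.2 fun i _ =>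
      Polynomial.X_sub_C_ne_zero _)]
    simp
  have h2 : Multiset.map f univ.val = Multiset.map g univ.val := by
    rw [← h1, ← h1, h]
  have h3 : ∀ (f : α → ℂ) c, card {i // f i = c}
      = (Multiset.map f univ.val).count c := fun f c => by
    rw [Multiset.count_map, Fintype.card_subtype]
    simp only [eq_comm]
    rfl
  have h4 : ∀ c, Nonempty ({i // f i = c} ≃ {i // g i = c}) := fun c =>
    ⟨Fintype.equivOfCardEq (by rw [h3, h3, h2])⟩
  exact ⟨Equiv.ofFiberEquiv fun c => (h4 c).some, fun i => Equiv.ofFiberEquiv_map _ i⟩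

open scoped ComplexOrder in
/-- If `‖P x‖ ≤ c ‖Q x‖` for positive semidefinite `P` and `Q`, then `P ≤ c Q`. -/
lemma form_le_of_norm_le {n : ℕ} {P Q : Matrix (Fin n) (Fin n) ℂ} (hP : P.PosSemidef)
    (hQ : Q.PosSemidef) {c : ℝ} (hc : 0 ≤ c)
    (h : ∀ x, ∑ i, ‖P.mulVec x i‖ ^ 2 ≤ c ^ 2 * ∑ i, ‖Q.mulVec x i‖ ^ 2) (x : Fin n → ℂ) :
    (star x ⬝ᵥ P.mulVec x).re ≤ c * (star x ⬝ᵥ Q.mulVec x).re := by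
  have hR : ((c : ℂ) • Q - P).IsHermitian := by
    refine Matrix.IsHermitian.sub ?_ hP.isHermitian
    rw [Matrix.IsHermitian, conjTranspose_smul, hQ.isHermitian.eq]
    simp
  have key : ((c : ℂ) • Q - P).PosSemidef := by
    rw [hR.posSemidef_iff_eigenvalues_nonneg]
    intro i
    by_contra! hlt
    rw [Pi.zero_apply] at hlt
    set e := hR.eigenvalues i
    set v : Fin n → ℂ := ⇑(hR.eigenvectorBasis i) with hv
    have h1 : ((c : ℂ) • Q - P).mulVec v = (e : ℂ) • v := by
      have := hR.mulVec_eigenvectorBasis i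
      exact this
    have hv0 : v ≠ 0 := by
      have := (hR.eigenvectorBasis).toBasis.ne_zero i
      intro hz
      apply this
      rw [OrthonormalBasis.coe_toBasis]
      ext j
      exact congrFun hz j
    have h2 : P.mulVec v = (c : ℂ) • Q.mulVec v - (e : ℂ) • v := by
      rw [← h1, sub_mulVec, smul_mulVec]; abel
    have h3 := h v
    have h4 : ∀ z : Fin n → ℂ, ∑ i, ‖z i‖ ^ 2 = (star z ⬝ᵥ z).re := fun z => by
      rw [IsDiag.star_dotProduct_self, ofReal_re]
    have h5 : (star (P.mulVec v) ⬝ᵥ P.mulVec v).re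
        = c ^ 2 * (star (Q.mulVec v) ⬝ᵥ Q.mulVec v).re
          - 2 * c * e * (star v ⬝ᵥ Q.mulVec v).re + e ^ 2 * (star v ⬝ᵥ v).re := by
      have h6 : (star (Q.mulVec v) ⬝ᵥ v).re = (star v ⬝ᵥ Q.mulVec v).re := by
        have : star (Q.mulVec v) ⬝ᵥ v = star (star v ⬝ᵥ Q.mulVec v) := by
          rw [star_dotProduct]
        rw [this]
        simp
      rw [h2]
      simp only [star_sub, star_smul, sub_dotProduct, dotProduct_sub, smul_dotProduct,
        dotProduct_smul, smul_eq_mul, RCLike.star_def, conj_ofReal, sub_re,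
        re_ofReal_mul, h6]
      ring
    rw [h4, h4, h5] at h3
    have h7 : 0 ≤ (star v ⬝ᵥ Q.mulVec v).re := (le_def.1 (hQ.dotProduct_mulVec_nonneg v)).1
    have h8 : 0 < (star v ⬝ᵥ v).re := by rw [← h4]; exact IsDiag.norm_sq_pos hv0
    have h9 : 0 ≤ c * -e * (star v ⬝ᵥ Q.mulVec v).re :=
      mul_nonneg (mul_nonneg hc (by linarith)) h7
    have h10 : 0 < e ^ 2 * (star v ⬝ᵥ v).re := by
      have := pow_pos (neg_pos.2 hlt) 2
      rw [neg_sq] at this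
      positivity
    nlinarith
  have := (le_def.1 (key.dotProduct_mulVec_nonneg x)).1
  rw [sub_mulVec, smul_mulVec, dotProduct_sub, dotProduct_smul, smul_eq_mul,
    sub_re, re_ofReal_mul] at this
  simp only [zero_re] at this
  linarith

/-! ### Zeros of the eigenvalues of a family of symmetric matrices -/

lemma sq_norm_le_sum {n : ℕ} (x : Fin n → ℂ) : ‖x‖ ^ 2 ≤ ∑ i, ‖x i‖ ^ 2 := by
  rcases isEmpty_or_nonempty (Fin n) with h | h
  · simp [Subsingleton.elim x 0]
  · obtain ⟨i, hi⟩ := Finite.exists_max fun i => ‖x i‖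
    have h1 : ‖x‖ ≤ ‖x i‖ := (pi_norm_le_iff_of_nonneg (norm_nonneg _)).2 hi
    calc ‖x‖ ^ 2 ≤ ‖x i‖ ^ 2 := by gcongr
      _ ≤ _ := single_le_sum (f := fun i => ‖x i‖ ^ 2) (fun _ _ => by positivity)
        (mem_univ i)

/-- A family of complex symmetric matrices, real for real parameters, that moves approximately like
`-s K`. -/
structure IsSloped {n : ℕ} (F : ℂ → Matrix (Fin n) (Fin n) ℂ) (K C ε δ : ℝ) : Prop where
  symm : ∀ s, ‖s‖ ≤ δ → (F s).transpose = F s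
  conj : ∀ s, ‖s‖ ≤ δ → F (starRingEnd ℂ s) = (F s).map (starRingEnd ℂ)
  slope : ∀ s s', ‖s‖ ≤ δ → ‖s'‖ ≤ δ → ∀ x x' : Fin n → ℂ,
    ‖x' ⬝ᵥ (F s).mulVec x - x' ⬝ᵥ (F s').mulVec x + (s - s') * (K * (x ⬝ᵥ x'))‖
      ≤ C * ‖s - s'‖ * (ε + ‖s‖ + ‖s'‖) * ‖x‖ * ‖x'‖

namespace IsSloped

variable {n : ℕ} {F : ℂ → Matrix (Fin n) (Fin n) ℂ} {K C ε δ : ℝ}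

lemma conjTranspose (h : IsSloped F K C ε δ) {s : ℂ} (hs : ‖s‖ ≤ δ) :
    (F s).conjTranspose = F (starRingEnd ℂ s) := by
  rw [h.conj s hs, Matrix.conjTranspose, h.symm s hs]; rfl

lemma hermitian (h : IsSloped F K C ε δ) {s : ℝ} (hs : |s| ≤ δ) : (F s).IsHermitian := by
  rw [Matrix.IsHermitian, h.conjTranspose (by simpa using hs), conj_ofReal]

lemma slope_star (h : IsSloped F K C ε δ) (hC : 0 ≤ C) (hε : 0 ≤ ε) {s s' : ℂ} (hs : ‖s‖ ≤ δ)
    (hs' : ‖s'‖ ≤ δ) (x : Fin n → ℂ) :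
    ‖star x ⬝ᵥ (F s).mulVec x - star x ⬝ᵥ (F s').mulVec x
        + (s - s') * (K * ((∑ i, ‖x i‖ ^ 2 : ℝ) : ℂ))‖
      ≤ C * ‖s - s'‖ * (ε + ‖s‖ + ‖s'‖) * ∑ i, ‖x i‖ ^ 2 := by
  have h1 := h.slope s s' hs hs' x (star x)
  rw [dotProduct_comm x, IsDiag.star_dotProduct_self, norm_star, mul_assoc _ ‖x‖, ← sq] at h1
  exact h1.trans (mul_le_mul_of_nonneg_left (sq_norm_le_sum x) (by positivity))

lemma shift_le (h : IsSloped F K C ε δ) (hC : 0 ≤ C) (hε : 0 ≤ ε) {s s' : ℝ} (hs : |s| ≤ δ)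
    (hs' : |s'| ≤ δ) {f g : Fin n → ℝ} {U W : Matrix (Fin n) (Fin n) ℂ} (hf : IsDiag (F s) f U)
    (hg : IsDiag (F s') g W) (k : Fin n) :
    f k + ((s - s') * K - C * |s - s'| * (ε + |s| + |s'|)) ≤ g k := by
  refine hf.le_of_form_le hg (f' := fun k => f k + ((s - s') * K - C * |s - s'| * (ε + |s| + |s'|)))
    (hf.mono.add_const _) hg.mono (fun x => ?_) k
  have h1 := h.slope_star hC hε (s := s) (s' := s') (by simpa using hs) (by simpa using hs') x
  rw [hf.form, hg.form] at h1
  norm_cast at h1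
  rw [norm_eq_abs, norm_eq_abs, norm_eq_abs, norm_eq_abs] at h1
  have h2 := (abs_le.1 h1).2
  simp only [add_mul, sum_add_distrib]
  rw [← mul_sum, hf.norm_sq]
  linarith

/-- The eigenvalues move with speed about `-K`. -/
lemma shift (h : IsSloped F K C ε δ) (hC : 0 ≤ C) (hε : 0 ≤ ε) {s s' : ℝ} (hs : |s| ≤ δ)
    (hs' : |s'| ≤ δ) {f g : Fin n → ℝ} {U W : Matrix (Fin n) (Fin n) ℂ} (hf : IsDiag (F s) f U)
    (hg : IsDiag (F s') g W) (k : Fin n) :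
    |f k - g k + (s - s') * K| ≤ C * |s - s'| * (ε + |s| + |s'|) := by
  have h1 := h.shift_le hC hε hs hs' hf hg k
  have h2 := h.shift_le hC hε hs' hs hg hf k
  rw [abs_sub_comm s' s] at h2
  rw [abs_le]
  constructor <;> linarith

/-- For small parameters, the matrix is singular exactly at the zeros of its eigenvalues, which are
real. -/
lemma exists_zeros (h : IsSloped F K C ε δ) (hC : 0 ≤ C) (hε : 0 ≤ ε) (hK : K ≠ 0) (hδ : 0 < δ)
    (hsmall : C * (ε + δ + δ) ≤ |K| / 2) {f : Fin n → ℝ} {U : Matrix (Fin n) (Fin n) ℂ}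
    (hf : IsDiag (F 0) f U) (hf0 : ∀ k, |f k| ≤ |K| * δ / 2) :
    ∃ t : Fin n → ℝ, (∀ k, |t k| ≤ 2 * |f k| / |K| ∧ |t k * K - f k| ≤ C * |t k| * (ε + |t k|)) ∧
      ∀ z : ℂ, ‖z‖ ≤ δ →
        Module.finrank ℂ (LinearMap.ker (F z).mulVecLin) = Nat.card {k // z = t k} := by
  have hKpos : 0 < |K| := abs_pos.2 hK
  have hex : ∀ s : ℝ, ∃ g : Fin n → ℝ, |s| ≤ δ → ∃ W, IsDiag (F s) g W := fun s => by
    by_cases hs : |s| ≤ δ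
    · obtain ⟨g, W, hW⟩ := exists_isDiag (h.hermitian hs)
      exact ⟨g, fun _ => ⟨W, hW⟩⟩
    · exact ⟨0, fun hs' => absurd hs' hs⟩
  choose g hg using hex
  have hshift : ∀ k s s', |s| ≤ δ → |s'| ≤ δ →
      |g s k - g s' k + (s - s') * K| ≤ |K| / 2 * |s - s'| := fun k s s' hs hs' => by
    obtain ⟨W, hW⟩ := hg s hs
    obtain ⟨W', hW'⟩ := hg s' hs'
    refine (h.shift hC hε hs hs' hW hW' k).trans ?_
    have h1 : C * (ε + |s| + |s'|) ≤ |K| / 2 := le_trans (by gcongr) hsmall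
    rw [mul_right_comm]
    gcongr
  have h0δ : |(0 : ℝ)| ≤ δ := by simpa using hδ.le
  have hg0 : ∀ k, g 0 k = f k := fun k => by
    obtain ⟨W, hW⟩ := hg 0 h0δ
    have := h.shift hC hε h0δ h0δ hW (by simpa using hf) k
    simp only [sub_self, abs_zero, zero_mul, mul_zero, add_zero] at this
    linarith [abs_eq_zero.1 (le_antisymm this (abs_nonneg _))]
  -- rescaled eigenvalues with slope between `-3/2` and `-1/2`
  set G : Fin n → ℝ → ℝ := fun k s => g s k / K with hG
  have hGs : ∀ k s s', |s| ≤ δ → |s'| ≤ δ → |G k s - G k s' + (s - s')| ≤ 1 / 2 * |s - s'| :=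
    fun k s s' hs hs' => by
      rw [show G k s - G k s' + (s - s') = (g s k - g s' k + (s - s') * K) / K by
        simp only [hG]; field_simp, abs_div, div_le_iff₀ hKpos]
      linarith [hshift k s s' hs hs']
  have hG0 : ∀ k, |G k 0| ≤ δ / 2 := fun k => by
    simp only [hG]; rw [hg0, abs_div, div_le_iff₀ hKpos]
    linarith [hf0 k]
  have hmem : ∀ s, s ∈ Set.Icc (-δ) δ ↔ |s| ≤ δ := fun s => by rw [abs_le]; rfl
  have hcont : ∀ k, ContinuousOn (G k) (Set.Icc (-δ) δ) := fun k => by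
    refine (LipschitzOnWith.of_dist_le_mul (K := 2) fun s hs s' hs' => ?_).continuousOn
    rw [Real.dist_eq, Real.dist_eq, NNReal.coe_ofNat]
    have h1 := hGs k s s' ((hmem s).1 hs) ((hmem s').1 hs')
    have h2 := abs_sub (G k s - G k s' + (s - s')) (s - s')
    rw [add_sub_cancel_right] at h2
    linarith [abs_nonneg (s - s')]
  have hroot : ∀ k, ∃ s, |s| ≤ δ ∧ G k s = 0 := fun k => by
    have h1 := (abs_le.1 (hGs k δ 0 (abs_of_pos hδ).le h0δ)).2
    have h2 := (abs_le.1 (hGs k (-δ) 0 (by simp [abs_of_pos hδ]) h0δ)).1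
    have h3 := abs_le.1 (hG0 k)
    rw [sub_zero, abs_of_pos hδ] at h1
    rw [sub_zero, abs_neg, abs_of_pos hδ] at h2
    have h4 := intermediate_value_Icc' (by linarith) (hcont k)
    obtain ⟨s, hs, hs0⟩ := h4 (show (0 : ℝ) ∈ _ from ⟨by linarith, by linarith⟩)
    exact ⟨s, (hmem s).1 hs, hs0⟩
  choose t ht ht0 using hroot
  have huniq : ∀ k s, |s| ≤ δ → (g s k = 0 ↔ s = t k) := fun k s hs => by
    rw [show g s k = 0 ↔ G k s = 0 by simp [hG, hK]]
    refine ⟨fun h2 => ?_, fun h2 => by rw [h2]; exact ht0 k⟩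
    have h3 := hGs k s (t k) hs (ht k)
    rw [h2, ht0, sub_zero, zero_add] at h3
    exact sub_eq_zero.1 (abs_eq_zero.1 (by linarith [abs_nonneg (s - t k)]))
  refine ⟨t, fun k => ⟨?_, ?_⟩, fun z hz => ?_⟩
  · have h1 := hGs k (t k) 0 (ht k) h0δ
    rw [ht0, sub_zero, zero_sub] at h1
    have h2 := abs_sub_abs_le_abs_sub (t k) (G k 0)
    rw [neg_add_eq_sub] at h1
    rw [mul_div_assoc, ← abs_div, ← hg0]
    linarith
  · obtain ⟨W, hW⟩ := hg (t k) (ht k)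
    have h1 := h.shift hC hε (ht k) h0δ hW (by simpa using hf) k
    rw [(huniq k _ (ht k)).2 rfl] at h1
    simp only [sub_zero, zero_sub, abs_zero, add_zero] at h1
    rwa [neg_add_eq_sub] at h1
  · by_cases him : z.im = 0
    · obtain ⟨s, rfl⟩ : ∃ s : ℝ, z = s := ⟨z.re, Complex.ext rfl (by simpa using him)⟩
      have hs : |s| ≤ δ := by simpa using hz
      obtain ⟨W, hW⟩ := hg s hs
      rw [hW.finrank_ker]
      refine Nat.card_congr (Equiv.subtypeEquivRight fun k => ?_)
      rw [huniq k s hs]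
      norm_cast
    · rw [Nat.card_eq_zero.2 (.inl ⟨fun ⟨k, hk⟩ => him (by rw [hk]; simp)⟩), Module.finrank_eq_zero_iff_of_free, Submodule.subsingleton_iff_eq_bot,
        LinearMap.ker_eq_bot']
      intro x hx
      rw [mulVecLin_apply] at hx
      by_contra hx0
      have hpos := IsDiag.norm_sq_pos hx0
      have h2 := h.slope_star hC hε hz ((RCLike.norm_conj z).trans_le hz) x
      -- the form at the conjugate parameter vanishes as well
      have h3 : star x ⬝ᵥ (F (starRingEnd ℂ z)).mulVec x = 0 := by
        rw [← h.conjTranspose hz, dotProduct_mulVec, ← star_mulVec, hx, star_zero,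
          zero_dotProduct]
      rw [h3, hx, dotProduct_zero, sub_zero, zero_add, norm_mul, norm_mul, norm_real,
        norm_real, norm_eq_abs, norm_eq_abs, abs_of_pos hpos, RCLike.norm_conj] at h2
      have h4 : 0 < ‖z - starRingEnd ℂ z‖ := by
        rw [norm_pos_iff, sub_conj]
        simp [him]
      have h5 : C * (ε + ‖z‖ + ‖z‖) ≤ |K| / 2 := le_trans (by gcongr) hsmall
      have h6 := mul_pos h4 hpos
      nlinarith [mul_le_mul_of_nonneg_left h5 h6.le, mul_pos hKpos h6]

end IsSloped

/-! ### Eigenvalues of nearly tridiagonal matrices -/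

/-- The differences of neighboring entries. -/
def diff {l : ℕ} (x : Fin (l + 1) → ℂ) (g : Fin l) : ℂ := x g.castSucc - x g.succ

/-- The symmetric tridiagonal matrix of the quadratic form `∑ α g |x g - x (g + 1)|²`. -/
def chainMatrix {l : ℕ} (α : Fin l → ℝ) : Matrix (Fin (l + 1)) (Fin (l + 1)) ℂ :=
  (-symTridiag α).map ofReal

section

variable {l : ℕ}

lemma single_mulVec_dotProduct (i j : Fin (l + 1)) (c : ℝ) (x y : Fin (l + 1) → ℂ) :
    y ⬝ᵥ ((Matrix.single i j c).map ofReal).mulVec x = c * (y i * x j) := by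
  have h : (Matrix.single i j c).map ofReal = Matrix.single i j (c : ℂ) := by
    ext i' j'
    simp only [Matrix.map_apply, Matrix.single_apply]
    split_ifs <;> simp
  rw [h, single_mulVec, ← Pi.single, dotProduct_single]
  ring

lemma chainMatrix_form (α : Fin l → ℝ) (x y : Fin (l + 1) → ℂ) :
    y ⬝ᵥ (chainMatrix α).mulVec x = ∑ g, α g * (diff y g * diff x g) := by
  have h : chainMatrix α = ∑ g : Fin l,
      ((Matrix.single g.castSucc g.castSucc (α g)).map ofReal
      + (Matrix.single g.castSucc g.succ (-α g)).map ofReal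
      + (Matrix.single g.succ g.castSucc (-α g)).map ofReal
      + (Matrix.single g.succ g.succ (α g)).map ofReal) := by
    ext i j
    simp only [chainMatrix, symTridiag, Matrix.map_apply, Matrix.neg_apply, Matrix.sum_apply,
      Matrix.add_apply, ofReal_neg, ofReal_sum, ← sum_neg_distrib]
    refine sum_congr rfl fun g _ => ?_
    simp only [Matrix.single_apply]
    push_cast
    split_ifs <;> simp
  rw [h, sum_mulVec, dotProduct_sum]
  refine sum_congr rfl fun g _ => ?_
  simp only [add_mulVec, dotProduct_add, single_mulVec_dotProduct, diff]
  push_cast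
  ring

lemma symTridiag_transpose (α : Fin l → ℝ) :
    (symTridiag α).transpose = symTridiag α := by
  rw [symTridiag, transpose_sum]
  refine sum_congr rfl fun g _ => ?_
  simp only [transpose_add, transpose_single]
  abel

lemma chainMatrix_isHermitian (α : Fin l → ℝ) : (chainMatrix α).IsHermitian := by
  ext i j
  have := congrFun (congrFun (symTridiag_transpose α) i) j
  rw [transpose_apply] at this
  simp [chainMatrix, conjTranspose_apply, this]

lemma diff_star (x : Fin (l + 1) → ℂ) (g : Fin l) :
    diff (star x) g = starRingEnd ℂ (diff x g) := by simp [diff]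

lemma chainMatrix_form_star (α : Fin l → ℝ) (x : Fin (l + 1) → ℂ) :
    star x ⬝ᵥ (chainMatrix α).mulVec x = ((∑ g, α g * ‖diff x g‖ ^ 2 : ℝ) : ℂ) := by
  rw [chainMatrix_form]
  push_cast
  refine sum_congr rfl fun g _ => ?_
  rw [diff_star, ← mul_conj', mul_comm (diff x g)]

/-- Indicator of the copies to the left of a gap. -/
def leftOf (g : Fin l) : Fin (l + 1) → ℂ := fun i => if i ≤ g.castSucc then 1 else 0

lemma sum_diff (x : Fin (l + 1) → ℂ) (i : Fin (l + 1)) :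
    x i = ∑ g, diff x g * leftOf g i + x (Fin.last l) := by
  induction i using Fin.reverseInduction with
  | last =>
    have h : ∀ g : Fin l, leftOf g (Fin.last l) = 0 := fun g => by
      simp [leftOf, (Fin.castSucc_lt_last g).not_ge]
    simp [h]
  | cast j ih =>
    have h : ∀ g : Fin l, diff x g * leftOf g j.castSucc
        = diff x g * leftOf g j.succ + if g = j then diff x j else 0 := fun g => by
      simp only [leftOf, Fin.castSucc_le_castSucc_iff, ← Fin.castSucc_lt_iff_succ_le,
        Fin.castSucc_lt_castSucc_iff]
      rcases lt_trichotomy g j with h | h | h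
      · simp [h.not_ge, h.not_gt, h.ne]
      · subst h; simp
      · simp [h, h.le, h.ne']
    simp only [h, sum_add_distrib, sum_ite_eq', mem_univ, if_true]
    rw [add_right_comm, ← ih, diff]
    ring

lemma diff_leftOf (g h : Fin l) : diff (leftOf g) h = if h = g then 1 else 0 := by
  simp only [diff, leftOf, Fin.castSucc_le_castSucc_iff, ← Fin.castSucc_lt_iff_succ_le,
    Fin.castSucc_lt_castSucc_iff]
  rcases lt_trichotomy h g with h' | h' | h'
  · simp [h', h'.le, h'.ne]
  · subst h'; simp
  · simp [h'.not_ge, h'.not_gt, h'.ne']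

lemma sum_norm_diff_sq_le (x : Fin (l + 1) → ℂ) :
    ∑ g, ‖diff x g‖ ^ 2 ≤ 4 * ∑ i, ‖x i‖ ^ 2 := by
  have h1 : ∀ g : Fin l, ‖diff x g‖ ^ 2 ≤ 2 * ‖x g.castSucc‖ ^ 2 + 2 * ‖x g.succ‖ ^ 2 := fun g => by
    have h2 : ‖diff x g‖ ^ 2 ≤ (‖x g.castSucc‖ + ‖x g.succ‖) ^ 2 := by
      exact pow_le_pow_left₀ (norm_nonneg _) (norm_sub_le (x g.castSucc) (x g.succ)) 2
    nlinarith [sq_nonneg (‖x g.castSucc‖ - ‖x g.succ‖)]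
  refine (sum_le_sum fun g _ => h1 g).trans ?_
  rw [sum_add_distrib, ← mul_sum, ← mul_sum]
  have h2 := Fin.sum_univ_castSucc fun i => ‖x i‖ ^ 2
  have h3 := Fin.sum_univ_succ fun i => ‖x i‖ ^ 2
  nlinarith [sq_nonneg ‖x 0‖]

lemma norm_sub_last_le (x : Fin (l + 1) → ℂ) :
    ‖x - x (Fin.last l) • (1 : Fin (l + 1) → ℂ)‖ ≤ ∑ g, ‖diff x g‖ := by
  refine (pi_norm_le_iff_of_nonneg (sum_nonneg fun _ _ => norm_nonneg _)).2 fun i => ?_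
  rw [Pi.sub_apply, Pi.smul_apply, Pi.one_apply, smul_eq_mul, mul_one, sum_diff x i,
    add_sub_cancel_right]
  refine norm_sum_le_of_le _ fun g _ => ?_
  rw [norm_mul]
  exact mul_le_of_le_one_right (norm_nonneg _) (by unfold leftOf; split_ifs <;> simp)

/-- If testing with the indicators of the left copies nearly reproduces the tridiagonal matrix,
then the quadratic form is close to the tridiagonal one, with an error that only involves
differences. -/
lemma form_sub_chain_le {E : Matrix (Fin (l + 1)) (Fin (l + 1)) ℂ} (hsym : E.transpose = E)
    (hone : E.mulVec 1 = 0) {α b : Fin l → ℝ}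
    (hgap : ∀ g (y : Fin (l + 1) → ℂ), ‖y‖ ≤ 1 →
      ‖leftOf g ⬝ᵥ E.mulVec y - diff y g * α g‖ ≤ b g) (x : Fin (l + 1) → ℂ) :
    ‖star x ⬝ᵥ E.mulVec x - ((∑ g, α g * ‖diff x g‖ ^ 2 : ℝ) : ℂ)‖
      ≤ ∑ g, ‖diff x g‖ * (b g * ∑ h, ‖diff x h‖) := by
  have hgap' : ∀ g (y : Fin (l + 1) → ℂ),
      ‖leftOf g ⬝ᵥ E.mulVec y - diff y g * α g‖ ≤ b g * ‖y‖ := fun g y => by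
    rcases eq_or_ne y 0 with rfl | hy
    · simp [diff]
    · have hy' := norm_pos_iff.2 hy
      have h1 := hgap g (((‖y‖ : ℝ) : ℂ)⁻¹ • y) (by
        rw [norm_smul, norm_inv, norm_real, norm_norm, inv_mul_cancel₀ hy'.ne'])
      have h2 : leftOf g ⬝ᵥ E.mulVec (((‖y‖ : ℝ) : ℂ)⁻¹ • y)
          - diff (((‖y‖ : ℝ) : ℂ)⁻¹ • y) g * α g
          = ((‖y‖ : ℝ) : ℂ)⁻¹ * (leftOf g ⬝ᵥ E.mulVec y - diff y g * α g) := by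
        rw [mulVec_smul, dotProduct_smul]
        simp only [diff, Pi.smul_apply, smul_eq_mul]
        ring
      rwa [h2, norm_mul, norm_inv, norm_real, norm_norm, inv_mul_le_iff₀ hy', mul_comm ‖y‖] at h1
  have h1x : ∀ y, 1 ⬝ᵥ E.mulVec y = 0 := fun y => by
    rw [dotProduct_mulVec, ← mulVec_transpose, hsym, hone, zero_dotProduct]
  set S := ∑ h, ‖diff x h‖ with hS
  set x' := x - x (Fin.last l) • (1 : Fin (l + 1) → ℂ) with hx'
  have hEx : E.mulVec x' = E.mulVec x := by
    rw [hx', mulVec_sub, mulVec_smul, hone, smul_zero, sub_zero]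
  have h2 : star x ⬝ᵥ E.mulVec x = ∑ g, starRingEnd ℂ (diff x g) * (leftOf g ⬝ᵥ E.mulVec x) := by
    have h3 : star x = ∑ g, starRingEnd ℂ (diff x g) • leftOf g
        + starRingEnd ℂ (x (Fin.last l)) • (1 : Fin (l + 1) → ℂ) := by
      funext i
      simp only [Pi.add_apply, Finset.sum_apply, Pi.smul_apply, smul_eq_mul, Pi.one_apply, mul_one]
      simpa only [diff_star, Pi.star_apply, RCLike.star_def] using (sum_diff (star x) i)
    rw [h3, add_dotProduct, sum_dotProduct, smul_dotProduct, h1x, smul_zero, add_zero]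
    exact sum_congr rfl fun g _ => by rw [smul_dotProduct, smul_eq_mul]
  have h3 : star x ⬝ᵥ E.mulVec x - ((∑ g, α g * ‖diff x g‖ ^ 2 : ℝ) : ℂ)
      = ∑ g, starRingEnd ℂ (diff x g) * (leftOf g ⬝ᵥ E.mulVec x' - diff x' g * α g) := by
    rw [h2, ofReal_sum, ← sum_sub_distrib]
    refine sum_congr rfl fun g _ => ?_
    rw [hEx, (fun g => by simp [diff, hx'] : ∀ g, diff x' g = diff x g), ofReal_mul, ofReal_pow, ← mul_conj']
    ring
  rw [h3]
  refine norm_sum_le_of_le _ fun g _ => ?_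
  rw [norm_mul, RCLike.norm_conj]
  refine mul_le_mul_of_nonneg_left ((hgap' g x').trans ?_) (norm_nonneg _)
  exact mul_le_mul_of_nonneg_left (norm_sub_last_le x) ((norm_nonneg _).trans (hgap g 0 (by simp)))

lemma sum_cross_le {a T : Fin l → ℝ} {t c X : ℝ} (ha : ∀ g, 0 ≤ a g)
    (ht : 0 < t) (ht1 : t ≤ 1) (hc : 0 ≤ c) (hX : ∑ g, a g ^ 2 ≤ 4 * X) :
    ∑ g, a g * (c * t ^ 12 * (T g + t ^ 12) * ∑ h, a h)
      ≤ c * l * (t ^ 6 * ∑ g, T g ^ 2 * a g ^ 2) + c * l * 8 * t ^ 18 * X := by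
  have h1 : ∀ g h, a g * (c * t ^ 12 * (T g + t ^ 12) * a h)
      ≤ c * (t ^ 6 * (T g ^ 2 * a g ^ 2)) + c * t ^ 18 * (a g ^ 2 + a h ^ 2) := fun g h => by
    have h2 : t ^ 24 ≤ t ^ 18 := pow_le_pow_of_le_one ht.le ht1 (by norm_num)
    have h3 : a g * a h ≤ (a g ^ 2 + a h ^ 2) / 2 := by nlinarith [sq_nonneg (a g - a h)]
    have h4 : t ^ 12 * (T g * a g) * a h ≤ t ^ 6 * (T g ^ 2 * a g ^ 2) / 2 + t ^ 18 * a h ^ 2 / 2 := by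
      nlinarith [mul_nonneg (pow_nonneg ht.le 6) (sq_nonneg (T g * a g - t ^ 6 * a h))]
    have h5 :=
      mul_le_mul h2 h3 (mul_nonneg (ha g) (ha h)) (by positivity)
    have h6 : 0 ≤ t ^ 6 * (T g ^ 2 * a g ^ 2) := by positivity
    have h7 : 0 ≤ t ^ 18 * a g ^ 2 := by positivity
    calc _ = c * (t ^ 12 * (T g * a g) * a h + t ^ 24 * (a g * a h)) := by ring
      _ ≤ c * (t ^ 6 * (T g ^ 2 * a g ^ 2) + t ^ 18 * (a g ^ 2 + a h ^ 2)) :=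
        mul_le_mul_of_nonneg_left (by nlinarith) hc
      _ = _ := by ring
  calc _ = ∑ g, ∑ h, a g * (c * t ^ 12 * (T g + t ^ 12) * a h) := by
        simp only [mul_sum]
    _ ≤ ∑ g, ∑ h, (c * (t ^ 6 * (T g ^ 2 * a g ^ 2)) + c * t ^ 18 * (a g ^ 2 + a h ^ 2)) :=
        sum_le_sum fun g _ => sum_le_sum fun h _ => h1 g h
    _ = c * l * (t ^ 6 * ∑ g, T g ^ 2 * a g ^ 2) + c * l * 2 * t ^ 18 * ∑ g, a g ^ 2 := by
        simp only [sum_add_distrib, sum_const, card_univ, Fintype.card_fin,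
          nsmul_eq_mul, ← mul_sum]
        ring
    _ ≤ _ := by
        have : 0 ≤ c * l * 2 * t ^ 18 := by positivity
        nlinarith

end

lemma norm_sq_mulVec {n : ℕ} {U : Matrix (Fin n) (Fin n) ℂ} (hU : U.conjTranspose * U = 1)
    (x : Fin n → ℂ) : ∑ i, ‖U.mulVec x i‖ ^ 2 = ∑ i, ‖x i‖ ^ 2 := by
  have h := IsDiag.form_gen U (fun _ => 1) x
  simp only [ofReal_one, diagonal_one, mul_one, hU, one_mulVec,
    one_mul, IsDiag.star_dotProduct_self] at h
  exact_mod_cast h.symm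

namespace IsDiag

variable {n : ℕ} {A : Matrix (Fin n) (Fin n) ℂ} {f : Fin n → ℝ} {U : Matrix (Fin n) (Fin n) ℂ}

lemma norm_sq_fun (hd : IsDiag A f U) (h : Fin n → ℝ) (x : Fin n → ℂ) :
    ∑ i, ‖(U.conjTranspose * diagonal (fun i => (h i : ℂ)) * U).mulVec x i‖ ^ 2
      = ∑ i, h i ^ 2 * ‖U.mulVec x i‖ ^ 2 := by
  rw [← mulVec_mulVec, ← mulVec_mulVec, norm_sq_mulVec (by
    rw [conjTranspose_conjTranspose, hd.right])]
  refine sum_congr rfl fun i _ => ?_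
  rw [mulVec_diagonal, norm_mul, mul_pow, norm_real, norm_eq_abs, sq_abs]

lemma abs_le_of_form (hd : IsDiag A f U) {B : ℝ}
    (h : ∀ x, |∑ i, f i * ‖U.mulVec x i‖ ^ 2| ≤ B * ∑ i, ‖x i‖ ^ 2) (k : Fin n) : |f k| ≤ B := by
  rw [abs_le]
  constructor
  · refine hd.le_of_form_le hd (f' := fun _ => -B) monotone_const hd.mono (fun x => ?_) k
    rw [← mul_sum, hd.norm_sq]
    linarith [(abs_le.1 (h x)).1]
  · refine hd.le_of_form_le hd (g' := fun _ => B) hd.mono monotone_const (fun x => ?_) k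
    rw [← mul_sum, hd.norm_sq]
    linarith [(abs_le.1 (h x)).2]

end IsDiag

section

variable {l : ℕ}

lemma sum_sq_chain_le (α : Fin l → ℝ) (x : Fin (l + 1) → ℂ) :
    ∑ i, ‖(chainMatrix α).mulVec x i‖ ^ 2 ≤ 4 * ∑ g, α g ^ 2 * ‖diff x g‖ ^ 2 := by
  set z := (chainMatrix α).mulVec x with hz
  have h1 := chainMatrix_form α x (star z)
  rw [← hz, IsDiag.star_dotProduct_self] at h1
  have h2 : ∑ i, ‖z i‖ ^ 2 ≤ ∑ g, ‖diff z g‖ * (|α g| * ‖diff x g‖) := by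
    have h3 := congrArg norm h1
    rw [norm_real, norm_eq_abs, abs_of_nonneg (by positivity)] at h3
    rw [h3]
    refine norm_sum_le_of_le _ fun g _ => ?_
    rw [norm_mul, norm_mul, diff_star, RCLike.norm_conj, norm_real, norm_eq_abs]
    exact le_of_eq (by ring)
  have h3 : ∑ g, ‖diff z g‖ * (|α g| * ‖diff x g‖)
      ≤ ∑ g, (‖diff z g‖ ^ 2 / 8 + 2 * (α g ^ 2 * ‖diff x g‖ ^ 2)) :=
    sum_le_sum fun g _ => by
      rw [(show α g ^ 2 * ‖diff x g‖ ^ 2 = (|α g| * ‖diff x g‖) ^ 2 by rw [mul_pow, sq_abs])]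
      nlinarith [sq_nonneg (‖diff z g‖ - 4 * (|α g| * ‖diff x g‖))]
  rw [sum_add_distrib, ← mul_sum, ← sum_div] at h3
  have h4 := sum_norm_diff_sq_le z
  linarith

lemma sum_sq_le_chain (α : Fin l → ℝ) (x : Fin (l + 1) → ℂ) :
    ∑ g, α g ^ 2 * ‖diff x g‖ ^ 2
      ≤ l * (l + 1) * ∑ i, ‖(chainMatrix α).mulVec x i‖ ^ 2 := by
  set z := (chainMatrix α).mulVec x with hz
  have h1 := fun g => by
    have h2 := chainMatrix_form α x (leftOf g)
    simp only [diff_leftOf, ← hz] at h2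
    simp only [ite_mul, one_mul, zero_mul, mul_ite, mul_zero, sum_ite_eq', mem_univ,
      if_true] at h2
    have h3 : |α g| * ‖diff x g‖ ≤ ∑ i, ‖z i‖ := by
      have h4 := congrArg norm h2
      rw [norm_mul, norm_real, norm_eq_abs] at h4
      rw [← h4]
      refine norm_sum_le_of_le _ fun i _ => ?_
      rw [norm_mul]
      exact mul_le_of_le_one_left (norm_nonneg _) (by unfold leftOf; split_ifs <;> simp)
    have h5 : (∑ i, ‖z i‖) ^ 2 ≤ (l + 1 : ℝ) * ∑ i, ‖z i‖ ^ 2 := by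
      simpa using (sq_sum_le_card_mul_sum_sq (s := univ) (f := fun i => ‖z i‖))
    calc α g ^ 2 * ‖diff x g‖ ^ 2 = (|α g| * ‖diff x g‖) ^ 2 := by rw [mul_pow, sq_abs]
      _ ≤ (∑ i, ‖z i‖) ^ 2 := by gcongr
      _ ≤ _ := h5
  calc _ ≤ ∑ _g : Fin l, (l + 1 : ℝ) * ∑ i, ‖z i‖ ^ 2 := sum_le_sum fun g _ => h1 g
    _ = _ := by rw [sum_const, card_univ, Fintype.card_fin, nsmul_eq_mul, mul_assoc]

open scoped ComplexOrder in
/-- The form with the coefficients `|α|` is dominated by the absolute value of the tridiagonal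
matrix with coefficients `α`. -/
lemma sum_abs_le {α : Fin l → ℝ} {f : Fin (l + 1) → ℝ}
    {U : Matrix (Fin (l + 1)) (Fin (l + 1)) ℂ} (hd : IsDiag (chainMatrix α) f U)
    (x : Fin (l + 1) → ℂ) :
    ∑ g, |α g| * ‖diff x g‖ ^ 2 ≤ 2 * (l + 1) * ∑ i, |f i| * ‖U.mulVec x i‖ ^ 2 := by
  have hP : (chainMatrix fun g => |α g|).PosSemidef := by
    refine Matrix.PosSemidef.of_dotProduct_mulVec_nonneg (chainMatrix_isHermitian _) fun x => ?_
    rw [chainMatrix_form_star]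
    exact zero_le_real.2 (sum_nonneg fun _ _ => by positivity)
  have hQ : (U.conjTranspose * diagonal (fun i => ((|f i| : ℝ) : ℂ)) * U).PosSemidef := by
    refine Matrix.PosSemidef.conjTranspose_mul_mul_same ?_ U
    rw [posSemidef_diagonal_iff]
    exact fun i => zero_le_real.2 (abs_nonneg _)
  have h := form_le_of_norm_le hP hQ (c := 2 * (l + 1)) (by positivity) (fun x => ?_) x
  · rwa [chainMatrix_form_star, IsDiag.form_gen, ofReal_re, ofReal_re] at h
  · have h1 := sum_sq_chain_le (fun g => |α g|) x
    have h2 := sum_sq_le_chain α x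
    have h3 := hd.norm_sq_fun (fun i => |f i|) x
    have h4 := hd.norm_sq_fun f x
    rw [← hd.eq] at h4
    simp only [sq_abs] at h1 h3
    rw [h3, ← h4]
    set Z := ∑ i, ‖(chainMatrix α).mulVec x i‖ ^ 2
    have hZ : 0 ≤ Z := by positivity
    nlinarith

/-- Relative perturbation of the eigenvalues: a perturbation of the form that is small compared
with `∑ |α g| |x g - x (g + 1)|²` changes the eigenvalues by a small fraction. -/
lemma eigenvalue_close {E : Matrix (Fin (l + 1)) (Fin (l + 1)) ℂ} {α : Fin l → ℝ}
    {f μ : Fin (l + 1) → ℝ} {U W : Matrix (Fin (l + 1)) (Fin (l + 1)) ℂ} (hf : IsDiag E f U)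
    (hμ : IsDiag (chainMatrix α) μ W) {a e : ℝ} (ha : 0 ≤ a) (ha1 : a * (2 * (l + 1)) ≤ 1)
    (h : ∀ x, |∑ i, f i * ‖U.mulVec x i‖ ^ 2 - ∑ g, α g * ‖diff x g‖ ^ 2|
      ≤ a * ∑ g, |α g| * ‖diff x g‖ ^ 2 + e * ∑ i, ‖x i‖ ^ 2) (k : Fin (l + 1)) :
    |f k - μ k| ≤ a * (2 * (l + 1)) * |μ k| + e := by
  set b := a * (2 * (l + 1)) with hb
  have hb0 : 0 ≤ b := by positivity
  have h1 := fun x => by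
    have := hμ.form x
    rw [chainMatrix_form_star] at this
    exact_mod_cast this
  have h2 : ∀ x, |∑ i, f i * ‖U.mulVec x i‖ ^ 2 - ∑ i, μ i * ‖W.mulVec x i‖ ^ 2|
      ≤ ∑ i, (b * |μ i| + e) * ‖W.mulVec x i‖ ^ 2 := fun x => by
    rw [← h1]
    refine (h x).trans ?_
    have h3 := mul_le_mul_of_nonneg_left (sum_abs_le hμ x) ha
    simp only [add_mul, sum_add_distrib, mul_assoc, ← mul_sum]
    rw [hμ.norm_sq]
    linarith
  have hsgn : ∀ s : ℝ, |s| ≤ b → Monotone fun r : ℝ => r + s * |r| := fun s hs r r' hr => by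
    have h4 : |s * (|r| - |r'|)| ≤ 1 * |r - r'| := by
      rw [abs_mul]
      exact mul_le_mul (hs.trans ha1) (abs_abs_sub_abs_le_abs_sub r r') (abs_nonneg _) zero_le_one
    rw [abs_sub_comm r r', abs_of_nonneg (sub_nonneg.2 hr), one_mul] at h4
    have := (abs_le.1 h4).2
    dsimp only
    linarith
  rw [abs_le]
  constructor
  · have h3 : μ k + -b * |μ k| + -e ≤ f k := by
      refine hμ.le_of_form_le hf (f' := fun i => μ i + -b * |μ i| + -e)
        (((hsgn (-b) (by rw [abs_neg, abs_of_nonneg hb0])).comp hμ.mono).add_const _)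
        hf.mono (fun x => ?_) k
      have h4 := (abs_le.1 (h2 x)).1
      simp only [add_mul, sum_add_distrib, neg_mul, sum_neg_distrib] at h4 ⊢
      linarith
    linarith
  · have h3 : f k ≤ μ k + b * |μ k| + e := by
      refine hf.le_of_form_le hμ (g' := fun i => μ i + b * |μ i| + e) hf.mono
        (((hsgn b (by rw [abs_of_nonneg hb0])).comp hμ.mono).add_const _) (fun x => ?_) k
      have h4 := (abs_le.1 (h2 x)).2
      simp only [add_mul, sum_add_distrib] at h4 ⊢
      linarith
    linarith

end

/-! ### The principal square root -/

lemma csqrt_re (x : ℝ) : (csqrt x).re = √x := by simp [csqrt]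

lemma csqrt_im (x : ℝ) : (csqrt x).im = √(-x) := by simp [csqrt]

lemma csqrt_zero : csqrt 0 = 0 := by simp [csqrt]

lemma csqrt_sq (x : ℝ) : csqrt x ^ 2 = x := by
  refine Complex.ext ?_ ?_
  · rw [sq, mul_re, csqrt_re, csqrt_im, ofReal_re]
    rcases le_total 0 x with h | h
    · rw [mul_self_sqrt h, sqrt_eq_zero_of_nonpos (neg_nonpos.2 h)]; ring
    · rw [mul_self_sqrt (neg_nonneg.2 h), sqrt_eq_zero_of_nonpos h]; ring
  · rw [sq, mul_im, csqrt_re, csqrt_im, ofReal_im]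
    rcases le_total 0 x with h | h
    · rw [sqrt_eq_zero_of_nonpos (neg_nonpos.2 h)]; ring
    · rw [sqrt_eq_zero_of_nonpos h]; ring

lemma csqrt_re_or_im (x : ℝ) : (csqrt x).re = 0 ∨ (csqrt x).im = 0 := by
  rw [csqrt_re, csqrt_im]
  rcases le_total 0 x with h | h
  · exact Or.inr (sqrt_eq_zero_of_nonpos (neg_nonpos.2 h))
  · exact Or.inl (sqrt_eq_zero_of_nonpos h)

lemma norm_csqrt_sq (x : ℝ) : ‖csqrt x‖ ^ 2 = |x| := by
  rw [← norm_pow, csqrt_sq, norm_real, norm_eq_abs]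

lemma norm_csqrt_add_sq (a b : ℝ) :
    ‖csqrt a + csqrt b‖ ^ 2 = (√a + √b) ^ 2 + (√(-a) + √(-b)) ^ 2 := by
  rw [← normSq_eq_norm_sq, normSq_apply, add_re, add_im, csqrt_re,
    csqrt_re, csqrt_im, csqrt_im]
  ring

lemma norm_csqrt_sub_sq (a b : ℝ) :
    ‖csqrt a - csqrt b‖ ^ 2 = (√a - √b) ^ 2 + (√(-a) - √(-b)) ^ 2 := by
  rw [← normSq_eq_norm_sq, normSq_apply, sub_re, sub_im, csqrt_re,
    csqrt_re, csqrt_im, csqrt_im]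
  ring

lemma csqrt_sub_mul_add (a b : ℝ) :
    ‖csqrt a - csqrt b‖ * ‖csqrt a + csqrt b‖ = |a - b| := by
  rw [← norm_mul, ← norm_eq_abs, ← norm_real]
  congr 1
  push_cast
  rw [← csqrt_sq a, ← csqrt_sq b]
  ring

lemma csqrt_sub_sq_le (a b : ℝ) : ‖csqrt a - csqrt b‖ ^ 2 ≤ |a - b| := by
  have h : ‖csqrt a - csqrt b‖ ≤ ‖csqrt a + csqrt b‖ := by
    refine (sq_le_sq₀ (norm_nonneg _) (norm_nonneg _)).1 ?_
    rw [norm_csqrt_add_sq, norm_csqrt_sub_sq]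
    have h1 := mul_nonneg (sqrt_nonneg a) (sqrt_nonneg b)
    have h2 := mul_nonneg (sqrt_nonneg (-a)) (sqrt_nonneg (-b))
    nlinarith
  calc _ = ‖csqrt a - csqrt b‖ * ‖csqrt a - csqrt b‖ := sq _
    _ ≤ ‖csqrt a - csqrt b‖ * ‖csqrt a + csqrt b‖ := mul_le_mul_of_nonneg_left h (norm_nonneg _)
    _ = _ := csqrt_sub_mul_add a b

lemma csqrt_sub_sq_mul_le (a b : ℝ) :
    ‖csqrt a - csqrt b‖ ^ 2 * (|a| + |b|) ≤ |a - b| ^ 2 := by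
  have h : |a| + |b| ≤ ‖csqrt a + csqrt b‖ ^ 2 := by
    rw [← norm_csqrt_sq a, ← norm_csqrt_sq b, norm_csqrt_add_sq, ← normSq_eq_norm_sq,
      ← normSq_eq_norm_sq, normSq_apply, normSq_apply, csqrt_re, csqrt_re,
      csqrt_im, csqrt_im]
    have h1 := mul_nonneg (sqrt_nonneg a) (sqrt_nonneg b)
    have h2 := mul_nonneg (sqrt_nonneg (-a)) (sqrt_nonneg (-b))
    nlinarith
  rw [← csqrt_sub_mul_add, mul_pow]
  exact mul_le_mul_of_nonneg_left h (by positivity)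

/-- A relative error of order `t ^ 6` and an absolute error of order `t ^ 18` in numbers of order
`t ^ 8` give an error of order `t ^ 9` in their square roots. -/
lemma csqrt_close {a b t E₀ E₁ E₂ : ℝ} (ht : 0 < t) (ht1 : t ≤ 1) (hE₁ : 0 ≤ E₁)
    (hE₂ : 0 ≤ E₂) (h0 : |a| + |b| ≤ E₀ * t ^ 8)
    (h : |a - b| ≤ E₁ * t ^ 6 * (|a| + |b|) + E₂ * t ^ 18) :
    ‖csqrt a - csqrt b‖ ^ 2 ≤ (2 * E₂ + 4 * E₁ ^ 2 * E₀) * t ^ 18 := by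
  have hm : 0 ≤ |a| + |b| := by positivity
  have hE₀ : 0 ≤ E₀ := by
    have := hm.trans h0
    exact nonneg_of_mul_nonneg_left this (by positivity)
  have h20 : t ^ 20 ≤ t ^ 18 := pow_le_pow_of_le_one ht.le ht1 (by norm_num)
  rcases le_total (E₁ * t ^ 6 * (|a| + |b|)) (E₂ * t ^ 18) with h1 | h1
  · have h2 := csqrt_sub_sq_le a b
    have h3 : 0 ≤ 4 * E₁ ^ 2 * E₀ * t ^ 18 := by positivity
    nlinarith
  · have h2 := csqrt_sub_sq_mul_le a b
    have h3 : |a - b| ^ 2 ≤ (2 * (E₁ * t ^ 6 * (|a| + |b|))) ^ 2 :=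
      pow_le_pow_left₀ (abs_nonneg _) (by linarith) 2
    have h4 : ‖csqrt a - csqrt b‖ ^ 2 ≤ 4 * E₁ ^ 2 * t ^ 12 * (|a| + |b|) := by
      rcases hm.eq_or_lt with h5 | h5
      · rw [← h5, mul_zero]
        have ha : a = 0 := by
          have := abs_nonneg b; have := abs_nonneg a; exact abs_eq_zero.1 (by linarith)
        have hb : b = 0 := by
          have := abs_nonneg b; have := abs_nonneg a; exact abs_eq_zero.1 (by linarith)
        simp [ha, hb]
      · refine le_of_mul_le_mul_right ?_ h5
        calc _ ≤ _ := h2.trans h3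
          _ = _ := by ring
    calc _ ≤ 4 * E₁ ^ 2 * t ^ 12 * (E₀ * t ^ 8) :=
          h4.trans (mul_le_mul_of_nonneg_left h0 (by positivity))
      _ = 4 * E₁ ^ 2 * E₀ * t ^ 20 := by ring
      _ ≤ 4 * E₁ ^ 2 * E₀ * t ^ 18 := mul_le_mul_of_nonneg_left h20 (by positivity)
      _ ≤ _ := by
        have : 0 ≤ 2 * E₂ * t ^ 18 := by positivity
        nlinarith

/-! ### Small eigenvalues of the reduced family -/

lemma abs_form_le {l : ℕ} {α : Fin l → ℝ} {B : ℝ} (h : ∀ g, |α g| ≤ B) (hB : 0 ≤ B)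
    (x : Fin (l + 1) → ℂ) : |∑ g, α g * ‖diff x g‖ ^ 2| ≤ 4 * B * ∑ i, ‖x i‖ ^ 2 := by
  calc _ ≤ ∑ g, B * ‖diff x g‖ ^ 2 := by
        refine (abs_sum_le_sum_abs _ _).trans (sum_le_sum fun g _ => ?_)
        rw [abs_mul, abs_of_nonneg (sq_nonneg ‖diff x g‖)]
        exact mul_le_mul_of_nonneg_right (h g) (by positivity)
    _ = B * ∑ g, ‖diff x g‖ ^ 2 := by rw [mul_sum]
    _ ≤ B * (4 * ∑ i, ‖x i‖ ^ 2) := mul_le_mul_of_nonneg_left (sum_norm_diff_sq_le x) hB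
    _ = _ := by ring

/-- The eigenvalues of the tridiagonal matrix, matched with given roots of the characteristic
polynomial. -/
lemma exists_matching {l : ℕ} {d : ℝ} (hd : 0 < d) {b : Fin l → ℝ} {μ : Fin l → ℝ}
    (hμ : (symTridiag b).charpoly
      = Polynomial.X * ∏ j, (Polynomial.X - Polynomial.C (μ j)))
    {m : Fin (l + 1) → ℝ} {W : Matrix (Fin (l + 1)) (Fin (l + 1)) ℂ}
    (hm : IsDiag (chainMatrix fun g => d * b g) m W) :
    ∃ e : Equiv.Perm (Fin (l + 1)), m (e 0) = 0 ∧ ∀ j : Fin l, m (e j.succ) = -(d * μ j) := by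
  have h1 : (symTridiag b).map (ofRealHom)
      = W.conjTranspose * diagonal (fun i => ((-(m i / d) : ℝ) : ℂ)) * W := by
    have h2 : chainMatrix (fun g => d * b g)
        = (-(d : ℂ)) • (symTridiag b).map (ofRealHom) := by
      ext i j
      simp only [chainMatrix, symTridiag, Matrix.map_apply, Matrix.neg_apply,
        Matrix.smul_apply, Matrix.sum_apply, Matrix.add_apply, ofRealHom_eq_coe,
        smul_eq_mul]
      push_cast
      rw [mul_sum, ← sum_neg_distrib]
      refine sum_congr rfl fun g _ => ?_
      simp only [Matrix.single_apply]
      split_ifs <;> (push_cast; ring)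
    have h3 : diagonal (fun i => ((-(m i / d) : ℝ) : ℂ))
        = (-(d : ℂ))⁻¹ • diagonal (fun i => (m i : ℂ)) := by
      rw [← diagonal_smul]
      congr 1
      funext i
      simp only [Pi.smul_apply, smul_eq_mul]
      push_cast
      rw [inv_neg]
      ring
    have h4 := hm.eq
    rw [h2] at h4
    have hd' : -(d : ℂ) ≠ 0 := by simpa using hd.ne'
    rw [h3, Matrix.mul_smul, Matrix.smul_mul, ← h4, smul_smul, inv_mul_cancel₀ hd', one_smul]
  have h2 := congrArg charpoly h1
  rw [charpoly_map, hμ, Matrix.mul_assoc, charpoly_mul_comm, Matrix.mul_assoc,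
    hm.right, mul_one, charpoly_diagonal] at h2
  have h3 : ∏ i, (Polynomial.X - Polynomial.C ((Fin.cons 0 μ : Fin (l + 1) → ℝ) i : ℂ))
      = ∏ i, (Polynomial.X - Polynomial.C ((-(m i / d) : ℝ) : ℂ)) := by
    rw [← h2, Fin.prod_univ_succ]
    simp [Polynomial.map_prod]
  obtain ⟨e, he⟩ := exists_perm_of_prod_eq h3
  refine ⟨e, ?_, fun j => ?_⟩
  · have := he 0
    rw [Fin.cons_zero] at this
    have h4 : -(m (e 0) / d) = 0 := by exact_mod_cast this
    have h5 : m (e 0) / d = 0 := by linarith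
    exact (div_eq_zero_iff.1 h5).resolve_right hd.ne'
  · have := he j.succ
    rw [Fin.cons_succ] at this
    have h4 : -(m (e j.succ) / d) = μ j := by exact_mod_cast this
    rw [← h4]
    field_simp

lemma card_sq_eq {l : ℕ} {s : Fin (l + 1) → ℝ} (h0 : s 0 = 0) (z : ℂ) :
    Nat.card {k // z ^ 2 = s k} = (if z = 0 then 1 else 0)
      + Nat.card {j : Fin l // z = csqrt (s j.succ) ∨ z = -csqrt (s j.succ)} := by
  classical
  have h1 : Nat.card {j : Fin l // z = csqrt (s j.succ) ∨ z = -csqrt (s j.succ)}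
      = Nat.card {j : Fin l // z ^ 2 = s j.succ} :=
    Nat.card_congr (Equiv.subtypeEquivRight fun j => by
      rw [← csqrt_sq, sq_eq_sq_iff_eq_or_eq_neg])
  rw [h1, Nat.card_eq_fintype_card, Nat.card_eq_fintype_card, Fintype.card_subtype,
    Fintype.card_subtype, Fin.card_filter_univ_succ, h0]
  by_cases hz : z = 0
  · simp [hz, add_comm]
  · simp [hz]

set_option maxHeartbeats 2000000 in
/-- The parameters at which a family with slope `-K` and nearly tridiagonal value at `0` is
singular, and their square roots. -/
lemma interaction_eigenvalues (l : ℕ) {K C₁ C₂ Ct Ca d δ₀ : ℝ} (hK : K ≠ 0) (hC₁ : 0 ≤ C₁)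
    (hC₂ : 0 < C₂) (hCt : 0 ≤ Ct) (hCa : 0 ≤ Ca) (hd : 0 < d) (hδ₀ : 0 < δ₀) :
    ∃ δ, 0 < δ ∧ δ ^ 2 ≤ δ₀ ∧ ∃ t₀, 0 < t₀ ∧ ∀ κ, 0 < κ → ∃ C, ∀ t, 0 < t → t ≤ 1 → t ≤ t₀ →
      ∀ F : ℂ → Matrix (Fin (l + 1)) (Fin (l + 1)) ℂ, IsSloped F K C₂ (t ^ 6) δ₀ →
      (F 0).mulVec 1 = 0 → ∀ b T : Fin l → ℝ, (∀ g, 0 ≤ T g) → (∀ g, T g ≤ Ct * t ^ 4) →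
      (∀ g, |b g| ≤ Ca * t ^ 8) →
      (∀ g (y : Fin (l + 1) → ℂ), ‖y‖ ≤ 1 →
        ‖leftOf g ⬝ᵥ (F 0).mulVec y - diff y g * ((d * b g : ℝ) : ℂ)‖
          ≤ C₁ * t ^ 12 * (T g + t ^ 12)) →
      ∀ μ : Fin l → ℝ, (symTridiag b).charpoly
        = Polynomial.X * ∏ j, (Polynomial.X - Polynomial.C (μ j)) →
      ∃ lam : Fin l → ℂ, (∀ j, ‖lam j‖ < δ ∧ ((lam j).re = 0 ∨ (lam j).im = 0)) ∧
        (∀ z : ℂ, ‖z‖ < δ → Module.finrank ℂ (LinearMap.ker (F (z ^ 2)).mulVecLin)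
          = (if z = 0 then 1 else 0) + Nat.card {j : Fin l // z = lam j ∨ z = -lam j}) ∧
        ((∀ g, κ * T g ^ 2 ≤ |b g|) → ∀ j, ‖lam j - csqrt (-(d * μ j) / K)‖ ≤ C * t ^ 9) := by
  have hKpos : 0 < |K| := abs_pos.2 hK
  set δ₁ : ℝ := min δ₀ (|K| / (6 * C₂)) with hδ₁
  have hδ₁0 : 0 < δ₁ := lt_min hδ₀ (by positivity)
  have hδ₁C : C₂ * (3 * δ₁) ≤ |K| / 2 := by
    have h1 : δ₁ ≤ |K| / (6 * C₂) := min_le_right _ _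
    rw [le_div_iff₀ (by positivity)] at h1
    nlinarith
  set B : ℝ := 4 * (d * Ca) + 4 * (C₁ * l * Ct ^ 2) + C₁ * l * 8 + 1 with hB
  have hB1 : 0 < B := by positivity
  set δ : ℝ := √δ₁ with hδ
  have hδ0 : 0 < δ := sqrt_pos.2 hδ₁0
  have hδsq : δ ^ 2 = δ₁ := sq_sqrt hδ₁0.le
  set t₀ : ℝ := min δ₁ (|K| * δ₁ / (3 * B)) with ht₀
  refine ⟨δ, hδ0, by rw [hδsq]; exact min_le_left _ _, t₀, lt_min hδ₁0 (by positivity),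
    fun κ hκ => ?_⟩
  set c₂ : ℝ := C₁ * l / (κ * d) * (2 * (l + 1)) with hc₂
  have hc₂0 : 0 ≤ c₂ := by positivity
  set E₀ : ℝ := 3 * B / |K| with hE₀
  have hE₀0 : 0 < E₀ := by positivity
  set E₁ : ℝ := C₂ * (1 + 2 * B / |K|) / |K| + c₂ with hE₁
  have hE₁0 : 0 ≤ E₁ := by positivity
  set E₂ : ℝ := C₁ * l * 8 / |K| with hE₂
  have hE₂0 : 0 ≤ E₂ := by positivity
  set G : ℝ := (2 * E₂ + 4 * E₁ ^ 2 * E₀) + E₀ * c₂ ^ 2 with hG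
  have hG0 : 0 ≤ G := by positivity
  refine ⟨2 * √G, fun t ht ht1 htt F hF hone b T hT hTC hbC hgap μ hμ => ?_⟩
  have hp : ∀ {m n : ℕ}, n ≤ m → t ^ m ≤ t ^ n := fun h => pow_le_pow_of_le_one ht.le ht1 h
  have ht' : ∀ {n : ℕ}, n ≠ 0 → t ^ n ≤ t₀ := fun hn => (pow_le_of_le_one ht.le ht1 hn).trans htt
  have ht6δ : t ^ 6 ≤ δ₁ := (ht' (by simp)).trans (min_le_left _ _)
  have hBt : 3 * B * t ^ 8 ≤ |K| * δ₁ := by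
    have h1 := (ht' (n := 8) (by simp)).trans (min_le_right _ _)
    rwa [le_div_iff₀' (by positivity)] at h1
  have hFδ : IsSloped F K C₂ (t ^ 6) δ₁ :=
    ⟨fun s hs => hF.symm s (hs.trans (min_le_left _ _)),
      fun s hs => hF.conj s (hs.trans (min_le_left _ _)),
      fun s s' hs hs' => hF.slope s s' (hs.trans (min_le_left _ _)) (hs'.trans (min_le_left _ _))⟩
  -- diagonalization at zero and of the tridiagonal part
  obtain ⟨f, U, hf⟩ := exists_isDiag (A := F 0)
    (by simpa using hFδ.hermitian (s := 0) (by simpa using hδ₁0.le))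
  set α : Fin l → ℝ := fun g => d * b g with hα
  obtain ⟨m, W, hm⟩ := exists_isDiag (chainMatrix_isHermitian α)
  have hαC : ∀ g, |α g| ≤ d * Ca * t ^ 8 := fun g => by
    simp only [hα]
    rw [abs_mul, abs_of_pos hd, mul_assoc]
    exact mul_le_mul_of_nonneg_left (hbC g) hd.le
  have hsymm0 : (F 0).transpose = F 0 := hFδ.symm 0 (by simpa using hδ₁0.le)
  have hform : ∀ x, |∑ i, f i * ‖U.mulVec x i‖ ^ 2 - ∑ g, α g * ‖diff x g‖ ^ 2|
      ≤ C₁ * l * (t ^ 6 * ∑ g, T g ^ 2 * ‖diff x g‖ ^ 2)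
        + C₁ * l * 8 * t ^ 18 * ∑ i, ‖x i‖ ^ 2 := fun x => by
    have h1 := form_sub_chain_le hsymm0 hone hgap x
    rw [hf.form, ← ofReal_sub, norm_real, norm_eq_abs] at h1
    exact h1.trans (sum_cross_le (fun g => norm_nonneg _) ht ht1 hC₁ (sum_norm_diff_sq_le x))
  have hmform : ∀ x, ∑ g, α g * ‖diff x g‖ ^ 2 = ∑ i, m i * ‖W.mulVec x i‖ ^ 2 := fun x => by
    have := hm.form x
    rw [chainMatrix_form_star] at this
    exact_mod_cast this
  have hmB : ∀ k, |m k| ≤ B * t ^ 8 := fun k => by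
    refine hm.abs_le_of_form (fun x => ?_) k
    rw [← hmform]
    refine (abs_form_le hαC (by positivity) x).trans (mul_le_mul_of_nonneg_right ?_ (by positivity))
    have : 0 ≤ (4 * (C₁ * l * Ct ^ 2) + C₁ * l * 8 + 1) * t ^ 8 := by positivity
    rw [hB]
    nlinarith
  have hfB : ∀ k, |f k| ≤ B * t ^ 8 := fun k => by
    refine hf.abs_le_of_form (fun x => ?_) k
    set X := ∑ i, ‖x i‖ ^ 2 with hX
    have hX0 : 0 ≤ X := by positivity
    have h1 := abs_form_le hαC (by positivity) x
    have h2 := (abs_sub_abs_le_abs_sub _ _).trans (hform x)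
    have h3 : ∑ g, T g ^ 2 * ‖diff x g‖ ^ 2 ≤ 4 * (Ct * t ^ 4) ^ 2 * X :=
      (le_abs_self _).trans (abs_form_le (fun g => by
        rw [abs_of_nonneg (sq_nonneg _)]; exact pow_le_pow_left₀ (hT g) (hTC g) 2)
        (by positivity) x)
    have h4 : C₁ * l * (t ^ 6 * ∑ g, T g ^ 2 * ‖diff x g‖ ^ 2)
        ≤ 4 * (C₁ * l * Ct ^ 2) * t ^ 8 * X := by
      have h14 : t ^ 14 ≤ t ^ 8 := hp (by norm_num)
      calc _ ≤ C₁ * l * (t ^ 6 * (4 * (Ct * t ^ 4) ^ 2 * X)) := by gcongr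
        _ = 4 * (C₁ * l * Ct ^ 2) * t ^ 14 * X := by ring
        _ ≤ _ := by gcongr
    have h5 : C₁ * l * 8 * t ^ 18 * X ≤ C₁ * l * 8 * t ^ 8 * X := by
      have h18 : t ^ 18 ≤ t ^ 8 := hp (by norm_num)
      gcongr
    have h7 : 0 ≤ t ^ 8 * X := by positivity
    rw [hB]
    nlinarith
  obtain ⟨s, hs, hker⟩ := hFδ.exists_zeros hC₂.le (by positivity) hK hδ₁0
    (le_trans (mul_le_mul_of_nonneg_left (by linarith) hC₂.le) hδ₁C) hf
    (fun k => by nlinarith [hfB k, pow_pos ht 8, mul_pos hB1 (pow_pos ht 8)])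
  have hsB : ∀ k, |s k| ≤ 2 * B / |K| * t ^ 8 := fun k => by
    refine (hs k).1.trans ?_
    rw [div_mul_eq_mul_div]
    exact div_le_div_of_nonneg_right (by linarith [hfB k]) hKpos.le
  have hsδ : ∀ k, |s k| < δ₁ := fun k => by
    refine (hsB k).trans_lt ?_
    rw [div_mul_eq_mul_div, div_lt_iff₀ hKpos]
    nlinarith [mul_pos hB1 (pow_pos ht 8)]
  -- distance to the prediction
  have hclose : (∀ g, κ * T g ^ 2 ≤ |b g|) → ∀ k, ‖csqrt (s k) - csqrt (m k / K)‖ ≤ √G * t ^ 9 := by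
    intro hκb k
    have h0 : |s k| + |m k / K| ≤ E₀ * t ^ 8 := by
      rw [abs_div, show E₀ * t ^ 8 = 2 * B / |K| * t ^ 8 + B * t ^ 8 / |K| by rw [hE₀]; ring]
      exact add_le_add (hsB k) (div_le_div_of_nonneg_right (hmB k) hKpos.le)
    have key : ‖csqrt (s k) - csqrt (m k / K)‖ ^ 2 ≤ G * t ^ 18 := by
      rcases le_total (c₂ * t ^ 6) 1 with hsmall | hbig
      · set a : ℝ := C₁ * l / (κ * d) * t ^ 6 with ha
        have ha0 : 0 ≤ a := by positivity
        have hac : a * (2 * (l + 1)) = c₂ * t ^ 6 := by rw [ha, hc₂]; ring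
        have h1 := eigenvalue_close hf hm (a := a) (e := C₁ * l * 8 * t ^ 18) ha0
          (by rw [hac]; exact hsmall) (fun x => (hform x).trans (add_le_add ?_ le_rfl)) k
        · rw [hac] at h1
          have h2 := (hs k).2
          have h3 : |s k - m k / K| ≤ E₁ * t ^ 6 * (|s k| + |m k / K|) + E₂ * t ^ 18 := by
            have h4 : s k - m k / K = ((s k * K - f k) + (f k - m k)) / K := by field_simp; ring
            have h5 : C₂ * |s k| * (t ^ 6 + |s k|)
                ≤ C₂ * (1 + 2 * B / |K|) * t ^ 6 * |s k| := by
              have h6 : |s k| ≤ 2 * B / |K| * t ^ 6 :=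
                (hsB k).trans (mul_le_mul_of_nonneg_left (hp (by norm_num)) (by positivity))
              calc _ ≤ C₂ * |s k| * (t ^ 6 + 2 * B / |K| * t ^ 6) := by gcongr
                _ = _ := by ring
            have h7 : |m k| = |m k / K| * |K| := by rw [abs_div]; field_simp
            rw [h4, abs_div, div_le_iff₀ hKpos]
            have h8 : C₁ * l * 8 * t ^ 18 = E₂ * t ^ 18 * |K| := by rw [hE₂]; field_simp
            have h9 : C₂ * (1 + 2 * B / |K|) * t ^ 6 * |s k|
                = C₂ * (1 + 2 * B / |K|) / |K| * t ^ 6 * |s k| * |K| := by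
              field_simp
            have h10 : 0 ≤ c₂ * t ^ 6 * |s k| * |K| := by positivity
            have h11 : 0 ≤ C₂ * (1 + 2 * B / |K|) / |K| * t ^ 6 * |m k / K| * |K| := by positivity
            have h12 := abs_add_le (s k * K - f k) (f k - m k)
            have h13 : (E₁ * t ^ 6 * (|s k| + |m k / K|) + E₂ * t ^ 18) * |K|
                = C₂ * (1 + 2 * B / |K|) / |K| * t ^ 6 * |s k| * |K|
                  + C₂ * (1 + 2 * B / |K|) / |K| * t ^ 6 * |m k / K| * |K|
                  + c₂ * t ^ 6 * |s k| * |K| + c₂ * t ^ 6 * (|m k / K| * |K|)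
                  + E₂ * t ^ 18 * |K| := by rw [hE₁]; ring
            rw [h13, ← h7, ← h8]
            linarith
          have h4 := csqrt_close ht ht1 hE₁0 hE₂0 h0 h3
          have h5 : 0 ≤ E₀ * c₂ ^ 2 * t ^ 18 := by positivity
          rw [hG]
          nlinarith
        · rw [mul_sum, mul_sum, mul_sum]
          refine sum_le_sum fun g _ => ?_
          have h2 : T g ^ 2 ≤ |α g| / (κ * d) := by
            rw [le_div_iff₀ (by positivity)]
            simp only [hα]
            rw [abs_mul, abs_of_pos hd]
            nlinarith [hκb g]
          calc _ ≤ C₁ * l * (t ^ 6 * (|α g| / (κ * d) * ‖diff x g‖ ^ 2)) := by gcongr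
            _ = _ := by rw [ha]; ring
      · have h1 := csqrt_sub_sq_le (s k) (m k / K)
        have h2 : |s k - m k / K| ≤ |s k| + |m k / K| := abs_sub _ _
        have h3 : 1 ≤ (c₂ * t ^ 6) ^ 2 := one_le_pow₀ hbig
        have h4 : E₀ * t ^ 8 ≤ E₀ * c₂ ^ 2 * t ^ 18 := by
          have h5 : t ^ 20 ≤ t ^ 18 := hp (by norm_num)
          calc _ ≤ E₀ * t ^ 8 * (c₂ * t ^ 6) ^ 2 := le_mul_of_one_le_right (by positivity) h3
            _ = E₀ * c₂ ^ 2 * t ^ 20 := by ring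
            _ ≤ _ := by gcongr
        have h5 : 0 ≤ (2 * E₂ + 4 * E₁ ^ 2 * E₀) * t ^ 18 := by positivity
        rw [hG]
        nlinarith
    refine (le_sqrt (norm_nonneg _) (by positivity)).2 key |>.trans_eq ?_
    rw [sqrt_mul hG0, show t ^ 18 = (t ^ 9) ^ 2 by ring, sqrt_sq (by positivity)]
  -- removal of the zero eigenvalue
  obtain ⟨e, he0, hej⟩ := exists_matching hd hμ hm
  obtain ⟨k₀, hk₀⟩ : ∃ k, s k = 0 := by
    have h1 := hker 0 (by simpa using hδ₁0.le)
    have h2 : 0 < Module.finrank ℂ (LinearMap.ker (F 0).mulVecLin) := by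
      rw [Module.finrank_pos_iff_exists_ne_zero]
      refine ⟨⟨1, by rw [LinearMap.mem_ker, mulVecLin_apply, hone]⟩, fun h => ?_⟩
      have := congrFun (congrArg Subtype.val h) 0
      simp at this
    rw [h1, Nat.card_pos_iff] at h2
    obtain ⟨k, hk⟩ := h2.1
    exact ⟨k, by exact_mod_cast hk.symm⟩
  set j₀ := e.symm k₀ with hj₀
  set τ : Equiv.Perm (Fin (l + 1)) := (Equiv.swap 0 j₀).trans e with hτ
  set s' : Fin (l + 1) → ℝ := fun k => s (τ k) with hs'
  have hs'0 : s' 0 = 0 := by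
    simp only [hs', hτ, Equiv.trans_apply, Equiv.swap_apply_left, hj₀, Equiv.apply_symm_apply, hk₀]
  refine ⟨fun j => csqrt (s' j.succ), fun j => ⟨?_, csqrt_re_or_im _⟩, fun z hz => ?_,
    fun hκb j => ?_⟩
  · refine (sq_lt_sq₀ (norm_nonneg _) hδ0.le).1 ?_
    rw [norm_csqrt_sq, hδsq]
    exact hsδ _
  · have hz' : ‖z ^ 2‖ ≤ δ₁ := by
      rw [norm_pow, ← hδsq]
      exact pow_le_pow_left₀ (norm_nonneg _) hz.le 2
    rw [hker _ hz', ← card_sq_eq hs'0]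
    exact Nat.card_congr (Equiv.subtypeEquiv τ.symm fun k => by simp [hs'])
  · rw [← hej]
    have h1 := hclose hκb
    have h2 : 0 ≤ √G * t ^ 9 := by positivity
    dsimp only
    by_cases hj : j.succ = j₀
    · have h3 : s' j.succ = s (e 0) := by
        simp only [hs', hτ, Equiv.trans_apply, hj, Equiv.swap_apply_right]
      have h4 := h1 (e 0)
      have h5 := h1 (e j.succ)
      rw [he0, zero_div, csqrt_zero, sub_zero] at h4
      rw [hj, hj₀, Equiv.apply_symm_apply, hk₀, csqrt_zero, zero_sub, norm_neg] at h5
      rw [h3, hj, hj₀, Equiv.apply_symm_apply]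
      refine (norm_sub_le _ _).trans ?_
      linarith
    · have h3 : s' j.succ = s (e j.succ) := by
        simp only [hs', hτ, Equiv.trans_apply]
        rw [Equiv.swap_apply_of_ne_of_ne (Fin.succ_ne_zero j) hj]
      rw [h3]
      linarith [h1 (e j.succ)]

variable (P : Primary Λ θ)

/-! ### Blocks and positions -/

section

variable {l : ℕ} {N : Fin l → ℕ}

lemma two_mul_Nplus (N : ℕ) : (N : ℤ) ≤ 2 * Nplus N + 1 := by
  unfold Nplus; omega

lemma two_mul_Nminus (N : ℕ) : (N : ℤ) ≤ 2 * Nminus N := by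
  unfold Nminus Nplus; omega

lemma Nplus_add_Nminus (N : ℕ) : Nplus N + Nminus N = N := by
  unfold Nminus; ring

lemma isChain_position (N : Fin l → ℕ) : IsChain N (position N) := fun g => by
    unfold position
    have h : ∀ h : Fin l, (if h.castSucc < g.succ then (N h : ℤ) else 0)
        = (if h.castSucc < g.castSucc then (N h : ℤ) else 0) + if h = g then (N g : ℤ) else 0 :=
      fun h => by
        simp only [Fin.castSucc_lt_succ_iff, Fin.castSucc_lt_castSucc_iff]
        rcases lt_trichotomy h g with h' | h' | h'
        · simp [h', h'.le, h'.ne]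
        · subst h'; simp
        · simp [h'.not_ge, h'.not_gt, h'.ne']
    simp only [h, sum_add_distrib, sum_ite_eq', mem_univ, if_true]

lemma exists_mem_block (N : Fin l → ℕ) (n : ℤ) : ∃ i, n ∈ block N i := by
  set s : Set (Fin (l + 1)) :=
    {i | ∀ g : Fin l, g.castSucc = i → n ≤ position N i + Nplus (N g)} with hs
  have hne : s.Nonempty := ⟨Fin.last l, fun g hg => absurd hg (Fin.castSucc_lt_last g).ne⟩
  obtain ⟨i, hi, hmin⟩ := WellFounded.has_min (wellFounded_lt (α := Fin (l + 1))) s hne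
  refine ⟨i, fun g hg => ?_, hi⟩
  have h1 : g.castSucc ∉ s := fun h => hmin _ h (by rw [← hg]; exact Fin.castSucc_lt_succ)
  rw [hs, Set.mem_ofPred_eq] at h1
  push Not at h1
  obtain ⟨g', hg', h2⟩ := h1
  have h3 : g' = g := Fin.castSucc_injective l hg'
  subst h3
  have h4 := isChain_position N g'
  rw [hg] at h4
  have := Nplus_add_Nminus (N g')
  omega

lemma le_of_mem_block {D : ℕ} (hD : ∀ g, D ≤ N g) {n : ℤ} {i j : Fin (l + 1)}
    (hn : n ∈ block N i) (hij : j ≠ i) : D ≤ 2 * (n - position N j).natAbs + 1 := by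
  have hc := isChain_position N
  rcases lt_or_gt_of_ne hij with h | h
  · obtain ⟨g, rfl⟩ := Fin.exists_succ_eq.2 (Fin.ne_zero_of_lt h)
    have h1 := hc.mono (Fin.le_castSucc_iff.2 h)
    have h2 := hn.1 g rfl
    have h3 := hc g
    have h4 := Nplus_add_Nminus (N g)
    have h5 := two_mul_Nplus (N g)
    have h6 := hD g
    omega
  · obtain ⟨g, rfl⟩ := Fin.exists_castSucc_eq.2 (Fin.ne_last_of_lt h)
    have h1 := hc.mono (Fin.castSucc_lt_iff_succ_le.1 h)
    have h2 := hn.2 g rfl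
    have h3 := hc g
    have h4 := Nplus_add_Nminus (N g)
    have h5 := two_mul_Nminus (N g)
    have h6 := hD g
    omega

end

/-! ### Comparison of neighboring tails -/

lemma Primary.tail_nonneg (n : ℤ) : 0 ≤ P.tail n :=
  le_max_of_le_left (norm_nonneg _)

/-- The linearized equation controls `q̇` at a site by its two neighbors on either side. -/
lemma Primary.tail_comparable :
    ∃ C, 1 ≤ C ∧ ∀ n, P.tail (n + 1) ≤ C * P.tail n ∧ P.tail n ≤ C * P.tail (n + 1) := by
  obtain ⟨C₁, hC₁, hA⟩ := pot_bound Λ P.D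
  have hd := Λ.d_pos
  set s : ℝ := ∑ i, |Λ.S i| with hs
  have hs0 : 0 ≤ s := by positivity
  set K : ℝ := 2 + (card ι * C₁ + s) / Λ.d with hK
  have hK0 : 0 ≤ K := by positivity
  set v := Λ.dot P.q with hv
  have hb : ∀ n, ‖v (n + 1) + v (n - 1)‖ ≤ K * ‖v n‖ := fun n => by
    refine (pi_norm_le_iff_of_nonneg (by positivity)).2 fun i => ?_
    have h := congrFun (congrFun P.q_sol.opR_dot_eq_zero n) i
    simp only [opR_apply, ← hv, Pi.zero_apply] at h
    have h1 : |(Λ.A (P.q n)).mulVec (v n) i| ≤ card ι * C₁ * ‖v n‖ := (norm_le_pi_norm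
      ((Λ.A (P.q n)).mulVec (v n)) i).trans (norm_mulVec_le _ hC₁.le
        (fun i j => by simpa [pot] using hA P.q P.norm_q_le n i j) _)
    have h2 : |v n i| ≤ ‖v n‖ := norm_le_pi_norm (v n) i
    have h3 : |Λ.S i * v n i| ≤ s * ‖v n‖ := by
      rw [abs_mul]
      exact mul_le_mul (single_le_sum (f := fun i => |Λ.S i|) (fun _ _ => abs_nonneg _)
        (mem_univ i)) h2 (abs_nonneg _) hs0
    rw [Pi.add_apply, norm_eq_abs, show v (n + 1) i + v (n - 1) i
      = 2 * v n i + ((Λ.A (P.q n)).mulVec (v n) i - Λ.S i * v n i) / Λ.d by field_simp; linarith]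
    refine (abs_add_le _ _).trans ?_
    rw [abs_mul, abs_two, abs_div, abs_of_pos hd, hK, add_mul, div_mul_eq_mul_div]
    gcongr
    exact (abs_sub _ _).trans (by linarith)
  have hup : ∀ n, ‖v (n + 1)‖ ≤ K * ‖v n‖ + ‖v (n - 1)‖ := fun n => by
    simpa using norm_sub_le_of_le (hb n) (le_refl ‖v (n - 1)‖)
  have hdown : ∀ n, ‖v (n - 1)‖ ≤ K * ‖v n‖ + ‖v (n + 1)‖ := fun n => by
    simpa using norm_sub_le_of_le (hb n) (le_refl ‖v (n + 1)‖)
  refine ⟨K + 1, by linarith, fun n => ?_⟩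
  simp only [tail, ← hv, add_sub_cancel_right]
  have h0 := norm_nonneg (v n)
  constructor
  · have h1 := le_max_left ‖v n‖ ‖v (n - 1)‖
    have h2 := le_max_right ‖v n‖ ‖v (n - 1)‖
    have h3 := hup n
    refine max_le ?_ ?_ <;> nlinarith
  · have h1 := le_max_right ‖v (n + 1)‖ ‖v n‖
    have h2 := le_max_left ‖v (n + 1)‖ ‖v n‖
    have h3 := hdown n
    refine max_le ?_ ?_ <;> nlinarith

/-- For a spatially even breather the two tails that meet at a gap are of comparable size. -/
lemma Primary.sq_tail_le (hsymm : ∀ n, P.q (-n) = P.q n) :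
    ∃ C, 0 < C ∧ ∀ N : ℕ, (P.tail (Nplus N) + P.tail (-Nminus N)) ^ 2
      ≤ C * (P.tail (Nplus N) * P.tail (-Nminus N)) := by
  obtain ⟨C, hC, h⟩ := P.tail_comparable
  have hrefl : ∀ n, P.tail (-n) = P.tail (n + 1) := fun n => by
    have h1 : ∀ n, Λ.dot P.q (-n) = Λ.dot P.q n := fun n => by
      simp only [dot, hsymm]
    unfold tail
    rw [h1, show -n - 1 = -(n + 1) by ring, h1, max_comm, add_sub_cancel_right]
  refine ⟨2 * C ^ 2 + 2, by positivity, fun N => ?_⟩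
  set x := P.tail (Nplus N) with hx
  set y := P.tail (-Nminus N) with hy
  have hx0 : 0 ≤ x := P.tail_nonneg _
  have hy0 : 0 ≤ y := P.tail_nonneg _
  have hxy : x ≤ C ^ 2 * y ∧ y ≤ C ^ 2 * x := by
    rw [hrefl] at hy
    have h1 := h (Nplus N)
    have h2 := h (Nplus N + 1)
    have h0 := P.tail_nonneg (Nplus N + 1)
    rcases (by unfold Nminus Nplus; omega :
      Nminus N = Nplus N ∨ Nminus N = Nplus N + 1) with h3 | h3
    · rw [h3] at hy
      rw [← hx, ← hy] at h1
      have hC2 : C ≤ C ^ 2 := le_self_pow₀ hC two_ne_zero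
      exact ⟨h1.2.trans (by gcongr), h1.1.trans (by gcongr)⟩
    · rw [h3] at hy
      rw [← hx] at h1
      rw [← hy] at h2
      have hC0 : 0 ≤ C := by linarith
      rw [sq, mul_assoc, mul_assoc]
      exact ⟨h1.2.trans (by gcongr; exact h2.2), h2.1.trans (by gcongr; exact h1.1)⟩
  nlinarith [mul_le_mul_of_nonneg_left hxy.1 hx0, mul_le_mul_of_nonneg_left hxy.2 hy0]

lemma Primary.tail_le {φ : ℝ} (hφ : 0 < φ) (hφ1 : φ < 1) (P : Primary Λ (φ ^ 8)) :
    ∃ C, 0 < C ∧ ∀ (n : ℤ) (D : ℕ), (D : ℤ) ≤ 2 * n.natAbs + 1 → P.tail n ≤ C * φ ^ (4 * D) := by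
  obtain ⟨D', hD'⟩ := P.dot_q_dec
  have hD'0 := hD'.nonneg (bump_isWeight P.θ_pos P.θ_lt 0)
  refine ⟨D' * (φ ^ 12)⁻¹ + 1, by positivity, fun n D hD => ?_⟩
  have h1 : ∀ m : ℤ, 4 * D ≤ 8 * (m - 0).natAbs + 12 →
      ‖Λ.dot P.q m‖ ≤ (D' * (φ ^ 12)⁻¹ + 1) * φ ^ (4 * D) := fun m hm => by
    have h2 := mul_le_mul_of_nonneg_left (bump_le_pow hφ hφ1 hm) hD'0
    have h3 := (hD' m).trans h2
    have : 0 ≤ φ ^ (4 * D) := by positivity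
    linarith
  exact max_le (h1 n (by omega)) (h1 (n - 1) (by omega))

lemma Primary.abs_inter_le (a c : ℤ) :
    |P.inter a c| ≤ 2 * card ι * (P.tail a * P.tail (-c)) := by
  have h := P.tail_nonneg a
  have h' := P.tail_nonneg (-c)
  have e : ∀ {x y : ι → ℝ}, ‖x‖ ≤ P.tail a → ‖y‖ ≤ P.tail (-c) →
      |x ⬝ᵥ y| ≤ card ι * (P.tail a * P.tail (-c)) := fun hx hy =>
    (norm_eq_abs _).ge.trans ((norm_dotProduct_le _ _).trans (by gcongr))
  rw [mul_assoc, two_mul]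
  exact (abs_sub _ _).trans (add_le_add (e (le_max_left _ _) (le_max_right _ _))
    (e (le_max_right _ _) (le_max_left _ _)))

/-! ### Interaction eigenvalues of multi-breathers -/

/-- `u` is an even solution that on each block is within `ρ` of the corresponding copy. -/
def Primary.IsMultiBreather {l : ℕ} (σ : Fin (l + 1) → ℝ) (N : Fin l → ℕ) (ρ : ℝ)
    (u : ℤ → ι → ℝ) : Prop :=
  Λ.IsEven u ∧ Λ.IsSol u ∧
    ∀ i, ∀ n ∈ block N i, ‖u n - σ i • P.q (n - position N i)‖ ≤ ρ

set_option maxHeartbeats 1000000 in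
/-- Existence and uniqueness of multi-breathers and their interaction eigenvalues. -/
lemma Primary.exists_interaction {φ : ℝ} (hφ : 0 < φ) (hφ1 : φ < 1) (P : Primary Λ (φ ^ 8))
    (hsymm : ∀ n, P.q (-n) = P.q n) (hmass : P.mass ≠ 0) (l : ℕ) :
    ∃ ρ₀, 0 < ρ₀ ∧ ∀ ε, 0 < ε → ∃ δ, 0 < δ ∧ ∃ D₀ : ℕ, ∀ κ, 0 < κ → ∃ C,
      ∀ (σ : Fin (l + 1) → ℝ) (N : Fin l → ℕ) (D : ℕ), IsSign σ → D₀ ≤ D →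
      (∀ g, D ≤ N g) → ∃ u, P.IsMultiBreather σ N ε u ∧
        (∀ u', P.IsMultiBreather σ N ρ₀ u' → u' = u) ∧
        ∀ μ : Fin l → ℝ, (symTridiag fun g => σ g.castSucc * σ g.succ
            * P.inter (Nplus (N g)) (Nminus (N g))).charpoly
          = Polynomial.X * ∏ j, (Polynomial.X - Polynomial.C (μ j)) →
        ∃ lam : Fin l → ℂ, (∀ j, ‖lam j‖ < δ ∧ ((lam j).re = 0 ∨ (lam j).im = 0)) ∧
          (∀ z : ℂ, ‖z‖ < δ → Module.finrank ℂ (Λ.modes u z)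
            = (if z = 0 then 1 else 0) + Nat.card {j : Fin l // z = lam j ∨ z = -lam j}) ∧
          ((∀ g, κ * (P.tail (Nplus (N g)) * P.tail (-Nminus (N g)))
              ≤ |P.inter (Nplus (N g)) (Nminus (N g))|) →
            ∀ j, ‖lam j - csqrt (-(Λ.d * μ j) / P.mass)‖ ≤ C * φ ^ (9 * D)) := by
  obtain ⟨C₀, hC₀, L, -, ρ, hρ, β, hβ, hS⟩ := P.exists_solvable
  obtain ⟨C', hC', D₁, hmulti⟩ := P.exists_multi hS hC₀ hρ hβ.le (Fin (l + 1))
  set m : ℝ := (card (Fin (l + 1)) : ℝ) with hm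
  obtain ⟨ρ₁, hρ₁, huniq⟩ := P.unique_multi hS hC₀ hβ.le ((C' + P.D) * m)
  obtain ⟨C₂, hC₂, δ₀, hδ₀, D₂, hfam⟩ := hS.exists_family hφ hφ1 hC₀ hβ (Fin (l + 1)) hC'.le
  obtain ⟨C₁, hC₁, D₃, hgap⟩ := P.gap_estimate hφ hφ1 l (δ := δ₀) hC'.le hC₂ L ρ
  obtain ⟨Ct, hCt, htail⟩ := P.tail_le hφ hφ1
  obtain ⟨Cs, hCs, hsq⟩ := P.sq_tail_le hsymm
  obtain ⟨δ, hδ, hδδ, t₀, ht₀, hmain⟩ := interaction_eigenvalues l hmass hC₁.le hC₂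
    (Ct := 2 * Ct) (Ca := 2 * card ι * Ct ^ 2) (by positivity) (by positivity) Λ.d_pos hδ₀
  refine ⟨ρ₁ / 2, by positivity, fun ε hε => ⟨δ, hδ, ?_⟩⟩
  set ε' : ℝ := min ε (min (ρ₁ / 2) (ρ / 2)) with hε'
  have hε'0 : 0 < ε' := by positivity
  obtain ⟨D₄, hclose⟩ := P.ansatz_close (Fin (l + 1)) (half_pos hε'0)
  obtain ⟨D₅, hnear⟩ := P.isNear_of_isClose L hρ
  obtain ⟨D₆, hD₆⟩ := exists_bump_le P.θ_pos P.θ_lt (C' * m) (half_pos hε'0)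
  obtain ⟨D₇, hD₇⟩ := exists_bump_le hφ hφ1 1 ht₀
  refine ⟨D₁ + D₂ + D₃ + D₄ + D₅ + D₆ + D₇ + 1, fun κ hκ => ?_⟩
  obtain ⟨C, hC⟩ := hmain (κ / Cs) (by positivity)
  refine ⟨C, fun σ N D hσ hD hN => ?_⟩
  set p := position N with hp
  have hchain : IsChain N p := isChain_position N
  have hsep := hchain.separated hN
  obtain ⟨u, hue, hus, huc⟩ := hmulti σ p D hσ (by omega) hsep
  have hmB : ∀ n, multiBump (φ ^ 8) p n ≤ m := fun n => multiBump_le P.θ_pos P.θ_lt p n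
  have hm0 : 0 ≤ m := by positivity
  have hsm : C' * (φ ^ 8) ^ D * m ≤ ε' / 2 := by
    have h1 := hD₆ 0 D (by simp; omega)
    simp only [bump, sub_zero, Int.natAbs_natCast] at h1
    linarith
  have hε₁ : ε' ≤ ρ₁ / 2 := (min_le_right _ _).trans (min_le_left _ _)
  have hε₂ : ε' ≤ ρ / 2 := (min_le_right _ _).trans (min_le_right _ _)
  have hua : ∀ n, ‖u n - P.ansatz σ p n‖ ≤ ε' / 2 := fun n =>
    (huc n).trans ((mul_le_mul_of_nonneg_left (hmB n) (by have := P.θ_pos; positivity)).trans hsm)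
  have hub : ∀ i, ∀ n ∈ block N i, ‖u n - σ i • P.q (n - p i)‖ ≤ ε' := fun i n hn => by
    have h1 := hclose σ p D hσ (by omega) n i fun j hj => le_of_mem_block hN hn hj
    have h2 := norm_sub_le_norm_sub_add_norm_sub (u n) (P.ansatz σ p n) (σ i • P.q (n - p i))
    linarith [hua n]
  have hun : P.IsNear σ p u L ρ := by
    refine hnear (Fin (l + 1)) σ p u D hσ (by omega) fun n => ?_
    obtain ⟨i, hi⟩ := exists_mem_block N n
    exact ⟨i, (hub i n hi).trans hε₂, fun j hj => le_of_mem_block hN hi hj⟩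
  have husm : ∃ s : Finset ℤ, ∀ n ∉ s, ‖u n‖ ≤ ρ := by
    obtain ⟨s, hs⟩ := P.ansatz_small hσ p (half_pos hρ)
    refine ⟨s, fun n hn => ?_⟩
    linarith [hua n, hs n hn, norm_le_norm_sub_add (u n) (P.ansatz σ p n)]
  have hM : P.IsMulti C' L ρ σ p D u :=
    ⟨hσ, hsep.injective (by omega), hsep, hue, hus, hun, husm, huc⟩
  refine ⟨u, ⟨hue, hus, fun i n hn => (hub i n hn).trans (min_le_left _ _)⟩, fun u' hu' => ?_,
    fun μ hμ => ?_⟩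
  · refine huniq (Fin (l + 1)) σ p u u' hσ hun (fun n => ?_) hue hu'.1 hus hu'.2.1 fun n => ?_
    · exact (hM.norm_le hC'.le n).trans (mul_le_mul_of_nonneg_left (hmB n) (by
        have := P.D_nonneg; positivity))
    · obtain ⟨i, hi⟩ := exists_mem_block N n
      have h1 := hub i n hi
      have h2 := hu'.2.2 i n hi
      have h3 := norm_sub_le_norm_sub_add_norm_sub (u' n) (σ i • P.q (n - p i)) (u n)
      rw [norm_sub_rev (σ i • _) (u n)] at h3
      linarith
  · obtain ⟨F, hF⟩ := hfam σ p D u (by omega) hM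
    have ht1 : φ ^ D ≤ 1 := pow_le_one₀ hφ.le hφ1.le
    have htt : φ ^ D ≤ t₀ := by simpa [bump] using hD₇ 0 D (by simp; omega)
    have hpow : ∀ k, (φ ^ D) ^ k = φ ^ (k * D) := fun k => by rw [← pow_mul, mul_comm]
    have hsl : IsSloped F P.mass C₂ ((φ ^ D) ^ 6) δ₀ := hpow 6 ▸ ⟨hF.symm, hF.conj, hF.slope⟩
    have hplus : ∀ g, (D : ℤ) ≤ 2 * Nplus (N g) + 1 := fun g => by
      have := two_mul_Nplus (N g); have := hN g; omega
    have hminus : ∀ g, (D : ℤ) ≤ 2 * Nminus (N g) + 1 := fun g => by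
      have := two_mul_Nminus (N g); have := hN g; omega
    have ht1' : ∀ g, P.tail (Nplus (N g)) ≤ Ct * φ ^ (4 * D) := fun g =>
      htail _ _ (by have := hplus g; omega)
    have ht2' : ∀ g, P.tail (-Nminus (N g)) ≤ Ct * φ ^ (4 * D) := fun g =>
      htail _ _ (by have := hminus g; omega)
    have hsg : ∀ g : Fin l, |σ g.castSucc * σ g.succ| = 1 := fun g => by
      rcases hσ g.castSucc with h | h <;> rcases hσ g.succ with h' | h' <;> simp [h, h']
    obtain ⟨lam, h1, h2, h3⟩ := hC (φ ^ D) (by positivity) ht1 htt F hsl hF.one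
      (fun g => σ g.castSucc * σ g.succ * P.inter (Nplus (N g)) (Nminus (N g)))
      (fun g => P.tail (Nplus (N g)) + P.tail (-Nminus (N g)))
      (fun g => add_nonneg (P.tail_nonneg _) (P.tail_nonneg _))
      (fun g => by rw [hpow]; linarith [ht1' g, ht2' g])
      (fun g => by
        rw [abs_mul, hsg, one_mul, hpow]
        have h := mul_le_mul (ht1' g) (ht2' g) (P.tail_nonneg _) (by positivity)
        calc _ ≤ 2 * card ι * (Ct * φ ^ (4 * D) * (Ct * φ ^ (4 * D))) :=
              (P.abs_inter_le _ _).trans (by gcongr)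
          _ = _ := by ring)
      (fun g y hy => by
        have h := hgap σ N p D u _ F (by omega) hN hchain hM hF g _ _ (Nplus_add_Nminus (N g))
          (hplus g) (hminus g) y hy
        rw [hpow]
        push_cast at h ⊢
        exact h) μ hμ
    refine ⟨lam, h1, fun z hz => ?_, fun hκ' j => ?_⟩
    · rw [← h2 z hz]
      obtain ⟨e⟩ := hF.modes z ((norm_pow z 2).trans_le (le_trans (by gcongr) hδδ))
      exact e.finrank_eq
    · rw [← hpow]
      refine h3 (fun g => ?_) j
      rw [abs_mul, hsg, one_mul]
      refine le_trans ?_ (hκ' g)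
      refine (mul_le_mul_of_nonneg_left (hsq (N g)) (by positivity)).trans_eq ?_
      field_simp

/-! ### Decay of bounded solutions -/

variable (Λ)

/-- The linearization at zero, on real sequences. -/
def Chain.free (z : ℤ → ι → ℝ) : ℤ → ι → ℝ := fun n i =>
  Λ.d * (z (n + 1) i + z (n - 1) i - 2 * z n i) + Λ.S i * z n i - Λ.a₀ * z n i

lemma Chain.op_free (z : ℤ → ι → ℝ) :
    Λ.op Λ.pot₀ (toC z) = toC (Λ.free z) := by
  funext n i
  simp [op_apply, pot₀, toC, free, smul_mulVec]

lemma Chain.g_zero : Λ.g 0 = 0 := self_eq_neg.1 (by simpa using Λ.g_neg 0)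

lemma Chain.hasFDerivAt_g (x : ι → ℝ) :
    HasFDerivAt Λ.g (LinearMap.toContinuousLinearMap (Λ.A x).mulVecLin) x := by
  obtain ⟨C, hC, h⟩ := Λ.g_taylor (‖x‖ + 1)
  have h0 : (fun y => Λ.g y - Λ.g x - (Λ.A x).mulVec (y - x)) =O[𝓝 x] fun y => ‖y - x‖ ^ 2 := by
    refine Asymptotics.IsBigO.of_bound (C * (2 * ‖x‖ + 1)) ?_
    filter_upwards [Metric.ball_mem_nhds x one_pos] with y hy
    rw [mem_ball_iff_norm] at hy
    have h1 : ‖y‖ ≤ ‖x‖ + 1 := by linarith [norm_le_norm_add_norm_sub' y x]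
    refine (h y x h1 (by linarith)).trans ?_
    rw [norm_eq_abs, abs_of_nonneg (by positivity)]
    exact mul_le_mul_of_nonneg_right (mul_le_mul_of_nonneg_left (by linarith) hC) (by positivity)
  refine HasFDerivAt.of_isLittleO (h0.trans_isLittleO ?_)
  have h2 : (fun y : ι → ℝ => ‖y - x‖) =o[𝓝 x] fun _ => (1 : ℝ) := by
    rw [Asymptotics.isLittleO_one_iff]
    simpa using ((continuous_id.sub (continuous_const (y := x))).norm.tendsto x)
  simpa [sq] using ((Asymptotics.isBigO_refl (fun y => ‖y - x‖) (𝓝 x)).mul_isLittleO h2).norm_right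

lemma Chain.A_near {b : ℝ} (hb : 0 < b) :
    ∃ ρ, 0 < ρ ∧ ∀ y, ‖y‖ ≤ ρ → ∀ z, ‖(Λ.A y - Λ.A 0).mulVec z‖ ≤ b * ‖z‖ := by
  obtain ⟨ε, hε, -, hεb⟩ := exists_mul_le (c := card ι) (Nat.cast_nonneg _) hb
  obtain ⟨ρ, hρ, hA⟩ := Λ.A_small hε
  refine ⟨ρ, hρ, fun y hy z => (norm_mulVec_le _ hε.le (fun i j => ?_) z).trans (by gcongr)⟩
  have := hA (fun _ => y) 0 hy i j
  rwa [Λ.pot_sub_pot₀] at this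

/-- Near zero the nonlinearity is a small perturbation of its linearization. -/
lemma Chain.g_near {b : ℝ} (hb : 0 < b) :
    ∃ ρ, 0 < ρ ∧ ∀ x y, ‖x‖ ≤ ρ → ‖y‖ ≤ ρ → ‖Λ.g x - Λ.g y - Λ.a₀ • (x - y)‖ ≤ b * ‖x - y‖ := by
  obtain ⟨C, hC, h⟩ := Λ.g_taylor 1
  obtain ⟨ρ, hρ, hA⟩ := Λ.A_near (half_pos hb)
  obtain ⟨r, hr, hr1, hrC⟩ := exists_mul_le (c := 4 * C) (by positivity) (half_pos hb)
  refine ⟨min r ρ, by positivity, fun x y hx hy => ?_⟩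
  have hx' := hx.trans (min_le_left _ _)
  have hy' := hy.trans (min_le_left _ _)
  have h4 : ‖x - y‖ ≤ 2 * r := (norm_sub_le _ _).trans (by linarith)
  rw [show Λ.g x - Λ.g y - Λ.a₀ • (x - y)
      = (Λ.g x - Λ.g y - (Λ.A y).mulVec (x - y)) + (Λ.A y - Λ.A 0).mulVec (x - y) by
    rw [Λ.A_zero, sub_mulVec, smul_mulVec, one_mulVec]; abel]
  calc _ ≤ C * (‖x‖ + ‖y‖) * ‖x - y‖ ^ 2 + b / 2 * ‖x - y‖ := norm_add_le_of_le
        (h x y (hx'.trans hr1) (hy'.trans hr1)) (hA y (hy.trans (min_le_right _ _)) _)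
    _ ≤ C * (1 + 1) * (2 * r * ‖x - y‖) + b / 2 * ‖x - y‖ := by rw [sq]; gcongr <;> linarith
    _ = (4 * C * r + b / 2) * ‖x - y‖ := by ring
    _ ≤ _ := by gcongr; linarith

/-- A bounded sequence decays if the linearization at zero is small along it, up to an exponentially
decaying term. -/
lemma Chain.exists_decay (hθ : 0 < θ) (hθ1 : θ < 1)
    (hν : ∀ i, |Λ.ν i| < θ) : ∃ b, 0 < b ∧ ∀ (z : ℤ → ι → ℝ) (B K : ℝ) (R : ℕ), (∀ n, ‖z n‖ ≤ B) →
      (∀ n : ℤ, R < n.natAbs → ‖Λ.free z n‖ ≤ b * ‖z n‖ + K * bump θ 0 n) →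
      ∃ C, WBound (bump θ 0) C z := by
  obtain ⟨C₀, hC₀, hfree⟩ := Λ.free_bound hθ hν
  refine ⟨1 / (2 * C₀), by positivity, fun z B K R hz h => ?_⟩
  have hp : ∀ n, 0 < bump θ 0 n := bump_pos hθ 0
  set a : ℝ := |K| + ∑ n ∈ Finset.Icc (-R : ℤ) R, ‖Λ.free z n‖ / bump θ 0 n with ha
  have hsum : 0 ≤ ∑ n ∈ Finset.Icc (-R : ℤ) R, ‖Λ.free z n‖ / bump θ 0 n :=
    sum_nonneg fun n _ => div_nonneg (norm_nonneg _) (hp n).le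
  have := Λ.weighted_bound hθ hfree (bump_isWeight hθ hθ1 0) (IsWeight.one hθ1.le)
    (b := 1 / (2 * C₀)) (by positivity) (le_of_eq (by field_simp)) (v := toC z) (a := a)
    ⟨B, fun n => by rw [norm_toC, mul_one]; exact hz n⟩ (by positivity) fun n => by
      rw [Λ.op_free, norm_toC, norm_toC]
      have h0 : 0 ≤ 1 / (2 * C₀) * ‖z n‖ := by positivity
      by_cases hn : R < n.natAbs
      · have h1 : K ≤ a := by linarith [le_abs_self K]
        linarith [h n hn, mul_le_mul_of_nonneg_right h1 (hp n).le]
      · have h1 : ‖Λ.free z n‖ / bump θ 0 n ≤ a := by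
          have := single_le_sum (f := fun n => ‖Λ.free z n‖ / bump θ 0 n)
            (fun n _ => div_nonneg (norm_nonneg _) (hp n).le)
            (mem_Icc.2 (show (-R : ℤ) ≤ n ∧ n ≤ R by omega))
          linarith [abs_nonneg K]
        rw [div_le_iff₀ (hp n)] at h1
        linarith
  exact ⟨_, fun n => by rw [← norm_toC]; exact this n⟩

lemma Chain.sol_decay (hθ : 0 < θ) (hθ1 : θ < 1)
    (hν : ∀ i, |Λ.ν i| < θ) {q : ℤ → ι → ℝ} (hq : Λ.IsSol q)
    (h0 : ∀ ε, 0 < ε → ∃ R : ℕ, ∀ n : ℤ, R < n.natAbs → ‖q n‖ ≤ ε) :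
    ∃ C, WBound (bump θ 0) C q := by
  obtain ⟨b, hb, h⟩ := Λ.exists_decay hθ hθ1 hν
  obtain ⟨ρ, hρ, hg⟩ := Λ.g_near hb
  obtain ⟨R, hR⟩ := h0 ρ hρ
  refine h q (ρ + ∑ n ∈ Finset.Icc (-R : ℤ) R, ‖q n‖) 0 R (fun n => ?_) fun n hn => ?_
  · have h1 : 0 ≤ ∑ n ∈ Finset.Icc (-R : ℤ) R, ‖q n‖ := sum_nonneg fun n _ => norm_nonneg _
    by_cases hn : R < n.natAbs
    · linarith [hR n hn]
    · have := single_le_sum (f := fun n => ‖q n‖) (fun n _ => norm_nonneg _)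
        (mem_Icc.2 (show (-R : ℤ) ≤ n ∧ n ≤ R by omega))
      linarith
  · have h1 := hg (q n) 0 (hR n hn) (by simpa using hρ.le)
    have h2 : Λ.free q n = Λ.g (q n) - Λ.g 0 - Λ.a₀ • (q n - 0) := by
      funext i
      have := hq n i
      simp [free, Λ.g_zero]
      linarith
    rw [h2]
    simpa using h1

lemma Chain.opR_decay (hθ : 0 < θ) (hθ1 : θ < 1)
    (hν : ∀ i, |Λ.ν i| < θ) {q y : ℤ → ι → ℝ} {D B K : ℝ} (hq : WBound (bump θ 0) D q)
    (hy : ∀ n, ‖y n‖ ≤ B) (h : WBound (bump θ 0) K (Λ.opR q y)) :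
    ∃ C, WBound (bump θ 0) C y := by
  obtain ⟨b, hb, hdec⟩ := Λ.exists_decay hθ hθ1 hν
  obtain ⟨ρ, hρ, hA⟩ := Λ.A_near hb
  obtain ⟨R, hR⟩ := exists_bump_le hθ hθ1 D hρ
  refine hdec y B K R hy fun n hn => ?_
  have h1 : Λ.free y n = Λ.opR q y n + (Λ.A (q n) - Λ.A 0).mulVec (y n) := by
    funext i
    rw [Λ.A_zero, sub_mulVec, smul_mulVec, one_mulVec]
    simp [free, opR_apply]
  rw [h1, add_comm]
  exact norm_add_le_of_le (hA _ ((hq n).trans (hR 0 n (by simpa using hn.le))) _) (h n)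

variable {Λ}

/-! ### The tangent directions of the stable manifold -/

variable (Λ)

/-- Near `q` there is a curve of solutions on the sites to the right of `m`, tending to zero at
`+∞`, whose velocity is `v`. -/
def Chain.HasCurve (q v : ℤ → ι → ℝ) (m : ℤ) : Prop :=
  ∃ u : ℝ → ℤ → ι → ℝ, (∀ᶠ h in 𝓝 0, (∀ n, m ≤ n → ∀ i,
      Λ.d * (u h (n + 1) i + u h (n - 1) i - 2 * u h n i) + Λ.S i * u h n i - Λ.g (u h n) i = 0) ∧
      Tendsto (u h) atTop (𝓝 0)) ∧
    (∀ n, m ≤ n + 1 → HasDerivAt (fun h => u h n) (v n) 0) ∧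
    (∀ n, m ≤ n + 1 → u 0 n = q n) ∧
    ∀ ε, 0 < ε → ∀ᶠ h in 𝓝 0, ∀ n, m ≤ n + 1 → ‖u h n - q n‖ < ε

/-- A small real perturbation of the linearization at zero. -/
lemma Chain.free_semilinear (hθ : θ ≤ 1) (hν : ∀ i, |Λ.ν i| < θ) {C₀ b F : ℝ}
    (hC₀ : 0 < C₀) (hfree : Λ.Free θ C₀) (hb : 0 ≤ b) (hsmall : C₀ * b ≤ 1 / 2)
    (N : ℤ → (ι → ℝ) → ι → ℝ) (hF : ∀ n, ‖N n 0‖ ≤ F)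
    (hN : ∀ n x y, ‖x‖ ≤ 2 * C₀ * F → ‖y‖ ≤ 2 * C₀ * F → ‖N n x - N n y‖ ≤ b * ‖x - y‖) :
    ∃ w : ℤ → ι → ℝ, (∀ n, ‖w n‖ ≤ 2 * C₀ * F) ∧ ∀ n, Λ.free w n = N n (w n) := by
  have hre : ∀ x : ι → ℂ, ‖fun i => (x i).re‖ ≤ ‖x‖ := fun x =>
    (pi_norm_le_iff_of_nonneg (norm_nonneg _)).2 fun i =>
      (abs_re_le_norm _).trans (norm_le_pi_norm x i)
  have hof : ∀ x : ι → ℝ, ‖fun i => (x i : ℂ)‖ = ‖x‖ := fun x => norm_toC (fun _ => x) 0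
  obtain ⟨w, hw, hweq⟩ := Λ.semilinear_solve hθ hν hC₀ hfree hsmall
    (fun n x i => (N n (fun i => (x i).re) i : ℂ)) (F := F)
    (fun n => by rw [hof]; exact hF n) (fun n x y hx hy => by
      refine (Eq.trans_le ?_ (hN n _ _ ((hre x).trans hx) ((hre y).trans hy))).trans
        (mul_le_mul_of_nonneg_left (hre (x - y)) hb)
      rw [← hof]
      congr 1
      ext; simp) hb
  refine ⟨fun n i => (w n i).re, fun n => (hre _).trans (hw n), fun n => funext fun i => ?_⟩
  have := congrArg re (congrFun (congrFun hweq n) i)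
  rw [ofReal_re] at this
  rw [← this]
  simp [op_apply, pot₀, free, smul_mulVec]

set_option maxHeartbeats 1000000 in
/-- Far to the right the curve exists, since there the equation is a small perturbation of its
linearization at zero. -/
lemma Chain.exists_hasCurve (hθ : 0 < θ) (hθ1 : θ < 1)
    (hν : ∀ i, |Λ.ν i| < θ) {q v : ℤ → ι → ℝ} {D B : ℝ} (hq : Λ.IsSol q)
    (hqD : WBound (bump θ 0) D q) (hv : ∀ n, ‖v n‖ ≤ B) (hv0 : Λ.opR q v = 0) :
    ∃ m, 0 ≤ m ∧ Λ.HasCurve q v m := by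
  obtain ⟨b₀, hb₀, hdec⟩ := Λ.exists_decay hθ hθ1 hν
  obtain ⟨C₀, hC₀, hfree⟩ := Λ.free_bound hθ hν
  have hB : 0 ≤ B := (norm_nonneg _).trans (hv 0)
  obtain ⟨ρ, hρ, hg⟩ := Λ.g_near (b := min b₀ (1 / (2 * C₀))) (by positivity)
  obtain ⟨C, hC, hT⟩ := Λ.g_taylor ρ
  obtain ⟨m, hm⟩ := exists_bump_le hθ hθ1 D (half_pos hρ)
  have hqm : ∀ n : ℤ, m ≤ n → ‖q n‖ ≤ ρ / 2 := fun n hn => (hqD n).trans (hm 0 n (by omega))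
  set c : ℝ := 2 * C₀ * (C * (ρ + ρ) * B ^ 2) with hc
  have hc0 : 0 ≤ c := by positivity
  obtain ⟨h₀, hh₀, hh₁, hBc⟩ := exists_mul_le (c := B + c) (by positivity) (half_pos hρ)
  have hhv : ∀ (h : ℝ) n, ‖h • v n‖ ≤ |h| * B := fun h n => by
    rw [norm_smul, norm_eq_abs]; gcongr; exact hv n
  have hin : ∀ h, |h| < h₀ → ∀ (n : ℤ) x, m ≤ n → ‖x‖ ≤ c * h ^ 2 → ‖q n + h • v n + x‖ ≤ ρ := by
    intro h hh n x hn hx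
    have h1 : c * h ^ 2 ≤ c * |h| := by
      rw [← sq_abs]
      gcongr
      exact pow_le_of_le_one (abs_nonneg _) (hh.le.trans hh₁) two_ne_zero
    have h2 : (B + c) * |h| ≤ (B + c) * h₀ := by gcongr
    linarith [norm_add₃_le (a := q n) (b := h • v n) (c := x), hhv h n, hqm n hn]
  have key : ∀ h, ∃ w : ℤ → ι → ℝ, (∀ n, ‖w n‖ ≤ c * h ^ 2) ∧ (|h| < h₀ → ∀ n : ℤ, m ≤ n →
      Λ.free w n = Λ.g (q n + h • v n + w n) - Λ.g (q n) - (Λ.A (q n)).mulVec (h • v n)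
        - Λ.a₀ • w n) := by
    intro h
    by_cases hh : |h| < h₀
    swap
    · exact ⟨0, fun n => by simpa using by positivity, fun h => absurd h hh⟩
    have hcF : 2 * C₀ * (C * (ρ + ρ) * (|h| * B) ^ 2) = c * h ^ 2 := by
      rw [hc, mul_pow, sq_abs]; ring
    obtain ⟨w, hw, hweq⟩ := Λ.free_semilinear hθ1.le hν hC₀ hfree (b := 1 / (2 * C₀))
      (by positivity) (le_of_eq (by field_simp)) (fun n x => if (m : ℤ) ≤ n then
        Λ.g (q n + h • v n + x) - Λ.g (q n) - (Λ.A (q n)).mulVec (h • v n) - Λ.a₀ • x else 0)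
      (F := C * (ρ + ρ) * (|h| * B) ^ 2)
      (fun n => by
        split_ifs with hn
        · have h1 := hin h hh n 0 hn (by simpa using by positivity)
          have h2 := hqm n hn
          rw [add_zero] at h1 ⊢
          have h3 := hT _ (q n) h1 (by linarith)
          rw [add_sub_cancel_left] at h3
          rw [smul_zero, sub_zero]
          exact h3.trans (by gcongr; exacts [by linarith, hhv h n])
        · simpa using by positivity)
      (fun n x y hx hy => by
        rw [hcF] at hx hy
        split_ifs with hn
        · have h1 := hg _ _ (hin h hh n x hn hx) (hin h hh n y hn hy)
          rw [add_sub_add_left_eq_sub] at h1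
          refine (le_of_eq (congrArg norm ?_)).trans (h1.trans (by gcongr; exact min_le_right _ _))
          rw [smul_sub]; abel
        · simpa using by positivity)
    exact ⟨w, fun n => (hw n).trans hcF.le, fun _ n hn => (hweq n).trans (if_pos hn)⟩
  choose w hw hweq using key
  have hw0 : w 0 = 0 := by
    funext n; simpa using hw 0 n
  have hh : ∀ᶠ h : ℝ in 𝓝 0, |h| < h₀ := by
    simpa using eventually_abs_sub_lt (0 : ℝ) hh₀
  refine ⟨m, by positivity, fun h n => q n + h • v n + w h n, ?_, fun n hn => ?_, fun n hn => ?_,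
    fun ε hε => ?_⟩
  · filter_upwards [hh] with h hh
    have hin := fun n hn => hin h hh n (w h n) hn (hw h n)
    have hsol : ∀ n : ℤ, m ≤ n → Λ.free (fun n => q n + h • v n + w h n) n
        = Λ.g (q n + h • v n + w h n) - Λ.a₀ • (q n + h • v n + w h n) := fun n hn => by
      funext i
      have h1 := congrFun (hweq h hh n hn) i
      have h2 := hq n i
      have h3 := congrFun (congrFun hv0 n) i
      simp only [free, opR_apply, mulVec_smul, Pi.add_apply,
        Pi.sub_apply, Pi.smul_apply, smul_eq_mul, Pi.zero_apply] at h1 h2 h3 ⊢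
      linear_combination h1 + h2 + h * h3
    refine ⟨fun n hn i => ?_, ?_⟩
    · have := congrFun (hsol n hn) i
      simp only [free, Pi.sub_apply, Pi.smul_apply, smul_eq_mul] at this
      linarith
    · obtain ⟨C₁, h1⟩ := hdec (fun n => if (m : ℤ) ≤ n then q n + h • v n + w h n else 0) ρ 0
        (m + 1) (fun n => by
          split_ifs with hn
          exacts [hin n hn, by simpa using hρ.le]) fun n hn => by
          rw [zero_mul, add_zero]
          rcases le_or_gt (0 : ℤ) n with h0 | h0
          · have e : Λ.free (fun n => if (m : ℤ) ≤ n then q n + h • v n + w h n else 0) n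
                = Λ.free (fun n => q n + h • v n + w h n) n := by
              funext i
              simp only [free, if_pos (show (m : ℤ) ≤ n by omega),
                if_pos (show (m : ℤ) ≤ n + 1 by omega), if_pos (show (m : ℤ) ≤ n - 1 by omega)]
            rw [e, hsol n (by omega), if_pos (show (m : ℤ) ≤ n by omega)]
            have h2 := hg _ 0 (hin n (by omega)) (by simpa using hρ.le)
            rw [Λ.g_zero, sub_zero, sub_zero] at h2
            exact h2.trans (mul_le_mul_of_nonneg_right (min_le_left _ _) (norm_nonneg _))
          · have e : Λ.free (fun n => if (m : ℤ) ≤ n then q n + h • v n + w h n else 0) n = 0 := by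
              funext i
              simp only [free, if_neg (show ¬ (m : ℤ) ≤ n by omega),
                if_neg (show ¬ (m : ℤ) ≤ n + 1 by omega), if_neg (show ¬ (m : ℤ) ≤ n - 1 by omega)]
              simp
            rw [e, norm_zero]
            positivity
      rw [Metric.tendsto_atTop]
      intro ε hε
      obtain ⟨R, hR⟩ := exists_bump_le hθ hθ1 C₁ (half_pos hε)
      refine ⟨max R m, fun n hn => ?_⟩
      have h2 := (h1 n).trans (hR 0 n (by omega))
      simp only [if_pos (show (m : ℤ) ≤ n by omega)] at h2
      rw [dist_zero_right]
      linarith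
  · have h1 : HasDerivAt (fun h => w h n) 0 0 := by
      have h2 : (fun h => w h n) =O[𝓝 0] fun h : ℝ => ‖h - 0‖ ^ 2 := by
        refine Asymptotics.IsBigO.of_bound c (Eventually.of_forall fun h => ?_)
        simpa using hw h n
      simpa using (h2.hasFDerivAt (𝕜 := ℝ) one_lt_two).hasDerivAt
    exact ((((hasDerivAt_id (0 : ℝ)).smul_const (v n)).const_add (q n)).add h1).congr_deriv
      (by simp)
  · simp [hw0]
  · have h1 : Tendsto (fun h : ℝ => |h| * B + c * h ^ 2) (𝓝 0) (𝓝 0) := by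
      have : Continuous fun h : ℝ => |h| * B + c * h ^ 2 := by fun_prop
      simpa using this.tendsto 0
    filter_upwards [h1.eventually (gt_mem_nhds hε)] with h hh n _
    rw [add_assoc, add_sub_cancel_left]
    exact (norm_add_le_of_le (hhv h n) (hw h n)).trans_lt hh

variable {Λ}

/-- The curve extends to the left along the inverse of the lattice dynamics. -/
lemma Chain.HasCurve.pred {q v : ℤ → ι → ℝ} (hq : Λ.IsSol q) (hv0 : Λ.opR q v = 0)
    {m : ℤ} (hc : Λ.HasCurve q v m) : Λ.HasCurve q v (m - 1) := by
  obtain ⟨u, h1, h2, h3, h4⟩ := hc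
  have hd := Λ.d_pos.ne'
  let z : ℝ → ι → ℝ := fun h i =>
    2 * u h (m - 1) i + (Λ.g (u h (m - 1)) i - Λ.S i * u h (m - 1) i) / Λ.d - u h m i
  have hz : HasDerivAt z (v (m - 2)) 0 := by
    rw [hasDerivAt_pi]
    intro i
    have e1 := h2 (m - 1) (by omega)
    have e2 := h2 m (by omega)
    have e3 := (Λ.hasFDerivAt_g (u 0 (m - 1))).comp_hasDerivAt 0 e1
    have a1 := hasDerivAt_pi.1 e1 i
    have a2 := hasDerivAt_pi.1 e2 i
    have a3 := hasDerivAt_pi.1 e3 i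
    have := ((a1.const_mul 2).add ((a3.sub (a1.const_mul (Λ.S i))).div_const Λ.d)).sub a2
    refine this.congr_deriv ?_
    have h5 := congrFun (congrFun hv0 (m - 1)) i
    simp only [opR_apply, Pi.zero_apply, sub_add_cancel] at h5
    rw [show m - 1 - 1 = m - 2 by ring] at h5
    rw [h3 (m - 1) (by omega)]
    simp only [LinearMap.coe_toContinuousLinearMap', mulVecLin_apply]
    field_simp
    linarith
  have hz0 : z 0 = q (m - 2) := by
    funext i
    have h5 := hq (m - 1) i
    rw [sub_add_cancel, show m - 1 - 1 = m - 2 by ring] at h5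
    simp only [z, h3 (m - 1) (by omega), h3 m (by omega)]
    field_simp
    linarith
  have hne : ∀ n, m ≤ n + 1 → n ≠ m - 2 := fun n hn => by omega
  refine ⟨fun h => Function.update (u h) (m - 2) (z h), ?_, fun n hn => ?_, fun n hn => ?_,
    fun ε hε => ?_⟩
  · filter_upwards [h1] with h hh
    refine ⟨fun n hn i => ?_, ?_⟩
    · rcases eq_or_lt_of_le hn with rfl | hn
      · rw [sub_add_cancel, show m - 1 - 1 = m - 2 by ring, update_self,
          update_of_ne (by omega), update_of_ne (by omega)]
        simp only [z]
        field_simp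
        ring
      · rw [update_of_ne (by omega), update_of_ne (by omega),
          update_of_ne (by omega)]
        exact hh.1 n (by omega) i
    · refine hh.2.congr' ?_
      filter_upwards [eventually_gt_atTop m] with n hn
      rw [update_of_ne (by omega)]
  · by_cases hn' : n = m - 2
    · subst hn'; simpa using hz
    · simpa [hn'] using h2 n (by omega)
  · by_cases hn' : n = m - 2
    · subst hn'; simpa using hz0
    · simpa [hn'] using h3 n (by omega)
  · have h5 : ∀ᶠ h in 𝓝 0, ‖z h - q (m - 2)‖ < ε := by
      have := hz.continuousAt.tendsto
      rw [hz0, tendsto_iff_norm_sub_tendsto_zero] at this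
      exact this.eventually (gt_mem_nhds hε)
    filter_upwards [h4 ε hε, h5] with h hh h6 n hn
    by_cases hn' : n = m - 2
    · subst hn'; simpa using h6
    · simpa [hn'] using hh n (by omega)

lemma Chain.hasCurve_zero (Λ : Chain ι) (hθ : 0 < θ) (hθ1 : θ < 1)
    (hν : ∀ i, |Λ.ν i| < θ) {q v : ℤ → ι → ℝ} {D B : ℝ} (hq : Λ.IsSol q)
    (hqD : WBound (bump θ 0) D q) (hv : ∀ n, ‖v n‖ ≤ B) (hv0 : Λ.opR q v = 0) :
    Λ.HasCurve q v 0 := by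
  obtain ⟨m, hm, h⟩ := Λ.exists_hasCurve hθ hθ1 hν hq hqD hv hv0
  induction m, hm using Int.leInduction with
  | base => exact h
  | succ n _ ih => exact ih (by simpa using h.pred hq hv0)

/-! ### A real Fourier basis -/

/-- The wave numbers `|k| ≤ M`, indexing the coordinates of `X_M`. -/
abbrev Idx (M : ℕ) : Type := {k : ℤ // k ∈ Finset.Icc (-(M : ℤ)) M}

/-- The opposite wave number. -/
def Idx.neg {M : ℕ} (i : Idx M) : Idx M :=
  ⟨-i.1, by have := mem_Icc.1 i.2; exact mem_Icc.2 (by omega)⟩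

lemma Idx.neg_neg {M : ℕ} (i : Idx M) : i.neg.neg = i := Subtype.ext (_root_.neg_neg _)

lemma Idx.sum_neg {M : ℕ} {E : Type*} [AddCommMonoid E] (f : Idx M → E) :
    ∑ i : Idx M, f i.neg = ∑ i, f i :=
  Equiv.sum_comp (Function.Involutive.toPerm Idx.neg Idx.neg_neg) f

/-- The parity in time of the basis function with wave number `k`. -/
def sgn (k : ℤ) : ℝ := if 0 ≤ k then 1 else -1

/-- The real orthonormal Fourier basis: cosines for `k ≥ 0` and sines for `k < 0`. -/
def bas (T : ℝ) (k : ℤ) (t : ℝ) : ℝ :=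
  (if k = 0 then √(1 / T) else √(2 / T)) *
    if 0 ≤ k then Real.cos (k * (2 * π / T) * t) else Real.sin (k * (2 * π / T) * t)

variable {T : ℝ}

lemma hasDerivAt_bas (k : ℤ) (t : ℝ) :
    HasDerivAt (bas T k) (k * (2 * π / T) * bas T (-k) t) t := by
  have h : HasDerivAt (fun t => k * (2 * π / T) * t) (k * (2 * π / T)) t := by
    simpa using (hasDerivAt_id t).const_mul (k * (2 * π / T))
  rcases lt_trichotomy k 0 with hk | hk | hk
  · refine ((h.sin).const_mul √(2 / T)).congr_of_eventuallyEq
      (Eventually.of_forall fun s => ?_) |>.congr_deriv ?_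
    · simp [bas, hk.ne, hk.not_ge]
    · simp [bas, hk.ne, hk.le]; ring
  · subst hk
    refine (hasDerivAt_const t √(1 / T)).congr_of_eventuallyEq
      (Eventually.of_forall fun s => ?_) |>.congr_deriv ?_ <;> simp [bas]
  · refine ((h.cos).const_mul √(2 / T)).congr_of_eventuallyEq
      (Eventually.of_forall fun s => ?_) |>.congr_deriv ?_
    · simp [bas, hk.ne', hk.le]
    · simp [bas, hk.ne', hk.not_ge]; ring

lemma continuous_bas (k : ℤ) : Continuous (bas T k) :=
  continuous_iff_continuousAt.2 fun t => (hasDerivAt_bas k t).continuousAt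

lemma bas_neg (k : ℤ) (t : ℝ) : bas T k (-t) = sgn k * bas T k t := by
  unfold bas sgn
  split_ifs <;> simp

lemma bas_period (hT : 0 < T) (k : ℤ) : bas T k T = bas T k 0 := by
  have h : k * (2 * π / T) * T = k * (2 * π) := by field_simp
  have h2 : Real.sin (k * (2 * π)) = 0 := by
    rw [← mul_assoc]; exact_mod_cast Real.sin_int_mul_pi (k * 2)
  simp only [bas, h, h2, Real.cos_int_mul_two_pi, mul_zero, Real.cos_zero, Real.sin_zero]

lemma abs_bas_le (hT : 0 < T) (k : ℤ) (t : ℝ) : |bas T k t| ≤ √(2 / T) := by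
  rw [bas, abs_mul]
  refine (mul_le_mul (b := √(2 / T)) (d := 1) ?_ ?_ (abs_nonneg _) (by positivity)).trans_eq
    (mul_one _)
  · split_ifs
    · rw [abs_of_nonneg (by positivity)]; gcongr; norm_num
    · rw [abs_of_nonneg (by positivity)]
  · split_ifs
    exacts [abs_cos_le_one _, abs_sin_le_one _]

lemma bas_pair (hT : 0 < T) (k : ℤ) (s t : ℝ) :
    bas T k s * bas T k t + bas T (-k) s * bas T (-k) t
      = 2 / T * Real.cos (k * (2 * π / T) * (t - s)) := by
  have h1 : √(1 / T) * √(1 / T) = 1 / T := mul_self_sqrt (by positivity)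
  have h2 : √(2 / T) * √(2 / T) = 2 / T := mul_self_sqrt (by positivity)
  rw [mul_sub, Real.cos_sub]
  rcases lt_trichotomy k 0 with hk | hk | hk
  · simp only [bas, hk.ne, hk.not_ge, neg_eq_zero, Left.nonneg_neg_iff, hk.le, if_true, if_false,
      Int.cast_neg, neg_mul, Real.cos_neg]
    linear_combination (Real.sin (k * (2 * π / T) * s) * Real.sin (k * (2 * π / T) * t) +
      Real.cos (k * (2 * π / T) * s) * Real.cos (k * (2 * π / T) * t)) * h2
  · subst hk
    simp only [bas, neg_zero, le_refl, if_true, Int.cast_zero, zero_mul, Real.cos_zero,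
      Real.sin_zero, mul_zero, mul_one, h1]
    ring
  · simp only [bas, hk.ne', hk.le, neg_eq_zero, Left.nonneg_neg_iff, hk.not_ge, if_true, if_false,
      Int.cast_neg, neg_mul, Real.sin_neg]
    linear_combination (Real.sin (k * (2 * π / T) * s) * Real.sin (k * (2 * π / T) * t) +
      Real.cos (k * (2 * π / T) * s) * Real.cos (k * (2 * π / T) * t)) * h2

lemma mode_eq (k : ℤ) (t : ℝ) : mode T k t = ((√T : ℝ) : ℂ)⁻¹ *
    ((Real.cos (k * (2 * π / T) * t) : ℝ)
      + (Real.sin (k * (2 * π / T) * t) : ℝ) * I) := by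
  rw [mode, mul_comm Complex.I, exp_mul_I, ofReal_cos, ofReal_sin,
    show 2 * π * k * t / T = k * (2 * π / T) * t by ring]
  push_cast; ring

lemma mode_pair (hT : 0 < T) (k : ℤ) (s t : ℝ) :
    (starRingEnd ℂ) (mode T k s) * mode T k t + (starRingEnd ℂ) (mode T (-k) s) * mode T (-k) t
      = ((bas T k s * bas T k t + bas T (-k) s * bas T (-k) t : ℝ) : ℂ) := by
  rw [bas_pair hT, mul_sub, Real.cos_sub]
  have h1 : ((√T : ℝ) : ℂ)⁻¹ * ((√T : ℝ) : ℂ)⁻¹ = 1 / T := by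
    rw [← mul_inv, ← ofReal_mul, mul_self_sqrt hT.le, one_div]
  simp only [mode_eq, Int.cast_neg, neg_mul, Real.cos_neg, Real.sin_neg, map_mul, map_add,
    conj_ofReal, conj_I, map_inv₀, ofReal_neg, map_neg]
  push_cast
  linear_combination (2 * (Complex.cos (k * (2 * π / T) * s) *
    Complex.cos (k * (2 * π / T) * t) + Complex.sin (k * (2 * π / T) * s) *
    Complex.sin (k * (2 * π / T) * t))) * h1 - 2 * ((√T : ℝ) : ℂ)⁻¹ ^ 2 *
    Complex.sin (k * (2 * π / T) * s) * Complex.sin (k * (2 * π / T) * t)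
    * Complex.I_sq

lemma integral_eq_zero (hT : 0 < T) {F F' : ℝ → ℝ} (h : ∀ t, HasDerivAt F (F' t) t)
    (hc : Continuous F') (hp : F T = F 0) : ∫ t in 0..T, F' t = 0 := by
  rw [integral_eq_sub_of_hasDerivAt (fun t _ => h t)
    (hc.intervalIntegrable 0 T), hp, sub_self]

lemma bas_orthonormal (hT : 0 < T) (k l : ℤ) :
    ∫ t in 0..T, bas T k t * bas T l t = if k = l then 1 else 0 := by
  have hc := continuous_bas (T := T)
  have hw : 2 * π / T ≠ 0 := by positivity
  have hii : ∀ k l, IntervalIntegrable (fun t => bas T k t * bas T l t) MeasureTheory.volume 0 T :=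
    fun k l => ((hc k).mul (hc l)).intervalIntegrable _ _
  have hd := fun k t => hasDerivAt_bas (T := T) k t
  have e2 : ∀ k t, HasDerivAt (fun t => (k : ℤ) * (2 * π / T) * bas T (-k) t)
      (-(k * (2 * π / T)) ^ 2 * bas T k t) t := fun k t => by
    refine ((hd (-k) t).const_mul _).congr_deriv ?_
    rw [neg_neg]; push_cast; ring
  by_cases h1 : k = l
  · subst h1
    rw [if_pos rfl]
    by_cases h0 : k = 0
    · subst h0
      have : √T ≠ 0 := (sqrt_pos.2 hT).ne'
      simp [bas, ← sq, sq_sqrt hT.le, hT.ne']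
    have hk : (k : ℝ) ≠ 0 := by exact_mod_cast h0
    have i1 : ∫ t in 0..T, (bas T (-k) t * bas T (-k) t - bas T k t * bas T k t) = 0 := by
      refine integral_eq_zero hT (F := fun t => bas T k t * bas T (-k) t / (k * (2 * π / T)))
        (fun t => (((hd k t).mul (hd (-k) t)).div_const _).congr_deriv ?_) (by fun_prop)
        (by simp only [bas_period hT])
      rw [neg_neg]; push_cast; field_simp; ring
    have i2 : ∫ t in 0..T, (bas T k t * bas T k t + bas T (-k) t * bas T (-k) t) = 2 := by
      simp [bas_pair hT, hT.ne']
    rw [integral_sub (hii _ _) (hii _ _)] at i1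
    rw [integral_add (hii _ _) (hii _ _)] at i2
    linarith
  · rw [if_neg h1]
    by_cases h2 : k = -l
    · subst h2
      have hl : (l : ℝ) ≠ 0 := by
        have : l ≠ 0 := by rintro rfl; simp at h1
        exact_mod_cast this
      refine integral_eq_zero hT (F := fun t => bas T l t * bas T l t / (2 * (l * (2 * π / T))))
        (fun t => (((hd l t).mul (hd l t)).div_const _).congr_deriv ?_) (by fun_prop)
        (by simp only [bas_period hT])
      field_simp; ring
    · have h3 : (l : ℝ) ^ 2 - k ^ 2 ≠ 0 := by
        rw [sub_ne_zero, Ne, sq_eq_sq_iff_eq_or_eq_neg, not_or]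
        exact ⟨by exact_mod_cast Ne.symm h1, fun h => h2 (by
          have : l = -k := by exact_mod_cast h
          omega)⟩
      refine integral_eq_zero hT (F := fun t => (k * (2 * π / T) * bas T (-k) t * bas T l t
        - bas T k t * (l * (2 * π / T) * bas T (-l) t))
          / ((l ^ 2 - k ^ 2) * (2 * π / T) ^ 2))
        (fun t => ((((e2 k t).mul (hd l t)).sub ((hd k t).mul (e2 l t))).div_const _).congr_deriv ?_)
        (by fun_prop) (by simp only [bas_period hT])
      rw [div_eq_iff (by positivity)]; ring

/-! ### Coordinates -/

section coordinates

variable {M : ℕ} {E : Type*} [NormedAddCommGroup E] [NormedSpace ℝ E] [CompleteSpace E]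

/-- The function with coordinates `x` in the real Fourier basis. -/
def syn (T : ℝ) (x : Idx M → E) (t : ℝ) : E := ∑ i : Idx M, bas T i t • x i

/-- The time derivative, in coordinates. -/
def dcoord (T : ℝ) (x : Idx M → E) (i : Idx M) : E :=
  (-(i.1 * (2 * π / T)) : ℝ) • x i.neg

lemma hasDerivAt_syn (x : Idx M → E) (t : ℝ) :
    HasDerivAt (syn T x) (syn T (dcoord T x) t) t := by
  refine (HasDerivAt.fun_sum fun (i : Idx M) _ => (hasDerivAt_bas (T := T) i t).smul_const (x i)).congr_deriv ?_
  rw [← Idx.sum_neg]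
  refine sum_congr rfl fun i _ => ?_
  rw [dcoord, smul_smul]
  congr 1
  simp [Idx.neg]; ring

lemma deriv_syn (x : Idx M → E) : deriv (syn T x) = syn T (dcoord T x) :=
  funext fun t => (hasDerivAt_syn x t).deriv

lemma dcoord_dcoord (x : Idx M → E) (i : Idx M) :
    dcoord T (dcoord T x) i = (-(i.1 * (2 * π / T)) ^ 2 : ℝ) • x i := by
  simp only [dcoord, Idx.neg_neg, smul_smul]
  congr 1
  simp [Idx.neg]; ring

lemma continuous_syn (x : Idx M → E) : Continuous (syn T x) :=
  continuous_iff_continuousAt.2 fun t => (hasDerivAt_syn x t).continuousAt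

lemma coord_syn (hT : 0 < T) (x : Idx M → E) (i : Idx M) :
    ∫ t in 0..T, bas T i t • syn T x t = x i := by
  have h : ∀ t, bas T i t • syn T x t = ∑ j : Idx M, (bas T i t * bas T j t) • x j := fun t => by
    simp only [syn, smul_sum, smul_smul]
  simp only [h]
  rw [integral_finsetSum fun j _ => by
    have := continuous_bas (T := T)
    exact Continuous.intervalIntegrable (by fun_prop) _ _]
  simp only [intervalIntegral.integral_smul_const, bas_orthonormal hT, Subtype.coe_inj, ite_smul,
    one_smul, zero_smul, sum_ite_eq, mem_univ, if_true]

lemma syn_injective (hT : 0 < T) : Function.Injective (syn T : (Idx M → E) → ℝ → E) :=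
  fun x y h => funext fun i => by rw [← coord_syn hT x i, h, coord_syn hT]

lemma syn_add (x y : Idx M → E) : syn T (x + y) = syn T x + syn T y := by
  funext t; simp [syn, sum_add_distrib]

lemma syn_smul {𝕜 : Type*} [NormedField 𝕜] [NormedSpace 𝕜 E] [SMulCommClass ℝ 𝕜 E] (c : 𝕜)
    (x : Idx M → E) : syn T (c • x) = c • syn T x := by
  funext t; simp [syn, smul_sum, smul_comm _ c]

lemma syn_sub (x y : Idx M → E) : syn T (x - y) = syn T x - syn T y := by
  funext t; simp [syn, smul_sub, sum_sub_distrib]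

lemma norm_syn_le (hT : 0 < T) (x : Idx M → E) (t : ℝ) :
    ‖syn T x t‖ ≤ card (Idx M) * √(2 / T) * ‖x‖ := by
  refine (norm_sum_le _ _).trans ((sum_le_card_nsmul _ _ (√(2 / T) * ‖x‖)
    fun i _ => ?_).trans_eq ?_)
  · rw [norm_smul]
    exact mul_le_mul (abs_bas_le hT _ _) (norm_le_pi_norm x i) (norm_nonneg _) (by positivity)
  · rw [nsmul_eq_mul, card_univ]; ring

/-- The projection onto the modes with `|k| ≤ M`, in the real basis. -/
lemma proj_eq (hT : 0 < T) {h : ℝ → ℂ} (hh : Continuous h) :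
    proj T M h = syn T fun i : Idx M => ∫ s in 0..T, bas T i s • h s := by
  funext t
  have hm : ∀ k, Continuous (mode T k) := fun k => by unfold mode; fun_prop
  have hb := continuous_bas (T := T)
  have key : ∀ k : ℤ, (∫ s in 0..T, h s * (starRingEnd ℂ) (mode T k s)) * mode T k t
      + (∫ s in 0..T, h s * (starRingEnd ℂ) (mode T (-k) s)) * mode T (-k) t
      = bas T k t • (∫ s in 0..T, bas T k s • h s)
        + bas T (-k) t • ∫ s in 0..T, bas T (-k) s • h s := fun k => by
    have hc := fun k => continuous_conj.comp (hm k)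
    simp only [comp_def] at hc
    rw [← integral_mul_const, ← integral_mul_const,
      ← integral_smul, ← integral_smul,
      ← integral_add, ← integral_add]
    · congr 1
      funext s
      have := mode_pair hT k s t
      simp only [real_smul]
      push_cast at this
      linear_combination h s * this
    all_goals exact Continuous.intervalIntegrable (by fun_prop) _ _
  have h2 : (2 : ℂ) * proj T M h t
      = 2 * syn T (fun i : Idx M => ∫ s in 0..T, bas T i s • h s) t := by
    have e1 : proj T M h t = ∑ i : Idx M,
        (∫ s in 0..T, h s * (starRingEnd ℂ) (mode T i s)) * mode T i t :=
      (sum_coe_sort _ fun k : ℤ =>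
        (∫ s in 0..T, h s * (starRingEnd ℂ) (mode T k s)) * mode T k t).symm
    rw [e1, syn, two_mul, two_mul]
    nth_rewrite 2 [← Idx.sum_neg]
    nth_rewrite 4 [← Idx.sum_neg]
    rw [← sum_add_distrib, ← sum_add_distrib]
    exact sum_congr rfl fun i _ => key i
  exact mul_left_cancel₀ two_ne_zero h2

end coordinates

lemma mem_XC {M : ℕ} (hT : 0 < T) {u : ℝ → ℂ} : u ∈ XC T M ↔ ∃ x : Idx M → ℂ, syn T x = u := by
  have hs : ((√2 : ℝ) : ℂ) ≠ 0 := by simp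
  have hss : ((√2 : ℝ) : ℂ) * (√2 : ℝ) = 2 := by
    rw [← ofReal_mul, mul_self_sqrt two_pos.le]; simp
  have h2 : √(2 / T) = √2 * (√T)⁻¹ := by rw [div_eq_mul_inv, sqrt_mul two_pos.le, sqrt_inv]
  have h1 : √(1 / T) = (√T)⁻¹ := by rw [one_div, sqrt_inv]
  have hbas : ∀ k : ℤ, ∃ a b : ℂ, ∀ t, (bas T k t : ℂ) = a * mode T k t + b * mode T (-k) t := by
    intro k
    rcases lt_trichotomy k 0 with hk | hk | hk
    · refine ⟨-I / √2, I / √2, fun t => ?_⟩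
      simp only [bas, hk.ne, hk.not_ge, if_false, mode_eq, h2, Int.cast_neg, neg_mul, Real.cos_neg,
        Real.sin_neg]
      push_cast
      field_simp
      linear_combination ((√T : ℝ) : ℂ)⁻¹ * Complex.sin (k * 2 * π * t / T) * (hss + 2 * Complex.I_sq)
    · subst hk
      exact ⟨1, 0, fun t => by simp [bas, mode_eq]⟩
    · refine ⟨1 / √2, 1 / √2, fun t => ?_⟩
      simp only [bas, hk.ne', hk.le, if_false, if_true, mode_eq, h2, Int.cast_neg, neg_mul,
        Real.cos_neg, Real.sin_neg]
      push_cast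
      field_simp
      linear_combination ((√T : ℝ) : ℂ)⁻¹ * Complex.cos (k * 2 * π * t / T) * hss
  have hmode : ∀ k : ℤ, ∃ a b : ℂ, ∀ t, mode T k t = a * bas T k t + b * bas T (-k) t := by
    intro k
    rcases lt_trichotomy k 0 with hk | hk | hk
    · refine ⟨I / √2, 1 / √2, fun t => ?_⟩
      simp only [bas, hk.ne, hk.not_ge, neg_eq_zero, Left.nonneg_neg_iff, hk.le, if_true, if_false,
        mode_eq, h2, Int.cast_neg, neg_mul, Real.cos_neg]
      push_cast
      field_simp
      ring
    · subst hk
      exact ⟨1, 0, fun t => by simp [bas, mode_eq]⟩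
    · refine ⟨1 / √2, -I / √2, fun t => ?_⟩
      simp only [bas, hk.ne', hk.le, neg_eq_zero, Left.nonneg_neg_iff, hk.not_ge, if_true, if_false,
        mode_eq, h2, Int.cast_neg, neg_mul, Real.sin_neg]
      push_cast
      field_simp
  constructor
  · intro hu
    refine Submodule.span_induction ?_ ⟨0, by funext; simp [syn]⟩ ?_ ?_ hu
    · rintro _ ⟨k, hk, rfl⟩
      obtain ⟨a, b, h⟩ := hmode k
      have hk' : k ∈ Finset.Icc (-(M : ℤ)) M := mem_Icc.2 (abs_le.1 hk)
      refine ⟨Pi.single ⟨k, hk'⟩ a + Pi.single (Idx.neg ⟨k, hk'⟩) b, ?_⟩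
      rw [syn_add]
      funext t
      rw [h]
      simp [syn, Pi.single_apply, Idx.neg, mul_comm]
    · rintro _ _ _ _ ⟨x, rfl⟩ ⟨y, rfl⟩
      exact ⟨x + y, syn_add x y⟩
    · rintro c _ _ ⟨x, rfl⟩
      exact ⟨c • x, syn_smul c x⟩
  · rintro ⟨x, rfl⟩
    have : syn T x = ∑ i : Idx M, x i • fun t => (bas T i t : ℂ) := by
      funext t; simp [syn, mul_comm]
    rw [this]
    refine Submodule.sum_mem _ fun i _ => Submodule.smul_mem _ _ ?_
    obtain ⟨a, b, h⟩ := hbas i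
    have hi := abs_le.2 (mem_Icc.1 i.2)
    have e : (fun t => (bas T i t : ℂ)) = a • mode T i + b • mode T (-i) := by
      funext t; simp [h]
    rw [e]
    exact add_mem (Submodule.smul_mem _ _ (Submodule.subset_span ⟨i, hi, rfl⟩))
      (Submodule.smul_mem _ _ (Submodule.subset_span ⟨-i, by simpa using hi, rfl⟩))

lemma syn_ofReal {M : ℕ} (x : Idx M → ℝ) (t : ℝ) :
    ((syn T x t : ℝ) : ℂ) = syn T (fun i => (x i : ℂ)) t := by
  simp [syn]

lemma re_syn {M : ℕ} (x : Idx M → ℂ) (t : ℝ) : (syn T x t).re = syn T (fun i => (x i).re) t := by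
  simp [syn]

lemma mem_XR {M : ℕ} (hT : 0 < T) {u : ℝ → ℝ} : u ∈ XR T M ↔ ∃ x : Idx M → ℝ, syn T x = u := by
  refine Iff.trans (mem_XC hT (u := fun t => (u t : ℂ))) ⟨?_, ?_⟩
  · rintro ⟨x, hx⟩
    exact ⟨fun i => (x i).re, by funext t; rw [← re_syn, hx, ofReal_re]⟩
  · rintro ⟨x, rfl⟩
    exact ⟨fun i => x i, by funext t; rw [syn_ofReal]⟩

lemma mem_XRe {M : ℕ} (hT : 0 < T) {u : ℝ → ℝ} :
    u ∈ XRe T M ↔ ∃ x : Idx M → ℝ, syn T x = u ∧ ∀ i : Idx M, sgn i * x i = x i := by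
  have h : ∀ (x : Idx M → ℝ) t, syn T x (-t) = syn T (fun i : Idx M => sgn i * x i) t :=
    fun x t => by simp [syn, bas_neg]; exact sum_congr rfl fun i _ => by ring
  constructor
  · rintro ⟨hu, he⟩
    obtain ⟨x, rfl⟩ := (mem_XR hT).1 hu
    exact ⟨x, rfl, congrFun (syn_injective hT (funext fun t => by rw [← h, he]))⟩
  · rintro ⟨x, rfl, hx⟩
    exact ⟨(mem_XR hT).2 ⟨x, rfl⟩, fun t => by rw [h, funext hx]⟩

lemma integral_syn_mul {M : ℕ} (hT : 0 < T) (x y : Idx M → ℝ) :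
    ∫ t in 0..T, syn T x t * syn T y t = x ⬝ᵥ y := by
  have h : ∀ t, syn T x t * syn T y t = ∑ i : Idx M, x i * (bas T i t • syn T y t) := fun t => by
    rw [syn, sum_mul]
    exact sum_congr rfl fun i _ => by simp only [smul_eq_mul]; ring
  simp only [h]
  rw [integral_finsetSum fun j _ => by
    have := continuous_bas (T := T)
    have := continuous_syn (T := T) y
    exact Continuous.intervalIntegrable (by fun_prop) _ _]
  simp only [integral_const_mul, coord_syn hT]
  rfl

lemma l2_syn {M : ℕ} (hT : 0 < T) (x : Idx M → ℝ) : l2 T (syn T x) = √(x ⬝ᵥ x) := by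
  simp only [l2, sq, integral_syn_mul hT]

lemma norm_le_l2 {M : ℕ} (hT : 0 < T) (x : Idx M → ℝ) : ‖x‖ ≤ l2 T (syn T x) := by
  rw [l2_syn hT]
  refine (pi_norm_le_iff_of_nonneg (sqrt_nonneg _)).2 fun i => ?_
  refine le_sqrt_of_sq_le ?_
  rw [norm_eq_abs, sq_abs, sq]
  exact single_le_sum (f := fun i => x i * x i) (fun i _ => mul_self_nonneg _)
    (mem_univ i)

lemma l2_le_norm {M : ℕ} (hT : 0 < T) (x : Idx M → ℝ) :
    l2 T (syn T x) ≤ √(card (Idx M)) * ‖x‖ := by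
  rw [l2_syn hT, ← sqrt_sq (norm_nonneg x), ← sqrt_mul (by positivity)]
  refine sqrt_le_sqrt ((sum_le_card_nsmul _ _ (‖x‖ ^ 2) fun i _ => ?_).trans_eq
    (by rw [nsmul_eq_mul, card_univ]))
  rw [← sq, ← sq_abs]
  exact pow_le_pow_left₀ (abs_nonneg _) (norm_le_pi_norm x i) 2

/-! ### The nonlinearity -/

lemma contDiff_deriv {f : ℝ → ℝ} (h : ContDiff ℝ ∞ f) : ContDiff ℝ ∞ (deriv f) :=
  (contDiff_infty_iff_deriv.1 h).2

lemma deriv_odd {f : ℝ → ℝ} (h : ∀ x, f (-x) = f x) (x : ℝ) : deriv f (-x) = -deriv f x := by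
  have := deriv_comp_neg f x
  rw [funext h] at this
  rw [this, neg_neg]

lemma deriv_even {f : ℝ → ℝ} (h : ∀ x, f (-x) = -f x) (x : ℝ) : deriv f (-x) = deriv f x := by
  have := deriv_comp_neg f x
  rw [funext h, deriv.fun_neg] at this
  exact (neg_injective this).symm

lemma abs_sub_le_of_deriv {f f' : ℝ → ℝ} (h : ∀ x, HasDerivAt f (f' x) x) {a b C : ℝ}
    (hC : ∀ x ∈ Set.uIcc b a, |f' x| ≤ C) : |f a - f b| ≤ C * |a - b| :=
  (convex_uIcc b a).norm_image_sub_le_of_norm_hasDerivWithin_le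
    (fun x _ => (h x).hasDerivWithinAt) hC Set.left_mem_uIcc Set.right_mem_uIcc

lemma scalar_taylor {V : ℝ → ℝ} (hV : ContDiff ℝ ∞ V) (he : ∀ x, V (-x) = V x) (R : ℝ) :
    ∃ C, 0 ≤ C ∧ ∀ a b, |a| ≤ R → |b| ≤ R →
      |deriv (deriv V) a - deriv (deriv V) b| ≤ C * (|a| + |b|) * |a - b| ∧
      |deriv V a - deriv V b - deriv (deriv V) b * (a - b)| ≤ C * (|a| + |b|) * |a - b| ^ 2 := by
  have hd : ∀ {f : ℝ → ℝ}, ContDiff ℝ ∞ f → ∀ x, HasDerivAt f (deriv f x) x := fun h x =>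
    (h.differentiable (by simp)).differentiableAt.hasDerivAt
  have h1 := contDiff_deriv hV
  have h2 := contDiff_deriv h1
  have h3 := contDiff_deriv h2
  obtain ⟨C, hC⟩ := (isCompact_Icc (a := -R) (b := R)).exists_bound_of_continuousOn
    (contDiff_deriv h3).continuous.continuousOn
  have hC0 : 0 ≤ max C 0 := le_max_right _ _
  have h30 : deriv (deriv (deriv V)) 0 = 0 := by
    have := deriv_odd (deriv_even (deriv_odd he)) 0
    rw [neg_zero] at this
    exact self_eq_neg.1 this
  have hbd : ∀ {a b : ℝ}, ∀ x ∈ Set.uIcc b a, |x| ≤ max |a| |b| ∧ |x - b| ≤ |a - b| := by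
    intro a b x hx
    refine ⟨?_, Set.abs_sub_left_of_mem_uIcc hx⟩
    rcases Set.mem_uIcc.1 hx with ⟨h, h'⟩ | ⟨h, h'⟩
    · rw [max_comm]; exact abs_le_max_abs_abs h h'
    · exact abs_le_max_abs_abs h h'
  have k3 : ∀ c, |c| ≤ R → |deriv (deriv (deriv V)) c| ≤ max C 0 * |c| := fun c hc => by
    have := abs_sub_le_of_deriv (hd h3) (a := c) (b := 0) (C := max C 0) fun x hx =>
      (hC x (abs_le.1 ((hbd x hx).1.trans (by simpa using hc)))).trans (le_max_left _ _)
    simpa [h30] using this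
  have k2 : ∀ a b, |a| ≤ R → |b| ≤ R →
      |deriv (deriv V) a - deriv (deriv V) b| ≤ max C 0 * (|a| + |b|) * |a - b| :=
    fun a b ha hb => abs_sub_le_of_deriv (hd h2) fun x hx => by
      have := (hbd x hx).1
      refine (k3 x (this.trans (max_le ha hb))).trans (mul_le_mul_of_nonneg_left ?_ hC0)
      exact this.trans (max_le_add_of_nonneg (abs_nonneg _) (abs_nonneg _))
  refine ⟨2 * max C 0, by positivity, fun a b ha hb => ⟨?_, ?_⟩⟩
  · refine (k2 a b ha hb).trans ?_
    nlinarith [mul_nonneg (mul_nonneg hC0 (add_nonneg (abs_nonneg a) (abs_nonneg b)))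
      (abs_nonneg (a - b))]
  · have := abs_sub_le_of_deriv (f := fun x => deriv V x - deriv (deriv V) b * x)
      (f' := fun x => deriv (deriv V) x - deriv (deriv V) b)
      (fun x => ((hd h1 x).sub ((hasDerivAt_id x).const_mul _)).congr_deriv (by simp))
      (a := a) (b := b) (C := 2 * max C 0 * (|a| + |b|) * |a - b|) fun x hx => by
        obtain ⟨e1, e2⟩ := hbd x hx
        have e3 := max_le_add_of_nonneg (abs_nonneg a) (abs_nonneg b)
        refine (k2 x b (e1.trans (max_le ha hb)) hb).trans ?_
        refine mul_le_mul ?_ e2 (abs_nonneg _) (by positivity)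
        rw [mul_comm 2, mul_assoc]
        exact mul_le_mul_of_nonneg_left (by linarith [abs_nonneg a]) hC0
    rw [show deriv V a - deriv V b - deriv (deriv V) b * (a - b)
      = deriv V a - deriv (deriv V) b * a - (deriv V b - deriv (deriv V) b * b) by ring]
    refine this.trans (le_of_eq (by ring))

/-! ### The spectrum at zero -/

/-- The standing assumptions on the potential and on the linearization at zero. -/
structure Model (V : ℝ → ℝ) (d T : ℝ) (M : ℕ) : Prop where
  smooth : ContDiff ℝ ∞ V
  even : ∀ x, V (-x) = V x
  d_pos : 0 < d
  T_pos : 0 < T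
  hyp : IsHyperbolic V d T M

variable {V : ℝ → ℝ} {d T : ℝ} {M : ℕ}

/-- The coefficient `2d + V''(0) - (2τk/T)²` of the dispersion relation. -/
def disp (V : ℝ → ℝ) (d T : ℝ) (k : ℤ) : ℝ :=
  2 * d + deriv (deriv V) 0 - (k * (2 * π / T)) ^ 2

lemma mem_spectrum (hT : 0 < T) (hd : 0 < d) {ν : ℂ} : ν ∈ spectrumAtZero V d T M ↔
    ∃ i : Idx M, d * (ν ^ 2 + 1) = disp V d T i * ν := by
  have hd' : (d : ℂ) ≠ 0 := by exact_mod_cast hd.ne'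
  have key : ∀ (x z : Idx M → ℂ), (∀ t, ((1 / d : ℝ) : ℂ) * deriv (deriv (syn T x)) t
        + ((deriv (deriv V) 0 / d + 2 : ℝ) : ℂ) * syn T x t - syn T z t = ν * syn T x t) ↔
      ∀ i : Idx M, disp V d T i * x i - d * z i = d * ν * x i := fun x z => by
    have h := (syn_injective hT).eq_iff (a := ((1 / d : ℝ) : ℂ) • dcoord T (dcoord T x)
      + ((deriv (deriv V) 0 / d + 2 : ℝ) : ℂ) • x - z) (b := ν • x)
    simp only [syn_sub, syn_add, syn_smul, funext_iff, Pi.add_apply, Pi.sub_apply, Pi.smul_apply,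
      smul_eq_mul, dcoord_dcoord] at h
    simp only [deriv_syn]
    refine h.trans (forall_congr' fun i => ?_)
    rw [← mul_right_inj' hd']
    refine Eq.congr ?_ (by ring)
    simp only [disp, real_smul]
    push_cast
    field_simp
    ring
  constructor
  · rintro ⟨v, w, hv, hw, hne, h1, h2⟩
    obtain ⟨x, rfl⟩ := (mem_XC hT).1 hv
    obtain ⟨z, rfl⟩ := (mem_XC hT).1 hw
    have hx : x = ν • z := syn_injective hT (by rw [syn_smul]; exact funext h2)
    obtain ⟨i, hi⟩ : ∃ i, z i ≠ 0 := by
      by_contra! h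
      have : z = 0 := funext h
      subst this
      rw [smul_zero] at hx
      subst hx
      exact hne (by ext <;> simp [syn])
    refine ⟨i, mul_right_cancel₀ hi ?_⟩
    have := (key x z).1 h1 i
    rw [hx, Pi.smul_apply, smul_eq_mul] at this
    linear_combination -this
  · rintro ⟨i, hi⟩
    refine ⟨syn T (ν • Pi.single i 1), syn T (Pi.single i 1), (mem_XC hT).2 ⟨_, rfl⟩,
      (mem_XC hT).2 ⟨_, rfl⟩, fun h => ?_, (key _ _).2 fun j => ?_, fun t => by rw [syn_smul]; rfl⟩
    · have h1 : syn T (Pi.single i (1 : ℂ)) = syn T (0 : Idx M → ℂ) := by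
        rw [(Prod.mk.inj h).2]; funext; simp [syn]
      simpa using congrFun (syn_injective hT h1) i
    · by_cases hj : j = i
      · subst hj
        simp only [Pi.smul_apply, Pi.single_eq_same, smul_eq_mul]
        linear_combination -hi
      · simp [hj]

lemma Model.exists_root (h : Model V d T M) (i : Idx M) :
    ∃ ν : ℝ, ν ≠ 0 ∧ |ν| < 1 ∧ d * (ν + ν⁻¹) = disp V d T i := by
  have hd := h.d_pos
  set B := disp V d T i with hB
  rcases le_or_gt (B ^ 2) (4 * d ^ 2) with hle | hlt
  · exfalso
    have h1 : √(4 * d ^ 2 - B ^ 2) ^ 2 = 4 * d ^ 2 - B ^ 2 := sq_sqrt (by linarith)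
    set s := √(4 * d ^ 2 - B ^ 2)
    have hd' : (d : ℂ) ≠ 0 := by exact_mod_cast hd.ne'
    refine h.hyp (⟨B / (2 * d), s / (2 * d)⟩ : ℂ) ((mem_spectrum h.T_pos hd).2 ⟨i, ?_⟩) ?_
    · rw [← hB]
      apply Complex.ext <;> simp [sq] <;> field_simp <;> nlinarith
    · rw [norm_def, sqrt_eq_one, normSq_mk]
      field_simp
      linarith
  · have hs : √(B ^ 2 - 4 * d ^ 2) ^ 2 = B ^ 2 - 4 * d ^ 2 := sq_sqrt (by linarith)
    have hs0 : 0 < √(B ^ 2 - 4 * d ^ 2) := sqrt_pos.2 (by linarith)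
    set s := √(B ^ 2 - 4 * d ^ 2)
    obtain ⟨x, hx, hx1⟩ : ∃ x, x ^ 2 - 2 * B * x + 4 * d ^ 2 = 0 ∧ |x| < 2 * d := by
      rcases le_or_gt 0 B with hb | hb
      · refine ⟨B - s, by nlinarith, abs_lt.2 ⟨by nlinarith, ?_⟩⟩
        by_contra! hc
        nlinarith
      · refine ⟨B + s, by nlinarith, abs_lt.2 ⟨?_, by nlinarith⟩⟩
        by_contra! hc
        nlinarith
    have hx0 : x ≠ 0 := by rintro rfl; nlinarith
    refine ⟨x / (2 * d), by positivity, ?_, ?_⟩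
    · rw [abs_div, abs_of_pos (by positivity : 0 < 2 * d), div_lt_one (by positivity)]
      exact hx1
    · field_simp
      linarith

/-- The stable eigenvalue of the linearization at zero with wave number `i`. -/
def Model.root (h : Model V d T M) (i : Idx M) : ℝ := (h.exists_root i).choose

lemma Model.root_spec (h : Model V d T M) (i : Idx M) : h.root i ≠ 0 ∧ |h.root i| < 1 ∧
    d * (h.root i + (h.root i)⁻¹) = disp V d T i := (h.exists_root i).choose_spec

lemma Model.rM_spec (h : Model V d T M) :
    1 < rM V d T M ∧ ∀ i, |h.root i| ≤ (rM V d T M)⁻¹ := by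
  have hd' : (d : ℂ) ≠ 0 := by exact_mod_cast h.d_pos.ne'
  have hr := h.root_spec
  set X := {x : ℝ | 1 < x ∧ ∃ ν ∈ spectrumAtZero V d T M, ‖ν‖ = x} with hX
  have hmem : ∀ i, |h.root i|⁻¹ ∈ X := fun i => by
    obtain ⟨h1, h2, h3⟩ := hr i
    have h1' : (h.root i : ℂ) ≠ 0 := by exact_mod_cast h1
    refine ⟨(one_lt_inv₀ (abs_pos.2 h1)).2 h2, ((h.root i)⁻¹ : ℝ),
      (mem_spectrum h.T_pos h.d_pos).2 ⟨i, ?_⟩, by simp⟩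
    rw [← h3]
    push_cast
    field_simp
    ring
  have hsub : X ⊆ Set.range fun i => |h.root i|⁻¹ := by
    rintro _ ⟨hx, ν, hν, rfl⟩
    obtain ⟨i, hi⟩ := (mem_spectrum h.T_pos h.d_pos).1 hν
    obtain ⟨h1, h2, h3⟩ := hr i
    have h1' : (h.root i : ℂ) ≠ 0 := by exact_mod_cast h1
    rw [← h3] at hi
    push_cast at hi
    have h4 : (ν - h.root i) * (ν * h.root i - 1) = 0 := by
      field_simp at hi
      linear_combination hi
    rcases mul_eq_zero.1 h4 with h5 | h5
    · rw [sub_eq_zero.1 h5, norm_real, norm_eq_abs] at hx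
      linarith
    · refine ⟨i, ?_⟩
      have : ν = ((h.root i : ℝ) : ℂ)⁻¹ := eq_inv_of_mul_eq_one_left (sub_eq_zero.1 h5)
      simp [this]
  have hfin : X.Finite := (Set.finite_range _).subset hsub
  have hne : X.Nonempty := ⟨_, hmem ⟨0, by simp⟩⟩
  have h1 : 1 < rM V d T M := (hne.csInf_mem hfin).1
  refine ⟨h1, fun i => ?_⟩
  rw [le_inv_comm₀ (abs_pos.2 (hr i).1) (by linarith)]
  exact csInf_le hfin.bddBelow (hmem i)

/-! ### The lattice system in Fourier coordinates -/

lemma abs_integral_le (hT : 0 < T) {f : ℝ → ℝ} {C : ℝ} (h : ∀ t, |f t| ≤ C) :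
    |∫ t in 0..T, f t| ≤ T * C := by
  have := norm_integral_le_of_norm_le_const (a := 0) (b := T) (f := f) (C := C)
    fun t _ => h t
  rwa [sub_zero, abs_of_pos hT, mul_comm] at this

/-- The coordinates of `P_M f(u)`. -/
def gco (V : ℝ → ℝ) (T : ℝ) (x : Idx M → ℝ) (i : Idx M) : ℝ :=
  ∫ s in 0..T, bas T i s * deriv V (syn T x s)

/-- The matrix of `w ↦ P_M (f'(u) w)`. -/
def Aco (V : ℝ → ℝ) (T : ℝ) (x : Idx M → ℝ) : Matrix (Idx M) (Idx M) ℝ :=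
  Matrix.of fun i j => ∫ s in 0..T, bas T i s * (deriv (deriv V) (syn T x s) * bas T j s)

lemma Aco_mulVec {E : Type*} [NormedAddCommGroup E] [NormedSpace ℝ E] [CompleteSpace E]
    (hV : ContDiff ℝ ∞ V) (x : Idx M → ℝ) (w : Idx M → E) (i : Idx M) :
    ∑ j, Aco V T x i j • w j
      = ∫ s in 0..T, bas T i s • deriv (deriv V) (syn T x s) • syn T w s := by
  have hb := continuous_bas (T := T)
  have hx := continuous_syn (T := T) x
  have hf := (contDiff_deriv (contDiff_deriv hV)).continuous
  have : ∀ s, bas T i s • deriv (deriv V) (syn T x s) • syn T w s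
      = ∑ j : Idx M, (bas T i s * (deriv (deriv V) (syn T x s) * bas T j s)) • w j := fun s => by
    simp only [syn, smul_sum, smul_smul]
  simp only [this]
  rw [integral_finsetSum fun j _ => by
    exact Continuous.intervalIntegrable (by fun_prop) _ _]
  simp only [intervalIntegral.integral_smul_const, Aco, of_apply]

/-- The time derivative as a matrix. -/
def Jco (T : ℝ) (M : ℕ) : Matrix (Idx M) (Idx M) ℝ :=
  Matrix.of fun i j => if j = i.neg then -(i.1 * (2 * π / T)) else 0

lemma Jco_sum {E : Type*} [NormedAddCommGroup E] [NormedSpace ℝ E] (w : Idx M → E) (i : Idx M) :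
    ∑ j, Jco T M i j • w j = dcoord T w i := by
  simp [Jco, dcoord, ite_smul]

lemma Jco_mulVec (w : Idx M → ℝ) : (Jco T M).mulVec w = dcoord T w :=
  funext fun i => Jco_sum w i

lemma sgn_mul_self (k : ℤ) : sgn k * sgn k = 1 := by
  unfold sgn; split_ifs <;> simp

lemma bas_refl (hT : 0 < T) (k : ℤ) (t : ℝ) : bas T k (T - t) = sgn k * bas T k t := by
  have h : k * (2 * π / T) * (T - t) = k * (2 * π) - k * (2 * π / T) * t := by
    field_simp
  simp only [bas, h, Real.cos_int_mul_two_pi_sub, Real.sin_int_mul_two_pi_sub, sgn]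
  split_ifs <;> simp

lemma integral_refl {c : ℝ} {F : ℝ → ℝ} (hF : ∀ t, F (T - t) = c * F t) :
    ∫ t in 0..T, F t = c * ∫ t in 0..T, F t := by
  have := integral_comp_sub_left F T (a := 0) (b := T)
  rw [sub_self, sub_zero] at this
  rw [← integral_const_mul, ← this]
  simp only [hF]

lemma syn_refl (hT : 0 < T) {x : Idx M → ℝ} (hx : ∀ i : Idx M, sgn i * x i = x i) (t : ℝ) :
    syn T x (T - t) = syn T x t :=
  sum_congr rfl fun i _ => by
    rw [bas_refl hT, smul_eq_mul, smul_eq_mul]; linear_combination bas T i t * hx i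

lemma syn_neg (x : Idx M → ℝ) (t : ℝ) : syn T (-x) t = -syn T x t := by simp [syn]

set_option maxHeartbeats 1000000 in
/-- The lattice system in Fourier coordinates. -/
def Model.lattice (h : Model V d T M) : Chain (Idx M) where
  d := d
  a₀ := deriv (deriv V) 0
  S i := (i.1 * (2 * π / T)) ^ 2
  J := Jco T M
  par i := sgn i
  g := gco V T
  A := Aco V T
  ν := h.root
  d_pos := h.d_pos
  par_eq i := by unfold sgn; dsimp only; split_ifs <;> simp
  J_skew := by
    ext i j
    by_cases hj : j = i.neg
    · subst hj; simp [Jco, Idx.neg_neg]; simp [Idx.neg]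
    · have : i ≠ j.neg := fun h => hj (by rw [h, Idx.neg_neg])
      simp [Jco, hj, this]
  J_sq := by
    refine ext_of_mulVec_single fun j => ?_
    rw [← mulVec_mulVec, Jco_mulVec, Jco_mulVec]
    funext i
    simp [dcoord_dcoord, mulVec_diagonal]
  J_par i j := by
    by_cases hj : j = i.neg
    · subst hj
      rcases eq_or_ne i.1 0 with h0 | h0
      · simp [Jco, h0]
      · have : sgn (-i.1) = -sgn i.1 := by
          unfold sgn
          rcases lt_or_gt_of_ne h0 with h1 | h1
          · simp [h1.le, h1.not_ge]
          · simp [h1.le, h1.not_ge]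
        simp [Jco, Idx.neg, this]; ring
    · simp [Jco, hj]
  A_symm x := by
    ext i j
    simp only [Aco, transpose_apply, of_apply]
    congr 1; funext s; ring
  A_par x hx i j := by
    have := integral_refl (T := T) (c := sgn i * sgn j)
      (F := fun s => bas T i s * (deriv (deriv V) (syn T x s) * bas T j s)) fun t => by
        rw [bas_refl h.T_pos, bas_refl h.T_pos, syn_refl h.T_pos hx]; ring
    simp only [Aco, of_apply]
    nth_rewrite 1 [this]
    linear_combination (sgn j * ∫ s in 0..T,
      bas T i s * (deriv (deriv V) (syn T x s) * bas T j s)) * sgn_mul_self i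
  g_par x hx i := (integral_refl (T := T) (c := sgn i) fun t => by
    rw [bas_refl h.T_pos, syn_refl h.T_pos hx, mul_assoc]).symm
  A_zero := by
    ext i j
    have : ∀ s, syn T (0 : Idx M → ℝ) s = 0 := fun s => by simp [syn]
    have h2 : ∀ s, bas T i s * (deriv (deriv V) 0 * bas T j s)
        = deriv (deriv V) 0 * (bas T i s * bas T j s) := fun s => by ring
    simp only [Aco, of_apply, this, h2, integral_const_mul,
      bas_orthonormal h.T_pos, Matrix.smul_apply, one_apply, Subtype.coe_inj, smul_eq_mul]
  A_neg x := by
    ext i j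
    simp only [Aco, of_apply, syn_neg, deriv_even (deriv_odd h.even)]
  g_neg x := by
    funext i
    simp only [gco, syn_neg, deriv_odd h.even, mul_neg, integral_neg,
      Pi.neg_apply]
  A_lip R := by
    have hT := h.T_pos
    set k : ℝ := card (Idx M) * √(2 / T) with hk
    obtain ⟨C, hC, hs⟩ := scalar_taylor h.smooth h.even (k * R)
    refine ⟨T * (√(2 / T) * (C * (k * k) * √(2 / T))), by positivity, fun x y hx hy i j => ?_⟩
    have hb := continuous_bas (T := T)
    have hc := continuous_syn (T := T) (E := ℝ) (M := M)
    have hf := (contDiff_deriv (contDiff_deriv h.smooth)).continuous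
    have hk0 : 0 ≤ k := by positivity
    simp only [Aco, of_apply]
    rw [← integral_sub (Continuous.intervalIntegrable (by fun_prop) _ _)
      (Continuous.intervalIntegrable (by fun_prop) _ _)]
    refine (abs_integral_le hT (C := √(2 / T) * (C * (k * ‖x‖ + k * ‖y‖) * (k * ‖x - y‖) * √(2 / T)))
      fun s => ?_).trans_eq (by ring)
    have e1 := norm_syn_le hT x s
    have e2 := norm_syn_le hT y s
    have e3 := norm_syn_le hT (x - y) s
    rw [syn_sub] at e3
    have := (hs _ _ (e1.trans (by gcongr)) (e2.trans (by gcongr))).1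
    rw [← mul_sub, ← sub_mul, abs_mul, abs_mul]
    refine mul_le_mul (abs_bas_le hT _ _) (mul_le_mul (this.trans ?_) (abs_bas_le hT _ _)
      (abs_nonneg _) (by positivity)) (by positivity) (by positivity)
    exact mul_le_mul (mul_le_mul_of_nonneg_left (add_le_add e1 e2) hC) e3 (abs_nonneg _)
      (by positivity)
  g_taylor R := by
    have hT := h.T_pos
    set k : ℝ := card (Idx M) * √(2 / T) with hk
    obtain ⟨C, hC, hs⟩ := scalar_taylor h.smooth h.even (k * R)
    refine ⟨T * (√(2 / T) * (C * (k * k ^ 2))), by positivity, fun x y hx hy => ?_⟩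
    have hb := continuous_bas (T := T)
    have hc := continuous_syn (T := T) (E := ℝ) (M := M)
    have hf := (contDiff_deriv (contDiff_deriv h.smooth)).continuous
    have hf' := (contDiff_deriv h.smooth).continuous
    have hk0 : 0 ≤ k := by positivity
    refine (pi_norm_le_iff_of_nonneg (by positivity)).2 fun i => ?_
    have e0 : (gco V T x - gco V T y - (Aco V T y).mulVec (x - y)) i = ∫ s in 0..T, bas T i s *
        (deriv V (syn T x s) - deriv V (syn T y s)
          - deriv (deriv V) (syn T y s) * (syn T x s - syn T y s)) := by
      have := Aco_mulVec (T := T) h.smooth y (x - y) i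
      rw [syn_sub] at this
      simp only [smul_eq_mul] at this
      simp only [Pi.sub_apply, gco, mulVec, dotProduct] at this ⊢
      rw [this, ← integral_sub, ← integral_sub]
      · congr 1; funext s; ring
      all_goals exact Continuous.intervalIntegrable (by fun_prop) _ _
    rw [e0, norm_eq_abs]
    refine (abs_integral_le hT (C := √(2 / T) * (C * (k * ‖x‖ + k * ‖y‖) * (k * ‖x - y‖) ^ 2))
      fun s => ?_).trans_eq (by ring)
    have e1 := norm_syn_le hT x s
    have e2 := norm_syn_le hT y s
    have e3 := norm_syn_le hT (x - y) s
    rw [syn_sub] at e3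
    have := (hs _ _ (e1.trans (by gcongr)) (e2.trans (by gcongr))).2
    rw [abs_mul]
    refine mul_le_mul (abs_bas_le hT _ _) (this.trans ?_) (abs_nonneg _) (by positivity)
    exact mul_le_mul (mul_le_mul_of_nonneg_left (add_le_add e1 e2) hC)
      (pow_le_pow_left₀ (abs_nonneg _) e3 2) (by positivity) (by positivity)
  A_J x := by
    funext i
    have hb := continuous_bas (T := T)
    have hc := continuous_syn (T := T) (E := ℝ) (M := M)
    have hf := (contDiff_deriv (contDiff_deriv h.smooth)).continuous
    have hf' := (contDiff_deriv h.smooth).continuous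
    have hd := fun t => (((contDiff_deriv h.smooth).differentiable (by simp)).differentiableAt
      (x := syn T x t)).hasDerivAt
    have h0 := integral_eq_zero h.T_pos (F := fun s => bas T i s * deriv V (syn T x s))
      (fun s => (hasDerivAt_bas _ s).mul ((hd s).comp s (hasDerivAt_syn x s))) (by fun_prop)
      (by simp only [syn, bas_period h.T_pos])
    have h1 := Aco_mulVec (T := T) h.smooth x (dcoord T x) i
    simp only [smul_eq_mul] at h1
    rw [Jco_mulVec, Jco_mulVec, mulVec, dotProduct, h1, dcoord, gco, smul_eq_mul,
      ← integral_const_mul, ← sub_eq_zero]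
    rw [← integral_sub]
    · refine Eq.trans ?_ h0
      congr 1; funext s; simp only [Idx.neg]; ring
    all_goals exact Continuous.intervalIntegrable (by fun_prop) _ _
  ν_ne i := (h.root_spec i).1
  ν_eq i := (h.root_spec i).2.2

section

variable {V : ℝ → ℝ} {d T : ℝ} {M : ℕ}

/-! ### Transfer to coordinates -/

lemma galerkin_syn (hV : ContDiff ℝ ∞ V) (hT : 0 < T) (x : Idx M → ℝ) :
    galerkin V T M (syn T x) = syn T (gco V T x) := by
  funext t
  have hc := continuous_syn (T := T) x
  have hf := (contDiff_deriv hV).continuous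
  rw [galerkin, proj_eq hT (by fun_prop), re_syn]
  congr 1
  funext i
  rw [gco, ← ofReal_re (∫ s in 0..T, bas T i s * deriv V (syn T x s)),
    ← integral_ofReal]
  simp

lemma step_iff (hV : ContDiff ℝ ∞ V) (hT : 0 < T) (hd : 0 < d) (a x b : Idx M → ℝ) :
    (syn T a, syn T x) = stepMap V d T M (syn T x, syn T b) ↔ ∀ i : Idx M,
      d * (a i + b i - 2 * x i) + (i * (2 * π / T)) ^ 2 * x i - gco V T x i = 0 := by
  have h := (syn_injective hT).eq_iff (a := a)
    (b := (2 : ℝ) • x + (1 / d) • gco V T x + (1 / d) • dcoord T (dcoord T x) - b)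
  simp only [syn_sub, syn_add, syn_smul] at h
  simp only [stepMap, galerkin_syn hV hT, deriv_syn, Prod.mk.injEq, and_true]
  refine (h.trans funext_iff).trans (forall_congr' fun i => ?_)
  simp only [Pi.add_apply, Pi.sub_apply, Pi.smul_apply, smul_eq_mul, dcoord_dcoord]
  field_simp
  constructor <;> intro h <;> linarith

lemma isSolution_iff (hV : ContDiff ℝ ∞ V) (hT : 0 < T) (hd : 0 < d) (x : ℤ → Idx M → ℝ) :
    IsSolution V d T M (fun n => syn T (x n)) ↔ ∀ n (i : Idx M),
      d * (x (n + 1) i + x (n - 1) i - 2 * x n i) + (i * (2 * π / T)) ^ 2 * x n i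
        - gco V T (x n) i = 0 := by
  refine forall_congr' fun n => ?_
  simp only [pairAt, add_sub_cancel_right]
  exact step_iff hV hT hd _ _ _

lemma Model.isSolution_iff (h : Model V d T M) (x : ℤ → Idx M → ℝ) :
    IsSolution V d T M (fun n => syn T (x n)) ↔ h.lattice.IsSol x :=
  Breather.isSolution_iff h.smooth h.T_pos h.d_pos x

lemma exists_coord {S : Submodule ℝ (ℝ → ℝ)} {p : (Idx M → ℝ) → Prop}
    (hS : ∀ u, u ∈ S → ∃ x : Idx M → ℝ, syn T x = u ∧ p x) {q : ℤ → ℝ → ℝ} (hq : ∀ n, q n ∈ S) :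
    ∃ x : ℤ → Idx M → ℝ, q = (fun n => syn T (x n)) ∧ ∀ n, p (x n) := by
  choose x hx hp using fun n => hS _ (hq n)
  exact ⟨x, funext fun n => (hx n).symm, hp⟩

lemma l2_small (hT : 0 < T) {x : ℤ → Idx M → ℝ} {q : ℤ → ℝ → ℝ} (hq : q = fun n => syn T (x n))
    (h1 : Tendsto (fun n => l2 T (q n)) atTop (𝓝 0))
    (h2 : Tendsto (fun n => l2 T (q n)) atBot (𝓝 0)) (ε : ℝ) (hε : 0 < ε) :
    ∃ R : ℕ, ∀ n : ℤ, R < n.natAbs → ‖x n‖ ≤ ε := by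
  subst hq
  obtain ⟨a, ha⟩ := eventually_atTop.1 (h1.eventually (gt_mem_nhds hε))
  obtain ⟨b, hb⟩ := eventually_atBot.1 (h2.eventually (gt_mem_nhds hε))
  refine ⟨a.natAbs + b.natAbs, fun n hn => (norm_le_l2 hT _).trans ?_⟩
  rcases le_total 0 n with h | h
  exacts [(ha n (by omega)).le, (hb n (by omega)).le]

/-! ### The tangent spaces -/

lemma continuous_synth : Continuous (syn T : (Idx M → ℝ) → ℝ → ℝ) := by
  unfold syn; fun_prop

lemma mem_cone {S : Set ((ℝ → ℝ) × (ℝ → ℝ))} {a b : ℝ → Idx M → ℝ} {a' b' : Idx M → ℝ}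
    (ha : HasDerivAt a a' 0) (hb : HasDerivAt b b' 0)
    (hS : ∀ᶠ h in 𝓝 0, (syn T (a h), syn T (b h)) ∈ S) :
    (syn T a', syn T b') ∈ tangentConeAt ℝ S (syn T (a 0), syn T (b 0)) := by
  have hc := continuous_synth (T := T) (M := M)
  refine mem_tangentConeAt_of_seq (𝓝[≠] (0 : ℝ)) (fun h => h⁻¹)
    (fun h => (syn T (a h), syn T (b h)) - (syn T (a 0), syn T (b 0))) ?_ ?_ ?_
  · have := ((hc.tendsto _).comp ha.continuousAt.tendsto).prodMk_nhds
      ((hc.tendsto _).comp hb.continuousAt.tendsto)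
    refine Tendsto.mono_left ?_ nhdsWithin_le_nhds
    have h2 := this.sub_const (syn T (a 0), syn T (b 0))
    rwa [sub_self] at h2
  · filter_upwards [nhdsWithin_le_nhds hS] with h hh
    rwa [add_sub_cancel]
  · have h1 := ha.tendsto_slope_zero
    have h2 := hb.tendsto_slope_zero
    have := ((hc.tendsto _).comp h1).prodMk_nhds ((hc.tendsto _).comp h2)
    refine this.congr fun h => ?_
    simp only [Function.comp_apply, zero_add, syn_smul, syn_sub]
    rfl

lemma l2pair_le (hT : 0 < T) (x y : Idx M → ℝ) :
    l2pair T (syn T x, syn T y) ≤ √(card (Idx M)) * (‖x‖ + ‖y‖) := by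
  have h1 : 0 ≤ l2 T (syn T x) := sqrt_nonneg _
  have h2 : 0 ≤ l2 T (syn T y) := sqrt_nonneg _
  rw [l2pair, mul_add]
  refine (sqrt_le_iff.2 ⟨add_nonneg h1 h2, ?_⟩).trans
    (add_le_add (l2_le_norm hT x) (l2_le_norm hT y))
  dsimp only
  nlinarith [mul_nonneg h1 h2]

/-- The pairs along a curve of solutions converging to zero lie on the stable manifold, read forward
or, after reflection, backward. -/
lemma Model.curve_mem (h : Model V d T M) {q v : ℤ → Idx M → ℝ} (hc : h.lattice.HasCurve q v 0)
    (hsymm : ∀ n, q (-n) = q n) :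
    (syn T (v 0), syn T (v (-1))) ∈ tangentStable V d T M (XR T M) (fun n => syn T (q n)) ∧
    (syn T (v 0), syn T (v 1)) ∈ tangentUnstable V d T M (XR T M) (fun n => syn T (q n)) := by
  obtain ⟨u, h1, h2, h3, h4⟩ := hc
  have hT := h.T_pos
  have hmem : ∀ x : Idx M → ℝ, syn T x ∈ XR T M := fun x => (mem_XR hT).2 ⟨x, rfl⟩
  have hclose : ∀ ε, 0 < ε → ∀ᶠ s in 𝓝 0, ∀ n m, -1 ≤ n → -1 ≤ m →
      l2pair T (syn T (u s n - q n), syn T (u s m - q m)) < ε := fun ε hε => by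
    have hk : 0 < 2 * (√(card (Idx M)) + 1) := by positivity
    filter_upwards [h4 _ (div_pos hε hk)] with s hs n m hn hm
    refine (l2pair_le hT _ _).trans_lt ?_
    have e1 := hs n (by omega)
    have e2 := hs m (by omega)
    rw [lt_div_iff₀ hk] at e1 e2
    nlinarith [norm_nonneg (u s n - q n), norm_nonneg (u s m - q m)]
  have hlim : ∀ s, Tendsto (u s) atTop (𝓝 0) → ∀ k : ℤ,
      Tendsto (fun n : ℕ => l2pair T (syn T (u s n), syn T (u s (n + k)))) atTop (𝓝 0) := by
    intro s hs k
    have e1 : Tendsto (fun n : ℕ => u s n) atTop (𝓝 0) := hs.comp tendsto_natCast_atTop_atTop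
    have e2 : Tendsto (fun n : ℕ => u s (n + k)) atTop (𝓝 0) :=
      hs.comp (tendsto_atTop_add_const_right _ k tendsto_natCast_atTop_atTop)
    refine squeeze_zero (fun n => sqrt_nonneg _) (fun n => l2pair_le hT _ _) ?_
    simpa using ((e1.norm.add e2.norm).const_mul √(card (Idx M)))
  have hstep : ∀ s, (∀ n : ℤ, 0 ≤ n → ∀ i, h.lattice.d * (u s (n + 1) i + u s (n - 1) i
      - 2 * u s n i) + h.lattice.S i * u s n i - h.lattice.g (u s n) i = 0) → ∀ n : ℤ, 0 ≤ n →
      (syn T (u s (n + 1)), syn T (u s n)) = stepMap V d T M (syn T (u s n), syn T (u s (n - 1)))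
      ∧ (syn T (u s (n - 1)), syn T (u s n))
        = stepMap V d T M (syn T (u s n), syn T (u s (n + 1))) := fun s hs n hn => by
    refine ⟨(step_iff h.smooth hT h.d_pos _ _ _).2 (hs n hn),
      (step_iff h.smooth hT h.d_pos _ _ _).2 fun i => ?_⟩
    rw [add_comm (u s (n - 1) i)]
    exact hs n hn i
  have h5 : ∀ ε : {ε : ℝ // 0 < ε}, ∀ᶠ s in 𝓝 0, (syn T (u s 0), syn T (u s (-1))) ∈
      stableNear V d T M (XR T M) (fun n => syn T (q n)) ε := fun ε => by
    filter_upwards [h1, hclose ε ε.2] with s hs hs2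
    refine ⟨fun n => (syn T (u s n), syn T (u s (n + -1))), by simp, fun n => ⟨hmem _, hmem _⟩,
      fun n => ?_, fun n => ?_, hlim s hs.2 (-1)⟩
    · have := (hstep s hs.1 n (by omega)).1
      push_cast
      rwa [add_neg_cancel_right]
    · have := hs2 n (n - 1) (by omega) (by omega)
      rwa [syn_sub, syn_sub] at this
  have h6 : ∀ ε : {ε : ℝ // 0 < ε}, ∀ᶠ s in 𝓝 0, (syn T (u s 0), syn T (u s 1)) ∈
      unstableNear V d T M (XR T M) (fun n => syn T (q n)) ε := fun ε => by
    filter_upwards [h1, hclose ε ε.2] with s hs hs2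
    refine ⟨fun n => (syn T (u s n), syn T (u s (n + 1))), by simp, fun n => ⟨hmem _, hmem _⟩,
      fun n => ?_, fun n => ?_, hlim s hs.2 1⟩
    · have := (hstep s hs.1 (n + 1) (by omega)).2
      push_cast
      rwa [add_sub_cancel_right] at this
    · have := hs2 n (n + 1) (by omega) (by omega)
      rw [syn_sub, syn_sub] at this
      simp only [pairAt, hsymm, show -(n : ℤ) - 1 = -(n + 1) by ring]
      exact this
  constructor
  · refine Set.mem_iInter.2 fun ε => ?_
    have := mem_cone (h2 0 (by norm_num)) (h2 (-1) (by norm_num)) (h5 ε)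
    rwa [h3 0 (by norm_num), h3 (-1) (by norm_num)] at this
  · refine Set.mem_iInter.2 fun ε => ?_
    have := mem_cone (h2 0 (by norm_num)) (h2 1 (by norm_num)) (h6 ε)
    rw [h3 0 (by norm_num), h3 1 (by norm_num)] at this
    simpa only [pairAt, zero_sub, hsymm] using this

lemma Chain.eq_zero_of_initial {ι : Type} [Fintype ι] [DecidableEq ι]
    (Λ : Chain ι) {q v : ℤ → ι → ℝ} (hv : Λ.opR q v = 0) (h0 : v 0 = 0) (h1 : v (-1) = 0) :
    v = 0 := by
  have key : ∀ n, v n = 0 → Λ.d • (v (n + 1) + v (n - 1)) = 0 := fun n hn => by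
    funext i
    have := congrFun (congrFun hv n) i
    simpa [opR, hn] using this
  have : ∀ n, v n = 0 ∧ v (n - 1) = 0 := fun n => by
    induction n using Int.induction_on with
    | zero => exact ⟨h0, by simpa using h1⟩
    | succ n ih =>
      have := key n ih.1
      rw [ih.2, add_zero, smul_eq_zero] at this
      exact ⟨this.resolve_left Λ.d_pos.ne', by simpa using ih.1⟩
    | pred n ih =>
      have := key (-n - 1) ih.2
      rw [sub_add_cancel, ih.1, zero_add, smul_eq_zero] at this
      exact ⟨ih.2, this.resolve_left Λ.d_pos.ne'⟩
  exact funext fun n => (this n).1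

/-- If the tangent spaces intersect in one dimension, the bounded solutions of the linearization
along the primary breather are the multiples of its time derivative. -/
lemma Model.kernel (h : Model V d T M) {θ : ℝ} (hθ : 0 < θ) (hθ1 : θ < 1)
    (hν : ∀ i, |h.root i| < θ) {q : ℤ → Idx M → ℝ} {D : ℝ} (hq : h.lattice.IsSol q)
    (hqD : WBound (bump θ 0) D q) (hsymm : ∀ n, q (-n) = q n)
    (hnd : IsNondegenerate V d T M (fun n => syn T (q n))) (hne : h.lattice.dot q ≠ 0)
    {v : ℤ → Idx M → ℝ} (hv : IsBdd v) (hv0 : h.lattice.opR q v = 0) :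
    ∃ c : ℝ, v = c • h.lattice.dot q := by
  obtain ⟨w, -, hw⟩ := hnd
  have key : ∀ v : ℤ → Idx M → ℝ, IsBdd v → h.lattice.opR q v = 0 →
      ∃ c : ℝ, c • w = (syn T (v 0), syn T (v (-1))) := by
    rintro v ⟨B, hB⟩ hv0
    have h1 := (h.curve_mem (h.lattice.hasCurve_zero hθ hθ1 hν hq hqD hB hv0) hsymm).1
    have h2 := (h.curve_mem (h.lattice.hasCurve_zero hθ hθ1 hν (v := fun n => v (-n)) hq hqD
      (fun n => hB _) (by
        funext n i
        have := congrFun (congrFun hv0 (-n)) i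
        simp only [opR_apply, hsymm, Pi.zero_apply] at this ⊢
        rw [← this, show -(n + 1) = -n - 1 by ring, show -(n - 1) = -n + 1 by ring]
        ring)) hsymm).2
    exact Submodule.mem_span_singleton.1 (hw.subset ⟨h1, by simpa using h2⟩)
  have hdot0 : h.lattice.opR q (h.lattice.dot q) = 0 := hq.opR_dot_eq_zero
  obtain ⟨a, ha⟩ := key v hv hv0
  obtain ⟨b, hb⟩ := key (h.lattice.dot q) (by
    obtain ⟨C, hC, hJ⟩ := norm_dot_le h.lattice
    refine ⟨C * |D|, fun n => (hJ _ _).trans (mul_le_mul_of_nonneg_left ((hqD n).trans ?_) hC.le)⟩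
    exact (mul_le_mul (le_abs_self D) (bump_le_one hθ hθ1 0 n) (bump_pos hθ 0 n).le
      (abs_nonneg D)).trans_eq (mul_one _)) hdot0
  have hb0 : b ≠ 0 := by
    rintro rfl
    rw [zero_smul] at hb
    have e : ∀ x : Idx M → ℝ, (0 : ℝ → ℝ) = syn T x → x = 0 := fun x hx =>
      syn_injective h.T_pos (hx.symm.trans (by funext; simp [syn]))
    exact hne (h.lattice.eq_zero_of_initial hdot0 (e _ (Prod.mk.inj hb).1) (e _ (Prod.mk.inj hb).2))
  refine ⟨a / b, ?_⟩
  rw [← sub_eq_zero]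
  have e : (syn T (v 0), syn T (v (-1)))
      = (a / b) • (syn T (h.lattice.dot q 0), syn T (h.lattice.dot q (-1))) := by
    rw [← ha, ← hb, smul_smul, div_mul_cancel₀ _ hb0]
  rw [Prod.smul_mk, ← syn_smul, ← syn_smul] at e
  refine h.lattice.eq_zero_of_initial (q := q) ?_
    (sub_eq_zero.2 (syn_injective h.T_pos (Prod.mk.inj e).1))
    (sub_eq_zero.2 (syn_injective h.T_pos (Prod.mk.inj e).2))
  funext n i
  have h1 := congrFun (congrFun hv0 n) i
  have h2 := congrFun (congrFun hdot0 n) i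
  simp only [opR_apply, Pi.zero_apply, Pi.sub_apply, Pi.smul_apply, smul_eq_mul,
    mulVec_sub, mulVec_smul] at h1 h2 ⊢
  linear_combination h1 - a / b * h2

/-! ### The derivative with respect to the frequency -/

lemma bas_scale {c : ℝ} (hc : 0 < c) (k : ℤ) (t : ℝ) :
    bas (c * T) k (c * t) = √c⁻¹ * bas T k t := by
  have h1 : k * (2 * π / (c * T)) * (c * t) = k * (2 * π / T) * t := by field_simp
  have h2 : ∀ a, √(a / (c * T)) = √c⁻¹ * √(a / T) := fun a => by
    rw [← sqrt_mul (by positivity)]; congr 1; field_simp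
  rw [bas, bas, h1, h2, h2]
  split_ifs <;> ring

lemma syn_scale {c : ℝ} (hc : 0 < c) (x : Idx M → ℝ) (t : ℝ) :
    syn (c * T) x (c * t) = syn T (√c⁻¹ • x) t := by
  rw [syn_smul]
  simp only [syn, bas_scale hc, Pi.smul_apply, smul_eq_mul, mul_sum, mul_assoc]

lemma gco_scale {c : ℝ} (hc : 0 < c) (x : Idx M → ℝ) (i : Idx M) :
    gco V (c * T) x i = c * √c⁻¹ * gco V T (√c⁻¹ • x) i := by
  have := mul_integral_comp_mul_left (a := 0) (b := T)
    (f := fun s => bas (c * T) i s * deriv V (syn (c * T) x s)) (c := c)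
  rw [mul_zero] at this
  rw [gco, ← this, gco, mul_assoc, ← integral_const_mul √c⁻¹]
  simp only [bas_scale hc, syn_scale hc, mul_assoc]

/-- The coordinates of a breather of frequency `om` in rescaled time. -/
lemma exists_rescaled (hV : ContDiff ℝ ∞ V) (hd : 0 < d) (hT : 0 < T) {om : ℝ} (hom : 0 < om)
    {z : ℤ → ℝ → ℝ} (hz : IsHomoclinic V d (2 * π / om) M fun n t => z n (om * t)) :
    ∃ a : ℤ → Idx M → ℝ, (∀ n t, z n (2 * π / T * t) = syn T (a n) t) ∧
      (∀ n (i : Idx M), sgn i * a n i = a n i) ∧ ∀ n (i : Idx M),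
        d * (a (n + 1) i + a (n - 1) i - 2 * a n i)
          + (om / (2 * π / T)) ^ 2 * ((i * (2 * π / T)) ^ 2 * a n i)
          - gco V T (a n) i = 0 := by
  set c := 2 * π / om / T with hc
  have hc0 : 0 < c := by positivity
  have hcT : 2 * π / om = c * T := by rw [hc]; field_simp
  rw [hcT] at hz
  obtain ⟨x, hx, hp⟩ := exists_coord (p := fun x => ∀ i : Idx M, sgn i * x i = x i)
    (fun u hu => (mem_XRe (by positivity : 0 < c * T)).1 hu) hz.1
  have hsol := hz.2.1
  rw [hx, isSolution_iff hV (by positivity) hd] at hsol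
  refine ⟨fun n => √c⁻¹ • x n, fun n t => ?_, fun n i => ?_, fun n i => ?_⟩
  · rw [← syn_scale hc0, ← congrFun (congrFun hx n) (c * t)]
    congr 1
    rw [hc]; field_simp
  · simp only [Pi.smul_apply, smul_eq_mul]
    linear_combination √c⁻¹ * hp n i
  · have h1 := hsol n i
    have h2 : √c⁻¹ * √c⁻¹ = c⁻¹ := mul_self_sqrt (by positivity)
    have h3 : (i * (2 * π / (c * T))) ^ 2
        = (om / (2 * π / T)) ^ 2 * (i * (2 * π / T)) ^ 2 := by
      rw [← hcT]; field_simp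
    rw [gco_scale hc0, h3] at h1
    have h4 : √c⁻¹ * (c * √c⁻¹ * gco V T (√c⁻¹ • x n) i) = gco V T (√c⁻¹ • x n) i := by
      rw [← mul_assoc, show √c⁻¹ * (c * √c⁻¹) = c * (√c⁻¹ * √c⁻¹) by ring, h2,
        mul_inv_cancel₀ hc0.ne', one_mul]
    simp only [Pi.smul_apply, smul_eq_mul]
    linear_combination √c⁻¹ * h1 + h4

/-- The point evaluations span the dual space, so pointwise differentiability is differentiability
of the coordinates. -/
lemma hasDerivAt_coord (hT : 0 < T) {a : ℝ → Idx M → ℝ} {w : ℝ} {D : ℝ → ℝ}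
    (h : ∀ t, HasDerivAt (fun s => syn T (a s) t) (D t) w) :
    ∃ a' : Idx M → ℝ, HasDerivAt a a' w ∧ syn T a' = D := by
  let L : ℝ → Module.Dual ℝ (Idx M → ℝ) := fun t =>
    { toFun := fun x => syn T x t
      map_add' := fun x y => by rw [syn_add]; rfl
      map_smul' := fun c x => by rw [syn_smul]; rfl }
  have htop : Submodule.span ℝ (Set.range L) = ⊤ := by
    rw [← Subspace.dualCoannihilator_dualAnnihilator_eq (W := Submodule.span ℝ (Set.range L))]
    have : (Submodule.span ℝ (Set.range L)).dualCoannihilator = ⊥ := by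
      rw [eq_bot_iff]
      intro x hx
      rw [Submodule.mem_dualCoannihilator] at hx
      have h0 : syn T x = syn T (0 : Idx M → ℝ) := by
        funext t
        rw [show syn T x t = 0 from hx (L t) (Submodule.subset_span ⟨t, rfl⟩)]
        simp [syn]
      exact syn_injective hT h0
    rw [this, Submodule.dualAnnihilator_bot]
  have hall : ∀ φ ∈ Submodule.span ℝ (Set.range L), DifferentiableAt ℝ (fun s => φ (a s)) w := by
    intro φ hφ
    induction hφ using Submodule.span_induction with
    | mem φ hφ => obtain ⟨t, rfl⟩ := hφ; exact (h t).differentiableAt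
    | zero => simp
    | add φ ψ _ _ h1 h2 => exact h1.add h2
    | smul c φ _ h1 => exact h1.const_mul c
  have hd : DifferentiableAt ℝ a w := differentiableAt_pi.2 fun i =>
    hall (LinearMap.proj i) (htop ▸ Submodule.mem_top)
  refine ⟨deriv a w, hd.hasDerivAt, funext fun t => ?_⟩
  refine HasDerivAt.unique ?_ (h t)
  exact HasDerivAt.fun_sum fun i _ =>
    ((hasDerivAt_pi.1 hd.hasDerivAt i).const_mul (bas T i t)).congr_deriv (by simp)

lemma Model.frequency (h : Model V d T M) {q : ℤ → Idx M → ℝ} {y : ℤ → ℝ → ℝ}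
    (hy : IsFrequencyDerivative V d T M (fun n => syn T (q n)) y) :
    ∃ z : ℤ → Idx M → ℝ, y = (fun n => syn T (z n)) ∧ h.lattice.IsEven z ∧ IsBdd z ∧
      ∀ n, h.lattice.opR q z n = (2 : ℝ) • h.lattice.J.mulVec (h.lattice.dot q n) := by
  obtain ⟨p, hp, hpq, hpy, hsum⟩ := hy
  have hT := h.T_pos
  set w := 2 * π / T with hw
  have hw0 : 0 < w := by positivity
  let Q : ℝ → (ℤ → Idx M → ℝ) → Prop := fun om a =>
    (∀ n t, p om n (w * t) = syn T (a n) t) ∧ (∀ n (i : Idx M), sgn i * a n i = a n i) ∧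
      ∀ n (i : Idx M), d * (a (n + 1) i + a (n - 1) i - 2 * a n i)
        + (om / w) ^ 2 * ((i * w) ^ 2 * a n i) - gco V T (a n) i = 0
  have hex : ∀ om, ∃ a, (∃ a, Q om a) → Q om a := fun om => by
    by_cases h : ∃ a, Q om a
    exacts [⟨h.choose, fun _ => h.choose_spec⟩, ⟨0, fun h' => absurd h' h⟩]
  choose a ha using hex
  have hQ : ∀ᶠ om in 𝓝 w, Q om (a om) := by
    filter_upwards [hp, lt_mem_nhds hw0] with om h1 h2
    exact ha om (exists_rescaled h.smooth h.d_pos hT h2 h1)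
  have hQw := hQ.self_of_nhds
  have haq : a w = q := funext fun n => syn_injective hT (funext fun t => by
    rw [← hQw.1 n t, hpq])
  choose D hD hDy using hpy
  have hder : ∀ n, ∃ a' : Idx M → ℝ, HasDerivAt (fun om => a om n) a' w ∧ syn T a' = D n := fun n =>
    hasDerivAt_coord hT fun t => (hD n t).congr_of_eventuallyEq (by
      filter_upwards [hQ] with om hom
      exact (hom.1 n t).symm)
  choose a' ha' haD using hder
  have hyz : y = fun n => syn T (w • a' n) := by
    funext n t
    rw [hDy, syn_smul, haD]
    rfl
  refine ⟨fun n => w • a' n, hyz, fun n i => ?_, ⟨√(∑' n, l2 T (y n) ^ 2), fun n => ?_⟩,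
    fun n => ?_⟩
  · have h1 := hasDerivAt_pi.1 (ha' n) i
    have h2 : HasDerivAt (fun om => sgn i * a om n i) (a' n i) w :=
      h1.congr_of_eventuallyEq (by filter_upwards [hQ] with om hom; exact hom.2.1 n i)
    have h3 := (h1.const_mul (sgn i)).unique h2
    change sgn i * (w * a' n i) = w * a' n i
    linear_combination w * h3
  · refine (norm_le_l2 hT _).trans (le_sqrt_of_sq_le ?_)
    rw [← congrFun hyz n]
    exact hsum.le_tsum n fun _ _ => sq_nonneg _
  · funext i
    have e := fun m => hasDerivAt_pi.1 (ha' m) i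
    have hg := hasDerivAt_pi.1 ((h.lattice.hasFDerivAt_g (a w n)).comp_hasDerivAt w (ha' n)) i
    have hs := (((hasDerivAt_id w).div_const w).pow 2).mul ((e n).const_mul ((i * w) ^ 2))
    have hF := (((((e (n + 1)).add (e (n - 1))).sub ((e n).const_mul 2)).const_mul d).add hs).sub hg
    have h0 := hF.unique ((hasDerivAt_const w (0 : ℝ)).congr_of_eventuallyEq (by
      filter_upwards [hQ] with om hom
      exact hom.2.2 n i))
    rw [haq] at h0
    simp only [LinearMap.coe_toContinuousLinearMap', mulVecLin_apply, id, div_self hw0.ne'] at h0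
    have hJ : h.lattice.J.mulVec (h.lattice.dot q n) i = -(i * w) ^ 2 * q n i := by
      change (Jco T M).mulVec ((Jco T M).mulVec (q n)) i = _
      rw [Jco_mulVec, Jco_mulVec, dcoord_dcoord, smul_eq_mul]
    rw [Pi.smul_apply, hJ, smul_eq_mul]
    change d * (w * a' (n + 1) i + w * a' (n - 1) i - 2 * (w * a' n i)) + (i * w) ^ 2 * (w * a' n i)
      - (h.lattice.A (q n)).mulVec (w • a' n) i = _
    rw [mulVec_smul, Pi.smul_apply, smul_eq_mul]
    simp only [Pi.pow_apply, div_self hw0.ne', one_pow, Nat.cast_ofNat] at h0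
    linear_combination w * h0 - 2 * (i * w) ^ 2 * q n i * mul_one_div_cancel hw0.ne'

end

section

variable {V : ℝ → ℝ} {d T : ℝ} {M l : ℕ}

/-! ### The interaction matrix -/

lemma bCoef_eq {q : ℤ → ℝ → ℝ} (hsymm : ∀ n, q (-n) = q n) (N : ℕ) :
    bCoef T q N = ∫ t in 0..T, (deriv (q (Nplus N)) t * deriv (q (-Nminus N - 1)) t
      - deriv (q (Nplus N - 1)) t * deriv (q (-Nminus N)) t) := by
  have h1 : q (-Nminus N - 1) = q (Nminus N + 1) := by rw [← hsymm]; congr 1; ring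
  rw [h1, hsymm, bCoef]
  split_ifs with hN
  · obtain ⟨k, rfl⟩ := hN
    have e1 : Nplus (k + k) = k := by unfold Nplus; omega
    have e2 : Nminus (k + k) = k := by unfold Nminus; rw [e1]; push_cast; ring
    have e3 : (((k + k : ℕ) : ℤ)) / 2 = k := by omega
    rw [e1, e2, e3]
    congr 1; funext t; ring
  · obtain ⟨k, rfl⟩ := Nat.not_even_iff_odd.1 hN
    have e1 : Nplus (2 * k + 1) = k := by unfold Nplus; omega
    have e2 : Nminus (2 * k + 1) = k + 1 := by unfold Nminus; rw [e1]; push_cast; ring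
    rw [e1, e2, show (((2 * k + 1 : ℕ) : ℤ) - 1) / 2 = k by omega,
      show (((2 * k + 1 : ℕ) : ℤ) + 3) / 2 = k + 1 + 1 by omega,
      show (((2 * k + 1 : ℕ) : ℤ) + 1) / 2 = k + 1 by omega,
      show (((2 * k + 1 : ℕ) : ℤ) - 3) / 2 = k - 1 by omega]
    congr 1; funext t; ring

lemma matrixA_eq {q : ℤ → ℝ → ℝ} (hsymm : ∀ n, q (-n) = q n) (σ : Fin (l + 1) → ℝ)
    (N : Fin l → ℕ) :
    matrixA T q σ N = symTridiag fun g => σ g.castSucc * σ g.succ * bCoef T q (N g) := by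
  have h : ∀ g, aTilde T q σ N g = -(σ g.castSucc * σ g.succ * bCoef T q (N g)) := fun g => by
    rw [bCoef_eq hsymm, aTilde, ← mul_neg, ← integral_neg]
    congr 2; funext t; ring
  simp only [matrixA, tridiag, symTridiag, h, aCoef, ← bCoef_eq hsymm, neg_neg]

lemma eq_zero_of_eigenvector {c : Fin l → ℝ} (hc : ∀ g, c g ≠ 0) {s : ℝ} {x : Fin (l + 1) → ℝ}
    (hx : (symTridiag c).mulVec x = s • x) (h0 : x 0 = 0) : x = 0 := by
  have hX : (chainMatrix c).mulVec (fun i => (x i : ℂ)) = fun i => ((-s * x i : ℝ) : ℂ) := by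
    funext i
    have h1 := congrFun hx i
    simp only [Pi.smul_apply, smul_eq_mul] at h1
    rw [neg_mul, ← h1]
    simp [chainMatrix, mulVec, dotProduct]
  have key : ∀ i : Fin (l + 1), ∀ j, j ≤ i → x j = 0 := by
    intro i
    induction i using Fin.induction with
    | zero => intro j hj; rw [Fin.le_zero_iff.1 hj, h0]
    | succ g ih =>
      intro j hj
      rcases hj.lt_or_eq with hj | rfl
      · exact ih j (Fin.le_castSucc_iff.2 hj)
      · have h2 := chainMatrix_form c (fun i => (x i : ℂ)) (leftOf g)
        rw [hX, sum_eq_single g (fun g' _ hg => by rw [diff_leftOf, if_neg hg]; simp)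
          (by simp)] at h2
        have h3 : leftOf g ⬝ᵥ (fun i => ((-s * x i : ℝ) : ℂ)) = 0 :=
          sum_eq_zero fun i _ => by
            unfold leftOf
            split_ifs with hi
            · simp [ih i hi]
            · simp
        rw [h3, diff_leftOf] at h2
        simpa [diff, ih g.castSucc le_rfl, hc g] using h2
  exact funext fun i => key i i le_rfl

/-- A tridiagonal matrix with nonzero off-diagonal entries has simple eigenvalues, since an
eigenvector is determined by its first entry. -/
lemma exists_simple_spectrum {c : Fin l → ℝ} (hc : ∀ g, c g ≠ 0) :
    ∃ μ : Fin l → ℝ, Function.Injective μ ∧ (∀ j, μ j ≠ 0) ∧ (symTridiag c).charpoly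
      = Polynomial.X * ∏ j, (Polynomial.X - Polynomial.C (μ j)) := by
  have hA : (symTridiag c).IsHermitian := by
    rw [Matrix.IsHermitian, conjTranspose_eq_transpose_of_trivial, symTridiag_transpose]
  have hne : ∀ i, hA.eigenvectorBasis i 0 ≠ 0 := fun i h => by
    have h1 := eq_zero_of_eigenvector hc (hA.mulVec_eigenvectorBasis i) h
    refine hA.eigenvectorBasis.toBasis.ne_zero i ?_
    ext j
    simpa using congrFun h1 j
  have hinj : Function.Injective hA.eigenvalues := fun i j hij => by
    by_contra hne'
    set v := hA.eigenvectorBasis i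
    set w := hA.eigenvectorBasis j
    have h1 := eq_zero_of_eigenvector hc (s := hA.eigenvalues i) (x := w 0 • ⇑v - v 0 • ⇑w) (by
      rw [mulVec_sub, mulVec_smul, mulVec_smul, hA.mulVec_eigenvectorBasis,
        hA.mulVec_eigenvectorBasis, ← hij]
      module) (by simp [mul_comm])
    have h2 : w 0 • v - v 0 • w = 0 := by
      ext k; simpa using congrFun h1 k
    have h3 := congrArg (inner ℝ v) h2
    have h4 : inner ℝ v v = 1 := (hA.eigenvectorBasis.inner_eq_ite i i).trans (if_pos rfl)
    have h5 : inner ℝ v w = 0 := (hA.eigenvectorBasis.inner_eq_ite i j).trans (if_neg hne')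
    rw [inner_sub_right, inner_smul_right, inner_smul_right, h4, h5, inner_zero_right] at h3
    exact hne j (by simpa using h3)
  have hdet : (symTridiag c).det = 0 := by
    refine exists_mulVec_eq_zero_iff.1 ⟨1, one_ne_zero, ?_⟩
    simp only [symTridiag, sum_mulVec, add_mulVec]
    refine sum_eq_zero fun g _ => ?_
    simp only [single_mulVec, Pi.one_apply, mul_one]
    rw [← Pi.single, ← Pi.single, ← Pi.single, ← Pi.single, Pi.single_neg, Pi.single_neg]
    abel
  rw [hA.det_eq_prod_eigenvalues, prod_eq_zero_iff] at hdet
  obtain ⟨i₀, -, h0⟩ := hdet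
  have h0 : hA.eigenvalues i₀ = 0 := h0
  refine ⟨fun j => hA.eigenvalues (i₀.succAbove j),
    hinj.comp Fin.succAbove_right_injective, fun j hj => ?_, ?_⟩
  · exact Fin.succAbove_ne i₀ j (hinj (hj.trans h0.symm))
  · rw [hA.charpoly_eq, Fin.prod_univ_succAbove _ i₀]
    simp [h0]

/-! ### Multi-breathers and eigenmodes in coordinates -/

lemma Model.isMultiBreather_iff (h : Model V d T M) {θ : ℝ} (P : Primary h.lattice θ)
    {σ : Fin (l + 1) → ℝ} {N : Fin l → ℕ} {ρ : ℝ} :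
    (∀ u, DKG.IsMultiBreather V d T M (fun n => syn T (P.q n)) σ N ρ u →
      ∃ x, u = (fun n => syn T (x n)) ∧ P.IsMultiBreather σ N ρ x) ∧
    ∀ x ε, P.IsMultiBreather σ N ε x → √(card (Idx M)) * ε ≤ ρ →
      DKG.IsMultiBreather V d T M (fun n => syn T (P.q n)) σ N ρ (fun n => syn T (x n)) := by
  have e : ∀ (x : ℤ → Idx M → ℝ) i n, syn T (x n) - σ i • syn T (P.q (n - position N i))
      = syn T (x n - σ i • P.q (n - position N i)) := fun x i n => by rw [syn_sub, syn_smul]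
  constructor
  · rintro u ⟨h1, h2, h3⟩
    obtain ⟨x, rfl, hp⟩ := exists_coord (p := fun x => ∀ i : Idx M, sgn i * x i = x i)
      (fun u hu => (mem_XRe h.T_pos).1 hu) h1
    refine ⟨x, rfl, hp, (h.isSolution_iff x).1 h2, fun i n hn => ?_⟩
    refine (norm_le_l2 h.T_pos _).trans ?_
    rw [← e]
    exact h3 i n hn
  · rintro x ε ⟨h1, h2, h3⟩ hε
    refine ⟨fun n => (mem_XRe h.T_pos).2 ⟨x n, rfl, h1 n⟩, (h.isSolution_iff x).2 h2,
      fun i n hn => ?_⟩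
    rw [e]
    exact ((l2_le_norm h.T_pos _).trans
      (mul_le_mul_of_nonneg_left (h3 i n hn) (sqrt_nonneg _))).trans hε

/-- The synthesis map on sequences. -/
def synSeq (T : ℝ) (M : ℕ) : (ℤ → Idx M → ℂ) →ₗ[ℂ] ℤ → ℝ → ℂ where
  toFun w n := syn T (w n)
  map_add' v w := funext fun n => syn_add (v n) (w n)
  map_smul' c w := funext fun n => syn_smul c (w n)

lemma Model.finrank_eigenmodes (h : Model V d T M) (x : ℤ → Idx M → ℝ) (z : ℂ) :
    Set.finrank ℂ (eigenmodes V d T M (fun n => syn T (x n)) z)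
      = Module.finrank ℂ (h.lattice.modes x z) := by
  have hT := h.T_pos
  have hinj : Function.Injective (synSeq T M) := fun v w hvw =>
    funext fun n => syn_injective hT (congrFun hvw n)
  have heq : ∀ (w : ℤ → Idx M → ℂ) n, (∀ t, (d : ℂ) * (syn T (w (n + 1)) t - 2 * syn T (w n) t
        + syn T (w (n - 1)) t)
        - proj T M (fun s => ((deriv (deriv V) (syn T (x n) s) : ℝ) : ℂ) * syn T (w n) s) t
        - deriv (deriv (syn T (w n))) t = 2 * z * deriv (syn T (w n)) t + z ^ 2 * syn T (w n) t) ↔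
      h.lattice.op (h.lattice.pot x) w n = (2 * z) • h.lattice.Jc.mulVec (w n) + z ^ 2 • w n := by
    intro w n
    have hf := (contDiff_deriv (contDiff_deriv h.smooth)).continuous
    have hc1 := continuous_syn (T := T) (x n)
    have hc2 := continuous_syn (T := T) (w n)
    have hA : proj T M (fun s => ((deriv (deriv V) (syn T (x n) s) : ℝ) : ℂ) * syn T (w n) s)
        = syn T ((h.lattice.pot x n).mulVec (w n)) := by
      rw [proj_eq hT (by fun_prop)]
      congr 1
      funext i
      exact (Aco_mulVec h.smooth (x n) (w n) i).symm
    have hJ : h.lattice.Jc.mulVec (w n) = dcoord T (w n) := funext fun i => Jco_sum (w n) i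
    have hi := (syn_injective hT).eq_iff (a := (d : ℂ) • (w (n + 1) - (2 : ℂ) • w n + w (n - 1))
        - (h.lattice.pot x n).mulVec (w n) - dcoord T (dcoord T (w n)))
      (b := (2 * z) • dcoord T (w n) + z ^ 2 • w n)
    simp only [syn_sub, syn_add, syn_smul] at hi
    rw [hA, deriv_syn, deriv_syn, hJ]
    refine (funext_iff.symm.trans hi).trans (Eq.congr_left ?_)
    funext i
    simp only [op_apply, Pi.sub_apply, Pi.add_apply, Pi.smul_apply, smul_eq_mul,
      dcoord_dcoord, real_smul]
    change _ = (d : ℂ) * _ + (((i * (2 * π / T)) ^ 2 : ℝ) : ℂ) * _ - _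
    push_cast
    ring
  have hmap : eigenmodes V d T M (fun n => syn T (x n)) z
      = ((h.lattice.modes x z).map (synSeq T M) : Set (ℤ → ℝ → ℂ)) := by
    ext w
    constructor
    · rintro ⟨h1, ⟨B, hB⟩, h3⟩
      choose v hv using fun n => (mem_XC hT).1 (h1 n)
      obtain rfl : (fun n => syn T (v n)) = w := funext hv
      refine ⟨v, ⟨⟨T * (√(2 / T) * B), fun n => ?_⟩, fun n => (heq v n).1 (h3 n)⟩, rfl⟩
      have hB0 : 0 ≤ B := (norm_nonneg _).trans (hB 0 0)
      refine (pi_norm_le_iff_of_nonneg (by positivity)).2 fun i => ?_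
      rw [← coord_syn hT (v n) i]
      refine (norm_integral_le_of_norm_le_const
        (C := √(2 / T) * B) fun t _ => ?_).trans_eq (by rw [sub_zero, abs_of_pos hT, mul_comm])
      rw [norm_smul]
      exact mul_le_mul (abs_bas_le hT _ _) (hB n t) (norm_nonneg _) (by positivity)
    · rintro ⟨v, ⟨⟨B, hB⟩, h2⟩, rfl⟩
      exact ⟨fun n => (mem_XC hT).2 ⟨v n, rfl⟩, ⟨_, fun n t => (norm_syn_le hT (v n) t).trans
        (mul_le_mul_of_nonneg_left (hB n) (by positivity))⟩, fun n => (heq v n).2 (h2 n)⟩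
  rw [hmap, Set.finrank, Submodule.span_eq]
  exact (Submodule.equivMapOfInjective _ hinj _).finrank_eq.symm

/-! ### The primary breather in coordinates -/

lemma kConst_syn (h : Model V d T M) (q z : ℤ → Idx M → ℝ) :
    kConst T (fun n => syn T (q n)) (fun n => syn T (z n)) = ∑' n, (h.lattice.dot q n
      ⬝ᵥ h.lattice.dot q n + 2 * (h.lattice.dot q n ⬝ᵥ h.lattice.dot z n)) := by
  have e : ∀ x : ℤ → Idx M → ℝ, ∀ n, dcoord T (x n) = h.lattice.dot x n := fun x n =>
    (Jco_mulVec (x n)).symm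
  refine tsum_congr fun n => ?_
  have hc := continuous_syn (T := T) (E := ℝ) (M := M)
  rw [← integral_syn_mul h.T_pos, ← integral_syn_mul h.T_pos,
    ← integral_const_mul, ← integral_add]
  · simp only [deriv_syn, e]
    congr 1; funext t; ring
  all_goals exact Continuous.intervalIntegrable (by fun_prop) _ _

lemma Model.exists_primary (h : Model V d T M) {φ : ℝ} (hφ : 0 < φ) (hφ1 : φ < 1)
    (hφr : φ ^ 9 = (rM V d T M)⁻¹) {q y : ℤ → ℝ → ℝ} (hq : IsHomoclinic V d T M q)
    (hnd : IsNondegenerate V d T M q) (hy : IsFrequencyDerivative V d T M q y)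
    (hsymm : ∀ n, q (-n) = q n) (hK : kConst T q y ≠ 0) :
    ∃ P : Primary h.lattice (φ ^ 8), q = (fun n => syn T (P.q n)) ∧ (∀ n, P.q (-n) = P.q n) ∧
      P.mass = kConst T q y := by
  have hθ : 0 < φ ^ 8 := pow_pos hφ 8
  have hθ1 : φ ^ 8 < 1 := pow_lt_one₀ hφ.le hφ1 (by norm_num)
  have hν : ∀ i, |h.lattice.ν i| < φ ^ 8 := fun i => (h.rM_spec.2 i).trans_lt (by
    rw [← hφr]; exact pow_lt_pow_right_of_lt_one₀ hφ hφ1 (by norm_num))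
  obtain ⟨x, hx, hp⟩ := exists_coord (p := fun x => ∀ i : Idx M, sgn i * x i = x i)
    (fun u hu => (mem_XRe h.T_pos).1 hu) hq.1
  have hsmall := l2_small h.T_pos hx hq.2.2.1 hq.2.2.2
  subst hx
  have hsol := (h.isSolution_iff x).1 hq.2.1
  have hxs : ∀ n, x (-n) = x n := fun n => syn_injective h.T_pos (hsymm n)
  obtain ⟨z, rfl, hze, ⟨B, hB⟩, hz⟩ := h.frequency hy
  rw [kConst_syn h] at hK ⊢
  obtain ⟨D₁, hD₁⟩ := h.lattice.sol_decay hθ hθ1 hν hsol hsmall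
  obtain ⟨C, hC, hJ⟩ := norm_dot_le h.lattice
  obtain ⟨D₂, hD₂⟩ := h.lattice.opR_decay hθ hθ1 hν (K := 2 * (C * (C * D₁))) hD₁ hB fun n => by
    have e1 := hJ (h.lattice.dot x) n
    have e2 := hJ x n
    have e3 : ‖h.lattice.opR x z n‖ = 2 * ‖h.lattice.dot (h.lattice.dot x) n‖ := by
      rw [hz n, norm_smul, Real.norm_ofNat]; rfl
    rw [e3]
    have e4 := mul_le_mul_of_nonneg_left (e2.trans (mul_le_mul_of_nonneg_left (hD₁ n) hC.le)) hC.le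
    linarith
  obtain ⟨n₀, hn₀⟩ : ∃ n₀, h.lattice.dot x n₀ ≠ 0 := by
    by_contra! h0
    exact hK (by simp [h0])
  have hw := bump_isWeight hθ hθ1 0
  exact ⟨⟨x, z, n₀, max D₁ D₂, hθ, hθ1, hν, hp, hze, hsol, hz, hD₁.mono hw (le_max_left _ _),
    hD₂.mono hw (le_max_right _ _), hn₀, fun v hv hv0 => h.kernel hθ hθ1 hν hsol hD₁ hxs hnd
      (fun h0 => hn₀ (congrFun h0 n₀)) hv hv0⟩, rfl, hxs, rfl⟩

lemma Primary.tail_le_tailNorm (h : Model V d T M) {θ : ℝ} (P : Primary h.lattice θ) (n : ℤ) :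
    P.tail n ≤ tailNorm T (fun n => syn T (P.q n)) n := by
  have e : ∀ n, ‖h.lattice.dot P.q n‖ ≤ l2 T (deriv (syn T (P.q n))) := fun n => by
    rw [deriv_syn, ← Jco_mulVec]; exact norm_le_l2 h.T_pos _
  refine max_le ((e n).trans (le_sqrt_of_sq_le ?_))
    ((e (n - 1)).trans (le_sqrt_of_sq_le ?_)) <;> dsimp only
  · linarith [sq_nonneg (l2 T (deriv (syn T (P.q (n - 1)))))]
  · linarith [sq_nonneg (l2 T (deriv (syn T (P.q n))))]

lemma Primary.bCoef_syn (h : Model V d T M) {θ : ℝ} (P : Primary h.lattice θ)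
    (hsymm : ∀ n, P.q (-n) = P.q n) (N : ℕ) :
    bCoef T (fun n => syn T (P.q n)) N = P.inter (Nplus N) (Nminus N) := by
  have hc := continuous_syn (T := T) (E := ℝ) (M := M)
  rw [bCoef_eq fun n => by rw [hsymm]]
  simp only [deriv_syn, ← Jco_mulVec]
  rw [integral_sub (Continuous.intervalIntegrable (by fun_prop) _ _)
    (Continuous.intervalIntegrable (by fun_prop) _ _), integral_syn_mul h.T_pos,
    integral_syn_mul h.T_pos]
  rfl

end

end Breather

end

open Breather

theorem corollary1 (V : ℝ → ℝ) (hV : ContDiff ℝ ∞ V) (hVeven : ∀ x, V (-x) = V x) (hV0 : V 0 = 0)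
    (hV2 : 0 < deriv (deriv V) 0) (d T : ℝ) (hd : 0 < d) (hT : 0 < T) (M : ℕ) (hM : 1 ≤ M)
    (hhyp : IsHyperbolic V d T M)
    (q : ℤ → ℝ → ℝ) (hq : IsPrimaryBreather V d T M q) (hnd : IsNondegenerate V d T M q)
    (y : ℤ → ℝ → ℝ) (hy : IsFrequencyDerivative V d T M q y)
    (hsymm : ∀ n, q (-n) = q n) (l : ℕ) (hl : 1 ≤ l) :
    -- the matrix `A`, for all orientations and distances
    (∀ (σ : Fin (l + 1) → ℝ) (N : Fin l → ℕ), (∀ i, σ i = 1 ∨ σ i = -1) →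
      (matrixA T q σ N).IsSymm ∧
      matrixA T q σ N = symTridiag (fun g => σ g.castSucc * σ g.succ * bCoef T q (N g)) ∧
      (∀ g, aCoef T q σ N g = σ g.castSucc * σ g.succ * bCoef T q (N g)) ∧
      ((∀ g, bCoef T q (N g) ≠ 0) →
        ∃ μ : Fin l → ℝ, Function.Injective μ ∧ (∀ j, μ j ≠ 0) ∧
          (matrixA T q σ N).charpoly
            = Polynomial.X * ∏ j, (Polynomial.X - Polynomial.C (μ j)))) ∧
    -- the interaction eigenmodes of well separated multi-breathers
    (kConst T q y ≠ 0 →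
      ∃ rad > 0, ∃ δ > 0, ∃ Nstar : ℕ, ∀ κ > 0, ∃ C : ℝ,
        ∀ (σ : Fin (l + 1) → ℝ) (N : Fin l → ℕ), (∀ i, σ i = 1 ∨ σ i = -1) →
          (∀ g, Nstar ≤ N g) →
          (∃! u, IsMultiBreather V d T M q σ N rad u) ∧
          ∀ u, IsMultiBreather V d T M q σ N rad u →
          ∀ μ : Fin l → ℝ, (matrixA T q σ N).charpoly
            = Polynomial.X * ∏ j, (Polynomial.X - Polynomial.C (μ j)) →
          ∃ lam : Fin l → ℂ,
            (∀ j, ‖lam j‖ < δ ∧ ((lam j).re = 0 ∨ (lam j).im = 0)) ∧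
            -- the eigenmodes in the disc, with multiplicity: zero and the pairs `± lam j`
            (∀ z : ℂ, ‖z‖ < δ →
              Set.finrank ℂ (eigenmodes V d T M u z)
                = (if z = 0 then 1 else 0)
                  + Nat.card {j : Fin l // z = lam j ∨ z = -lam j}) ∧
            ((∀ g, GapNondegenerate T q κ (N g)) →
              ∀ j, ‖lam j - csqrt (-(d * μ j) / kConst T q y)‖
                ≤ C * rM V d T M ^ (-2 * charDist N))) := by
  have h : Model V d T M := ⟨hV, hVeven, hd, hT, hhyp⟩
  refine ⟨fun σ N hσ => ⟨?_, matrixA_eq hsymm σ N, fun g => ?_, fun hb => ?_⟩,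
    fun hK => ?_⟩
  · rw [matrixA_eq hsymm]
    exact symTridiag_transpose _
  · rw [aCoef, bCoef_eq hsymm]
  · rw [matrixA_eq hsymm]
    refine exists_simple_spectrum fun g => mul_ne_zero (mul_ne_zero ?_ ?_) (hb g)
    · rcases hσ g.castSucc with h | h <;> simp [h]
    · rcases hσ g.succ with h | h <;> simp [h]
  obtain ⟨hr1, -⟩ := h.rM_spec
  have hr0 : 0 < rM V d T M := one_pos.trans hr1
  set φ : ℝ := rM V d T M ^ (-(1 / 9) : ℝ) with hφ
  have hφ0 : 0 < φ := Real.rpow_pos_of_pos hr0 _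
  have hφ1 : φ < 1 := Real.rpow_lt_one_of_one_lt_of_neg hr1 (by norm_num)
  have hφr : φ ^ 9 = (rM V d T M)⁻¹ := by
    rw [hφ, ← Real.rpow_mul_natCast hr0.le, ← Real.rpow_neg_one]
    norm_num
  obtain ⟨P, rfl, hPs, hPm⟩ := h.exists_primary hφ0 hφ1 hφr hq.1 hnd hy hsymm hK
  rw [← hPm] at hK ⊢
  obtain ⟨ρ, hρ, hmain⟩ := P.exists_interaction hφ0 hφ1 hPs hK l
  set k : ℝ := √(Fintype.card (Idx M)) + 1 with hk
  have hk0 : 0 < k := by positivity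
  obtain ⟨δ, hδ, D₀, hmain⟩ := hmain (ρ / k) (by positivity)
  refine ⟨ρ, hρ, δ, hδ, D₀, fun κ hκ => ?_⟩
  obtain ⟨C, hmain⟩ := hmain κ hκ
  refine ⟨C, fun σ N hσ hN => ?_⟩
  have : Nonempty (Fin l) := ⟨⟨0, hl⟩⟩
  obtain ⟨g₀, hg₀⟩ := Finite.exists_min N
  obtain ⟨x, hx, huniq, hμ⟩ := hmain σ N (N g₀) hσ (hN g₀) hg₀
  obtain ⟨hto, hfrom⟩ := h.isMultiBreather_iff P (σ := σ) (N := N) (ρ := ρ)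
  have hux : ∀ u, IsMultiBreather V d T M (fun n => syn T (P.q n)) σ N ρ u →
      u = fun n => syn T (x n) := fun u hu => by
    obtain ⟨x', rfl, hx'⟩ := hto u hu
    rw [huniq x' hx']
  refine ⟨⟨_, hfrom x _ hx ?_, hux⟩, fun u hu μ hchar => ?_⟩
  · rw [mul_div_assoc', div_le_iff₀ hk0, mul_comm ρ]
    exact mul_le_mul_of_nonneg_right (by linarith) hρ.le
  obtain rfl := hux u hu
  rw [matrixA_eq (q := fun n => syn T (P.q n)) hsymm] at hchar
  simp only [P.bCoef_syn h hPs] at hchar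
  obtain ⟨lam, h1, h2, h3⟩ := hμ μ hchar
  refine ⟨lam, h1, fun z hz => (h.finrank_eigenmodes x z).trans (h2 z hz), fun hgap j => ?_⟩
  have hrate : φ ^ (9 * N g₀) = rM V d T M ^ (-2 * charDist N) := by
    have hmin : ⨅ g, (N g : ℝ) = N g₀ := le_antisymm (ciInf_le (Finite.bddBelow_range _) g₀)
      (le_ciInf fun g => by exact_mod_cast hg₀ g)
    rw [pow_mul, hφr, charDist, hmin, inv_pow, ← Real.rpow_natCast, ← Real.rpow_neg hr0.le]
    congr 1; ring
  rw [← hrate]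
  refine h3 (fun g => le_trans (mul_le_mul_of_nonneg_left ?_ hκ.le) ((hgap g).trans_eq ?_)) j
  · exact mul_le_mul (P.tail_le_tailNorm h _) (P.tail_le_tailNorm h _)
      (le_max_of_le_left (norm_nonneg _)) (Real.sqrt_nonneg _)
  · rw [P.bCoef_syn h hPs]
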